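/- **Conventions.** Let $k$ be a commutative ring, $\mathcal H$ a Hopf algebra over $k$ whose antipode $S$ is bijective, and $A$ a (left) $\mathcal H$-module algebra, with crossed product $A\rtimes\mathcal H=A\otimes\mathcal H$, $(a\otimes g)(b\otimes h)=a(g^{(0)}b)\otimes g^{(1)}h$. Let $\mathsf W=(W_j)_{j\in\mathbb Z}$ be a graded $k[u]$-module, $|u|=-2$. For a graded $k$-module $V_\bullet$ ($\bullet\ge 0$) put $V\boxtimes\mathsf W=V[[u]]\otimes_{k[u]}\mathsf W$, with $V[[u]]_n=\prod_{i\ge0}V_{n+2i}u^i$; for a cyclic module $X$ put $HC_n(X;\mathsf W)=H_n(\mathsf C(X)\boxtimes\mathsf W,\,b+uB)$, and $HC_n(R;\mathsf W)=HC_n(\mathsf C_\bullet(R);\mathsf W)$ for an algebra $R$. For a left $\mathcal H$-module $M$ let $C_q(\mathcal H,M)=\mathcal H^{\otimes q}\otimes M$ with boundary $$\delta(g_1,\dots,g_q,m)=\epsilon(g_1)(g_2,\dots,g_q,m)+\sum_{i=1}^{q-1}(-1)^i(g_1,\dots,g_ig_{i+1},\dots,g_q,m)+(-1)^q(g_1,\dots,g_{q-1},g_qm),$$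 and let $H_q(\mathcal H,M)$ be its homology. Let $\mathsf C_n(A^\natural_{\mathcal H})=\mathcal H\otimes A^{\otimes(n+1)}$ with the $\mathcal H$-action $h\cdot(g\mid a_0,\dots,a_n)=(h^{(n+2)}gS(h^{(0)})\mid h^{(1)}a_0,\dots,h^{(n+1)}a_n)$ and the operators $$\tau(g\mid a_0,\dots,a_n)=(g^{(1)}\mid S^{-1}(g^{(0)})a_n,a_0,\dots,a_{n-1}),$$ $$\partial_i(g\mid a_0,\dots,a_n)=(g\mid \dots,a_ia_{i+1},\dots)\ (i<n),\qquad \partial_n=\partial_0\tau,\qquad \sigma_i(g\mid a_0,\dots,a_n)=(g\mid \dots,a_i,1,a_{i+1},\dots).$$ Write $C_q(\mathcal H,\mathsf C_p(A^\natural_{\mathcal H})\boxtimes\mathsf W)$ for the degree $p$ part of $C_q(\mathcal H,\mathsf C_\bullet(A^\natural_{\mathcal H}))\boxtimes\mathsf W$, and $H_q(\mathcal H,\mathsf C_p(A^\natural_{\mathcal H})\boxtimes\mathsf W)$ for its homology with respect to $\delta$. Let $A^{op}\natural\mathcal H^{cop}$ be the cylindrical module $\{\mathcal H^{\otimes(m+1)}\otimes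 A^{\otimes(n+1)}\}_{m,n\ge0}$, with operators in the $A$-direction $$\tau(g_0,\dots,g_m\mid a_0,\dots,a_n)=(g_0^{(1)},\dots,g_m^{(1)}\mid S^{-1}(g_0^{(0)}\cdots g_m^{(0)})a_n,a_0,\dots,a_{n-1}),$$ $\partial_i$ multiplying $a_i,a_{i+1}$ for $i<n$, $\partial_n=\partial_0\tau$, $\sigma_i$ inserting $1$ after $a_i$; and in the $\mathcal H$-direction $$\bar\tau(g_0,\dots,g_m\mid a_0,\dots,a_n)=(g_m^{(n+1)},g_0,\dots,g_{m-1}\mid g_m^{(0)}a_0,\dots,g_m^{(n)}a_n),$$ $\bar\partial_i$ multiplying $g_i,g_{i+1}$ for $i<m$, $\bar\partial_m=\bar\partial_0\bar\tau$, $\bar\sigma_i$ inserting $1$ after $g_i$. On its (unnormalised) total complex $\mathrm{Tot}\boxtimes\mathsf W$ take $D=\bar b+b+u(B+T\bar B)$, where $T=\tau^{n+1}$, where $b$ and $B$ carry the sign $(-1)^m$, and where $B=(1-(-1)^{n+1}\tau)\,\sigma'N$ is formed with the extra degeneracy $\sigma'=\sigma b'\sigma$, $\sigma=\tau\sigma_n$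 ($\bar B$ similarly). Let $F_p$ be spanned, in total degree $n$, by the part of $\mathcal H$-degree $m\ge n-p$; that is, by the elements whose degree in the $A$-direction, counting the degrees of $u$ and of $\mathsf W$, is at most $p$. **Proposition.** $(\mathrm{Tot}(A^{op}\natural\mathcal H^{cop})\boxtimes\mathsf W,D)$ is a complex, $F$ is an increasing filtration of it by subcomplexes, and $F_p$ is everything in degrees $n\le p$. The associated spectral sequence $(E^r_{pq},d^r)_{r\ge0}$ satisfies $E^r_{pq}=0$ for $q<0$, and for all $p\in\mathbb Z$, $q\ge0$: 1. $E^0_{pq}\cong C_q(\mathcal H,\mathsf C_p(A^\natural_{\mathcal H})\boxtimes\mathsf W)$, with $d^0$ corresponding to $\delta$. 2. $E^1_{pq}\cong H_q(\mathcal H,\mathsf C_p(A^\natural_{\mathcal H})\boxtimes\mathsf W)$, by the isomorphism induced from the one in 1; here $d^1$ corresponds to $(-1)^q(\mathfrak b+u\mathfrak B)$, where $\mathfrak b+u\mathfrak B$ is induced by the operators of $A^\natural_{\mathcal H}$ (with $B=(1-(-1)^{n+1}\tau)\sigma N$). 3. For every $q$ the operators of $A^\natural_{\mathcal H}$ induce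 on $H_q(\mathcal H,\mathsf C_\bullet(A^\natural_{\mathcal H}))$ the structure of a cyclic module. If all $W_j$ are flat over $k$ (for instance, if $k$ is a field), then $E^2_{pq}\cong HC_p(H_q(\mathcal H,\mathsf C_\bullet(A^\natural_{\mathcal H}));\mathsf W)$. The spectral sequence converges to $HC_\bullet(A\rtimes\mathcal H;\mathsf W)$ in the following sense. The homology of the filtered complex in degree $n$ is isomorphic to $HC_n(A\rtimes\mathcal H;\mathsf W)$. If $W_j=0$ for all $j<N$, then the filtration is finite in each degree ($F_p=0$ for $p<N$), and for all $p,q$ and all large $r$ the term $E^r_{pq}$ is canonically isomorphic to $F_p/F_{p-1}$ of the induced filtration of $HC_{p+q}(A\rtimes\mathcal H;\mathsf W)$ (strong convergence). If every $W_j$ is finitely presented over $k$ and $u:W_j\to W_{j-2}$ is bijective for all sufficiently negative $j$ (for instance $\mathsf W=k[u]$ or $k[u,u^{-1}]$), then the filtration is exhaustive, Hausdorff and complete in each degree (conditional convergence). -/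

import Mathlib

open scoped TensorProduct DirectSum

noncomputable section

namespace CrossedCyclic

/-! ## Tensor powers

`TPow k M n` is `M ⊗ ⋯ ⊗ M` (`n` factors); entries are numbered `0, …, n - 1`. -/

section TensorPower

variable (k : Type*) [CommRing k] (M : Type*) [AddCommGroup M] [Module k M]

/-- The `n`-th tensor power of `M` over `k`. -/
abbrev TPow (n : ℕ) : Type _ := PiTensorProduct k (fun _ : Fin n => M)

/-- `Fin (n + 1)` is one point followed by `Fin n`. -/
def headTail (n : ℕ) : Unit ⊕ Fin n ≃ Fin (n + 1) where
  toFun := Sum.elim (fun _ => 0) Fin.succ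
  invFun := Fin.cases (Sum.inl ()) Sum.inr
  left_inv := by rintro (_ | i) <;> simp
  right_inv i := by refine Fin.cases ?_ (fun j => ?_) i <;> simp

/-- `M^{⊗(n+1)} ≅ M ⊗ M^{⊗n}`, splitting off the first entry. -/
def consEquiv (n : ℕ) : TPow k M (n + 1) ≃ₗ[k] M ⊗[k] TPow k M n :=
  (PiTensorProduct.reindex k (fun _ : Fin (n + 1) => M) (headTail n).symm).trans <|
    (PiTensorProduct.tmulEquiv (ι := Unit) (ι₂ := Fin n) k M).symm.trans <|
      TensorProduct.congr (PiTensorProduct.subsingletonEquiv (R := k) (s := fun _ => M) ())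
        (LinearEquiv.refl k _)

theorem consEquiv_tprod (n : ℕ) (a : Fin (n + 1) → M) :
    consEquiv k M n (PiTensorProduct.tprod k a) =
      a 0 ⊗ₜ[k] PiTensorProduct.tprod k (fun i : Fin n => a i.succ) := by
  unfold consEquiv
  simp only [LinearEquiv.trans_apply]
  rw [PiTensorProduct.reindex_tprod]
  erw [PiTensorProduct.tmulEquiv_symm_apply]
  rw [TensorProduct.congr_tmul, PiTensorProduct.subsingletonEquiv_apply_tprod]
  rfl

variable {M}

/-- `(a_0, …, a_n) ↦ a_n ⊗ (a_0, …, a_{n-1})`. -/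
def frontLast : ∀ n : ℕ, TPow k M (n + 1) →ₗ[k] M ⊗[k] TPow k M n
  | 0 => (consEquiv k M 0).toLinearMap
  | n + 1 =>
    TensorProduct.map LinearMap.id (consEquiv k M n).symm.toLinearMap ∘ₗ
      (TensorProduct.leftComm k M M (TPow k M n)).toLinearMap ∘ₗ
        TensorProduct.map LinearMap.id (frontLast n) ∘ₗ (consEquiv k M (n + 1)).toLinearMap

/-- `(a_0, …, a_n) ↦ (a_n, a_0, …, a_{n-1})`. -/
def rot (n : ℕ) : TPow k M (n + 1) →ₗ[k] TPow k M (n + 1) :=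
  (consEquiv k M n).symm.toLinearMap ∘ₗ frontLast k n

/-- `(a_0, …, a_{n-1}) ↦ (a_0, …, a_{i-1}, x, a_i, …, a_{n-1})` for `i ≤ n`. -/
def insertAt (x : M) : ∀ n : ℕ, ℕ → (TPow k M n →ₗ[k] TPow k M (n + 1))
  | n, 0 => (consEquiv k M n).symm.toLinearMap ∘ₗ TensorProduct.mk k M (TPow k M n) x
  | 0, _ + 1 => 0
  | n + 1, i + 1 =>
    (consEquiv k M (n + 1)).symm.toLinearMap ∘ₗ
      TensorProduct.map LinearMap.id (insertAt x n i) ∘ₗ (consEquiv k M n).toLinearMap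

end TensorPower

section TensorPowerAlgebra

variable (k : Type*) [CommRing k] {R : Type*} [Ring R] [Algebra k R]

/-- `(a_0, …, a_n) ↦ (a_0, …, a_i a_{i+1}, …, a_n)` for `i < n`. -/
def mulAt : ∀ n : ℕ, ℕ → (TPow k R (n + 1) →ₗ[k] TPow k R n)
  | 0, _ => 0
  | n + 1, 0 =>
    (consEquiv k R n).symm.toLinearMap ∘ₗ
      TensorProduct.map (LinearMap.mul' k R) LinearMap.id ∘ₗ
        (TensorProduct.assoc k R R (TPow k R n)).symm.toLinearMap ∘ₗ
          TensorProduct.map LinearMap.id (consEquiv k R n).toLinearMap ∘ₗ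
            (consEquiv k R (n + 1)).toLinearMap
  | n + 1, i + 1 =>
    (consEquiv k R n).symm.toLinearMap ∘ₗ
      TensorProduct.map LinearMap.id (mulAt n i) ∘ₗ (consEquiv k R (n + 1)).toLinearMap

end TensorPowerAlgebra

/-! ## Paracyclic operators, `b` and `B` -/

/-- Faces `d n i : X (n+1) → X n` (`0 ≤ i ≤ n+1`), degeneracies `s n i : X n → X (n+1)`
(`0 ≤ i ≤ n`) and cyclic operators `t n : X n → X n` on a graded module `X`. -/
structure CycOps (k : Type*) [CommRing k] (X : ℕ → Type*) [∀ n, AddCommGroup (X n)]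
    [∀ n, Module k (X n)] where
  d : ∀ n, Fin (n + 2) → (X (n + 1) →ₗ[k] X n)
  s : ∀ n, Fin (n + 1) → (X n →ₗ[k] X (n + 1))
  t : ∀ n, X n →ₗ[k] X n

namespace CycOps

variable {k : Type*} [CommRing k] {X : ℕ → Type*} [∀ n, AddCommGroup (X n)]
  [∀ n, Module k (X n)] (O : CycOps k X)

/-- The identities of a paracyclic module. -/
structure IsParacyclic : Prop where
  d_d : ∀ n (i j : Fin (n + 2)), i ≤ j →
    O.d n i ∘ₗ O.d (n + 1) j.succ = O.d n j ∘ₗ O.d (n + 1) i.castSucc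
  s_s : ∀ n (i j : Fin (n + 1)), i ≤ j →
    O.s (n + 1) i.castSucc ∘ₗ O.s n j = O.s (n + 1) j.succ ∘ₗ O.s n i
  d_s_lt : ∀ n (i : Fin (n + 2)) (j : Fin (n + 1)), i ≤ j.castSucc →
    O.d (n + 1) i.castSucc ∘ₗ O.s (n + 1) j.succ = O.s n j ∘ₗ O.d n i
  d_s_eq : ∀ n (i : Fin (n + 1)), O.d n i.castSucc ∘ₗ O.s n i = LinearMap.id
  d_s_eq' : ∀ n (i : Fin (n + 1)), O.d n i.succ ∘ₗ O.s n i = LinearMap.id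
  d_s_gt : ∀ n (i : Fin (n + 2)) (j : Fin (n + 1)), j.castSucc < i →
    O.d (n + 1) i.succ ∘ₗ O.s (n + 1) j.castSucc = O.s n j ∘ₗ O.d n i
  d_t : ∀ n (i : Fin (n + 1)), O.d n i.succ ∘ₗ O.t (n + 1) = O.t n ∘ₗ O.d n i.castSucc
  d_zero_t : ∀ n, O.d n 0 ∘ₗ O.t (n + 1) = O.d n (Fin.last (n + 1))
  s_t : ∀ n (i : Fin n), O.s n i.succ ∘ₗ O.t n = O.t (n + 1) ∘ₗ O.s n i.castSucc
  s_zero_t : ∀ n, O.s n 0 ∘ₗ O.t n = O.t (n + 1) ∘ₗ O.t (n + 1) ∘ₗ O.s n (Fin.last n)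
  t_bijective : ∀ n, Function.Bijective (O.t n)

/-- The identities of a cyclic module. -/
structure IsCyclic : Prop extends O.IsParacyclic where
  t_pow : ∀ n, O.t n ^ (n + 1) = 1

/-- `b = ∑_{i=0}^{n+1} (-1)^i ∂_i : X (n+1) → X n`. -/
def b (n : ℕ) : X (n + 1) →ₗ[k] X n := ∑ i : Fin (n + 2), (-1 : k) ^ (i : ℕ) • O.d n i

/-- `b' = ∑_{i=0}^{n} (-1)^i ∂_i : X (n+1) → X n`. -/
def b' (n : ℕ) : X (n + 1) →ₗ[k] X n :=
  ∑ i : Fin (n + 1), (-1 : k) ^ (i : ℕ) • O.d n i.castSucc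

/-- The norm operator `N = ∑_{i=0}^n (-1)^{in} τ^i`. -/
def norm (n : ℕ) : X n →ₗ[k] X n :=
  ∑ i ∈ Finset.range (n + 1), (-1 : k) ^ (i * n) • O.t n ^ i

/-- The extra degeneracy `σ = τ σ_n`, which satisfies `τ σ = σ_0 τ` and `b' σ + σ b' = 1`. -/
def extra (n : ℕ) : X n →ₗ[k] X (n + 1) := O.t (n + 1) ∘ₗ O.s n (Fin.last n)

/-- `B = (1 - (-1)^{n+1} τ) σ N`. -/
def B (n : ℕ) : X n →ₗ[k] X (n + 1) :=
  (LinearMap.id - (-1 : k) ^ (n + 1) • O.t (n + 1)) ∘ₗ O.extra n ∘ₗ O.norm n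

/-- `σ' = σ b' σ`: again a contracting homotopy for `b'`, and one with `σ' σ' = 0`. -/
def extra' (n : ℕ) : X n →ₗ[k] X (n + 1) := O.extra n ∘ₗ O.b' n ∘ₗ O.extra n

/-- The operator `B' = (1 - (-1)^{n+1} τ) σ' N`.  For every paracyclic module it satisfies
`B' B' = 0` and `b B' + B' b = 1 - τ^{n+1}` on unnormalised chains.  (With `σ` in place of `σ'`,
`B B = 0` holds for cyclic modules but for general paracyclic ones only modulo degenerate chains.)
It agrees with `B` on normalised chains. -/
def B' (n : ℕ) : X n →ₗ[k] X (n + 1) :=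
  (LinearMap.id - (-1 : k) ^ (n + 1) • O.t (n + 1)) ∘ₗ O.extra' n ∘ₗ O.norm n

/-- The part of `B` that lands in `X n`. -/
def BInto : ∀ n : ℕ, (∀ m, X m) →ₗ[k] X n
  | 0 => 0
  | n + 1 => O.B n ∘ₗ LinearMap.proj n

/-- `b + B` on `∏ n, X n`. -/
def mixedD : (∀ n, X n) →ₗ[k] (∀ n, X n) :=
  LinearMap.pi fun n => O.b n ∘ₗ LinearMap.proj (n + 1) + O.BInto n

end CycOps

/-! ## The graded module `V ⊠ W = V[[u]] ⊗_{k[u]} W` -/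

section Box

variable (k : Type*) [CommRing k]

section PS

variable {I : Type*} (deg : I → ℕ) (V : I → Type*) [∀ i, AddCommGroup (V i)] [∀ i, Module k (V i)]

/-- Let `V` be the graded module with `V_n = ⨁_{deg i = n} V i`, where each `deg i = n` has finitely
many solutions.  The degree `m` part `∏_{r ≥ 0} V_{m+2r} u^r` of `V[[u]]` (`u` of degree `-2`) is
the module of the families `x` in `∏ i, V i` that are supported on those `i` for which
`deg i = m + 2r` with `r ≥ 0`; the coefficient of `u^r` is the part of `x` with `deg i = m + 2r`.
In this description multiplication by `u` is the inclusion `V[[u]]_{m+2} ⊆ V[[u]]_m`. -/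
def PS (m : ℤ) : Submodule k (∀ i, V i) where
  carrier := {x | ∀ i, ¬ (m ≤ deg i ∧ Even ((deg i : ℤ) - m)) → x i = 0}
  add_mem' hx hy i hi := by simp [hx i hi, hy i hi]
  zero_mem' := by intro i _; rfl
  smul_mem' c x hx i hi := by simp [hx i hi]

theorem PS_le {m m' : ℤ} (h : m' + 2 = m) : PS k deg V m ≤ PS k deg V m' := by
  intro x hx i hi
  refine hx i fun h' => hi ⟨by omega, ?_⟩
  obtain ⟨r, hr⟩ := h'.2
  exact ⟨r + 1, by omega⟩

end PS

variable {W : ℤ → Type*} [∀ j, AddCommGroup (W j)] [∀ j, Module k (W j)]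
  (u : ∀ j, W j →ₗ[k] W (j - 2))

section Def

variable {I : Type*} (deg : I → ℕ) (V : I → Type*) [∀ i, AddCommGroup (V i)] [∀ i, Module k (V i)]

/-- `V[[u]]_m ⊗ W_j`. -/
def Piece (W : ℤ → Type*) [∀ j, AddCommGroup (W j)] [∀ j, Module k (W j)] (m j : ℤ) : Type _ :=
  PS k deg V m ⊗[k] W j

instance (m j : ℤ) : AddCommGroup (Piece k deg V W m j) :=
  inferInstanceAs (AddCommGroup (PS k deg V m ⊗[k] W j))

instance (m j : ℤ) : Module k (Piece k deg V W m j) :=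
  inferInstanceAs (Module k (PS k deg V m ⊗[k] W j))

/-- The degree `n` part of `V[[u]] ⊗_k W`. -/
abbrev PreBox (W : ℤ → Type*) [∀ j, AddCommGroup (W j)] [∀ j, Module k (W j)] (n : ℤ) : Type _ :=
  ⨁ j : ℤ, Piece k deg V W (n - j) j

/-- The element `x ⊗ w` of `V[[u]] ⊗_k W`. -/
def PreBox.tmul (n j : ℤ) (x : PS k deg V (n - j)) (w : W j) : PreBox k deg V W n :=
  DirectSum.lof k ℤ (fun j => Piece k deg V W (n - j) j) j (x ⊗ₜ[k] w)

/-- The relations `u x ⊗ w = x ⊗ u w` in degree `n`. -/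
def boxRel (n : ℤ) : Submodule k (PreBox k deg V W n) :=
  Submodule.span k
    {z | ∃ (j : ℤ) (x : PS k deg V (n - (j - 2))) (w : W j),
      z = PreBox.tmul k deg V n j (Submodule.inclusion (PS_le k deg V (by ring)) x) w
          - PreBox.tmul k deg V n (j - 2) x (u j w)}

/-- The degree `n` part of `V ⊠ W = V[[u]] ⊗_{k[u]} W`, where the graded `k[u]`-module `W` is given
by its homogeneous parts `W j` and the action `u j : W j → W (j - 2)` of the variable `u`. -/
def Box (n : ℤ) : Type _ := PreBox k deg V W n ⧸ boxRel k u deg V n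

instance (n : ℤ) : AddCommGroup (Box k u deg V n) :=
  inferInstanceAs (AddCommGroup (PreBox k deg V W n ⧸ boxRel k u deg V n))

instance (n : ℤ) : Module k (Box k u deg V n) :=
  inferInstanceAs (Module k (PreBox k deg V W n ⧸ boxRel k u deg V n))

/-- The class of `x ⊗ w` in `V ⊠ W`. -/
def Box.tmul (n j : ℤ) (x : PS k deg V (n - j)) (w : W j) : Box k u deg V n :=
  (boxRel k u deg V n).mkQ (PreBox.tmul k deg V n j x w)

end Def

section Map

variable {I : Type*} (deg : I → ℕ) {V : I → Type*} [∀ i, AddCommGroup (V i)] [∀ i, Module k (V i)]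
  {V' : I → Type*} [∀ i, AddCommGroup (V' i)] [∀ i, Module k (V' i)]

/-- `Θ` lowers the degree by `c`, as a map of graded `k[u]`-modules `V[[u]] → V'[[u]]`. -/
def Lowers (c : ℤ) (Θ : (∀ i, V i) →ₗ[k] (∀ i, V' i)) : Prop :=
  ∀ m m' : ℤ, m' + c = m → ∀ x ∈ PS k deg V m, Θ x ∈ PS k deg V' m'

/-- `Θ ⊗ 1 : V[[u]]_m ⊗ W_j → V'[[u]]_{m'} ⊗ W_j`, `m' = m - c`. -/
def Piece.map {c : ℤ} {Θ : (∀ i, V i) →ₗ[k] (∀ i, V' i)} (hΘ : Lowers k deg c Θ) {m m' : ℤ}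
    (h : m' + c = m) (j : ℤ) : Piece k deg V W m j →ₗ[k] Piece k deg V' W m' j :=
  TensorProduct.map (Θ.restrict (p := PS k deg V m) (q := PS k deg V' m') fun x hx =>
    hΘ m m' h x hx) LinearMap.id

/-- The map `Θ ⊗ 1 : (V ⊠ W)_n → (V' ⊠ W)_{n'}`, `n' = n - c`. -/
def Box.map {c : ℤ} {Θ : (∀ i, V i) →ₗ[k] (∀ i, V' i)} (hΘ : Lowers k deg c Θ) {n n' : ℤ}
    (h : n' + c = n) : Box k u deg V n →ₗ[k] Box k u deg V' n' :=
  Submodule.mapQ (boxRel k u deg V n) (boxRel k u deg V' n')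
    (DirectSum.lmap fun j => Piece.map k deg hΘ (show (n' - j) + c = n - j by omega) j) (by
    rw [boxRel, Submodule.span_le]
    rintro _ ⟨j, x, w, rfl⟩
    refine Submodule.subset_span ⟨j, ⟨Θ x, hΘ _ _ (by omega) _ x.2⟩, w, ?_⟩
    rw [map_sub]
    congr 1 <;> exact DirectSum.lmap_lof _ _ _)

end Map

end Box

/-! ## Subquotients and homology -/

section Subquotient

variable {k : Type*} [CommRing k] {X : Type*} [AddCommGroup X] [Module k X]
  {Y : Type*} [AddCommGroup Y] [Module k Y]

/-- The subquotient `Z / (B ∩ Z)` of `X`. -/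
def Subq (Z B : Submodule k X) : Type _ := Z ⧸ B.submoduleOf Z

instance (Z B : Submodule k X) : AddCommGroup (Subq Z B) :=
  inferInstanceAs (AddCommGroup (Z ⧸ B.submoduleOf Z))

instance (Z B : Submodule k X) : Module k (Subq Z B) :=
  inferInstanceAs (Module k (Z ⧸ B.submoduleOf Z))

/-- The class of an element of `Z`. -/
def Subq.mk (Z B : Submodule k X) : Z →ₗ[k] Subq Z B := (B.submoduleOf Z).mkQ

/-- `f` maps `Z` into `Z'` and `B ∩ Z` into `B'`. -/
def Descends (f : X →ₗ[k] Y) (Z B : Submodule k X) (Z' B' : Submodule k Y) : Prop :=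
  Z ≤ Z'.comap f ∧ B ⊓ Z ≤ B'.comap f

open Classical in
/-- The map `[x] ↦ [f x]` of subquotients, for `f` with `Descends f Z B Z' B'`. -/
def Subq.map (f : X →ₗ[k] Y) (Z B : Submodule k X) (Z' B' : Submodule k Y) :
    Subq Z B →ₗ[k] Subq Z' B' :=
  if h : Descends f Z B Z' B' then
    Submodule.mapQ (B.submoduleOf Z) (B'.submoduleOf Z')
      (f.restrict (p := Z) (q := Z') fun _ hx => h.1 hx)
      (fun x hx => h.2 (show (x : X) ∈ B ⊓ Z from ⟨hx, x.2⟩))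
  else 0

end Subquotient

/-! ## Cyclic homology with coefficients in `W` -/

section CyclicHomology

variable {k : Type*} [CommRing k] {W : ℤ → Type*} [∀ j, AddCommGroup (W j)] [∀ j, Module k (W j)]
  (u : ∀ j, W j →ₗ[k] W (j - 2))
  {X : ℕ → Type*} [∀ n, AddCommGroup (X n)] [∀ n, Module k (X n)]

theorem lowers_mixedD (O : CycOps k X) : Lowers k (id : ℕ → ℕ) 1 O.mixedD := by
  intro m m' h x hx n hn
  have h1 : x (n + 1) = 0 := by
    refine hx _ fun h' => hn ⟨?_, ?_⟩
    · have := h'.1; simp only [id] at this ⊢; push_cast at this; omega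
    · obtain ⟨r, hr⟩ := h'.2
      refine ⟨r, ?_⟩
      simp only [id] at hr ⊢; push_cast at hr; omega
  have h2 : O.BInto n x = 0 := by
    cases n with
    | zero => rfl
    | succ n =>
      have : x n = 0 := by
        refine hx _ fun h' => hn ⟨?_, ?_⟩
        · have := h'.1; simp only [id] at this ⊢; push_cast; omega
        · obtain ⟨r, hr⟩ := h'.2
          refine ⟨r + 1, ?_⟩
          simp only [id] at hr ⊢; push_cast; omega
      simp [CycOps.BInto, this]
  simp [CycOps.mixedD, h1, h2]

/-- The differential `b + u B` of `C(X) ⊠ W`. -/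
def cycD (O : CycOps k X) {n n' : ℤ} (h : n' + 1 = n) :
    Box k u (id : ℕ → ℕ) X n →ₗ[k] Box k u (id : ℕ → ℕ) X n' :=
  Box.map k u id (lowers_mixedD O) h

/-- `HC_n(X; W)`: the homology of `(C(X) ⊠ W, b + u B)` in degree `n`, for a cyclic module `X`. -/
abbrev HC (O : CycOps k X) (n : ℤ) : Type _ :=
  Subq (LinearMap.ker (cycD u O (show (n - 1) + 1 = n by omega)))
    (LinearMap.range (cycD u O (show n + 1 = n + 1 from rfl)))

end CyclicHomology

/-! ## The cyclic module of an algebra -/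

section AlgebraCyclic

variable (k : Type*) [CommRing k] (R : Type*) [Ring R] [Algebra k R]

/-- The operators of the cyclic module `C(R)`, `C_n(R) = R^{⊗(n+1)}`, of an algebra `R`. -/
def algOps : CycOps k (fun n => TPow k R (n + 1)) where
  d n i := if (i : ℕ) < n + 1 then mulAt k (n + 1) i else mulAt k (n + 1) 0 ∘ₗ rot k (n + 1)
  s n i := insertAt k 1 (n + 1) (i + 1)
  t n := rot k n

end AlgebraCyclic

/-! ## Module algebras and crossed products -/

section ModuleAlgebra

open Coalgebra

/-- `A` is a (left) `H`-module algebra: `h (a b) = (h⁽⁰⁾ a) (h⁽¹⁾ b)` and `h 1 = ε(h) 1`. -/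
class IsModuleAlgebra (k H A : Type*) [CommRing k] [Ring H] [Bialgebra k H] [Ring A] [Algebra k A]
    [Module H A] : Prop where
  smul_mul : ∀ (h : H) (a b : A) (r : Repr k h (H × H)),
    h • (a * b) = ∑ i ∈ r.index, (r.left i • a) * (r.right i • b)
  smul_one : ∀ h : H, h • (1 : A) = counit (R := k) h • (1 : A)

end ModuleAlgebra

section CrossedProduct

open Coalgebra

variable (k H A : Type*) [CommRing k] [Ring H] [Bialgebra k H] [Ring A] [Algebra k A]
  [Module H A] [IsScalarTower k H A]

/-- The underlying `k`-module `A ⊗ H` of the crossed product `A ⋊ H`. -/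
def CrossedProduct : Type _ := A ⊗[k] H

instance : AddCommGroup (CrossedProduct k H A) := inferInstanceAs (AddCommGroup (A ⊗[k] H))

instance : Module k (CrossedProduct k H A) := inferInstanceAs (Module k (A ⊗[k] H))

namespace CrossedProduct

/-- `b ⊗ h ↦ a b ⊗ h`. -/
def leftA : A →ₐ[k] Module.End k (A ⊗[k] H) :=
  (Module.endTensorEndAlgHom (R := k) (S := k) (A := k) (M := A) (N := H)).comp
    ((Algebra.TensorProduct.includeLeft (R := k) (S := k)).comp (Algebra.lmul k A))

/-- `b ⊗ h ↦ (g⁽⁰⁾ b) ⊗ g⁽¹⁾ h`. -/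
def leftH : H →ₐ[k] Module.End k (A ⊗[k] H) :=
  (Module.endTensorEndAlgHom (R := k) (S := k) (A := k) (M := A) (N := H)).comp
    ((Algebra.TensorProduct.map (Algebra.lsmul k k A) (Algebra.lmul k H)).comp
      (Bialgebra.comulAlgHom k H))

/-- `(a ⊗ g) (b ⊗ h) = a (g⁽⁰⁾ b) ⊗ g⁽¹⁾ h`. -/
def mulHom : A ⊗[k] H →ₗ[k] A ⊗[k] H →ₗ[k] A ⊗[k] H :=
  TensorProduct.lift ((LinearMap.mul k (Module.End k (A ⊗[k] H))).compl₁₂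
    (leftA k H A).toLinearMap (leftH k H A).toLinearMap)

variable {k H A}

theorem mulHom_tmul (a : A) (g : H) :
    mulHom k H A (a ⊗ₜ g) = leftA k H A a * leftH k H A g := by
  simp [mulHom]

theorem leftH_tmul (g : H) (b : A) (h : H) {ι : Type*} (r : Repr k g ι) :
    leftH k H A g (b ⊗ₜ h) = ∑ i ∈ r.index, (r.left i • b) ⊗ₜ[k] (r.right i * h) := by
  simp only [leftH, AlgHom.comp_apply, Bialgebra.comulAlgHom_apply, ← r.eq, map_sum,
    LinearMap.sum_apply]
  rfl

theorem mulHom_tmul_tmul (a : A) (g : H) (b : A) (h : H) {ι : Type*} (r : Repr k g ι) :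
    mulHom k H A (a ⊗ₜ g) (b ⊗ₜ h) =
      ∑ i ∈ r.index, (a * (r.left i • b)) ⊗ₜ[k] (r.right i * h) := by
  rw [mulHom_tmul, Module.End.mul_apply, leftH_tmul g b h r, map_sum]
  rfl

theorem one_mulHom (y : A ⊗[k] H) : mulHom k H A (1 ⊗ₜ 1) y = y := by
  rw [mulHom_tmul, map_one, map_one]
  rfl

variable [IsModuleAlgebra k H A]

theorem leftH_mul_leftA (g : H) (b : A) :
    leftH k H A g * leftA k H A b =
      ∑ i ∈ (ℛ k g).index, leftA k H A ((ℛ k g).left i • b) * leftH k H A ((ℛ k g).right i) := by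
  refine TensorProduct.ext' fun c l => ?_
  let Φ : H ⊗[k] (H ⊗[k] H) →ₗ[k] A ⊗[k] H :=
    TensorProduct.map (LinearMap.mul' k A) LinearMap.id ∘ₗ
      (TensorProduct.assoc k A A H).symm.toLinearMap ∘ₗ
        TensorProduct.map ((LinearMap.toSpanSingleton H A b).restrictScalars k)
          (TensorProduct.map ((LinearMap.toSpanSingleton H A c).restrictScalars k)
            (LinearMap.mulRight k l))
  have hΦ : ∀ x y z : H, Φ (x ⊗ₜ (y ⊗ₜ z)) = ((x • b) * (y • c)) ⊗ₜ[k] (z * l) := fun _ _ _ => rfl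
  have key := congrArg Φ (sum_tmul_tmul_eq (ℛ k g) (fun i => ℛ k ((ℛ k g).left i))
    (fun i => ℛ k ((ℛ k g).right i)))
  simp only [map_sum, hΦ] at key
  rw [Module.End.mul_apply, show leftA k H A b (c ⊗ₜ l) = (b * c) ⊗ₜ[k] l from rfl,
    leftH_tmul g _ l (ℛ k g), LinearMap.sum_apply]
  simp only [Module.End.mul_apply]
  refine Eq.trans ?_ (key.trans ?_)
  · refine Finset.sum_congr rfl fun i _ => ?_
    rw [IsModuleAlgebra.smul_mul (k := k) _ _ _ (ℛ k ((ℛ k g).left i)), TensorProduct.sum_tmul]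
  · refine Finset.sum_congr rfl fun i _ => ?_
    rw [leftH_tmul _ c l (ℛ k ((ℛ k g).right i)), map_sum]
    rfl

theorem mulHom_mul (x y : A ⊗[k] H) :
    mulHom k H A (mulHom k H A x y) = mulHom k H A x * mulHom k H A y := by
  induction x using TensorProduct.induction_on with
  | zero => simp
  | add x₁ x₂ h₁ h₂ => simp only [map_add, LinearMap.add_apply, h₁, h₂, add_mul]
  | tmul a g =>
    induction y using TensorProduct.induction_on with
    | zero => simp
    | add y₁ y₂ h₁ h₂ => simp only [map_add, h₁, h₂, mul_add]
    | tmul b h =>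
      rw [mulHom_tmul_tmul a g b h (ℛ k g), map_sum]
      simp only [mulHom_tmul, map_mul]
      have := leftH_mul_leftA (k := k) (A := A) g b
      rw [mul_assoc, ← mul_assoc (leftH k H A g), this, Finset.sum_mul, Finset.mul_sum]
      simp only [mul_assoc]

theorem mulHom_one (x : A ⊗[k] H) : mulHom k H A x (1 ⊗ₜ 1) = x := by
  induction x using TensorProduct.induction_on with
  | zero => simp
  | add x₁ x₂ h₁ h₂ => simp only [map_add, LinearMap.add_apply, h₁, h₂]
  | tmul a g =>
    rw [mulHom_tmul_tmul a g 1 1 (ℛ k g)]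
    simp only [IsModuleAlgebra.smul_one (k := k) (H := H) (A := A), mul_one]
    conv_rhs => rw [← sum_counit_smul (ℛ k g), TensorProduct.tmul_sum]
    refine Finset.sum_congr rfl fun i _ => ?_
    rw [mul_smul_comm, mul_one, TensorProduct.smul_tmul]

/-- The algebra structure of the crossed product `A ⋊ H`. -/
instance : Ring (CrossedProduct k H A) where
  __ := (inferInstance : AddCommGroup (CrossedProduct k H A))
  mul x y := mulHom k H A x y
  one := (1 : A) ⊗ₜ[k] (1 : H)
  left_distrib x y z := (mulHom k H A x).map_add y z
  right_distrib x y z := LinearMap.congr_fun ((mulHom k H A).map_add x y) z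
  zero_mul x := LinearMap.congr_fun (mulHom k H A).map_zero x
  mul_zero x := (mulHom k H A x).map_zero
  mul_assoc x y z := LinearMap.congr_fun (mulHom_mul x y) z
  one_mul := one_mulHom
  mul_one := mulHom_one

instance : Algebra k (CrossedProduct k H A) :=
  Algebra.ofModule
    (fun r x y => show mulHom k H A (r • x) y = r • mulHom k H A x y from
      LinearMap.congr_fun ((mulHom k H A).map_smul r x) y)
    (fun r x y => show mulHom k H A x (r • y) = r • mulHom k H A x y from
      (mulHom k H A x).map_smul r y)

end CrossedProduct

end CrossedProduct

/-! ## Hopf homology -/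

section HopfHomology

open Coalgebra

variable {k H : Type*} [CommRing k] [Ring H] [Bialgebra k H]
  {M : Type*} [AddCommGroup M] [Module k M]

/-- `(g_1, …, g_{q+1}, m) ↦ (g_1, …, g_q, g_{q+1} m)`. -/
def actLast (α : H →ₗ[k] Module.End k M) (q : ℕ) :
    TPow k H (q + 1) ⊗[k] M →ₗ[k] TPow k H q ⊗[k] M :=
  TensorProduct.map LinearMap.id (TensorProduct.lift α) ∘ₗ
    (TensorProduct.assoc k (TPow k H q) H M).toLinearMap ∘ₗ
      TensorProduct.map (TensorProduct.comm k H (TPow k H q)).toLinearMap LinearMap.id ∘ₗ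
        TensorProduct.map (frontLast k q) LinearMap.id

variable (k H) in
/-- `(g_1, …, g_{q+1}) ↦ ε(g_1) (g_2, …, g_{q+1})`. -/
def counitHead (q : ℕ) : TPow k H (q + 1) →ₗ[k] TPow k H q :=
  (TensorProduct.lid k (TPow k H q)).toLinearMap ∘ₗ
    TensorProduct.map counit LinearMap.id ∘ₗ (consEquiv k H q).toLinearMap

/-- The boundary `δ : C_{q+1}(H, M) → C_q(H, M)`, where `C_q(H, M) = H^{⊗q} ⊗ M` and the left
`H`-module `M` is given by its structure map `α`. -/
def hopfδ (α : H →ₗ[k] Module.End k M) (q : ℕ) :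
    TPow k H (q + 1) ⊗[k] M →ₗ[k] TPow k H q ⊗[k] M :=
  TensorProduct.map (counitHead k H q) LinearMap.id
    + ∑ i ∈ Finset.range q,
        (-1 : k) ^ (i + 1) • TensorProduct.map (mulAt k q i) (LinearMap.id : M →ₗ[k] M)
    + (-1 : k) ^ (q + 1) • actLast α q

/-- The cycles in `C_q(H, M)`. -/
def hopfCycles (α : H →ₗ[k] Module.End k M) : ∀ q : ℕ, Submodule k (TPow k H q ⊗[k] M)
  | 0 => ⊤
  | q + 1 => LinearMap.ker (hopfδ α q)

/-- The Hopf homology `H_q(H, M)`. -/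
abbrev HopfH (α : H →ₗ[k] Module.End k M) (q : ℕ) : Type _ :=
  Subq (hopfCycles α q) (LinearMap.range (hopfδ α q))

end HopfHomology

/-! ## The cylindrical module `A^op ♮ H^cop` and its first column -/

section Cylindrical

open Coalgebra

variable (k H A : Type*) [CommRing k] [Ring H] [HopfAlgebra k H] [Ring A] [Algebra k A]
  [Module H A] [IsScalarTower k H A]

/-- The diagonal action `h (a_0, …, a_{n-1}) = (h⁽⁰⁾ a_0, …, h⁽ⁿ⁻¹⁾ a_{n-1})` on `A^{⊗n}`. -/
def diagAct : ∀ n : ℕ, H →ₐ[k] Module.End k (TPow k A n)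
  | 0 => (Algebra.ofId k _).comp (Bialgebra.counitAlgHom k H)
  | n + 1 =>
    ((LinearEquiv.conjAlgEquiv k (consEquiv k A n).symm : _ →ₐ[k] _).comp
      (Module.endTensorEndAlgHom (R := k) (S := k) (A := k) (M := A) (N := TPow k A n))).comp
        ((Algebra.TensorProduct.map (Algebra.lsmul k k A) (diagAct n)).comp
          (Bialgebra.comulAlgHom k H))

/-- `h ⊗ (a_0, …, a_n) ↦ (h a_0, a_1, …, a_n)`. -/
def headAct (n : ℕ) : H ⊗[k] TPow k A (n + 1) →ₗ[k] TPow k A (n + 1) :=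
  (consEquiv k A n).symm.toLinearMap ∘ₗ
    TensorProduct.map (TensorProduct.lift (Algebra.lsmul k k A).toLinearMap) LinearMap.id ∘ₗ
      (TensorProduct.assoc k H A (TPow k A n)).symm.toLinearMap ∘ₗ
        TensorProduct.map LinearMap.id (consEquiv k A n).toLinearMap

/-- `(g_0, …, g_{m-1}) ↦ g_0⁽⁰⁾ ⋯ g_{m-1}⁽⁰⁾ ⊗ (g_0⁽¹⁾, …, g_{m-1}⁽¹⁾)`. -/
def coact : ∀ m : ℕ, TPow k H m →ₗ[k] H ⊗[k] TPow k H m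
  | 0 => TensorProduct.mk k H (TPow k H 0) 1
  | m + 1 =>
    TensorProduct.map (LinearMap.mul' k H) (consEquiv k H m).symm.toLinearMap ∘ₗ
      (TensorProduct.tensorTensorTensorComm k H H H (TPow k H m)).toLinearMap ∘ₗ
        TensorProduct.map comul (coact m) ∘ₗ (consEquiv k H m).toLinearMap

variable {k H}

/-- The inverse of a bijective antipode. -/
def antipodeInv (hS : Function.Bijective (HopfAlgebra.antipode k : H →ₗ[k] H)) : H →ₗ[k] H :=
  (LinearEquiv.ofBijective (HopfAlgebra.antipode k) hS).symm.toLinearMap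

/-- The operators in the `A`-direction on `Y ⊗ A^{⊗(n+1)}`, for a coaction `ρ y = y⁽⁰⁾ ⊗ y⁽¹⁾` of
`H` on `Y`:
`τ (y | a_0, …, a_n) = (y⁽¹⁾ | S⁻¹(y⁽⁰⁾) a_n, a_0, …, a_{n-1})`,
`∂_i (y | a_0, …, a_n) = (y | a_0, …, a_i a_{i+1}, …, a_n)` for `i < n`,
`∂_n (y | a_0, …, a_n) = (y⁽¹⁾ | (S⁻¹(y⁽⁰⁾) a_n) a_0, a_1, …, a_{n-1})`,
`σ_i (y | a_0, …, a_n) = (y | a_0, …, a_i, 1, a_{i+1}, …, a_n)`. -/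
def aOps (hS : Function.Bijective (HopfAlgebra.antipode k : H →ₗ[k] H))
    {Y : Type*} [AddCommGroup Y] [Module k Y] (ρ : Y →ₗ[k] H ⊗[k] Y) :
    CycOps k (fun n => Y ⊗[k] TPow k A (n + 1)) :=
  let τ : ∀ n, Y ⊗[k] TPow k A (n + 1) →ₗ[k] Y ⊗[k] TPow k A (n + 1) := fun n =>
    TensorProduct.map LinearMap.id
        (headAct k H A n ∘ₗ TensorProduct.map (antipodeInv hS) LinearMap.id) ∘ₗ
      (TensorProduct.assoc k Y H (TPow k A (n + 1))).toLinearMap ∘ₗ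
        TensorProduct.map ((TensorProduct.comm k H Y).toLinearMap ∘ₗ ρ) (rot k n)
  { d := fun n i =>
      if (i : ℕ) < n + 1 then TensorProduct.map LinearMap.id (mulAt k (n + 1) i)
      else TensorProduct.map LinearMap.id (mulAt k (n + 1) 0) ∘ₗ τ (n + 1)
    s := fun n i => TensorProduct.map LinearMap.id (insertAt k 1 (n + 1) (i + 1))
    t := τ }

/-- The operators in the `H`-direction on `H^{⊗(m+1)} ⊗ Z`, for an action `α` of `H` on `Z`:
`τ̄ (g_0, …, g_m | z) = (g_m⁽¹⁾, g_0, …, g_{m-1} | g_m⁽⁰⁾ z)`,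
`∂̄_i (g_0, …, g_m | z) = (g_0, …, g_i g_{i+1}, …, g_m | z)` for `i < m`,
`∂̄_m (g_0, …, g_m | z) = (g_m⁽¹⁾ g_0, g_1, …, g_{m-1} | g_m⁽⁰⁾ z)`,
`σ̄_i (g_0, …, g_m | z) = (g_0, …, g_i, 1, g_{i+1}, …, g_m | z)`. -/
def hOps {Z : Type*} [AddCommGroup Z] [Module k Z] (α : H →ₗ[k] Module.End k Z) :
    CycOps k (fun m => TPow k H (m + 1) ⊗[k] Z) :=
  let τ : ∀ m, TPow k H (m + 1) ⊗[k] Z →ₗ[k] TPow k H (m + 1) ⊗[k] Z := fun m =>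
    TensorProduct.map (consEquiv k H m).symm.toLinearMap (TensorProduct.lift α) ∘ₗ
      (TensorProduct.assoc k (H ⊗[k] TPow k H m) H Z).toLinearMap ∘ₗ
        TensorProduct.map
          ((TensorProduct.comm k H (H ⊗[k] TPow k H m)).toLinearMap ∘ₗ
            (TensorProduct.assoc k H H (TPow k H m)).toLinearMap ∘ₗ
              TensorProduct.map comul LinearMap.id ∘ₗ frontLast k m)
          LinearMap.id
  { d := fun m i =>
      if (i : ℕ) < m + 1 then TensorProduct.map (mulAt k (m + 1) i) LinearMap.id
      else TensorProduct.map (mulAt k (m + 1) 0) LinearMap.id ∘ₗ τ (m + 1)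
    s := fun m i => TensorProduct.map (insertAt k 1 (m + 1) (i + 1)) LinearMap.id
    t := τ }

variable (k H)

/-- `C_n(A^♮_H) = H ⊗ A^{⊗(n+1)}`. -/
abbrev NatC (n : ℕ) : Type _ := H ⊗[k] TPow k A (n + 1)

/-- The action of `H` on `C_n(A^♮_H)`:
`h (g | a_0, …, a_n) = (h⁽ⁿ⁺²⁾ g S(h⁽⁰⁾) | h⁽¹⁾ a_0, …, h⁽ⁿ⁺¹⁾ a_n)`. -/
def natAct (n : ℕ) : H →ₗ[k] Module.End k (NatC k H A n) :=
  let P : H →ₗ[k] Module.End k (NatC k H A n) :=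
    LinearMap.rTensorHom (TPow k A (n + 1)) ∘ₗ (LinearMap.mul k H).flip ∘ₗ HopfAlgebra.antipode k
  let Q : H →ₗ[k] Module.End k (NatC k H A n) :=
    LinearMap.lTensorHom H ∘ₗ (diagAct k H A (n + 1)).toLinearMap
  let L : H →ₗ[k] Module.End k (NatC k H A n) :=
    LinearMap.rTensorHom (TPow k A (n + 1)) ∘ₗ LinearMap.mul k H
  LinearMap.mul' k (Module.End k (NatC k H A n)) ∘ₗ
    TensorProduct.map P
      (LinearMap.mul' k (Module.End k (NatC k H A n)) ∘ₗ TensorProduct.map Q L ∘ₗ comul) ∘ₗ comul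

/-- `C_q(H, C_n(A^♮_H)) = H^{⊗q} ⊗ C_n(A^♮_H)`. -/
abbrev HopfNat (q n : ℕ) : Type _ := TPow k H q ⊗[k] NatC k H A n

variable {k H}

/-- The operators on `C_q(H, C_•(A^♮_H))`:
`𝔱 (g_1, …, g_q | g | a_0, …, a_n) = (g_1, …, g_q | g⁽¹⁾ | S⁻¹(g⁽⁰⁾) a_n, a_0, …, a_{n-1})`,
and correspondingly for the faces and degeneracies. -/
def rowOps (hS : Function.Bijective (HopfAlgebra.antipode k : H →ₗ[k] H)) (q : ℕ) :
    CycOps k (HopfNat k H A q) where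
  d n i := TensorProduct.map LinearMap.id ((aOps A hS comul).d n i)
  s n i := TensorProduct.map LinearMap.id ((aOps A hS comul).s n i)
  t n := TensorProduct.map LinearMap.id ((aOps A hS comul).t n)

/-- All operators of `C_•(A^♮_H)` descend to `H_q(H, C_•(A^♮_H))`. -/
structure RowDescends (hS : Function.Bijective (HopfAlgebra.antipode k : H →ₗ[k] H)) (q : ℕ) :
    Prop where
  d : ∀ n i, Descends ((rowOps A hS q).d n i)
    (hopfCycles (natAct k H A (n + 1)) q) (LinearMap.range (hopfδ (natAct k H A (n + 1)) q))
    (hopfCycles (natAct k H A n) q) (LinearMap.range (hopfδ (natAct k H A n) q))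
  s : ∀ n i, Descends ((rowOps A hS q).s n i)
    (hopfCycles (natAct k H A n) q) (LinearMap.range (hopfδ (natAct k H A n) q))
    (hopfCycles (natAct k H A (n + 1)) q) (LinearMap.range (hopfδ (natAct k H A (n + 1)) q))
  t : ∀ n, Descends ((rowOps A hS q).t n)
    (hopfCycles (natAct k H A n) q) (LinearMap.range (hopfδ (natAct k H A n) q))
    (hopfCycles (natAct k H A n) q) (LinearMap.range (hopfδ (natAct k H A n) q))

/-- The cyclic module `H_q(H, C_•(A^♮_H))`, with the operators induced by those of `rowOps`. -/
def hopfHOps (hS : Function.Bijective (HopfAlgebra.antipode k : H →ₗ[k] H)) (q : ℕ) :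
    CycOps k (fun n => HopfH (natAct k H A n) q) where
  d n i := Subq.map ((rowOps A hS q).d n i) _ _ _ _
  s n i := Subq.map ((rowOps A hS q).s n i) _ _ _ _
  t n := Subq.map ((rowOps A hS q).t n) _ _ _ _

end Cylindrical

/-! ## Hopf homology with coefficients in `C_p(A^♮_H) ⊠ W` -/

section RowBox

variable {k H : Type*} (A : Type*) [CommRing k] [Ring H] [HopfAlgebra k H] [Ring A] [Algebra k A]
  [Module H A] [IsScalarTower k H A]
  {W : ℤ → Type*} [∀ j, AddCommGroup (W j)] [∀ j, Module k (W j)]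
  (u : ∀ j, W j →ₗ[k] W (j - 2))

/-- A family of maps, acting index by index on `∏ i, V i`, has degree zero. -/
theorem lowers_pi {I : Type*} (deg : I → ℕ) {V : I → Type*} [∀ i, AddCommGroup (V i)]
    [∀ i, Module k (V i)] {V' : I → Type*} [∀ i, AddCommGroup (V' i)] [∀ i, Module k (V' i)]
    (f : ∀ i, V i →ₗ[k] V' i) :
    Lowers k deg 0 (LinearMap.pi fun i => f i ∘ₗ LinearMap.proj i) := by
  intro m m' h x hx i hi
  have : x i = 0 := hx i (by rw [add_zero] at h; exact h ▸ hi)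
  simp [this]

/-- `C_q(H, C_p(A^♮_H) ⊠ W)`: the degree `p` part of `C_q(H, C_•(A^♮_H)) ⊠ W`. -/
abbrev RowBox (k H : Type*) (A : Type*) [CommRing k] [Ring H] [HopfAlgebra k H] [Ring A]
    [Algebra k A] [Module H A] [IsScalarTower k H A]
    {W : ℤ → Type*} [∀ j, AddCommGroup (W j)] [∀ j, Module k (W j)]
    (u : ∀ j, W j →ₗ[k] W (j - 2)) (p : ℤ) (q : ℕ) : Type _ :=
  Box k u (id : ℕ → ℕ) (HopfNat k H A q) p

variable (k H) in
/-- The boundary `δ : C_{q+1}(H, C_p(A^♮_H) ⊠ W) → C_q(H, C_p(A^♮_H) ⊠ W)`. -/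
def rowδ (p : ℤ) (q : ℕ) : RowBox k H A u p (q + 1) →ₗ[k] RowBox k H A u p q :=
  Box.map k u id (lowers_pi id fun n => hopfδ (natAct k H A n) q) (add_zero p)

variable (k H) in
/-- The `δ`-cycles in `C_q(H, C_p(A^♮_H) ⊠ W)`. -/
def rowCycles (p : ℤ) : ∀ q : ℕ, Submodule k (RowBox k H A u p q)
  | 0 => ⊤
  | q + 1 => LinearMap.ker (rowδ k H A u p q)

variable (k H) in
/-- `H_q(H, C_p(A^♮_H) ⊠ W)`. -/
abbrev RowH (p : ℤ) (q : ℕ) : Type _ :=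
  Subq (rowCycles k H A u p q) (LinearMap.range (rowδ k H A u p q))

/-- `𝔟 + u 𝔅` descends to a map `H_q(H, C_p(A^♮_H) ⊠ W) → H_q(H, C_{p-1}(A^♮_H) ⊠ W)`. -/
def RowDDescends (hS : Function.Bijective (HopfAlgebra.antipode k : H →ₗ[k] H)) {p p' : ℤ}
    (h : p' + 1 = p) (q : ℕ) : Prop :=
  Descends (cycD u (rowOps A hS q) h)
    (rowCycles k H A u p q) (LinearMap.range (rowδ k H A u p q))
    (rowCycles k H A u p' q) (LinearMap.range (rowδ k H A u p' q))

/-- The map `𝔟 + u 𝔅 : H_q(H, C_p(A^♮_H) ⊠ W) → H_q(H, C_{p-1}(A^♮_H) ⊠ W)`. -/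
def rowHD (hS : Function.Bijective (HopfAlgebra.antipode k : H →ₗ[k] H)) {p p' : ℤ}
    (h : p' + 1 = p) (q : ℕ) : RowH k H A u p q →ₗ[k] RowH k H A u p' q :=
  Subq.map (cycD u (rowOps A hS q) h) _ _ _ _

end RowBox

/-! ## The spectral sequence of a filtered complex -/

/-- A differential `d` of degree `-1` and submodules `F n p ⊆ K n` on a graded module `K`. -/
structure FiltOps (k : Type*) [CommRing k] (K : ℤ → Type*) [∀ n, AddCommGroup (K n)]
    [∀ n, Module k (K n)] where
  d : ∀ {n n' : ℤ}, n' + 1 = n → (K n →ₗ[k] K n')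
  F : ∀ n : ℤ, ℤ → Submodule k (K n)

namespace FiltOps

variable {k : Type*} [CommRing k] {K : ℤ → Type*} [∀ n, AddCommGroup (K n)]
  [∀ n, Module k (K n)] (C : FiltOps k K)

/-- `(K, d)` is a complex and `F` is an increasing filtration of it by subcomplexes. -/
structure IsFilteredComplex : Prop where
  d_d : ∀ {n n' n'' : ℤ} (h : n' + 1 = n) (h' : n'' + 1 = n'), C.d h' ∘ₗ C.d h = 0
  mono : ∀ n, Monotone (C.F n)
  stable : ∀ {n n' : ℤ} (h : n' + 1 = n) (p : ℤ), C.F n p ≤ (C.F n' p).comap (C.d h)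

/-- `Z^r_p K_n = {x ∈ F_p K_n | d x ∈ F_{p-r} K_{n-1}}`. -/
def Z (r p n : ℤ) : Submodule k (K n) :=
  C.F n p ⊓ ⨅ (n' : ℤ) (h : n' + 1 = n), (C.F n' (p - r)).comap (C.d h)

/-- `Z^{r-1}_{p-1} K_n + d (Z^{r-1}_{p+r-1} K_{n+1})`. -/
def Bd (r p n : ℤ) : Submodule k (K n) :=
  C.Z (r - 1) (p - 1) n ⊔ ⨆ (n' : ℤ) (h : n + 1 = n'), (C.Z (r - 1) (p + r - 1) n').map (C.d h)

/-- The term `E^r_{pq}`, `r ≥ 0`, of the spectral sequence. -/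
abbrev E (r : ℕ) (p q : ℤ) : Type _ := Subq (C.Z r p (p + q)) (C.Bd r p (p + q))

/-- The differential `d^r : E^r_{pq} → E^r_{p-r,q+r-1}`. -/
def dE (r : ℕ) {p q p' q' : ℤ} (hp : p' + r = p) (hq : q' + 1 = q + r) :
    C.E r p q →ₗ[k] C.E r p' q' :=
  Subq.map (C.d (show (p' + q') + 1 = p + q by omega)) _ _ _ _

/-- The cycles in degree `n`. -/
abbrev cycles (n : ℤ) : Submodule k (K n) :=
  LinearMap.ker (C.d (show (n - 1) + 1 = n by omega))

/-- The boundaries in degree `n`. -/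
abbrev boundaries (n : ℤ) : Submodule k (K n) :=
  LinearMap.range (C.d (show n + 1 = n + 1 from rfl))

/-- The homology of the complex. -/
abbrev Hom (n : ℤ) : Type _ := Subq (C.cycles n) (C.boundaries n)

/-- The filtration induced on homology. -/
def filtHom (n p : ℤ) : Submodule k (C.Hom n) :=
  ((C.F n p).submoduleOf (C.cycles n)).map (Subq.mk _ _)

end FiltOps

/-! ## The total complex of the cylindrical module -/

section Tot

variable {k : Type*} [CommRing k]

/-- The degree in the total complex. -/
def totDeg (i : ℕ × ℕ) : ℕ := i.1 + i.2

section General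

variable {X : ℕ → ℕ → Type*} [∀ m n, AddCommGroup (X m n)] [∀ m n, Module k (X m n)]
  (Oh : ∀ n, CycOps k (fun m => X m n)) (Oa : ∀ m, CycOps k (fun n => X m n))

/-- The part of `B` (second direction) that lands in `X m n`, with its sign. -/
def totBInto : ∀ m n : ℕ, (∀ i : ℕ × ℕ, X i.1 i.2) →ₗ[k] X m n
  | _, 0 => 0
  | m, n + 1 => (-1 : k) ^ m • ((Oa m).B' n ∘ₗ LinearMap.proj ((m, n) : ℕ × ℕ))

/-- The part of `T B̄` (`B̄` in the first direction, `T = 1 - (b B + B b) = τ^{n+1}`) that lands in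
`X m n`. -/
def totBbarInto : ∀ m n : ℕ, (∀ i : ℕ × ℕ, X i.1 i.2) →ₗ[k] X m n
  | 0, _ => 0
  | m + 1, n => ((Oa (m + 1)).t n ^ (n + 1)) ∘ₗ (Oh n).B' m ∘ₗ LinearMap.proj ((m, n) : ℕ × ℕ)

/-- `(b̄ + b) + (B + T B̄)` on `∏ X m n`, where `b` and `B` carry the sign `(-1)^m` that makes the
operators of the two directions anticommute. -/
def totD : (∀ i : ℕ × ℕ, X i.1 i.2) →ₗ[k] (∀ i : ℕ × ℕ, X i.1 i.2) :=
  LinearMap.pi fun i =>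
    (Oh i.2).b i.1 ∘ₗ LinearMap.proj ((i.1 + 1, i.2) : ℕ × ℕ)
      + (-1 : k) ^ i.1 • ((Oa i.1).b i.2 ∘ₗ LinearMap.proj ((i.1, i.2 + 1) : ℕ × ℕ))
      + totBInto Oa i.1 i.2 + totBbarInto Oh Oa i.1 i.2

theorem lowers_totD : Lowers k totDeg 1 (totD Oh Oa) := by
  intro l l' h x hx i hi
  have key : ∀ i' : ℕ × ℕ, (totDeg i' = totDeg i + 1 ∨ totDeg i' + 1 = totDeg i) → x i' = 0 := by
    intro i' hi'
    refine hx i' fun hc => hi ?_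
    obtain ⟨h1, r, hr⟩ := hc
    rcases hi' with hi' | hi'
    · exact ⟨by omega, r, by omega⟩
    · exact ⟨by omega, r + 1, by omega⟩
  obtain ⟨m, n⟩ := i
  have h1 : x (m + 1, n) = 0 := key _ (Or.inl (by simp only [totDeg]; omega))
  have h2 : x (m, n + 1) = 0 := key _ (Or.inl (by simp only [totDeg]; omega))
  have h3 : totBInto Oa m n x = 0 := by
    cases n with
    | zero => rfl
    | succ n =>
      have : x (m, n) = 0 := key _ (Or.inr (by simp only [totDeg]; omega))
      simp [totBInto, this]
  have h4 : totBbarInto Oh Oa m n x = 0 := by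
    cases m with
    | zero => rfl
    | succ m =>
      have : x (m, n) = 0 := key _ (Or.inr (by simp only [totDeg]; omega))
      simp [totBbarInto, this]
  simp [totD, h1, h2, h3, h4]

end General

variable {H : Type*} (A : Type*) [Ring H] [HopfAlgebra k H] [Ring A] [Algebra k A]
  [Module H A] [IsScalarTower k H A]
  {W : ℤ → Type*} [∀ j, AddCommGroup (W j)] [∀ j, Module k (W j)]
  (u : ∀ j, W j →ₗ[k] W (j - 2))

/-- `(A^op ♮ H^cop)_{m,n} = H^{⊗(m+1)} ⊗ A^{⊗(n+1)}`. -/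
abbrev Cyl (k H A : Type*) [CommRing k] [Ring H] [HopfAlgebra k H] [Ring A] [Algebra k A]
    [Module H A] [IsScalarTower k H A] (m n : ℕ) : Type _ :=
  TPow k H (m + 1) ⊗[k] TPow k A (n + 1)

/-- `Tot(A^op ♮ H^cop) ⊠ W` in degree `n`. -/
abbrev TotBox (k H A : Type*) [CommRing k] [Ring H] [HopfAlgebra k H] [Ring A] [Algebra k A]
    [Module H A] [IsScalarTower k H A]
    {W : ℤ → Type*} [∀ j, AddCommGroup (W j)] [∀ j, Module k (W j)]
    (u : ∀ j, W j →ₗ[k] W (j - 2)) (n : ℤ) : Type _ :=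
  Box k u totDeg (fun i : ℕ × ℕ => Cyl k H A i.1 i.2) n

/-- `Tot(A^op ♮ H^cop) ⊠ W` with the differential `b̄ + b + u (B + T B̄)`.  The submodule `F_p` in
degree `n` is spanned by the part of `H`-degree `m ≥ n - p`, that is, by the elements whose degree
in the `A`-direction, with the degrees of `u` and of `W` included, is at most `p`. -/
def totFilt (hS : Function.Bijective (HopfAlgebra.antipode k : H →ₗ[k] H)) :
    FiltOps k (TotBox k H A u) where
  d h := Box.map k u totDeg
    (lowers_totD (X := Cyl k H A) (fun n => hOps (diagAct k H A (n + 1)).toLinearMap)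
      (fun m => aOps A hS (coact k H (m + 1)))) h
  F n p := Submodule.span k
    {z | ∃ (j : ℤ) (x : PS k totDeg (fun i : ℕ × ℕ => Cyl k H A i.1 i.2) (n - j)) (w : W j),
      (∀ i : ℕ × ℕ, (i.1 : ℤ) < n - p → x.1 i = 0) ∧
        z = Box.tmul k u totDeg (fun i : ℕ × ℕ => Cyl k H A i.1 i.2) n j x w}

end Tot

end CrossedCyclic

end

open CrossedCyclic

noncomputable section

namespace CrossedCyclic

open TensorProduct (map map_tmul zero_tmul tmul_zero mk assoc add_tmul tmul_sum ext' tmul_add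
  sum_tmul lid piScalarRight mk_apply smul_tmul' tmul_smul smul_tmul rid_tmul rid leftComm
  leftComm_tmul tensorTensorTensorComm congr_tmul assoc_tmul assoc_symm_tmul lid_tmul)
open LinearMap (comp_apply proj id_apply mulLeft proj_apply llcomp_apply llcomp lcomp_apply lcomp
  mulRight mulLeft_apply pi_apply)
open Finset (sum_congr sum_comm sum_add_distrib)
open Finsupp (lmapDomain induction_linear mapDomain_single curryLinearEquiv lmapDomain_comp
  lmapDomain_apply)
open Function (Bijective Surjective Injective)
local notation "𝟙" => LinearMap.id

lemma tmul_ind {k M N : Type*} [CommRing k] [AddCommGroup M] [Module k M] [AddCommGroup N]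
    [Module k N] {C : M ⊗[k] N → Prop} (x : M ⊗[k] N) (tmul : ∀ x y, C (x ⊗ₜ y))
    (add : ∀ x y, C x → C y → C (x + y) := by
      intro x y hx hy
      simp only [map_add, add_tmul, tmul_add, sum_add_distrib, hx, hy]) : C x :=
  x.induction_on (by simpa using tmul 0 0) tmul add

lemma app_eq {k M N : Type*} [Semiring k] [AddCommMonoid M] [Module k M] [AddCommMonoid N]
    [Module k N] {f g : M →ₗ[k] N} (h : f = g) (x : M) : f x = g x := h ▸ rfl

lemma sum_sum_eq_zero_of_face {M : Type*} [AddCommGroup M] (n : ℕ) (F : ℕ → ℕ → M)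
    (h : ∀ i j, i ≤ j → j ≤ n → F i (j + 1) = -F j i) :
    ∑ i ∈ Finset.range (n + 1), ∑ j ∈ Finset.range (n + 2), F i j = 0 := by
  have split : ∀ i ∈ Finset.range (n + 1), ∑ j ∈ Finset.range (n + 2), F i j =
      ∑ j ∈ Finset.range (n + 1), (if j ≤ i then F i j else 0) +
        ∑ j ∈ Finset.range (n + 1), (if i ≤ j then F i (j + 1) else 0) := by
    intro i hi
    rw [Finset.mem_range] at hi
    have e1 : ∑ j ∈ Finset.range (n + 1), (if j ≤ i then F i j else 0) =
        ∑ j ∈ Finset.range (n + 2), (if j ≤ i then F i j else 0) := by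
      rw [Finset.sum_range_succ _ (n + 1), if_neg (by omega), add_zero]
    have e2 : ∑ j ∈ Finset.range (n + 1), (if i ≤ j then F i (j + 1) else 0) =
        ∑ j ∈ Finset.range (n + 2), (if i < j then F i j else 0) := by
      rw [Finset.sum_range_succ' _ (n + 1)]
      simp
    rw [e1, e2, ← sum_add_distrib]
    refine sum_congr rfl fun j _ => ?_
    by_cases hj : j ≤ i
    · simp [hj, not_lt.2 hj]
    · simp [hj, not_le.1 hj]
  rw [sum_congr rfl split, sum_add_distrib]
  conv_lhs => arg 1; rw [sum_comm]
  rw [← sum_add_distrib]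
  refine Finset.sum_eq_zero fun i hi => ?_
  rw [← sum_add_distrib]
  refine Finset.sum_eq_zero fun j hj => ?_
  rw [Finset.mem_range] at hj
  by_cases hij : i ≤ j
  · simp [hij, h i j hij (by omega)]
  · simp [hij]

namespace CycOps

variable {k : Type*} [CommRing k] {X : ℕ → Type*} [∀ n, AddCommGroup (X n)]
  [∀ n, Module k (X n)] (O : CycOps k X)

/-- The signed cyclic operator `(-1)^n τ`. -/
def tS (n : ℕ) : Module.End k (X n) := (-1 : k) ^ n • O.t n

/-- The signed face `(-1)^i ∂_i`, zero for `i` out of range. -/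
def dS (n i : ℕ) : X (n + 1) →ₗ[k] X n := if h : i < n + 2 then (-1 : k) ^ i • O.d n ⟨i, h⟩ else 0

lemma dS_of_lt {n i : ℕ} (h : i < n + 2) : O.dS n i = (-1 : k) ^ i • O.d n ⟨i, h⟩ := dif_pos h

lemma b_eq (n : ℕ) : O.b n = ∑ i ∈ Finset.range (n + 2), O.dS n i := by
  rw [Finset.sum_range]
  exact sum_congr rfl fun i _ => (O.dS_of_lt i.2).symm

lemma b'_eq (n : ℕ) : O.b' n = ∑ i ∈ Finset.range (n + 1), O.dS n i := by
  rw [Finset.sum_range]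
  exact sum_congr rfl fun i _ => (O.dS_of_lt (by omega)).symm

lemma norm_eq (n : ℕ) : O.norm n = ∑ i ∈ Finset.range (n + 1), O.tS n ^ i := by
  refine sum_congr rfl fun i _ => ?_
  rw [tS, smul_pow, ← pow_mul, mul_comm]

lemma tS_pow_succ (n : ℕ) : O.tS n ^ (n + 1) = O.t n ^ (n + 1) := by
  rw [tS, smul_pow, ← pow_mul, Even.neg_one_pow (Nat.even_mul_succ_self n), one_smul]

lemma one_sub_tS_mul_norm (n : ℕ) : (1 - O.tS n) * O.norm n = 1 - O.t n ^ (n + 1) := by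
  rw [norm_eq, mul_neg_geom_sum, tS_pow_succ]

lemma norm_mul_one_sub_tS (n : ℕ) : O.norm n * (1 - O.tS n) = 1 - O.t n ^ (n + 1) := by
  rw [norm_eq, geom_sum_mul_neg, tS_pow_succ]

lemma B_eq (n : ℕ) : O.B n = (1 - O.tS (n + 1)) ∘ₗ O.extra n ∘ₗ O.norm n := rfl

lemma B'_eq (n : ℕ) : O.B' n = (1 - O.tS (n + 1)) ∘ₗ O.extra' n ∘ₗ O.norm n := rfl

variable {O} (hO : O.IsParacyclic)

namespace IsParacyclic

include hO

lemma dS_tS {n i : ℕ} (h : i < n + 1) (x : X (n + 1)) :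
    O.dS n (i + 1) (O.tS (n + 1) x) = O.tS n (O.dS n i x) := by
  have := app_eq (hO.d_t n ⟨i, h⟩) x
  simp only [comp_apply] at this
  rw [dS_of_lt _ (by omega), dS_of_lt _ (by omega), tS, tS]
  simp only [LinearMap.smul_apply, map_smul, smul_smul]
  rw [show (⟨i + 1, by omega⟩ : Fin (n + 2)) = Fin.succ ⟨i, h⟩ from rfl, this]
  congr 1
  ring

lemma dS_zero_tS (n : ℕ) (x : X (n + 1)) : O.dS n 0 (O.tS (n + 1) x) = O.dS n (n + 1) x := by
  have := app_eq (hO.d_zero_t n) x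
  simp only [comp_apply] at this
  rw [dS_of_lt _ (by omega), dS_of_lt _ (by omega), tS]
  simp only [LinearMap.smul_apply, map_smul, pow_zero, one_smul]
  rw [show (⟨0, by omega⟩ : Fin (n + 2)) = 0 from rfl, this]
  rfl

lemma dS_dS {n i j : ℕ} (hij : i ≤ j) (hj : j ≤ n + 1) (x : X (n + 2)) :
    O.dS n i (O.dS (n + 1) (j + 1) x) = -O.dS n j (O.dS (n + 1) i x) := by
  have := app_eq (hO.d_d n ⟨i, by omega⟩ ⟨j, by omega⟩ hij) x
  simp only [comp_apply] at this
  rw [dS_of_lt _ (by omega), dS_of_lt _ (by omega), dS_of_lt _ (by omega), dS_of_lt _ (by omega)]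
  simp only [LinearMap.smul_apply, map_smul, smul_smul]
  rw [show (⟨j + 1, by omega⟩ : Fin (n + 3)) = Fin.succ ⟨j, by omega⟩ from rfl, this,
    ← neg_smul]
  congr 1
  ring

lemma b_b (n : ℕ) (x : X (n + 2)) : O.b n (O.b (n + 1) x) = 0 := by
  simp only [b_eq, LinearMap.sum_apply, map_sum]
  rw [sum_comm]
  exact sum_sum_eq_zero_of_face (n + 1) (fun i j => O.dS n i (O.dS (n + 1) j x))
    fun i j hij hj => hO.dS_dS hij hj x

lemma b'_b' (n : ℕ) (x : X (n + 2)) : O.b' n (O.b' (n + 1) x) = 0 := by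
  simp only [b'_eq, LinearMap.sum_apply, map_sum]
  rw [sum_comm]
  exact sum_sum_eq_zero_of_face n (fun i j => O.dS n i (O.dS (n + 1) j x))
    fun i j hij hj => hO.dS_dS hij (by omega) x

lemma b_one_sub_tS (n : ℕ) (x : X (n + 1)) :
    O.b n ((1 - O.tS (n + 1)) x) = (1 - O.tS n) (O.b' n x) := by
  have h1 : O.b n (O.tS (n + 1) x) = O.dS n (n + 1) x + O.tS n (O.b' n x) := by
    rw [b_eq, b'_eq, LinearMap.sum_apply, Finset.sum_range_succ', hO.dS_zero_tS, add_comm,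
      LinearMap.sum_apply, map_sum]
    congr 1
    exact sum_congr rfl fun i hi => hO.dS_tS (Finset.mem_range.1 hi) x
  have h2 : O.b n x = O.b' n x + O.dS n (n + 1) x := by
    rw [b_eq, Finset.sum_range_succ, ← b'_eq]; rfl
  simp only [LinearMap.sub_apply, Module.End.one_apply, map_sub, h1, h2]
  abel

lemma dS_tS_pow (n i : ℕ) : ∀ j, i + j ≤ n + 1 → ∀ x : X (n + 1),
    O.dS n (i + j) ((O.tS (n + 1) ^ j) x) = (O.tS n ^ j) (O.dS n i x)
  | 0, _, x => by simp
  | j + 1, h, x => by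
    rw [pow_succ', pow_succ', Module.End.mul_apply, Module.End.mul_apply, ← add_assoc,
      hO.dS_tS (by omega), dS_tS_pow n i j (by omega)]

lemma dS_tS_pow' {n i j : ℕ} (hi : i ≤ n + 1) (hj : i < j) (hj' : j ≤ i + n + 2) (x : X (n + 1)) :
    O.dS n i ((O.tS (n + 1) ^ j) x) = (O.tS n ^ (j - 1)) (O.dS n (n + 2 + i - j) x) := by
  obtain ⟨l, rfl⟩ : ∃ l, j = i + (1 + l) := ⟨j - i - 1, by omega⟩
  have h0 := hO.dS_tS_pow n 0 i (by omega) ((O.tS (n + 1) ^ (1 + l)) x)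
  rw [zero_add] at h0
  rw [pow_add, Module.End.mul_apply, h0, pow_add _ 1 l, pow_one, Module.End.mul_apply,
    hO.dS_zero_tS]
  have h1 := hO.dS_tS_pow n (n + 1 - l) l (by omega) x
  rw [show n + 1 - l + l = n + 1 by omega] at h1
  rw [h1, ← Module.End.mul_apply, ← pow_add]
  congr 3 <;> omega

lemma b'_norm (n : ℕ) (x : X (n + 1)) : O.b' n (O.norm (n + 1) x) = O.norm n (O.b n x) := by
  simp only [b_eq, b'_eq, norm_eq, LinearMap.sum_apply, map_sum]
  rw [← Finset.sum_product', ← Finset.sum_product']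
  refine Finset.sum_bij'
    (fun a _ => if a.1 ≤ a.2 then (a.2 - a.1, a.1) else (n + 2 + a.2 - a.1, a.1 - 1))
    (fun a _ => if a.1 + a.2 ≤ n then (a.2, a.1 + a.2) else (a.2 + 1, a.1 + a.2 - n - 1))
    ?_ ?_ ?_ ?_ ?_
  all_goals
    rintro ⟨i, j⟩ hij
    simp only [Finset.mem_product, Finset.mem_range] at hij
  · dsimp only
    split_ifs <;> simp only [Finset.mem_product, Finset.mem_range] <;> omega
  · dsimp only
    split_ifs <;> simp only [Finset.mem_product, Finset.mem_range] <;> omega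
  · dsimp only
    by_cases h : i ≤ j
    · rw [if_pos h, if_pos (by dsimp only; omega)]
      exact Prod.ext (by dsimp only) (by dsimp only; omega)
    · rw [if_neg h, if_neg (by dsimp only; omega)]
      exact Prod.ext (by dsimp only; omega) (by dsimp only; omega)
  · dsimp only
    by_cases h : i + j ≤ n
    · rw [if_pos h, if_pos (by dsimp only; omega)]
      exact Prod.ext (by dsimp only; omega) (by dsimp only)
    · rw [if_neg h, if_neg (by dsimp only; omega)]
      exact Prod.ext (by dsimp only; omega) (by dsimp only; omega)
  · dsimp only
    split_ifs with h1
    · have := hO.dS_tS_pow n (j - i) i (by omega) x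
      rwa [Nat.sub_add_cancel h1] at this
    · exact hO.dS_tS_pow' (by omega) (by omega) (by omega) x

lemma t_pow_dS (n i : ℕ) (h : i ≤ n + 1) (x : X (n + 1)) :
    O.dS n i ((O.t (n + 1) ^ (n + 2)) x) = (O.t n ^ (n + 1)) (O.dS n i x) := by
  rw [← tS_pow_succ, ← tS_pow_succ, hO.dS_tS_pow' h (by omega) (by omega),
    show n + 2 + i - (n + 2) = i by omega]
  rfl

lemma d_t_pow (n : ℕ) (i : Fin (n + 2)) (x : X (n + 1)) :
    O.d n i ((O.t (n + 1) ^ (n + 2)) x) = (O.t n ^ (n + 1)) (O.d n i x) := by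
  have := hO.t_pow_dS n i (by omega) x
  simp only [dS_of_lt _ i.2, LinearMap.smul_apply, map_smul] at this
  have h2 := congrArg (fun y => (-1 : k) ^ (i : ℕ) • y) this
  simpa only [smul_smul, ← mul_pow, mul_neg, neg_mul, one_mul, mul_one, neg_neg, one_pow,
    one_smul] using h2

lemma s_t_pow (n : ℕ) : ∀ (i j : ℕ) (h : i + j < n + 1) (x : X n),
    O.s n ⟨i + j, h⟩ ((O.t n ^ j) x) = (O.t (n + 1) ^ j) (O.s n ⟨i, by omega⟩ x)
  | i, 0, h, x => by simp
  | i, j + 1, h, x => by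
    have := app_eq (hO.s_t n ⟨i + j, by omega⟩) ((O.t n ^ j) x)
    simp only [comp_apply] at this
    rw [pow_succ', pow_succ', Module.End.mul_apply, Module.End.mul_apply]
    rw [← s_t_pow n i j (by omega)]
    exact this

lemma s_t_pow_succ (n : ℕ) (i : Fin (n + 1)) (x : X n) :
    O.s n i ((O.t n ^ (n + 1)) x) = (O.t (n + 1) ^ (n + 2)) (O.s n i x) := by
  obtain ⟨i, hi⟩ := i
  obtain ⟨l, rfl⟩ : ∃ l, n = i + l := ⟨n - i, by omega⟩
  have h0 := hO.s_t_pow (i + l) 0 i (by omega) ((O.t (i + l) ^ (1 + l)) x)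
  simp only [zero_add] at h0
  have h1 := app_eq (hO.s_zero_t (i + l)) ((O.t (i + l) ^ l) x)
  simp only [comp_apply] at h1
  have h2 := hO.s_t_pow (i + l) i l (by omega) x
  have e1 : O.t (i + l) ^ (i + l + 1) = O.t (i + l) ^ i * O.t (i + l) ^ (1 + l) := by
    rw [← pow_add]; congr 1; ring
  have e2 : O.t (i + l + 1) ^ (i + l + 2) = O.t (i + l + 1) ^ i *
      (O.t (i + l + 1) * (O.t (i + l + 1) * O.t (i + l + 1) ^ l)) := by
    rw [← pow_succ', ← pow_succ', ← pow_add]; congr 1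
  rw [e1, e2, Module.End.mul_apply, h0, pow_add _ 1 l, pow_one, Module.End.mul_apply,
    show (⟨0, by omega⟩ : Fin (i + l + 1)) = 0 from rfl, h1]
  simp only [Module.End.mul_apply]
  rw [← h2]
  rfl

lemma t_pow_extra (n : ℕ) (x : X n) :
    O.extra n ((O.t n ^ (n + 1)) x) = (O.t (n + 1) ^ (n + 2)) (O.extra n x) := by
  simp only [extra, comp_apply]
  rw [hO.s_t_pow_succ, ← Module.End.mul_apply, ← Module.End.mul_apply, ← pow_succ', ← pow_succ]

lemma dS_zero_extra (n : ℕ) (x : X n) : O.dS n 0 (O.extra n x) = x := by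
  rw [dS_of_lt _ (by omega), pow_zero, one_smul, extra]
  have h := app_eq (hO.d_zero_t n) (O.s n (Fin.last n) x)
  have h2 := app_eq (hO.d_s_eq' n (Fin.last n)) x
  simp only [comp_apply] at h h2
  exact h.trans h2

lemma dS_succ_extra {n i : ℕ} (h : i < n + 1) (x : X (n + 1)) :
    O.dS (n + 1) (i + 1) (O.extra (n + 1) x) = -O.extra n (O.dS n i x) := by
  rw [dS_of_lt _ (by omega), dS_of_lt _ (by omega), extra, extra]
  have h1 := app_eq (hO.d_t (n + 1) ⟨i, by omega⟩) (O.s (n + 1) (Fin.last (n + 1)) x)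
  have h2 := app_eq (hO.d_s_lt n ⟨i, by omega⟩ (Fin.last n)
    (show i ≤ n by omega)) x
  simp only [comp_apply] at h1 h2
  simp only [LinearMap.smul_apply, comp_apply, map_smul]
  rw [show (⟨i + 1, by omega⟩ : Fin (n + 3)) = Fin.succ ⟨i, by omega⟩ from rfl, h1, ← neg_smul,
    ← neg_one_mul ((-1 : k) ^ i), ← pow_succ']
  congr 2

lemma b'_extra_zero (x : X 0) : O.b' 0 (O.extra 0 x) = x := by
  rw [b'_eq]
  simp [hO.dS_zero_extra]

lemma b'_extra_succ (n : ℕ) (x : X (n + 1)) :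
    O.b' (n + 1) (O.extra (n + 1) x) = x - O.extra n (O.b' n x) := by
  rw [b'_eq, LinearMap.sum_apply, Finset.sum_range_succ', hO.dS_zero_extra, b'_eq,
    LinearMap.sum_apply, map_sum, sub_eq_add_neg, add_comm _ x, ← Finset.sum_neg_distrib]
  congr 1
  exact sum_congr rfl fun i hi => hO.dS_succ_extra (Finset.mem_range.1 hi) x

lemma t_pow_b' (n : ℕ) (x : X (n + 1)) :
    O.b' n ((O.t (n + 1) ^ (n + 2)) x) = (O.t n ^ (n + 1)) (O.b' n x) := by
  simp only [b'_eq, LinearMap.sum_apply, map_sum]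
  exact sum_congr rfl fun i hi => hO.t_pow_dS n i (by simp at hi; omega) x

omit hO in
lemma t_pow_tS (n j : ℕ) (x : X n) : O.tS n ((O.t n ^ j) x) = (O.t n ^ j) (O.tS n x) := by
  simp only [tS, LinearMap.smul_apply, map_smul, ← Module.End.mul_apply, ← pow_succ, ← pow_succ']

lemma t_pow_extra' (n : ℕ) (x : X n) :
    O.extra' n ((O.t n ^ (n + 1)) x) = (O.t (n + 1) ^ (n + 2)) (O.extra' n x) := by
  simp only [extra', comp_apply, hO.t_pow_extra, hO.t_pow_b']

lemma b'_extra_b' (n : ℕ) (x : X (n + 1)) : O.b' n (O.extra n (O.b' n x)) = O.b' n x := by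
  cases n with
  | zero => rw [hO.b'_extra_zero]
  | succ n => rw [hO.b'_extra_succ, hO.b'_b', map_zero, sub_zero]

lemma extra'_zero (x : X 0) : O.extra' 0 x = O.extra 0 x := by
  simp only [extra', comp_apply, hO.b'_extra_zero]

lemma extra'_succ (n : ℕ) (x : X (n + 1)) :
    O.extra' (n + 1) x = O.extra (n + 1) x - O.extra (n + 1) (O.extra n (O.b' n x)) := by
  simp only [extra', comp_apply, hO.b'_extra_succ, map_sub]

lemma b'_extra' (n : ℕ) (x : X n) : O.b' n (O.extra' n x) = O.b' n (O.extra n x) := by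
  simp only [extra', comp_apply, hO.b'_extra_b']

lemma extra'_extra' (n : ℕ) (x : X n) : O.extra' (n + 1) (O.extra' n x) = 0 := by
  rw [hO.extra'_succ, hO.b'_extra']
  simp only [extra', comp_apply, sub_self]

lemma b'_extra'_succ (n : ℕ) (x : X (n + 1)) :
    O.b' (n + 1) (O.extra' (n + 1) x) = x - O.extra' n (O.b' n x) := by
  rw [b'_extra' hO, hO.b'_extra_succ]
  congr 1
  cases n with
  | zero => rw [hO.extra'_zero]
  | succ n => rw [hO.extra'_succ, hO.b'_b', map_zero, map_zero, sub_zero]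

lemma B'_B' (n : ℕ) (x : X n) : O.B' (n + 1) (O.B' n x) = 0 := by
  simp only [B'_eq, comp_apply]
  have := app_eq (O.norm_mul_one_sub_tS (n + 1)) (O.extra' n (O.norm n x))
  rw [Module.End.mul_apply] at this
  rw [this, LinearMap.sub_apply (1 : Module.End k (X (n + 1))), map_sub, Module.End.one_apply,
    hO.extra'_extra', ← hO.t_pow_extra', hO.extra'_extra', sub_zero, map_zero]

lemma b_B'_zero (x : X 0) : O.b 0 (O.B' 0 x) = x - (O.t 0 ^ 1) x := by
  simp only [B'_eq, comp_apply]
  rw [hO.b_one_sub_tS, b'_extra' hO, hO.b'_extra_zero, ← Module.End.mul_apply, one_sub_tS_mul_norm]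
  rfl

lemma b_B'_succ (n : ℕ) (x : X (n + 1)) :
    O.b (n + 1) (O.B' (n + 1) x) + O.B' n (O.b n x) = x - (O.t (n + 1) ^ (n + 2)) x := by
  simp only [B'_eq, comp_apply]
  rw [hO.b_one_sub_tS, hO.b'_extra'_succ, hO.b'_norm, map_sub, sub_add_cancel,
    ← Module.End.mul_apply, one_sub_tS_mul_norm]
  rfl

end IsParacyclic

end CycOps

section

variable {k : Type*} [CommRing k]

/-- A family of maps commuting with all operators. -/
structure CycHom {X : ℕ → Type*} [∀ n, AddCommGroup (X n)] [∀ n, Module k (X n)]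
    {X' : ℕ → Type*} [∀ n, AddCommGroup (X' n)] [∀ n, Module k (X' n)]
    (O : CycOps k X) (O' : CycOps k X') (f : ∀ n, X n →ₗ[k] X' n) : Prop where
  d : ∀ n i x, f n (O.d n i x) = O'.d n i (f (n + 1) x)
  s : ∀ n i x, f (n + 1) (O.s n i x) = O'.s n i (f n x)
  t : ∀ n x, f n (O.t n x) = O'.t n (f n x)

namespace CycHom

variable {X : ℕ → Type*} [∀ n, AddCommGroup (X n)] [∀ n, Module k (X n)]
  {X' : ℕ → Type*} [∀ n, AddCommGroup (X' n)] [∀ n, Module k (X' n)]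
  {O : CycOps k X} {O' : CycOps k X'} {f : ∀ n, X n →ₗ[k] X' n} (hf : CycHom O O' f)

lemma comp {X'' : ℕ → Type*} [∀ n, AddCommGroup (X'' n)] [∀ n, Module k (X'' n)]
    {O'' : CycOps k X''} {g : ∀ n, X' n →ₗ[k] X'' n} (hg : CycHom O' O'' g) (hf : CycHom O O' f) :
    CycHom O O'' (fun n => g n ∘ₗ f n) where
  d n i x := by simp [hf.d, hg.d]
  s n i x := by simp [hf.s, hg.s]
  t n x := by simp [hf.t, hg.t]

lemma id (O : CycOps k X) : CycHom O O (fun _ => 𝟙) :=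
  ⟨fun _ _ _ => rfl, fun _ _ _ => rfl, fun _ _ => rfl⟩

lemma pow {g : ∀ n, Module.End k (X n)} (hg : CycHom O O g) : ∀ j : ℕ, CycHom O O (fun n => g n ^ j)
  | 0 => id O
  | j + 1 => by
    have := comp hg (pow hg j)
    simp only [pow_succ']
    exact this

lemma smul (c : k) (hf : CycHom O O' f) : CycHom O O' (fun n => c • f n) where
  d n i x := by simp [hf.d]
  s n i x := by simp [hf.s]
  t n x := by simp [hf.t]

lemma add {g : ∀ n, X n →ₗ[k] X' n} (hf : CycHom O O' f) (hg : CycHom O O' g) :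
    CycHom O O' (fun n => f n + g n) where
  d n i x := by simp [hf.d, hg.d]
  s n i x := by simp [hf.s, hg.s]
  t n x := by simp [hf.t, hg.t]

lemma sum {ι : Type*} (s : Finset ι) (g : ι → ∀ n, X n →ₗ[k] X' n)
    (h : ∀ i ∈ s, CycHom O O' (g i)) : CycHom O O' (fun n => ∑ i ∈ s, g i n) where
  d n i x := by
    simp only [LinearMap.sum_apply, map_sum]
    exact sum_congr rfl fun j hj => (h j hj).d n i x
  s n i x := by
    simp only [LinearMap.sum_apply, map_sum]
    exact sum_congr rfl fun j hj => (h j hj).s n i x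
  t n x := by
    simp only [LinearMap.sum_apply, map_sum]
    exact sum_congr rfl fun j hj => (h j hj).t n x

lemma sub {g : ∀ n, X n →ₗ[k] X' n} (hf : CycHom O O' f) (hg : CycHom O O' g) :
    CycHom O O' (fun n => f n - g n) where
  d n i x := by simp [hf.d, hg.d]
  s n i x := by simp [hf.s, hg.s]
  t n x := by simp [hf.t, hg.t]

include hf

lemma b (n : ℕ) (x : X (n + 1)) : f n (O.b n x) = O'.b n (f (n + 1) x) := by
  simp only [CycOps.b, LinearMap.sum_apply, map_sum, LinearMap.smul_apply, map_smul, hf.d]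

lemma b' (n : ℕ) (x : X (n + 1)) : f n (O.b' n x) = O'.b' n (f (n + 1) x) := by
  simp only [CycOps.b', LinearMap.sum_apply, map_sum, LinearMap.smul_apply, map_smul, hf.d]

lemma t_pow (n j : ℕ) (x : X n) : f n ((O.t n ^ j) x) = (O'.t n ^ j) (f n x) := by
  induction j with
  | zero => rfl
  | succ j ih => rw [pow_succ', pow_succ', Module.End.mul_apply, Module.End.mul_apply, hf.t, ih]

lemma norm (n : ℕ) (x : X n) : f n (O.norm n x) = O'.norm n (f n x) := by
  simp only [CycOps.norm, LinearMap.sum_apply, map_sum, LinearMap.smul_apply, map_smul, hf.t_pow]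

lemma tS (n : ℕ) (x : X n) : f n (O.tS n x) = O'.tS n (f n x) := by
  simp only [CycOps.tS, LinearMap.smul_apply, map_smul, hf.t]

lemma extra (n : ℕ) (x : X n) : f (n + 1) (O.extra n x) = O'.extra n (f n x) := by
  simp only [CycOps.extra, comp_apply, hf.t, hf.s]

lemma extra' (n : ℕ) (x : X n) : f (n + 1) (O.extra' n x) = O'.extra' n (f n x) := by
  simp only [CycOps.extra', comp_apply, hf.extra, hf.b']

lemma B (n : ℕ) (x : X n) : f (n + 1) (O.B n x) = O'.B n (f n x) := by
  simp only [CycOps.B_eq, comp_apply, LinearMap.sub_apply, map_sub, Module.End.one_apply,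
    hf.tS, hf.extra, hf.norm]

lemma B' (n : ℕ) (x : X n) : f (n + 1) (O.B' n x) = O'.B' n (f n x) := by
  simp only [CycOps.B'_eq, comp_apply, LinearMap.sub_apply, map_sub, Module.End.one_apply,
    hf.tS, hf.extra', hf.norm]

end CycHom

namespace CycOps

variable {X : ℕ → Type*} [∀ n, AddCommGroup (X n)] [∀ n, Module k (X n)] (O : CycOps k X)

/-- The correction `-(1 - t) σ σ σ b' N` that interpolates between `B` and `B'`. -/
def corr : ∀ n : ℕ, X n →ₗ[k] X (n + 2)
  | 0 => 0
  | n + 1 => -((1 - O.tS (n + 3)) ∘ₗ O.extra (n + 2) ∘ₗ O.extra (n + 1) ∘ₗ O.extra n ∘ₗ O.b' n ∘ₗ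
      O.norm (n + 1))

/-- The operator `Q` in `B Y - Y B' = (1 - τ^{n+1}) Q`, where `Y` is `corr`. -/
def corrRest (n : ℕ) : X n →ₗ[k] X (n + 3) :=
  (1 - O.tS (n + 3)) ∘ₗ (O.extra (n + 2) ∘ₗ O.extra (n + 1) ∘ₗ O.extra n ∘ₗ O.b' n ∘ₗ O.extra' n ∘ₗ
    O.norm n) + (match n with
      | 0 => 0
      | n + 1 => -((1 - O.tS (n + 4)) ∘ₗ O.extra (n + 3) ∘ₗ O.extra (n + 2) ∘ₗ O.extra (n + 1) ∘ₗ
          O.extra n ∘ₗ O.b' n ∘ₗ O.norm (n + 1)))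

variable {O} (hO : O.IsParacyclic)

namespace IsParacyclic
include hO

lemma B_add_b_corr (n : ℕ) (x : X n) : O.B n x + O.b (n + 1) (O.corr n x) = O.B' n x := by
  cases n with
  | zero => simp only [corr, LinearMap.zero_apply, map_zero, add_zero, B_eq, B'_eq, comp_apply,
      hO.extra'_zero]
  | succ n =>
    simp only [corr, B_eq, B'_eq, comp_apply, LinearMap.neg_apply, map_neg]
    rw [hO.b_one_sub_tS, hO.b'_extra_succ, hO.b'_extra_succ, hO.b'_extra_b', sub_self, map_zero,
      sub_zero, hO.extra'_succ, map_sub]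
    exact (sub_eq_add_neg _ _).symm

lemma corr_b (n : ℕ) (x : X (n + 1)) : O.corr n (O.b n x) = 0 := by
  cases n with
  | zero => rfl
  | succ n =>
    simp only [corr, comp_apply, LinearMap.neg_apply]
    rw [← hO.b'_norm, hO.b'_b']
    simp only [map_zero, neg_zero]

lemma B_corr_sub (n : ℕ) (x : X n) : O.B (n + 2) (O.corr n x) - O.corr (n + 1) (O.B' n x) =
      O.corrRest n x - (O.t (n + 3) ^ (n + 4)) (O.corrRest n x) := by
  have h1 : ∀ m (y : X (m + 1)), O.norm (m + 1) ((1 - O.tS (m + 1)) y) =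
      y - (O.t (m + 1) ^ (m + 2)) y := fun m y =>
    app_eq (O.norm_mul_one_sub_tS (m + 1)) y
  have h3 : ∀ m j (y : X m), (1 - O.tS m) ((O.t m ^ j) y) = (O.t m ^ j) ((1 - O.tS m) y) :=
    fun m j y => by rw [LinearMap.sub_apply, LinearMap.sub_apply, map_sub, t_pow_tS]; rfl
  have h2 : O.corr (n + 1) (O.B' n x) = -((1 - O.tS (n + 3)) (O.extra (n + 2) (O.extra (n + 1)
      (O.extra n (O.b' n (O.extra' n (O.norm n x)))))) -
      (O.t (n + 3) ^ (n + 4)) ((1 - O.tS (n + 3)) (O.extra (n + 2) (O.extra (n + 1)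
      (O.extra n (O.b' n (O.extra' n (O.norm n x)))))))) := by
    simp only [corr, B'_eq, comp_apply, LinearMap.neg_apply]
    rw [h1, map_sub, hO.t_pow_b', map_sub, hO.t_pow_extra, map_sub, hO.t_pow_extra, map_sub,
      hO.t_pow_extra, map_sub, h3]
  rw [h2, sub_neg_eq_add]
  cases n with
  | zero => simp only [corr, corrRest, LinearMap.zero_apply, map_zero, zero_add, add_zero,
      comp_apply]
  | succ n =>
    simp only [corr, corrRest, B_eq, comp_apply, LinearMap.neg_apply, map_neg,
      LinearMap.add_apply, map_add]
    rw [h1, map_sub, hO.t_pow_extra, map_sub, h3]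
    abel

end IsParacyclic

lemma _root_.CrossedCyclic.CycHom.corr {X' : ℕ → Type*} [∀ n, AddCommGroup (X' n)]
    [∀ n, Module k (X' n)] {O' : CycOps k X'} {f : ∀ n, X n →ₗ[k] X' n} (hf : CycHom O O' f)
    (n : ℕ) (x : X n) : f (n + 2) (O.corr n x) = O'.corr n (f n x) := by
  cases n with
  | zero => simp [CycOps.corr]
  | succ n => simp only [CycOps.corr, comp_apply, LinearMap.neg_apply, map_neg,
      LinearMap.sub_apply, map_sub, Module.End.one_apply, hf.tS, hf.extra, hf.norm, hf.b']

lemma _root_.CrossedCyclic.CycHom.corrRest {X' : ℕ → Type*} [∀ n, AddCommGroup (X' n)]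
    [∀ n, Module k (X' n)] {O' : CycOps k X'} {f : ∀ n, X n →ₗ[k] X' n} (hf : CycHom O O' f)
    (n : ℕ) (x : X n) : f (n + 3) (O.corrRest n x) = O'.corrRest n (f n x) := by
  cases n with
  | zero => simp only [CycOps.corrRest, comp_apply, LinearMap.add_apply, map_add,
      LinearMap.sub_apply, map_sub, Module.End.one_apply, hf.tS, hf.extra, hf.norm, hf.b',
      hf.extra', LinearMap.zero_apply, map_zero]
  | succ n => simp only [CycOps.corrRest, comp_apply, LinearMap.neg_apply, map_neg,
      LinearMap.add_apply, map_add,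
      LinearMap.sub_apply, map_sub, Module.End.one_apply, hf.tS, hf.extra, hf.norm, hf.b',
      hf.extra']

variable (O)

/-- The part of `B'` that lands in `X n`. -/
def B'Into : ∀ n : ℕ, (∀ m, X m) →ₗ[k] X n
  | 0 => 0
  | n + 1 => O.B' n ∘ₗ proj n

/-- `b + B'` on `∏ n, X n`. -/
def mixedD' : (∀ n, X n) →ₗ[k] (∀ n, X n) :=
  LinearMap.pi fun n => O.b n ∘ₗ proj (n + 1) + O.B'Into n

lemma mixedD'_zero (x : ∀ n, X n) : O.mixedD' x 0 = O.b 0 (x 1) := by simp [mixedD', B'Into]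

lemma mixedD'_succ (x : ∀ n, X n) (n : ℕ) :
    O.mixedD' x (n + 1) = O.b (n + 1) (x (n + 2)) + O.B' n (x n) := by
  simp [mixedD', B'Into]

lemma mixedD_zero (x : ∀ n, X n) : O.mixedD x 0 = O.b 0 (x 1) := by simp [mixedD, BInto]

lemma mixedD_succ (x : ∀ n, X n) (n : ℕ) :
    O.mixedD x (n + 1) = O.b (n + 1) (x (n + 2)) + O.B n (x n) := by
  simp [mixedD, BInto]

/-- `1 + Y` on `∏ n, X n`, where `Y` is `corr`. -/
def twist : (∀ n, X n) →ₗ[k] (∀ n, X n) := LinearMap.pi fun n => match n with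
    | 0 => proj 0
    | 1 => proj 1
    | n + 2 => proj (n + 2) + O.corr n ∘ₗ proj n

/-- The components of the inverse of `twist`. -/
def untwistInto : ∀ n : ℕ, (∀ m, X m) →ₗ[k] X n
  | 0 => proj 0
  | 1 => proj 1
  | n + 2 => proj (n + 2) - O.corr n ∘ₗ untwistInto n

/-- The inverse of `twist`. -/
def untwist : (∀ n, X n) →ₗ[k] (∀ n, X n) := LinearMap.pi O.untwistInto

lemma twist_add_two (x : ∀ n, X n) (n : ℕ) : O.twist x (n + 2) = x (n + 2) + O.corr n (x n) := rfl

lemma untwist_add_two (x : ∀ n, X n) (n : ℕ) :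
    O.untwist x (n + 2) = x (n + 2) - O.corr n (O.untwist x n) := by
  simp [untwist, untwistInto]

lemma twist_untwist (x : ∀ n, X n) : O.twist (O.untwist x) = x := by
  funext n
  match n with
  | 0 => rfl
  | 1 => rfl
  | n + 2 => rw [twist_add_two, untwist_add_two, sub_add_cancel]

lemma untwist_twist_apply (x : ∀ n, X n) : ∀ n, O.untwist (O.twist x) n = x n
  | 0 => rfl
  | 1 => rfl
  | n + 2 => by rw [untwist_add_two, untwist_twist_apply x n, twist_add_two, add_sub_cancel_right]

lemma untwist_twist (x : ∀ n, X n) : O.untwist (O.twist x) = x := funext (O.untwist_twist_apply x)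

/-- `x ↦ (1 - τ^{n+1}) Q x`, the amount by which `1 + Y` fails to intertwine `b + B'` with
`b + B`. -/
def defect (x : ∀ n, X n) : ∀ n, X n
  | 0 => 0
  | 1 => 0
  | 2 => 0
  | n + 3 => O.corrRest n (x n) - (O.t (n + 3) ^ (n + 4)) (O.corrRest n (x n))

variable {O}

include hO in
lemma IsParacyclic.mixedD_twist (x : ∀ n, X n) :
    O.mixedD (O.twist x) = O.twist (O.mixedD' x) + O.defect x := by
  funext n
  rw [Pi.add_apply]
  match n with
  | 0 =>
    change O.mixedD (O.twist x) 0 = O.mixedD' x 0 + 0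
    rw [mixedD_zero, mixedD'_zero, add_zero]; rfl
  | 1 =>
    change _ = O.mixedD' x 1 + 0
    rw [mixedD_succ, mixedD'_succ, add_zero, twist_add_two, map_add, ← hO.B_add_b_corr]
    change O.b 1 (x 2) + _ + O.B 0 (x 0) = _
    abel
  | 2 =>
    change _ = O.twist (O.mixedD' x) 2 + 0
    rw [mixedD_succ, twist_add_two, twist_add_two, mixedD'_succ, mixedD'_zero, map_add,
      ← hO.B_add_b_corr, hO.corr_b]
    change O.b 2 (x 3) + _ + O.B 1 (x 1) = _
    abel
  | n + 3 =>
    change _ = _ + (O.corrRest n (x n) - (O.t (n + 3) ^ (n + 4)) (O.corrRest n (x n)))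
    rw [mixedD_succ, twist_add_two, twist_add_two, twist_add_two, mixedD'_succ, mixedD'_succ,
      map_add, map_add, map_add, ← hO.B_add_b_corr, hO.corr_b, ← hO.B_corr_sub]
    abel

include hO in
lemma IsParacyclic.mixedD'_mixedD'  (x : ∀ n, X n) (n : ℕ) :
    O.mixedD' (O.mixedD' x) n = x n - (O.t n ^ (n + 1)) (x n) := by
  match n with
  | 0 => rw [mixedD'_zero, mixedD'_succ, map_add, hO.b_b, zero_add, hO.b_B'_zero]
  | 1 =>
    rw [mixedD'_succ, mixedD'_succ, mixedD'_zero, map_add, hO.b_b]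
    exact (congrArg (· + _) (zero_add _)).trans (hO.b_B'_succ 0 (x 1))
  | n + 2 =>
    rw [mixedD'_succ, mixedD'_succ, mixedD'_succ, map_add, map_add, hO.b_b, zero_add, hO.B'_B',
      add_zero, hO.b_B'_succ]

end CycOps

section Bi

variable {X : ℕ → ℕ → Type*} [∀ m n, AddCommGroup (X m n)] [∀ m n, Module k (X m n)]
  (Oh : ∀ n, CycOps k (fun m => X m n)) (Oa : ∀ m, CycOps k (fun n => X m n))

/-- Two commuting paracyclic structures. -/
structure IsBiPara : Prop where
  h : ∀ n, (Oh n).IsParacyclic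
  a : ∀ m, (Oa m).IsParacyclic
  d : ∀ m i, CycHom (Oa (m + 1)) (Oa m) (fun n => (Oh n).d m i)
  s : ∀ m i, CycHom (Oa m) (Oa (m + 1)) (fun n => (Oh n).s m i)
  t : ∀ m, CycHom (Oa m) (Oa m) (fun n => (Oh n).t m)

/-- The diagonal. -/
def diagOps : CycOps k (fun n => X n n) where
  d n i := (Oh n).d n i ∘ₗ (Oa (n + 1)).d n i
  s n i := (Oh (n + 1)).s n i ∘ₗ (Oa n).s n i
  t n := (Oh n).t n ∘ₗ (Oa n).t n

variable {Oh Oa} (hX : IsBiPara Oh Oa)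

namespace IsBiPara
include hX

lemma hom_b (m : ℕ) : CycHom (Oa (m + 1)) (Oa m) (fun n => (Oh n).b m) :=
  CycHom.sum _ (fun (i : Fin (m + 2)) n => (-1 : k) ^ (i : ℕ) • (Oh n).d m i) fun i _ => (hX.d m i).smul _

lemma hom_b' (m : ℕ) : CycHom (Oa (m + 1)) (Oa m) (fun n => (Oh n).b' m) :=
  CycHom.sum _ (fun (i : Fin (m + 1)) n => (-1 : k) ^ (i : ℕ) • (Oh n).d m i.castSucc) fun i _ =>
    (hX.d m i.castSucc).smul _

lemma hom_norm (m : ℕ) : CycHom (Oa m) (Oa m) (fun n => (Oh n).norm m) :=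
  CycHom.sum _ (fun i n => (-1 : k) ^ (i * m) • (Oh n).t m ^ i) fun i _ => ((hX.t m).pow i).smul _

lemma hom_extra (m : ℕ) : CycHom (Oa m) (Oa (m + 1)) (fun n => (Oh n).extra m) :=
  CycHom.comp (hX.t (m + 1)) (hX.s m (Fin.last m))

lemma hom_extra' (m : ℕ) : CycHom (Oa m) (Oa (m + 1)) (fun n => (Oh n).extra' m) :=
  CycHom.comp (hX.hom_extra m) (CycHom.comp (hX.hom_b' m) (hX.hom_extra m))

lemma hom_B' (m : ℕ) : CycHom (Oa m) (Oa (m + 1)) (fun n => (Oh n).B' m) :=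
  CycHom.comp ((CycHom.id _).sub ((hX.t (m + 1)).smul _))
    (CycHom.comp (hX.hom_extra' m) (hX.hom_norm m))

lemma a_d (n : ℕ) (i) : CycHom (Oh (n + 1)) (Oh n) (fun m => (Oa m).d n i) :=
  ⟨fun m j x => ((hX.d m j).d n i x).symm, fun m j x => ((hX.s m j).d n i x).symm,
    fun m x => ((hX.t m).d n i x).symm⟩

lemma a_s (n : ℕ) (i) : CycHom (Oh n) (Oh (n + 1)) (fun m => (Oa m).s n i) :=
  ⟨fun m j x => ((hX.d m j).s n i x).symm, fun m j x => ((hX.s m j).s n i x).symm,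
    fun m x => ((hX.t m).s n i x).symm⟩

lemma a_t (n : ℕ) : CycHom (Oh n) (Oh n) (fun m => (Oa m).t n) :=
  ⟨fun m j x => ((hX.d m j).t n x).symm, fun m j x => ((hX.s m j).t n x).symm,
    fun m x => ((hX.t m).t n x).symm⟩

lemma diag : (diagOps Oh Oa).IsParacyclic where
  d_d n i j hij := LinearMap.ext fun x => by
    have h1 := app_eq ((hX.h n).d_d n i j hij)
    have h2 := app_eq ((hX.a (n + 2)).d_d n i j hij)
    simp only [diagOps, comp_apply] at *
    rw [(hX.a_d _ _).d, h2, h1, (hX.a_d _ _).d]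
  s_s n i j hij := LinearMap.ext fun x => by
    have h1 := app_eq ((hX.h (n + 2)).s_s n i j hij)
    have h2 := app_eq ((hX.a n).s_s n i j hij)
    simp only [diagOps, comp_apply] at *
    rw [(hX.a_s _ _).s, h2, h1, (hX.a_s _ _).s]
  d_s_lt n i j hij := LinearMap.ext fun x => by
    have h1 := app_eq ((hX.h (n + 1)).d_s_lt n i j hij)
    have h2 := app_eq ((hX.a (n + 1)).d_s_lt n i j hij)
    simp only [diagOps, comp_apply] at *
    rw [(hX.a_d _ _).s, h2, h1, (hX.a_s _ _).d]
  d_s_eq n i := LinearMap.ext fun x => by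
    have h1 := app_eq ((hX.h n).d_s_eq n i)
    have h2 := app_eq ((hX.a n).d_s_eq n i)
    simp only [diagOps, comp_apply] at *
    rw [(hX.a_d _ _).s, h2, h1, id_apply, id_apply]
  d_s_eq' n i := LinearMap.ext fun x => by
    have h1 := app_eq ((hX.h n).d_s_eq' n i)
    have h2 := app_eq ((hX.a n).d_s_eq' n i)
    simp only [diagOps, comp_apply] at *
    rw [(hX.a_d _ _).s, h2, h1, id_apply, id_apply]
  d_s_gt n i j hij := LinearMap.ext fun x => by
    have h1 := app_eq ((hX.h (n + 1)).d_s_gt n i j hij)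
    have h2 := app_eq ((hX.a (n + 1)).d_s_gt n i j hij)
    simp only [diagOps, comp_apply] at *
    rw [(hX.a_d _ _).s, h2, h1, (hX.a_s _ _).d]
  d_t n i := LinearMap.ext fun x => by
    have h1 := app_eq ((hX.h n).d_t n i)
    have h2 := app_eq ((hX.a (n + 1)).d_t n i)
    simp only [diagOps, comp_apply] at *
    rw [(hX.a_d _ _).t, h2, h1, (hX.a_t _).d]
  d_zero_t n := LinearMap.ext fun x => by
    have h1 := app_eq ((hX.h n).d_zero_t n)
    have h2 := app_eq ((hX.a (n + 1)).d_zero_t n)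
    simp only [diagOps, comp_apply] at *
    rw [(hX.a_d _ _).t, h2, h1]
  s_t n i := LinearMap.ext fun x => by
    have h1 := app_eq ((hX.h (n + 1)).s_t n i)
    have h2 := app_eq ((hX.a n).s_t n i)
    simp only [diagOps, comp_apply] at *
    rw [(hX.a_s _ _).t, h2, h1, (hX.a_t _).s]
  s_zero_t n := LinearMap.ext fun x => by
    have h1 := app_eq ((hX.h (n + 1)).s_zero_t n)
    have h2 := app_eq ((hX.a n).s_zero_t n)
    simp only [diagOps, comp_apply] at *
    rw [(hX.a_s _ _).t, h2, h1, (hX.a_t _).s, (hX.a_t _).t, (hX.a_t _).s]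
  t_bijective n := ((hX.h n).t_bijective n).comp ((hX.a n).t_bijective n)

lemma diag_t_pow (n j : ℕ) (x : X n n) :
    ((diagOps Oh Oa).t n ^ j) x = ((Oa n).t n ^ j) (((Oh n).t n ^ j) x) := by
  have : Commute ((Oa n).t n) ((Oh n).t n) := LinearMap.ext fun x => (hX.a_t n).t n x
  rw [← Module.End.mul_apply, ← this.mul_pow, this.eq]
  rfl

end IsBiPara

lemma totD_zero_zero (x : ∀ i : ℕ × ℕ, X i.1 i.2) :
    totD Oh Oa x (0, 0) = (Oh 0).b 0 (x (1, 0)) + (Oa 0).b 0 (x (0, 1)) := by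
  simp [totD, totBInto, totBbarInto]

lemma totD_zero_succ (x : ∀ i : ℕ × ℕ, X i.1 i.2) (n : ℕ) :
    totD Oh Oa x (0, n + 1) = (Oh (n + 1)).b 0 (x (1, n + 1)) + (Oa 0).b (n + 1) (x (0, n + 2)) +
      (Oa 0).B' n (x (0, n)) := by
  simp [totD, totBInto, totBbarInto]

lemma totD_succ_zero (x : ∀ i : ℕ × ℕ, X i.1 i.2) (m : ℕ) :
    totD Oh Oa x (m + 1, 0) = (Oh 0).b (m + 1) (x (m + 2, 0)) +
      (-1 : k) ^ (m + 1) • (Oa (m + 1)).b 0 (x (m + 1, 1)) +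
      ((Oa (m + 1)).t 0 ^ 1) ((Oh 0).B' m (x (m, 0))) := by
  simp [totD, totBInto, totBbarInto]

lemma totD_succ_succ (x : ∀ i : ℕ × ℕ, X i.1 i.2) (m n : ℕ) :
    totD Oh Oa x (m + 1, n + 1) = (Oh (n + 1)).b (m + 1) (x (m + 2, n + 1)) +
      (-1 : k) ^ (m + 1) • (Oa (m + 1)).b (n + 1) (x (m + 1, n + 2)) +
      (-1 : k) ^ (m + 1) • (Oa (m + 1)).B' n (x (m + 1, n)) +
      ((Oa (m + 1)).t (n + 1) ^ (n + 2)) ((Oh (n + 1)).B' m (x (m, n + 1))) := by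
  simp [totD, totBInto, totBbarInto]

/-- The part `b̄ + T B̄` of `totD`. -/
def totP : (∀ i : ℕ × ℕ, X i.1 i.2) →ₗ[k] (∀ i : ℕ × ℕ, X i.1 i.2) :=
  LinearMap.pi fun i => (Oh i.2).b i.1 ∘ₗ proj ((i.1 + 1, i.2) : ℕ × ℕ)
    + totBbarInto Oh Oa i.1 i.2

variable (Oh Oa) in
lemma totD_eq (x : ∀ i : ℕ × ℕ, X i.1 i.2) (m n : ℕ) : totD Oh Oa x (m, n) =
      totP (Oh := Oh) (Oa := Oa) x (m, n) + (-1 : k) ^ m • (Oa m).mixedD' (fun n => x (m, n)) n := by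
  cases n with
  | zero =>
    rw [CycOps.mixedD'_zero]
    simp only [totD, totP, pi_apply, LinearMap.add_apply, LinearMap.smul_apply,
      comp_apply, proj_apply, totBInto, LinearMap.zero_apply, add_zero]
    abel
  | succ n =>
    rw [CycOps.mixedD'_succ]
    simp only [totD, totP, pi_apply, LinearMap.add_apply, LinearMap.smul_apply,
      comp_apply, proj_apply, totBInto, smul_add]
    abel

lemma CycHom.mixedD' {X : ℕ → Type*} [∀ n, AddCommGroup (X n)] [∀ n, Module k (X n)]
    {X' : ℕ → Type*} [∀ n, AddCommGroup (X' n)] [∀ n, Module k (X' n)]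
    {O : CycOps k X} {O' : CycOps k X'} {f : ∀ n, X n →ₗ[k] X' n} (hf : CycHom O O' f)
    (x : ∀ n, X n) (n : ℕ) : f n (O.mixedD' x n) = O'.mixedD' (fun n => f n (x n)) n := by
  cases n with
  | zero => rw [CycOps.mixedD'_zero, CycOps.mixedD'_zero, hf.b]
  | succ n => rw [CycOps.mixedD'_succ, CycOps.mixedD'_succ, map_add, hf.b, hf.B']

lemma CycOps.IsParacyclic.hom_T {X : ℕ → Type*} [∀ n, AddCommGroup (X n)]
    [∀ n, Module k (X n)] {O : CycOps k X} (hO : O.IsParacyclic) :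
    CycHom O O (fun n => O.t n ^ (n + 1)) :=
  ⟨fun n i x => (hO.d_t_pow n i x).symm, fun n i x => (hO.s_t_pow_succ n i x).symm,
    fun n x => by rw [← Module.End.mul_apply, ← Module.End.mul_apply, ← pow_succ, ← pow_succ']⟩

namespace IsBiPara
include hX

lemma totP_mixedD' (x y : ∀ i : ℕ × ℕ, X i.1 i.2) (m : ℕ) (c : k)
    (h : ∀ m' n, (m' = m + 1 ∨ m' + 1 = m) → y (m', n) = c • (Oa m').mixedD' (fun n => x (m', n)) n)
    (n : ℕ) : totP (Oh := Oh) (Oa := Oa) y (m, n) =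
      c • (Oa m).mixedD' (fun n => totP (Oh := Oh) (Oa := Oa) x (m, n)) n := by
  cases m with
  | zero =>
    simp only [totP, pi_apply, LinearMap.add_apply, comp_apply,
      proj_apply, totBbarInto, LinearMap.zero_apply, add_zero]
    rw [h 1 n (Or.inl rfl), map_smul, (hX.hom_b 0).mixedD']
  | succ m =>
    simp only [totP, pi_apply, LinearMap.add_apply, comp_apply, proj_apply, totBbarInto]
    rw [h (m + 2) n (Or.inl rfl), h m n (Or.inr rfl), map_smul, map_smul, map_smul,
      (hX.hom_b (m + 1)).mixedD', (hX.hom_B' m).mixedD', ((hX.a (m + 1)).hom_T).mixedD', ← smul_add]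
    congr 1
    exact (congrFun (map_add (Oa (m + 1)).mixedD' (fun n => (Oh n).b (m + 1) (x (m + 2, n)))
      (fun n => ((Oa (m + 1)).t n ^ (n + 1)) ((Oh n).B' m (x (m, n))))) n).symm

lemma totP_totP (x : ∀ i : ℕ × ℕ, X i.1 i.2) (m n : ℕ) :
    totP (Oh := Oh) (Oa := Oa) (totP (Oh := Oh) (Oa := Oa) x) (m, n) =
      ((Oa m).t n ^ (n + 1)) (x (m, n) - ((Oh n).t m ^ (m + 1)) (x (m, n))) := by
  have hT : ∀ m m' (f : ∀ n, X m n →ₗ[k] X m' n), CycHom (Oa m) (Oa m') f →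
      ∀ n x, f n (((Oa m).t n ^ (n + 1)) x) = ((Oa m').t n ^ (n + 1)) (f n x) :=
    fun m m' f hf n x => hf.t_pow n _ x
  match m with
  | 0 =>
    simp only [totP, pi_apply, LinearMap.add_apply, comp_apply,
      proj_apply, totBbarInto, LinearMap.zero_apply, add_zero]
    rw [map_add, (hX.h n).b_b, zero_add, hT _ _ _ (hX.hom_b 0), (hX.h n).b_B'_zero]
  | 1 =>
    simp only [totP, pi_apply, LinearMap.add_apply, comp_apply,
      proj_apply, totBbarInto, LinearMap.zero_apply, add_zero]
    rw [map_add, (hX.h n).b_b]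
    refine (congrArg (· + _) (zero_add _)).trans ?_
    rw [hT _ _ _ (hX.hom_b 1), ← map_add]
    exact congrArg _ ((hX.h n).b_B'_succ 0 _)
  | m + 2 =>
    simp only [totP, pi_apply, LinearMap.add_apply, comp_apply, proj_apply, totBbarInto]
    rw [map_add, (hX.h n).b_b, zero_add, hT _ _ _ (hX.hom_b _), map_add, hT _ _ _ (hX.hom_B' _),
      (hX.h n).B'_B', map_zero, add_zero, ← map_add, (hX.h n).b_B'_succ]

lemma totD_totD (x : ∀ i : ℕ × ℕ, X i.1 i.2) (m n : ℕ) : totD Oh Oa (totD Oh Oa x) (m, n) =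
      x (m, n) - ((Oa m).t n ^ (n + 1)) (((Oh n).t m ^ (m + 1)) (x (m, n))) := by
  set y : ∀ i : ℕ × ℕ, X i.1 i.2 := fun i =>
    (-1 : k) ^ i.1 • (Oa i.1).mixedD' (fun n => x (i.1, n)) i.2 with hy
  have e : totD Oh Oa x = totP (Oh := Oh) (Oa := Oa) x + y := funext fun ⟨m, n⟩ => totD_eq Oh Oa x m n
  have e1 : totP (Oh := Oh) (Oa := Oa) y (m, n) = (-(-1 : k) ^ m) •
      (Oa m).mixedD' (fun n => totP (Oh := Oh) (Oa := Oa) x (m, n)) n := by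
    refine hX.totP_mixedD' x y m _ (fun m' n h => ?_) n
    rw [hy]
    dsimp only
    congr 1
    rcases h with rfl | rfl <;> ring
  have e2 : (Oa m).mixedD' (fun n => y (m, n)) n =
      (-1 : k) ^ m • (x (m, n) - ((Oa m).t n ^ (n + 1)) (x (m, n))) := by
    rw [← (hX.a m).mixedD'_mixedD' (fun n => x (m, n)) n]
    exact congrFun (map_smul (Oa m).mixedD' ((-1 : k) ^ m) ((Oa m).mixedD' (fun n => x (m, n)))) n
  have e3 : (Oa m).mixedD' (fun n => (totP (Oh := Oh) (Oa := Oa) x + y) (m, n)) n =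
      (Oa m).mixedD' (fun n => totP (Oh := Oh) (Oa := Oa) x (m, n)) n +
        (Oa m).mixedD' (fun n => y (m, n)) n :=
    congrFun (map_add (Oa m).mixedD' (fun n => totP (Oh := Oh) (Oa := Oa) x (m, n))
      (fun n => y (m, n))) n
  rw [e, totD_eq, map_add, Pi.add_apply, e1, e3, e2, hX.totP_totP, smul_add, smul_smul,
    ← mul_pow, neg_mul_neg, one_mul, one_pow, one_smul, neg_smul, map_sub]
  abel

end IsBiPara

end Bi
end

section

variable {k : Type*} [CommRing k]

/-- Operators of an augmented simplicial module, with `Y n` in degree `n - 1`. -/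
structure AugOps (k : Type*) [CommRing k] (Y : ℕ → Type*) [∀ n, AddCommGroup (Y n)]
    [∀ n, Module k (Y n)] where
  d : ∀ n, ℕ → (Y (n + 1) →ₗ[k] Y n)
  s : ∀ n, ℕ → (Y (n + 1) →ₗ[k] Y (n + 2))

namespace AugOps

variable {Y : ℕ → Type*} [∀ n, AddCommGroup (Y n)] [∀ n, Module k (Y n)] (O : AugOps k Y)

/-- The identities of an augmented simplicial module. -/
structure IsAug : Prop where
  d_d : ∀ n i j, i ≤ j → j ≤ n → ∀ x, O.d n i (O.d (n + 1) (j + 1) x) = O.d n j (O.d (n + 1) i x)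
  s_s : ∀ n i j, i ≤ j → j ≤ n → ∀ x, O.s (n + 1) i (O.s n j x) = O.s (n + 1) (j + 1) (O.s n i x)
  d_s_lt : ∀ n i j, i ≤ j → j ≤ n → ∀ x,
    O.d (n + 2) i (O.s (n + 1) (j + 1) x) = O.s n j (O.d (n + 1) i x)
  d_s_eq : ∀ n i, i ≤ n → ∀ x, O.d (n + 1) i (O.s n i x) = x
  d_s_eq' : ∀ n i, i ≤ n → ∀ x, O.d (n + 1) (i + 1) (O.s n i x) = x
  d_s_gt : ∀ n i j, j < i → i ≤ n + 1 → ∀ x,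
    O.d (n + 2) (i + 1) (O.s (n + 1) j x) = O.s n j (O.d (n + 1) i x)

/-- The décalage, which forgets the first face and degeneracy. -/
def dec : AugOps k (fun n => Y (n + 1)) where
  d n i := O.d (n + 1) (i + 1)
  s n i := O.s (n + 1) (i + 1)

variable {O} in
lemma IsAug.dec (hO : O.IsAug) : O.dec.IsAug where
  d_d n i j hij hj x := hO.d_d (n + 1) (i + 1) (j + 1) (by omega) (by omega) x
  s_s n i j hij hj x := hO.s_s (n + 1) (i + 1) (j + 1) (by omega) (by omega) x
  d_s_lt n i j hij hj x := hO.d_s_lt (n + 1) (i + 1) (j + 1) (by omega) (by omega) x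
  d_s_eq n i hi x := hO.d_s_eq (n + 1) (i + 1) (by omega) x
  d_s_eq' n i hi x := hO.d_s_eq' (n + 1) (i + 1) (by omega) x
  d_s_gt n i j hij hi x := hO.d_s_gt (n + 1) (i + 1) (j + 1) (by omega) (by omega) x

/-- Maps of augmented simplicial modules. -/
structure Hom {Y' : ℕ → Type*} [∀ n, AddCommGroup (Y' n)] [∀ n, Module k (Y' n)]
    (O : AugOps k Y) (O' : AugOps k Y') (f : ∀ n, Y n →ₗ[k] Y' n) : Prop where
  d : ∀ n i, i ≤ n → ∀ x, f n (O.d n i x) = O'.d n i (f (n + 1) x)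
  s : ∀ n i, i ≤ n → ∀ x, f (n + 2) (O.s n i x) = O'.s n i (f (n + 1) x)

lemma Hom.dec {Y' : ℕ → Type*} [∀ n, AddCommGroup (Y' n)] [∀ n, Module k (Y' n)]
    {O : AugOps k Y} {O' : AugOps k Y'} {f : ∀ n, Y n →ₗ[k] Y' n} (hf : Hom O O' f) :
    Hom O.dec O'.dec (fun n => f (n + 1)) :=
  ⟨fun n i hi x => hf.d (n + 1) (i + 1) (by omega) x,
    fun n i hi x => hf.s (n + 1) (i + 1) (by omega) x⟩

variable {O} in
lemma IsAug.d_zero_hom (hO : O.IsAug) : Hom O.dec O (fun n => O.d n 0) :=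
  ⟨fun n i hi x => hO.d_d n 0 i (by omega) hi x,
    fun n i hi x => hO.d_s_lt n 0 i (by omega) hi x⟩

/-- The simplicial operator of a sequence `v` of vertices, for vertices labelled
`c, …, c + n - 1`. -/
def sop : ∀ (d n : ℕ) {Y : ℕ → Type*} [∀ n, AddCommGroup (Y n)] [∀ n, Module k (Y n)]
    (_ : AugOps k Y) (_ : ℤ) (_ : Fin d → ℤ), Y n →ₗ[k] Y d
  | 0, 0, _, _, _, _, _, _ => 𝟙
  | 0, n + 1, _, _, _, O, c, v => sop 0 n O (c + 1) v ∘ₗ O.d n 0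
  | _ + 1, 0, _, _, _, _, _, _ => 0
  | 1, n + 1, _, _, _, O, c, v =>
    if v 0 = c then sop 0 n O.dec (c + 1) (Fin.tail v) else sop 1 n O (c + 1) v ∘ₗ O.d n 0
  | d + 2, n + 1, _, _, _, O, c, v =>
    if v 0 = c then
      if v 1 = c then O.s d 0 ∘ₗ sop (d + 1) (n + 1) O c (Fin.tail v)
      else sop (d + 1) n O.dec (c + 1) (Fin.tail v)
    else sop (d + 2) n O (c + 1) v ∘ₗ O.d n 0
termination_by d n => d + n

lemma sop_skip {d n : ℕ} {c : ℤ} {v : Fin d → ℤ} (h : ∀ j, v j ≠ c) :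
    sop d (n + 1) O c v = sop d n O (c + 1) v ∘ₗ O.d n 0 := by
  match d with
  | 0 => rw [sop]
  | 1 => rw [sop, if_neg (h 0)]
  | d + 2 => rw [sop, if_neg (h 0)]

lemma sop_dec {d n : ℕ} {c : ℤ} {v : Fin (d + 1) → ℤ} (h0 : v 0 = c)
    (h : ∀ j : Fin d, v j.succ ≠ c) :
    sop (d + 1) (n + 1) O c v = sop d n O.dec (c + 1) (Fin.tail v) := by
  match d with
  | 0 => rw [sop, if_pos h0]
  | d + 1 => rw [sop, if_pos h0, if_neg (show ¬ v 1 = c from h 0)]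

lemma sop_dup {d n : ℕ} {c : ℤ} {v : Fin (d + 2) → ℤ} (h0 : v 0 = c) (h1 : v 1 = c) :
    sop (d + 2) (n + 1) O c v = O.s d 0 ∘ₗ sop (d + 1) (n + 1) O c (Fin.tail v) := by
  rw [sop, if_pos h0, if_pos h1]

/-- Admissible sequences. -/
structure Good (n : ℕ) (c : ℤ) {d : ℕ} (v : Fin d → ℤ) : Prop where
  mono : Monotone v
  ge : ∀ j, c ≤ v j
  lt : ∀ j, v j < c + n

lemma Good.comp {n : ℕ} {c : ℤ} {d e : ℕ} {v : Fin d → ℤ} (h : Good n c v) {f : Fin e → Fin d}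
    (hf : Monotone f) : Good n c (v ∘ f) :=
  ⟨h.mono.comp hf, fun j => h.ge _, fun j => h.lt _⟩

lemma Good.tail {n : ℕ} {c : ℤ} {d : ℕ} {v : Fin (d + 1) → ℤ} (h : Good n c v) :
    Good n c (Fin.tail v) := h.comp (Fin.strictMono_succ).monotone

lemma Good.shrink {n : ℕ} {c : ℤ} {d : ℕ} {v : Fin d → ℤ} (h : Good (n + 1) c v)
    (hc : ∀ j, v j ≠ c) : Good n (c + 1) v :=
  ⟨h.mono, fun j => by have := h.ge j; have := hc j; omega,
    fun j => by have := h.lt j; push_cast at this; omega⟩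

/-- The alternatives in the recursion. -/
lemma Good.cases {n : ℕ} {c : ℤ} {d : ℕ} {v : Fin (d + 1) → ℤ} (h : Good n c v) :
    (∀ j, v j ≠ c) ∨ (v 0 = c ∧ ∀ j : Fin d, v j.succ ≠ c) ∨
      (v 0 = c ∧ ∃ e, ∃ he : e + 1 = d, v (Fin.succ ⟨0, by omega⟩) = c) := by
  by_cases h0 : v 0 = c
  · right
    cases d with
    | zero => exact Or.inl ⟨h0, fun j => j.elim0⟩
    | succ d =>
      by_cases h1 : v 1 = c
      · exact Or.inr ⟨h0, d, rfl, h1⟩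
      · refine Or.inl ⟨h0, fun j hj => h1 ?_⟩
        have a1 : v 1 ≤ v j.succ := h.mono (by
          rw [Fin.le_def, Fin.val_succ, Fin.val_one]; omega)
        have := h.ge 1
        omega
  · left
    intro j hj
    have a1 : v 0 ≤ v j := h.mono (Fin.zero_le j)
    have := h.ge 0
    omega

lemma sop_hom (N : ℕ) : ∀ (d n : ℕ), d + n = N → ∀ {Y : ℕ → Type*} [∀ n, AddCommGroup (Y n)]
    [∀ n, Module k (Y n)] {Y' : ℕ → Type*} [∀ n, AddCommGroup (Y' n)] [∀ n, Module k (Y' n)]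
    {O : AugOps k Y} {O' : AugOps k Y'} {f : ∀ n, Y n →ₗ[k] Y' n}, Hom O O' f →
    ∀ {c : ℤ} {v : Fin d → ℤ}, Good n c v →
    ∀ x, f d (sop d n O c v x) = sop d n O' c v (f n x) := by
  induction N using Nat.strong_induction_on with
  | _ N ih =>
  intro d n hN Y _ _ Y' _ _ O O' f hf c v hv x
  match d, n with
  | 0, 0 => simp [sop]
  | 0, n + 1 => rw [sop_skip _ (fun j => j.elim0), sop_skip _ (fun j => j.elim0), comp_apply,
      comp_apply, ih _ (by omega) 0 n rfl hf (hv.shrink fun j => j.elim0),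
      hf.d n 0 (by omega)]
  | d + 1, 0 => exact absurd (hv.lt 0) (by have := hv.ge 0; push_cast; omega)
  | d + 1, n + 1 =>
    rcases hv.cases with h | ⟨h0, h⟩ | ⟨h0, e, rfl, h1⟩
    · rw [sop_skip _ h, sop_skip _ h, comp_apply, comp_apply,
        ih _ (by omega) (d + 1) n rfl hf (hv.shrink h), hf.d n 0 (by omega)]
    · rw [sop_dec _ h0 h, sop_dec _ h0 h]
      exact ih _ (by omega) d n rfl hf.dec (hv.tail.shrink h) x
    · rw [sop_dup _ h0 h1, sop_dup _ h0 h1, comp_apply, comp_apply,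
        hf.s e 0 (by omega), ih _ (by omega) (e + 1) (n + 1) rfl hf hv.tail]

lemma tail_removeNth {d : ℕ} (v : Fin (d + 2) → ℤ) (i : Fin (d + 1)) :
    Fin.tail (i.succ.removeNth v) = i.removeNth (Fin.tail v) := by
  funext j
  simp [Fin.tail, Fin.removeNth]

lemma sop_d (N : ℕ) : ∀ (d n : ℕ), d + n = N → ∀ {Y : ℕ → Type*} [∀ n, AddCommGroup (Y n)]
    [∀ n, Module k (Y n)] {O : AugOps k Y}, O.IsAug →
    ∀ {c : ℤ} {v : Fin (d + 1) → ℤ}, Good n c v → ∀ (i : Fin (d + 1)) (x : Y n),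
    O.d d i (sop (d + 1) n O c v x) = sop d n O c (i.removeNth v) x := by
  induction N using Nat.strong_induction_on with
  | _ N ih =>
  intro d n hN Y _ _ O hO c v hv i x
  have hv' : Good n c (i.removeNth v) := hv.comp (Fin.strictMono_succAbove i).monotone
  match n with
  | 0 => exact absurd (hv.lt 0) (by have := hv.ge 0; push_cast; omega)
  | n + 1 =>
    rcases hv.cases with h | ⟨h0, h⟩ | ⟨h0, e, rfl, h1⟩
    · rw [sop_skip _ h, sop_skip (v := i.removeNth v) _ (fun j => h _), comp_apply,
        comp_apply, ih _ (by omega) d n rfl hO (hv.shrink h)]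
    · rw [sop_dec _ h0 h]
      induction i using Fin.cases with
      | zero =>
        rw [show Fin.removeNth 0 v = Fin.tail v from rfl, sop_skip (v := Fin.tail v) _ (fun j => h j),
          comp_apply]
        exact sop_hom _ d n rfl hO.d_zero_hom (hv.tail.shrink h) x
      | succ i =>
        match d with
        | 0 => exact i.elim0
        | d + 1 =>
          rw [sop_dec _ (show (i.succ.removeNth v) 0 = c from h0), tail_removeNth]
          · exact ih _ (by omega) d n rfl hO.dec (hv.tail.shrink h) i x
          · intro j
            have := congrFun (tail_removeNth v i) j
            rw [Fin.tail] at this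
            rw [this]
            exact h _
    · rw [sop_dup _ h0 h1, comp_apply]
      induction i using Fin.cases with
      | zero => exact hO.d_s_eq e 0 (by omega) _
      | succ i =>
        induction i using Fin.cases with
        | zero =>
          rw [show Fin.removeNth (Fin.succ 0) v = Fin.tail v by
            funext j
            induction j using Fin.cases with
            | zero => exact h0.trans h1.symm
            | succ j => rfl]
          exact hO.d_s_eq' e 0 (by omega) _
        | succ i =>
          match e with
          | 0 => exact i.elim0
          | e + 1 =>
            rw [sop_dup _ (show (i.succ.succ.removeNth v) 0 = c from h0)
              (show (i.succ.succ.removeNth v) 1 = c from h1), tail_removeNth, comp_apply,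
              ← ih _ (by omega) (e + 1) (n + 1) rfl hO hv.tail]
            exact hO.d_s_gt e (i + 1) 0 (by omega) (by omega) _

lemma tail_dup {d : ℕ} (v : Fin (d + 2) → ℤ) (i : Fin (d + 1)) :
    Fin.tail (v ∘ i.succ.predAbove) = Fin.tail v ∘ i.predAbove := by
  funext j
  simp [Fin.tail]

lemma sop_s (N : ℕ) : ∀ (d n : ℕ), d + n = N → ∀ {Y : ℕ → Type*} [∀ n, AddCommGroup (Y n)]
    [∀ n, Module k (Y n)] {O : AugOps k Y}, O.IsAug →
    ∀ {c : ℤ} {v : Fin (d + 1) → ℤ}, Good n c v → ∀ (i : Fin (d + 1)) (x : Y n),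
    O.s d i (sop (d + 1) n O c v x) = sop (d + 2) n O c (v ∘ i.predAbove) x := by
  induction N using Nat.strong_induction_on with
  | _ N ih =>
  intro d n hN Y _ _ O hO c v hv i x
  match n with
  | 0 => exact absurd (hv.lt 0) (by have := hv.ge 0; push_cast; omega)
  | n + 1 =>
    rcases hv.cases with h | ⟨h0, h⟩ | ⟨h0, e, rfl, h1⟩
    · rw [sop_skip _ h, sop_skip (v := v ∘ i.predAbove) _ (fun j => h _), comp_apply,
        comp_apply, ih _ (by omega) d n rfl hO (hv.shrink h)]
    · induction i using Fin.cases with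
      | zero =>
        have e1 : Fin.tail (v ∘ (0 : Fin (d + 1)).predAbove) = v := by funext j; simp [Fin.tail]
        rw [sop_dup (v := v ∘ (0 : Fin (d + 1)).predAbove) _ h0 h0, e1]; rfl
      | succ i =>
        match d with
        | 0 => exact i.elim0
        | d + 1 =>
          rw [sop_dec _ h0 h, sop_dec (v := v ∘ i.succ.predAbove) _ h0, tail_dup]
          · exact ih _ (by omega) d n rfl hO.dec (hv.tail.shrink h) i x
          · intro j
            have := congrFun (tail_dup v i) j
            rw [Fin.tail] at this
            rw [this]
            exact h _
    · induction i using Fin.cases with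
      | zero =>
        have e1 : Fin.tail (v ∘ (0 : Fin (e + 1 + 1)).predAbove) = v := by funext j; simp [Fin.tail]
        rw [sop_dup (v := v ∘ (0 : Fin (e + 1 + 1)).predAbove) _ h0 h0, e1]; rfl
      | succ i =>
        rw [sop_dup _ h0 h1, sop_dup (v := v ∘ i.succ.predAbove) _ h0, tail_dup,
          comp_apply, comp_apply, ← ih _ (by omega) e (n + 1) rfl hO hv.tail]
        · exact (hO.s_s e 0 i (by omega) (by omega) _).symm
        · have := congrFun (tail_dup v i) 0
          rw [Fin.tail] at this
          refine this.trans ?_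
          simp only [Function.comp_apply, Fin.tail]
          exact (congrArg v (by simp)).trans h1

lemma sop_id : ∀ (n : ℕ) {Y : ℕ → Type*} [∀ n, AddCommGroup (Y n)]
    [∀ n, Module k (Y n)] (O : AugOps k Y) (c : ℤ) (v : Fin n → ℤ), (∀ j : Fin n, v j = c + j) →
    sop n n O c v = 𝟙
  | 0, _, _, _, _, _, _, _ => by rw [sop]
  | n + 1, _, _, _, O, c, v, hv => by
    have h0 : v 0 = c := by simpa using hv 0
    have h1 : ∀ j : Fin n, v j.succ = c + 1 + j := fun j => by
      rw [hv]; push_cast [Fin.val_succ]; ring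
    rw [sop_dec _ h0 (fun j => by rw [h1]; omega), sop_id n O.dec _ (Fin.tail v) h1]

end AugOps

end

/-! ### Rotations of sequences -/

section Sequences

/-- Move the last entry to the front. -/
def rotL (n : ℕ) {d : ℕ} (v : Fin (d + 1) → ℤ) : Fin (d + 1) → ℤ :=
  Fin.cons (v (Fin.last d) - (n + 1)) (Fin.init v)

/-- Move the first entry to the end. -/
def rotR (n : ℕ) {d : ℕ} (v : Fin (d + 1) → ℤ) : Fin (d + 1) → ℤ :=
  Fin.snoc (α := fun _ => ℤ) (Fin.tail v) (v 0 + (n + 1))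

variable {n d : ℕ} (v : Fin (d + 1) → ℤ)

@[simp] lemma rotL_zero : rotL n v 0 = v (Fin.last d) - (n + 1) := rfl

@[simp] lemma rotL_succ (i : Fin d) : rotL n v i.succ = v i.castSucc := rfl

@[simp] lemma rotR_last : rotR n v (Fin.last d) = v 0 + (n + 1) := by simp [rotR]

@[simp] lemma rotR_castSucc (i : Fin d) : rotR n v i.castSucc = v i.succ := by simp [rotR, Fin.tail]

@[simp] lemma rotL_rotR : rotL n (rotR n v) = v := by
  funext j
  refine Fin.cases ?_ (fun j => ?_) j <;> simp

@[simp] lemma rotR_rotL : rotR n (rotL n v) = v := by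
  funext j
  refine Fin.lastCases ?_ (fun j => ?_) j <;> simp

/-- Non-decreasing sequences that spread over at most one period. -/
structure Valid (n : ℕ) {d : ℕ} (v : Fin (d + 1) → ℤ) : Prop where
  mono : Monotone v
  wrap : v (Fin.last d) ≤ v 0 + (n + 1)

variable {v}

lemma Valid.rotL (h : Valid n v) : Valid n (rotL n v) := by
  refine ⟨?_, ?_⟩
  · intro i j hij
    induction i using Fin.cases with
    | zero =>
      induction j using Fin.cases with
      | zero => exact le_rfl
      | succ j =>
        have := h.wrap
        have := h.mono (Fin.zero_le j.castSucc)
        rw [rotL_zero, rotL_succ]; omega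
    | succ i =>
      induction j using Fin.cases with
      | zero => exact absurd hij (by simp)
      | succ j => exact h.mono (Fin.castSucc_le_castSucc_iff.2 (Fin.succ_le_succ_iff.1 hij))
  · rw [rotL_zero]
    have h1 : CrossedCyclic.rotL n v (Fin.last d) ≤ v (Fin.last d) := by
      induction d with
      | zero => simp [CrossedCyclic.rotL]; omega
      | succ d _ =>
        rw [← Fin.succ_last, rotL_succ]
        exact h.mono (Fin.le_last _)
    omega

lemma Valid.rotR (h : Valid n v) : Valid n (rotR n v) := by
  refine ⟨?_, ?_⟩
  · intro i j hij
    induction j using Fin.lastCases with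
    | last =>
      induction i using Fin.lastCases with
      | last => exact le_rfl
      | cast i =>
        have := h.wrap
        have := h.mono (Fin.le_last i.succ)
        rw [rotR_last, rotR_castSucc]; omega
    | cast j =>
      induction i using Fin.lastCases with
      | last => exact absurd hij (by simp [Fin.le_def])
      | cast i =>
        rw [rotR_castSucc, rotR_castSucc]
        exact h.mono (Fin.succ_le_succ_iff.2 (Fin.castSucc_le_castSucc_iff.1 hij))
  · rw [rotR_last]
    have h1 : v 0 ≤ CrossedCyclic.rotR n v 0 := by
      induction d with
      | zero =>
        have := rotR_last (n := n) v
        rw [show (0 : Fin 1) = Fin.last 0 from rfl, this]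
        simp only [Fin.last_zero]; omega
      | succ d _ =>
        rw [show (0 : Fin (d + 2)) = Fin.castSucc 0 from rfl, rotR_castSucc]
        exact h.mono (by simp)
    omega

lemma Valid.comp {e : ℕ} (h : Valid n v) {f : Fin (e + 1) → Fin (d + 1)} (hf : Monotone f) :
    Valid n (v ∘ f) :=
  ⟨h.mono.comp hf, (h.mono (Fin.le_last _)).trans (h.wrap.trans
    (by have := h.mono (Fin.zero_le (f 0)); simp only [Function.comp_apply]; omega))⟩

/-- A measure of the distance of `v` to `0, …, n`. -/
def spread (n : ℕ) (v : Fin (d + 1) → ℤ) : ℕ := ∑ i, (2 * v i - n).natAbs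

lemma spread_rotR (h : v 0 < 0) : spread n (rotR n v) < spread n v := by
  unfold spread
  rw [Fin.sum_univ_castSucc, Fin.sum_univ_succ]
  simp only [rotR_last, rotR_castSucc]
  omega

lemma spread_rotL (h : (n : ℤ) < v (Fin.last d)) : spread n (rotL n v) < spread n v := by
  unfold spread
  rw [Fin.sum_univ_succ, Fin.sum_univ_castSucc]
  simp only [rotL_zero, rotL_succ]
  omega

lemma rotL_comp_succAbove_zero (v : Fin (d + 2) → ℤ) :
    rotL n v ∘ (0 : Fin (d + 2)).succAbove = v ∘ (Fin.last (d + 1)).succAbove := by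
  funext j
  simp only [Function.comp_apply, Fin.zero_succAbove, rotL_succ, Fin.succAbove_last]

lemma rotL_comp_succAbove_succ (v : Fin (d + 2) → ℤ) (i : Fin (d + 1)) :
    rotL n v ∘ i.succ.succAbove = rotL n (v ∘ i.castSucc.succAbove) := by
  funext j
  induction j using Fin.cases with
  | zero =>
    simp only [Function.comp_apply, Fin.succ_succAbove_zero, rotL_zero]
    rw [Fin.succAbove_of_le_castSucc _ _ (by simp [Fin.le_last]), Fin.succ_last]
  | succ j =>
    simp only [Function.comp_apply, Fin.succ_succAbove_succ, rotL_succ]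
    rw [Fin.castSucc_succAbove_castSucc]

lemma rotL_comp_predAbove_succ (v : Fin (d + 1) → ℤ) (i : Fin d) :
    rotL n v ∘ (i.succ : Fin (d + 1)).predAbove = rotL n (v ∘ (i.castSucc).predAbove) := by
  funext j
  induction j using Fin.cases with
  | zero =>
    simp only [Function.comp_apply, rotL_zero, Fin.predAbove_right_last]
    rw [Fin.predAbove_right_zero, rotL_zero]
  | succ j =>
    simp only [Function.comp_apply, rotL_succ]
    rw [Fin.succ_predAbove_succ, rotL_succ, Fin.castSucc_predAbove_castSucc]

lemma rotL_comp_predAbove_zero (v : Fin (d + 1) → ℤ) : rotL n v ∘ (0 : Fin (d + 1)).predAbove =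
      rotL n (rotL n (v ∘ (Fin.last d).predAbove)) := by
  have aux : ∀ j : Fin (d + 1), (Fin.last d).predAbove j.castSucc = j := fun j => by simp
  funext j
  induction j using Fin.cases with
  | zero =>
    rw [rotL_zero, ← Fin.succ_last, rotL_succ, Function.comp_apply, Fin.predAbove_right_zero,
      rotL_zero, Function.comp_apply, aux]
  | succ j =>
    rw [rotL_succ]
    induction j using Fin.cases with
    | zero =>
      rw [Fin.castSucc_zero, rotL_zero, Function.comp_apply, Function.comp_apply]
      simp
    | succ j =>
      rw [← Fin.succ_castSucc, rotL_succ, Function.comp_apply, Function.comp_apply, aux]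
      simp

end Sequences

/-! ### Operators of a paracyclic module -/

namespace CycOps

variable {k : Type*} [CommRing k] {X : ℕ → Type*} [∀ n, AddCommGroup (X n)]
  [∀ n, Module k (X n)] (O : CycOps k X)

/-- The underlying simplicial module, augmented by zero. -/
def aug : AugOps k (fun n => X (n - 1)) where
  d
    | 0, _ => 0
    | n + 1, i => if h : i < n + 2 then O.d n ⟨i, h⟩ else 0
  s n i := if h : i < n + 1 then O.s n ⟨i, h⟩ else 0

lemma aug_d (n : ℕ) (i : Fin (n + 2)) : O.aug.d (n + 1) i = O.d n i := dif_pos i.2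

lemma aug_s (n : ℕ) (i : Fin (n + 1)) : O.aug.s n i = O.s n i := dif_pos i.2

variable {O}

lemma IsParacyclic.aug (hO : O.IsParacyclic) : O.aug.IsAug where
  d_d n i j hij hj x := by
    cases n with
    | zero => rfl
    | succ n =>
      have := app_eq (hO.d_d n ⟨i, by omega⟩ ⟨j, by omega⟩ hij) x
      simp only [comp_apply, ← aug_d] at this
      exact this
  s_s n i j hij hj x := by
    have := app_eq (hO.s_s n ⟨i, by omega⟩ ⟨j, by omega⟩ hij) x
    simp only [comp_apply, ← aug_s] at this
    exact this
  d_s_lt n i j hij hj x := by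
    have := app_eq (hO.d_s_lt n ⟨i, by omega⟩ ⟨j, by omega⟩ hij) x
    simp only [comp_apply, ← aug_s, ← aug_d] at this
    exact this
  d_s_eq n i hi x := by
    have := app_eq (hO.d_s_eq n ⟨i, by omega⟩) x
    simp only [comp_apply, ← aug_s, ← aug_d] at this
    exact this
  d_s_eq' n i hi x := by
    have := app_eq (hO.d_s_eq' n ⟨i, by omega⟩) x
    simp only [comp_apply, ← aug_s, ← aug_d] at this
    exact this
  d_s_gt n i j hij hi x := by
    have := app_eq (hO.d_s_gt n ⟨i, by omega⟩ ⟨j, by omega⟩ hij) x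
    simp only [comp_apply, ← aug_s, ← aug_d] at this
    exact this

/-- The cyclic operator as an automorphism. -/
def IsParacyclic.tEquiv (hO : O.IsParacyclic) (n : ℕ) : X n ≃ₗ[k] X n :=
  LinearEquiv.ofBijective (O.t n) (hO.t_bijective n)

/-- The paracyclic operator of a sequence of integers. -/
def IsParacyclic.op (hO : O.IsParacyclic) (n d : ℕ) (v : Fin (d + 1) → ℤ) : X n →ₗ[k] X d :=
  if _h : v 0 < 0 then O.t d ∘ₗ hO.op n d (rotR n v)
  else if _h : (n : ℤ) < v (Fin.last d) then
    (hO.tEquiv d).symm.toLinearMap ∘ₗ hO.op n d (rotL n v)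
  else O.aug.sop (d + 1) (n + 1) 0 v
termination_by spread n v
decreasing_by
  · exact spread_rotR _h
  · exact spread_rotL _h

variable (hO : O.IsParacyclic) {n d : ℕ}

lemma IsParacyclic.t_op {v : Fin (d + 1) → ℤ} (hv : Valid n v) (x : X n) :
    O.t d (hO.op n d v x) = hO.op n d (rotL n v) x := by
  by_cases h : (rotL n v) 0 < 0
  · conv_rhs => rw [IsParacyclic.op, dif_pos h, rotR_rotL]
    rfl
  · have h' : (n : ℤ) < v (Fin.last d) := by rw [rotL_zero] at h; omega
    rw [IsParacyclic.op, dif_neg (by have := hv.wrap; omega), dif_pos h']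
    exact (hO.tEquiv d).apply_symm_apply _

lemma IsParacyclic.op_of_good {v : Fin (d + 1) → ℤ} (hv : AugOps.Good (n + 1) 0 v) :
    hO.op n d v = O.aug.sop (d + 1) (n + 1) 0 v := by
  rw [IsParacyclic.op, dif_neg (by have := hv.ge 0; omega),
    dif_neg (by have := hv.lt (Fin.last d); push_cast at this; omega)]

/-- Every valid sequence is a rotation of one with values in `0, …, n`. -/
lemma rot_induction {P : (Fin (d + 1) → ℤ) → Prop}
    (good : ∀ v, AugOps.Good (n + 1) 0 v → P v) (left : ∀ v, Valid n v → P v → P (rotL n v))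
    (right : ∀ v, Valid n v → P (rotL n v) → P v) {v : Fin (d + 1) → ℤ} (hv : Valid n v) : P v := by
  induction hN : spread n v using Nat.strong_induction_on generalizing v with
  | _ N ih =>
  by_cases h0 : v 0 < 0
  · have := left _ hv.rotR (ih _ (hN ▸ spread_rotR h0) hv.rotR rfl)
    rwa [rotL_rotR] at this
  · by_cases h1 : (n : ℤ) < v (Fin.last d)
    · exact right _ hv (ih _ (hN ▸ spread_rotL h1) hv.rotL rfl)
    · refine good v ⟨hv.mono, fun j => ?_, fun j => ?_⟩
      · have := hv.mono (Fin.zero_le j); omega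
      · have := hv.mono (Fin.le_last j); push_cast; omega

lemma IsParacyclic.d_op {v : Fin (d + 2) → ℤ} (hv : Valid n v) : ∀ (i : Fin (d + 2)) (x : X n),
    O.d d i (hO.op n (d + 1) v x) = hO.op n d (v ∘ i.succAbove) x := by
  refine rot_induction (P := fun v => ∀ (i : Fin (d + 2)) (x : X n),
    O.d d i (hO.op n (d + 1) v x) = hO.op n d (v ∘ i.succAbove) x) ?_ ?_ ?_ hv
  · intro v hv i x
    rw [hO.op_of_good hv, hO.op_of_good (hv.comp (Fin.strictMono_succAbove i).monotone), ← aug_d]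
    exact AugOps.sop_d _ (d + 1) (n + 1) rfl hO.aug hv i x
  · intro v hv ih i x
    rw [← hO.t_op hv]
    induction i using Fin.cases with
    | zero =>
      rw [rotL_comp_succAbove_zero, ← ih]
      exact app_eq (hO.d_zero_t d) _
    | succ i =>
      rw [rotL_comp_succAbove_succ, ← hO.t_op (hv.comp (Fin.strictMono_succAbove _).monotone), ← ih]
      exact app_eq (hO.d_t d i) _
  · intro v hv ih i x
    induction i using Fin.lastCases with
    | last =>
      rw [← rotL_comp_succAbove_zero (n := n), ← ih, ← hO.t_op hv]
      exact (app_eq (hO.d_zero_t d) _).symm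
    | cast i =>
      apply (hO.t_bijective d).1
      rw [hO.t_op (hv.comp (Fin.strictMono_succAbove _).monotone), ← rotL_comp_succAbove_succ,
        ← ih, ← hO.t_op hv]
      exact (app_eq (hO.d_t d i) _).symm

lemma IsParacyclic.s_op {v : Fin (d + 1) → ℤ} (hv : Valid n v) : ∀ (i : Fin (d + 1)) (x : X n),
    O.s d i (hO.op n d v x) = hO.op n (d + 1) (v ∘ i.predAbove) x := by
  refine rot_induction (P := fun v => ∀ (i : Fin (d + 1)) (x : X n),
    O.s d i (hO.op n d v x) = hO.op n (d + 1) (v ∘ i.predAbove) x) ?_ ?_ ?_ hv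
  · intro v hv i x
    rw [hO.op_of_good hv, hO.op_of_good (hv.comp (Fin.predAbove_right_monotone i)), ← aug_s]
    exact AugOps.sop_s _ d (n + 1) rfl hO.aug hv i x
  · intro v hv ih i x
    rw [← hO.t_op hv]
    induction i using Fin.cases with
    | zero =>
      have h1 := hv.comp (Fin.predAbove_right_monotone (Fin.last d))
      rw [rotL_comp_predAbove_zero, ← hO.t_op h1.rotL, ← hO.t_op h1, ← ih]
      exact app_eq (hO.s_zero_t d) _
    | succ i =>
      rw [rotL_comp_predAbove_succ, ← hO.t_op (hv.comp (Fin.predAbove_right_monotone _)), ← ih]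
      exact app_eq (hO.s_t d i) _
  · intro v hv ih i x
    have h1 := hv.comp (Fin.predAbove_right_monotone i)
    induction i using Fin.lastCases with
    | last =>
      apply (hO.t_bijective (d + 1)).1
      apply (hO.t_bijective (d + 1)).1
      rw [hO.t_op h1, hO.t_op h1.rotL, ← rotL_comp_predAbove_zero, ← ih, ← hO.t_op hv]
      exact (app_eq (hO.s_zero_t d) _).symm
    | cast i =>
      apply (hO.t_bijective (d + 1)).1
      rw [hO.t_op h1, ← rotL_comp_predAbove_succ, ← ih, ← hO.t_op hv]
      exact (app_eq (hO.s_t d i) _).symm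

lemma IsParacyclic.op_id (v : Fin (n + 1) → ℤ) (hv : ∀ j, v j = (j : ℕ)) (x : X n) :
    hO.op n n v x = x := by
  rw [hO.op_of_good ⟨fun i j hij => ?_, fun j => ?_, fun j => ?_⟩, AugOps.sop_id]
  · rfl
  · intro j; rw [hv, zero_add]
  · rw [hv, hv]; exact_mod_cast hij
  · rw [hv]; omega
  · rw [hv]; push_cast; omega

lemma _root_.CrossedCyclic.CycHom.aug {X' : ℕ → Type*} [∀ n, AddCommGroup (X' n)] [∀ n, Module k (X' n)]
    {O' : CycOps k X'} {f : ∀ n, X n →ₗ[k] X' n} (hf : CycHom O O' f) :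
    AugOps.Hom O.aug O'.aug (fun n => f (n - 1)) where
  d n i hi x := by
    cases n with
    | zero => exact map_zero (f 0)
    | succ n =>
      have := hf.d n ⟨i, by omega⟩ x
      simp only [← aug_d] at this
      exact this
  s n i hi x := by
    have := hf.s n ⟨i, by omega⟩ x
    simp only [← aug_s] at this
    exact this

lemma _root_.CrossedCyclic.CycHom.op {X' : ℕ → Type*} [∀ n, AddCommGroup (X' n)] [∀ n, Module k (X' n)]
    {O' : CycOps k X'} {f : ∀ n, X n →ₗ[k] X' n} (hf : CycHom O O' f) (hO' : O'.IsParacyclic)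
    {v : Fin (d + 1) → ℤ} (hv : Valid n v) (x : X n) :
    f d (hO.op n d v x) = hO'.op n d v (f n x) := by
  refine rot_induction (P := fun v => f d (hO.op n d v x) = hO'.op n d v (f n x)) ?_ ?_ ?_ hv
  · intro v hv
    rw [hO.op_of_good hv, hO'.op_of_good hv]
    exact AugOps.sop_hom _ (d + 1) (n + 1) rfl hf.aug hv x
  · intro v hv ih
    rw [← hO.t_op hv, ← hO'.t_op hv, hf.t, ih]
  · intro v hv ih
    rw [← hO.t_op hv, ← hO'.t_op hv, hf.t] at ih
    exact (hO'.t_bijective d).1 ih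

end CycOps

/-! ### The free bi-paracyclic module on one generator -/

section Fin

open CategoryTheory SimplexCategory

lemma succAbove_comm {n : ℕ} {i j : Fin (n + 2)} (h : i ≤ j) (x : Fin (n + 1)) :
    j.succ.succAbove (i.succAbove x) = i.castSucc.succAbove (j.succAbove x) :=
  congrArg (fun f => f.toOrderHom x) (δ_comp_δ h)

lemma predAbove_comm {n : ℕ} {i j : Fin (n + 1)} (h : i ≤ j) (x : Fin (n + 3)) :
    j.predAbove (i.castSucc.predAbove x) = i.predAbove (j.succ.predAbove x) :=
  congrArg (fun f => f.toOrderHom x) (σ_comp_σ h)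

lemma predAbove_succAbove_of_le {n : ℕ} {i : Fin (n + 2)} {j : Fin (n + 1)} (h : i ≤ j.castSucc)
    (x : Fin (n + 2)) : j.succ.predAbove (i.castSucc.succAbove x) = i.succAbove (j.predAbove x) :=
  congrArg (fun f => f.toOrderHom x) (δ_comp_σ_of_le h)

lemma predAbove_succAbove_of_gt {n : ℕ} {i : Fin (n + 2)} {j : Fin (n + 1)} (h : j.castSucc < i)
    (x : Fin (n + 2)) : j.castSucc.predAbove (i.succ.succAbove x) = i.succAbove (j.predAbove x) :=
  congrArg (fun f => f.toOrderHom x) (δ_comp_σ_of_gt h)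

lemma predAbove_succ_succAbove {n : ℕ} (i : Fin (n + 1)) (x : Fin (n + 1)) :
    i.predAbove (i.succ.succAbove x) = x :=
  congrArg (fun f => f.toOrderHom x) (δ_comp_σ_succ (i := i))

end Fin

universe w uk

/-- Valid sequences of length `d + 1`. -/
@[ext] structure Seq (n d : ℕ) : Type w where
  val : Fin (d + 1) → ℤ
  valid : Valid n val

namespace Seq

variable {n d : ℕ}

def face (i : Fin (d + 2)) (v : Seq.{w} n (d + 1)) : Seq.{w} n d :=
  ⟨v.val ∘ i.succAbove, v.valid.comp (Fin.strictMono_succAbove i).monotone⟩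

def degen (i : Fin (d + 1)) (v : Seq.{w} n d) : Seq.{w} n (d + 1) :=
  ⟨v.val ∘ i.predAbove, v.valid.comp (Fin.predAbove_right_monotone i)⟩

def rotate (v : Seq.{w} n d) : Seq.{w} n d := ⟨rotL n v.val, v.valid.rotL⟩

def rotateEquiv : Seq.{w} n d ≃ Seq.{w} n d where
  toFun := rotate
  invFun v := ⟨rotR n v.val, v.valid.rotR⟩
  left_inv v := Seq.ext (rotR_rotL _)
  right_inv v := Seq.ext (rotL_rotR _)

def top (n : ℕ) : Seq.{w} n n where
  val j := (j : ℕ)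
  valid := ⟨fun i j h => by exact_mod_cast h, by simp⟩

lemma face_face {i j : Fin (d + 2)} (h : i ≤ j) (v : Seq.{w} n (d + 2)) :
    face i (face j.succ v) = face j (face i.castSucc v) :=
  Seq.ext (funext fun x => congrArg v.val (succAbove_comm h x))

lemma degen_degen {i j : Fin (d + 1)} (h : i ≤ j) (v : Seq.{w} n d) :
    degen i.castSucc (degen j v) = degen j.succ (degen i v) :=
  Seq.ext (funext fun x => congrArg v.val (predAbove_comm h x))

lemma face_degen_lt {i : Fin (d + 2)} {j : Fin (d + 1)} (h : i ≤ j.castSucc)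
    (v : Seq.{w} n (d + 1)) : face i.castSucc (degen j.succ v) = degen j (face i v) :=
  Seq.ext (funext fun x => congrArg v.val (predAbove_succAbove_of_le h x))

lemma face_degen_gt {i : Fin (d + 2)} {j : Fin (d + 1)} (h : j.castSucc < i)
    (v : Seq.{w} n (d + 1)) : face i.succ (degen j.castSucc v) = degen j (face i v) :=
  Seq.ext (funext fun x => congrArg v.val (predAbove_succAbove_of_gt h x))

lemma face_degen_eq (i : Fin (d + 1)) (v : Seq.{w} n d) : face i.castSucc (degen i v) = v :=
  Seq.ext (funext fun x => congrArg v.val (Fin.predAbove_succAbove i x))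

lemma face_degen_eq' (i : Fin (d + 1)) (v : Seq.{w} n d) : face i.succ (degen i v) = v :=
  Seq.ext (funext fun x => congrArg v.val (predAbove_succ_succAbove i x))

lemma face_rotate (i : Fin (d + 1)) (v : Seq.{w} n (d + 1)) :
    face i.succ (rotate v) = rotate (face i.castSucc v) :=
  Seq.ext (rotL_comp_succAbove_succ v.val i)

lemma face_zero_rotate (v : Seq.{w} n (d + 1)) : face 0 (rotate v) = face (Fin.last (d + 1)) v :=
  Seq.ext (rotL_comp_succAbove_zero (n := n) v.val)

lemma degen_rotate (i : Fin d) (v : Seq.{w} n d) :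
    degen i.succ (rotate v) = rotate (degen i.castSucc v) :=
  Seq.ext (rotL_comp_predAbove_succ v.val i)

lemma degen_zero_rotate (v : Seq.{w} n d) :
    degen 0 (rotate v) = rotate (rotate (degen (Fin.last d) v)) :=
  Seq.ext (rotL_comp_predAbove_zero v.val)

end Seq

section Free

variable (k : Type uk) [CommRing k] (p q : ℕ)

/-- The free bi-paracyclic module on one generator in bidegree `(p, q)`. -/
abbrev FreeBi (m n : ℕ) : Type (max w uk) := (Seq.{w} p m × Seq.{w} q n) →₀ k

/-- The operators in the first direction. -/
def freeH (n : ℕ) : CycOps k (fun m => FreeBi.{w} k p q m n) where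
  d _ i := lmapDomain k k (Prod.map (Seq.face i) id)
  s _ i := lmapDomain k k (Prod.map (Seq.degen i) id)
  t _ := lmapDomain k k (Prod.map Seq.rotate id)

/-- The operators in the second direction. -/
def freeA (m : ℕ) : CycOps k (fun n => FreeBi.{w} k p q m n) where
  d _ i := lmapDomain k k (Prod.map id (Seq.face i))
  s _ i := lmapDomain k k (Prod.map id (Seq.degen i))
  t _ := lmapDomain k k (Prod.map id Seq.rotate)

lemma lmapDomain_comp_eq {α β β' γ : Type*} {f : β → γ} {g : α → β} {f' : β' → γ} {g' : α → β'}
    (h : ∀ x, f (g x) = f' (g' x)) : lmapDomain k k f ∘ₗ lmapDomain k k g =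
      lmapDomain k k f' ∘ₗ lmapDomain k k g' := by
  rw [← lmapDomain_comp, ← lmapDomain_comp]
  exact congrArg _ (funext h)

lemma lmapDomain_comp_eq_one {α β : Type*} {f : β → α} {g : α → β} (h : ∀ x, f (g x) = x) :
    lmapDomain k k f ∘ₗ lmapDomain k k g = 𝟙 := by
  rw [← lmapDomain_comp, show f ∘ g = id from funext h, Finsupp.lmapDomain_id]

lemma mapDomain_bijective {k α β : Type*} [CommRing k] (e : α ≃ β) :
    Bijective (Finsupp.mapDomain e : (α →₀ k) → (β →₀ k)) :=
  ⟨Finsupp.mapDomain_injective e.injective, Finsupp.mapDomain_surjective e.surjective⟩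

lemma freeH_isParacyclic (n : ℕ) : (freeH.{w} k p q n).IsParacyclic where
  d_d _ _ _ h := lmapDomain_comp_eq k fun x => Prod.ext (Seq.face_face h x.1) rfl
  s_s _ _ _ h := lmapDomain_comp_eq k fun x => Prod.ext (Seq.degen_degen h x.1) rfl
  d_s_lt _ _ _ h := lmapDomain_comp_eq k fun x => Prod.ext (Seq.face_degen_lt h x.1) rfl
  d_s_eq _ i := lmapDomain_comp_eq_one k fun x => Prod.ext (Seq.face_degen_eq i x.1) rfl
  d_s_eq' _ i := lmapDomain_comp_eq_one k fun x => Prod.ext (Seq.face_degen_eq' i x.1) rfl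
  d_s_gt _ _ _ h := lmapDomain_comp_eq k fun x => Prod.ext (Seq.face_degen_gt h x.1) rfl
  d_t _ i := lmapDomain_comp_eq k fun x => Prod.ext (Seq.face_rotate i x.1) rfl
  d_zero_t _ := by
    rw [freeH, ← lmapDomain_comp]
    exact congrArg _ (funext fun x => Prod.ext (Seq.face_zero_rotate x.1) rfl)
  s_t _ i := lmapDomain_comp_eq k fun x => Prod.ext (Seq.degen_rotate i x.1) rfl
  s_zero_t _ := by
    simp only [freeH, ← lmapDomain_comp]
    exact congrArg _ (funext fun x => Prod.ext (Seq.degen_zero_rotate x.1) rfl)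
  t_bijective _ := mapDomain_bijective (Seq.rotateEquiv.prodCongr (Equiv.refl _))

lemma freeA_isParacyclic (m : ℕ) : (freeA.{w} k p q m).IsParacyclic where
  d_d _ _ _ h := lmapDomain_comp_eq k fun x => Prod.ext rfl (Seq.face_face h x.2)
  s_s _ _ _ h := lmapDomain_comp_eq k fun x => Prod.ext rfl (Seq.degen_degen h x.2)
  d_s_lt _ _ _ h := lmapDomain_comp_eq k fun x => Prod.ext rfl (Seq.face_degen_lt h x.2)
  d_s_eq _ i := lmapDomain_comp_eq_one k fun x => Prod.ext rfl (Seq.face_degen_eq i x.2)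
  d_s_eq' _ i := lmapDomain_comp_eq_one k fun x => Prod.ext rfl (Seq.face_degen_eq' i x.2)
  d_s_gt _ _ _ h := lmapDomain_comp_eq k fun x => Prod.ext rfl (Seq.face_degen_gt h x.2)
  d_t _ i := lmapDomain_comp_eq k fun x => Prod.ext rfl (Seq.face_rotate i x.2)
  d_zero_t _ := by
    rw [freeA, ← lmapDomain_comp]
    exact congrArg _ (funext fun x => Prod.ext rfl (Seq.face_zero_rotate x.2))
  s_t _ i := lmapDomain_comp_eq k fun x => Prod.ext rfl (Seq.degen_rotate i x.2)
  s_zero_t _ := by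
    simp only [freeA, ← lmapDomain_comp]
    exact congrArg _ (funext fun x => Prod.ext rfl (Seq.degen_zero_rotate x.2))
  t_bijective _ := mapDomain_bijective ((Equiv.refl _).prodCongr Seq.rotateEquiv)

lemma lmapDomain_fst_snd {α α' β β' : Type*} (f : α → α') (g : β → β') (x : (α × β) →₀ k) :
    lmapDomain k k (Prod.map f id) (lmapDomain k k (Prod.map id g) x) =
      lmapDomain k k (Prod.map id g) (lmapDomain k k (Prod.map f id) x) :=
  app_eq (lmapDomain_comp_eq k (f := Prod.map f id) (g := Prod.map id g)
    (f' := Prod.map id g) (g' := Prod.map f id) fun _ => rfl) x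

lemma free_isBiPara : IsBiPara (freeH.{w} k p q) (freeA.{w} k p q) where
  h := freeH_isParacyclic k p q
  a := freeA_isParacyclic k p q
  d _ _ := ⟨fun _ _ => lmapDomain_fst_snd k _ _, fun _ _ => lmapDomain_fst_snd k _ _,
    fun _ => lmapDomain_fst_snd k _ _⟩
  s _ _ := ⟨fun _ _ => lmapDomain_fst_snd k _ _, fun _ _ => lmapDomain_fst_snd k _ _,
    fun _ => lmapDomain_fst_snd k _ _⟩
  t _ := ⟨fun _ _ => lmapDomain_fst_snd k _ _, fun _ _ => lmapDomain_fst_snd k _ _,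
    fun _ => lmapDomain_fst_snd k _ _⟩

variable {X : ℕ → ℕ → Type*} [∀ m n, AddCommGroup (X m n)] [∀ m n, Module k (X m n)]
  {Oh : ∀ n, CycOps k (fun m => X m n)} {Oa : ∀ m, CycOps k (fun n => X m n)}
  (hX : IsBiPara Oh Oa)

variable {k p q}

/-- The map from the free bi-paracyclic module that sends the generator to `x`. -/
def IsBiPara.ev (x : X p q) (m n : ℕ) : FreeBi.{w} k p q m n →ₗ[k] X m n :=
  Finsupp.linearCombination k fun s => (hX.a m).op q n s.2.val ((hX.h q).op p m s.1.val x)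

lemma IsBiPara.ev_single (x : X p q) (m n : ℕ) (s : Seq.{w} p m × Seq.{w} q n) (c : k) :
    hX.ev x m n (Finsupp.single s c) = c • (hX.a m).op q n s.2.val ((hX.h q).op p m s.1.val x) := by
  simp [IsBiPara.ev]

lemma IsBiPara.ev_h (x : X p q) (n : ℕ) :
    CycHom (freeH.{w} k p q n) (Oh n) (fun m => hX.ev x m n) where
  d m i y := by
    induction y using induction_linear with
    | zero => simp
    | add y z hy hz => simp only [map_add, hy, hz]
    | single s c =>
      rw [freeH, lmapDomain_apply, mapDomain_single, hX.ev_single, hX.ev_single, map_smul]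
      refine congrArg _ ?_
      rw [(hX.d m i).op (hX.a _) (hX.a _) s.2.valid, (hX.h q).d_op s.1.valid]
      rfl
  s m i y := by
    induction y using induction_linear with
    | zero => simp
    | add y z hy hz => simp only [map_add, hy, hz]
    | single s c =>
      rw [freeH, lmapDomain_apply, mapDomain_single, hX.ev_single, hX.ev_single, map_smul]
      refine congrArg _ ?_
      rw [(hX.s m i).op (hX.a _) (hX.a _) s.2.valid, (hX.h q).s_op s.1.valid]
      rfl
  t m y := by
    induction y using induction_linear with
    | zero => simp
    | add y z hy hz => simp only [map_add, hy, hz]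
    | single s c =>
      rw [freeH, lmapDomain_apply, mapDomain_single, hX.ev_single, hX.ev_single, map_smul]
      refine congrArg _ ?_
      rw [(hX.t m).op (hX.a _) (hX.a _) s.2.valid, (hX.h q).t_op s.1.valid]
      rfl

lemma IsBiPara.ev_a (x : X p q) (m : ℕ) :
    CycHom (freeA.{w} k p q m) (Oa m) (fun n => hX.ev x m n) where
  d n i y := by
    induction y using induction_linear with
    | zero => simp
    | add y z hy hz => simp only [map_add, hy, hz]
    | single s c =>
      rw [freeA, lmapDomain_apply, mapDomain_single, hX.ev_single, hX.ev_single, map_smul]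
      exact congrArg _ ((hX.a m).d_op s.2.valid _ _).symm
  s n i y := by
    induction y using induction_linear with
    | zero => simp
    | add y z hy hz => simp only [map_add, hy, hz]
    | single s c =>
      rw [freeA, lmapDomain_apply, mapDomain_single, hX.ev_single, hX.ev_single, map_smul]
      exact congrArg _ ((hX.a m).s_op s.2.valid _ _).symm
  t n y := by
    induction y using induction_linear with
    | zero => simp
    | add y z hy hz => simp only [map_add, hy, hz]
    | single s c =>
      rw [freeA, lmapDomain_apply, mapDomain_single, hX.ev_single, hX.ev_single, map_smul]
      exact congrArg _ ((hX.a m).t_op s.2.valid _).symm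

variable (k p q) in
/-- The generator. -/
def FreeBi.gen : FreeBi.{w} k p q p q := Finsupp.single (Seq.top p, Seq.top q) 1

lemma IsBiPara.ev_gen (x : X p q) : hX.ev x p q (FreeBi.gen.{w} k p q) = x := by
  rw [FreeBi.gen, hX.ev_single, one_smul, (hX.h q).op_id (Seq.top.{w} p).val fun _ => rfl,
    (hX.a p).op_id (Seq.top.{w} q).val fun _ => rfl]

end Free

/-! ### Acyclicity of complexes of lists -/

section ListComplex

variable (k : Type*) [CommRing k] (M : Type*) [AddCommGroup M] [Module k M] {E : Type*}

/-- Put an entry in front. -/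
def consMap (e : E) : (List E →₀ M) →ₗ[k] (List E →₀ M) := lmapDomain M k (e :: ·)

/-- The alternating sum of the deletions of an entry of a list. -/
def delList : List E → (M →ₗ[k] (List E →₀ M))
  | [] => 0
  | e :: v => Finsupp.lsingle v - consMap k M e ∘ₗ delList v

/-- The augmented complex of lists. -/
def del : (List E →₀ M) →ₗ[k] (List E →₀ M) := Finsupp.lsum k (delList k M)

/-- The prism between the identity and `r`. -/
def prismList (r : E → E) : List E → (M →ₗ[k] (List E →₀ M))
  | [] => 0
  | e :: v => Finsupp.lsingle (r e :: e :: v) - consMap k M (r e) ∘ₗ prismList r v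

/-- The prism between the identity and `r`. -/
def prism (r : E → E) : (List E →₀ M) →ₗ[k] (List E →₀ M) := Finsupp.lsum k (prismList k M r)

variable {k M}

lemma consMap_single (e : E) (v : List E) (m : M) :
    consMap k M e (Finsupp.single v m) = Finsupp.single (e :: v) m := by
  simp [consMap, mapDomain_single]

lemma del_single (v : List E) (m : M) : del k M (Finsupp.single v m) = delList k M v m := by
  simp [del]

lemma prism_single (r : E → E) (v : List E) (m : M) :
    prism k M r (Finsupp.single v m) = prismList k M r v m := by
  simp [prism]

lemma del_nil (m : M) : del k M (Finsupp.single ([] : List E) m) = 0 := by rw [del_single]; rfl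

lemma del_consMap (e : E) (x : List E →₀ M) :
    del k M (consMap k M e x) = x - consMap k M e (del k M x) := by
  induction x using induction_linear with
  | zero => simp
  | add x y hx hy => simp only [map_add, hx, hy]; abel
  | single v m =>
    rw [consMap_single, del_single, del_single]
    simp [delList]

lemma prism_consMap (r : E → E) (e : E) (x : List E →₀ M) : prism k M r (consMap k M e x) =
      consMap k M (r e) (consMap k M e x) - consMap k M (r e) (prism k M r x) := by
  induction x using induction_linear with
  | zero => simp
  | add x y hx hy => simp only [map_add, hx, hy]; abel
  | single v m =>
    rw [consMap_single, prism_single, prism_single, consMap_single]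
    simp [prismList]

/-- Apply `r` to all entries. -/
def mapList (k M : Type*) [CommRing k] [AddCommGroup M] [Module k M] {E E' : Type*} (r : E → E') :
    (List E →₀ M) →ₗ[k] (List E' →₀ M) := lmapDomain M k (List.map r)

lemma mapList_single {E' : Type*} (r : E → E') (v : List E) (m : M) :
    mapList k M r (Finsupp.single v m) = Finsupp.single (v.map r) m := by
  simp [mapList, mapDomain_single]

lemma mapList_consMap {E' : Type*} (r : E → E') (e : E) (x : List E →₀ M) :
    mapList k M r (consMap k M e x) = consMap k M (r e) (mapList k M r x) := by
  induction x using induction_linear with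
  | zero => simp
  | add x y hx hy => simp only [map_add, hx, hy]
  | single v m => rw [consMap_single, mapList_single, mapList_single, consMap_single, List.map_cons]

lemma mapList_del {E' : Type*} (r : E → E') (x : List E →₀ M) :
    mapList k M r (del k M x) = del k M (mapList k M r x) := by
  induction x using induction_linear with
  | zero => simp
  | add x y hx hy => simp only [map_add, hx, hy]
  | single v m =>
    induction v with
    | nil => rw [del_nil, mapList_single, List.map_nil, del_nil, map_zero]
    | cons e v ih =>
      rw [← consMap_single (k := k), del_consMap, map_sub, mapList_consMap, mapList_consMap,
        del_consMap, ih]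

lemma del_prism (r : E → E) (x : List E →₀ M) :
    del k M (prism k M r x) = x - mapList k M r x - prism k M r (del k M x) := by
  induction x using induction_linear with
  | zero => simp
  | add x y hx hy => simp only [map_add, hx, hy]; abel
  | single v m =>
    induction v with
    | nil =>
      rw [del_nil, prism_single, mapList_single, List.map_nil, map_zero, sub_self, sub_zero]
      exact map_zero _
    | cons e v ih =>
      rw [← consMap_single (k := k), prism_consMap, map_sub, del_consMap, del_consMap, del_consMap,
        map_sub, map_sub, mapList_consMap, ih, prism_consMap, map_sub, map_sub]
      abel

/-- Chains of lists with a given property. -/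
def listChains (k M : Type*) [CommRing k] [AddCommGroup M] [Module k M] {E : Type*}
    (P : List E → Prop) : Submodule k (List E →₀ M) := Finsupp.supported M k {v | P v}

lemma listChains_induction {P : List E → Prop} {C : (List E →₀ M) → Prop} (zero : C 0)
    (add : ∀ x y, C x → C y → C (x + y)) (single : ∀ v m, P v → C (Finsupp.single v m))
    {x : List E →₀ M} (hx : x ∈ listChains k M P) : C x := by
  have h : ∀ v ∈ x.support, P v := fun v hv => (Finsupp.mem_supported k x).1 hx hv
  rw [← Finsupp.sum_single x]
  exact Finset.sum_induction _ C add zero fun v hv => single v _ (h v hv)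

lemma single_mem_listChains {P : List E → Prop} {v : List E} (hv : P v) (m : M) :
    Finsupp.single v m ∈ listChains k M P := Finsupp.single_mem_supported k m hv

lemma map_mem_listChains {E' : Type*} {P : List E → Prop} {Q : List E' → Prop}
    (f : (List E →₀ M) →ₗ[k] (List E' →₀ M))
    (h : ∀ v m, P v → f (Finsupp.single v m) ∈ listChains k M Q) {x : List E →₀ M}
    (hx : x ∈ listChains k M P) : f x ∈ listChains k M Q := by
  refine listChains_induction (C := fun x => f x ∈ listChains k M Q) ?_ ?_ h hx
  · rw [map_zero]; exact zero_mem _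
  · intro x y hx hy
    rw [map_add]
    exact add_mem hx hy

lemma consMap_mem {P Q : List E → Prop} {e : E} (h : ∀ v, P v → Q (e :: v)) {x : List E →₀ M}
    (hx : x ∈ listChains k M P) : consMap k M e x ∈ listChains k M Q :=
  map_mem_listChains _ (fun v m hv => by
    rw [consMap_single]; exact single_mem_listChains (h v hv) m) hx

lemma listChains_mono {P Q : List E → Prop} (h : ∀ v, P v → Q v) {x : List E →₀ M}
    (hx : x ∈ listChains k M P) : x ∈ listChains k M Q :=
  Finsupp.supported_mono (fun v hv => h v hv) hx

lemma prismList_mem (r : E → E) (R : E → E → Prop) (v : List E) (m : M)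
    (h1 : v.Pairwise fun a b => R a b ∧ R (r a) (r b) ∧ R (r a) b) (h2 : ∀ a ∈ v, R (r a) a) :
    prismList k M r v m ∈ listChains k M (fun w : List E => w.Pairwise R ∧
      w.length = v.length + 1 ∧ ∀ x ∈ w, ∃ a ∈ v, x = a ∨ x = r a) := by
  induction v with
  | nil => exact zero_mem _
  | cons e v ih =>
    rw [List.pairwise_cons] at h1
    have ih' := ih h1.2 fun a ha => h2 a (List.mem_cons_of_mem _ ha)
    refine sub_mem (single_mem_listChains ?_ m) (consMap_mem ?_ ih')
    · refine ⟨?_, rfl, fun x hx => ?_⟩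
      · rw [List.pairwise_cons, List.pairwise_cons]
        refine ⟨fun x hx => ?_, fun x hx => (h1.1 x hx).1, h1.2.imp fun h => h.1⟩
        rcases List.mem_cons.1 hx with rfl | hx
        · exact h2 _ (List.mem_cons_self ..)
        · exact (h1.1 x hx).2.2
      · rcases List.mem_cons.1 hx with rfl | hx
        · exact ⟨e, List.mem_cons_self .., Or.inr rfl⟩
        · exact ⟨x, hx, Or.inl rfl⟩
    · refine fun w hw => ⟨List.pairwise_cons.2 ⟨fun x hx => ?_, hw.1⟩, by simp [hw.2.1],
        fun x hx => ?_⟩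
      · obtain ⟨a, ha, rfl | rfl⟩ := hw.2.2 x hx
        · exact (h1.1 _ ha).2.2
        · exact (h1.1 _ ha).2.1
      · rcases List.mem_cons.1 hx with rfl | hx
        · exact ⟨e, List.mem_cons_self .., Or.inr rfl⟩
        · obtain ⟨a, ha, h⟩ := hw.2.2 x hx
          exact ⟨a, List.mem_cons_of_mem _ ha, h⟩

/-- One step of a contraction. -/
lemma exact_step {R : E → E → Prop} {r : E → E} {Bd : E → Prop}
    (hr : ∀ a b, Bd a → Bd b → R a b → R (r a) (r b) ∧ R (r a) b) (hr' : ∀ a, Bd a → R (r a) a)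
    {ℓ : ℕ} {x : List E →₀ M} (hx : x ∈ listChains k M (fun w : List E => w.Pairwise R ∧
      w.length = ℓ ∧ ∀ a ∈ w, Bd a)) (h0 : del k M x = 0) :
    mapList k M r x ∈ listChains k M (fun w : List E => w.Pairwise R ∧
      w.length = ℓ ∧ ∀ a ∈ w, ∃ b, Bd b ∧ a = r b) ∧ del k M (mapList k M r x) = 0 ∧
    ∃ y ∈ listChains k M (fun w : List E => w.Pairwise R ∧ w.length = ℓ + 1),
      del k M y = x - mapList k M r x := by
  refine ⟨map_mem_listChains _ (fun v m hv => ?_) hx, ?_, prism k M r x,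
    map_mem_listChains _ (fun v m hv => ?_) hx, ?_⟩
  · rw [mapList_single]
    refine single_mem_listChains ⟨?_, by simp [hv.2.1], fun a ha => ?_⟩ m
    · rw [List.pairwise_map]
      exact hv.1.imp_of_mem fun ha hb h => (hr _ _ (hv.2.2 _ ha) (hv.2.2 _ hb) h).1
    · obtain ⟨b, hb, rfl⟩ := List.mem_map.1 ha
      exact ⟨b, hv.2.2 b hb, rfl⟩
  · rw [← mapList_del, h0, map_zero]
  · rw [prism_single]
    refine listChains_mono ?_ (prismList_mem r R v m ?_ fun a ha => hr' a (hv.2.2 a ha))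
    · rintro w ⟨h1, h2, -⟩
      exact ⟨h1, by rw [h2, hv.2.1]⟩
    · exact hv.1.imp_of_mem fun ha hb h => ⟨h, hr _ _ (hv.2.2 _ ha) (hv.2.2 _ hb) h⟩
  · rw [del_prism, h0, map_zero, sub_zero]

/-- The relation between the vertices of a cell, in each of two directions. -/
def Near (p q : ℕ) (a b : ℤ × ℤ) : Prop :=
  (a.1 ≤ b.1 ∧ b.1 ≤ a.1 + (p + 1)) ∧ (a.2 ≤ b.2 ∧ b.2 ≤ a.2 + (q + 1))

lemma exact_near_bounded (p q : ℕ) (ℓ : ℕ) (L : ℤ) (N : ℕ) {x : List (ℤ × ℤ) →₀ M}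
    (hx : x ∈ listChains k M (fun w : List (ℤ × ℤ) => w.Pairwise (Near p q) ∧ w.length = ℓ ∧
      ∀ a ∈ w, (L ≤ a.1 ∧ a.1 ≤ L + N) ∧ (L ≤ a.2 ∧ a.2 ≤ L + N))) (h0 : del k M x = 0) :
    ∃ y ∈ listChains k M (fun w : List (ℤ × ℤ) => w.Pairwise (Near p q) ∧ w.length = ℓ + 1),
      del k M y = x := by
  induction N generalizing x with
  | zero =>
    refine ⟨consMap k M (L, L) x, consMap_mem (fun v hv => ?_) hx, ?_⟩
    · refine ⟨List.pairwise_cons.2 ⟨fun a ha => ?_, hv.1⟩, by simp [hv.2.1]⟩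
      have := hv.2.2 a ha
      simp only [Near]
      push_cast at this
      omega
    · rw [del_consMap, h0, map_zero, sub_zero]
  | succ N ih =>
    obtain ⟨h1, h2, y, hy, hy'⟩ := exact_step (R := Near p q)
      (r := fun a => (min a.1 (L + N), min a.2 (L + N)))
      (Bd := fun a => (L ≤ a.1 ∧ a.1 ≤ L + (N + 1 : ℕ)) ∧ (L ≤ a.2 ∧ a.2 ≤ L + (N + 1 : ℕ)))
      (fun a b ha hb h => by simp only [Near] at h ⊢; push_cast at ha hb; omega)
      (fun a ha => by simp only [Near]; push_cast at ha; omega) hx h0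
    obtain ⟨z, hz, hz'⟩ := ih (listChains_mono (fun w hw => ⟨hw.1, hw.2.1, fun a ha => by
      obtain ⟨b, hb, rfl⟩ := hw.2.2 a ha
      push_cast at hb ⊢
      omega⟩) h1) h2
    exact ⟨y + z, add_mem hy hz, by rw [map_add, hy', hz', sub_add_cancel]⟩

lemma exact_near (p q : ℕ) (ℓ : ℕ) {x : List (ℤ × ℤ) →₀ M}
    (hx : x ∈ listChains k M (fun w : List (ℤ × ℤ) => w.Pairwise (Near p q) ∧ w.length = ℓ))
    (h0 : del k M x = 0) :
    ∃ y ∈ listChains k M (fun w : List (ℤ × ℤ) => w.Pairwise (Near p q) ∧ w.length = ℓ + 1),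
      del k M y = x := by
  have key : ∃ N : ℕ, ∀ w ∈ x.support, ∀ a ∈ w, a.1.natAbs ≤ N ∧ a.2.natAbs ≤ N := by
    refine ⟨∑ w ∈ x.support, (w.map fun a => a.1.natAbs + a.2.natAbs).sum, fun w hw a ha => ?_⟩
    have h1 := Finset.single_le_sum (f := fun w : List (ℤ × ℤ) =>
      (w.map fun a => a.1.natAbs + a.2.natAbs).sum) (fun _ _ => Nat.zero_le _) hw
    have h2 : a.1.natAbs + a.2.natAbs ≤ (w.map fun a => a.1.natAbs + a.2.natAbs).sum :=
      List.single_le_sum (by simp) _ (List.mem_map.2 ⟨a, ha, rfl⟩)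
    omega
  obtain ⟨N, hN⟩ := key
  refine exact_near_bounded p q ℓ (-N) (2 * N) ((Finsupp.mem_supported k x).2 fun w hw => ?_) h0
  have := (Finsupp.mem_supported k x).1 hx hw
  refine ⟨this.1, this.2, fun a ha => ?_⟩
  have := hN w hw a ha
  push_cast
  omega

/-- The relation between the vertices of a cell, in one direction. -/
def Near₁ (p : ℕ) (a b : ℤ) : Prop := a ≤ b ∧ b ≤ a + (p + 1)

lemma exact_near₁ (p : ℕ) (ℓ : ℕ) {x : List ℤ →₀ M}
    (hx : x ∈ listChains k M (fun w : List ℤ => w.Pairwise (Near₁ p) ∧ w.length = ℓ))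
    (h0 : del k M x = 0) :
    ∃ y ∈ listChains k M (fun w : List ℤ => w.Pairwise (Near₁ p) ∧ w.length = ℓ + 1),
      del k M y = x := by
  obtain ⟨y, hy, hy'⟩ := exact_near (k := k) p 0 ℓ (x := mapList k M (fun a => (a, 0)) x)
    (map_mem_listChains _ (fun v m hv => by
      rw [mapList_single]
      refine single_mem_listChains ⟨?_, by simp [hv.2]⟩ m
      rw [List.pairwise_map]
      exact hv.1.imp fun h => by simp only [Near, Near₁] at h ⊢; omega) hx)
    (by rw [← mapList_del, h0, map_zero])
  refine ⟨mapList k M Prod.fst y, map_mem_listChains _ (fun v m hv => ?_) hy, ?_⟩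
  · rw [mapList_single]
    refine single_mem_listChains ⟨?_, by simp [hv.2]⟩ m
    rw [List.pairwise_map]
    exact hv.1.imp fun h => h.1
  · rw [← mapList_del, hy']
    unfold mapList
    rw [← comp_apply, ← lmapDomain_comp]
    have : List.map Prod.fst ∘ List.map (fun a : ℤ => (a, (0 : ℤ))) = id := by
      funext l; simp [Function.comp_def]
    rw [this, Finsupp.lmapDomain_id, id_apply]

end ListComplex

section Exactness

variable {k : Type uk} [CommRing k]

section Emb

variable {M : Type*} [AddCommGroup M] [Module k M] {E : Type*}

lemma del_single_eq_sum (v : List E) (m : M) : del k M (Finsupp.single v m) =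
    ∑ i ∈ Finset.range v.length, (-1 : k) ^ i • Finsupp.single (v.eraseIdx i) m := by
  induction v with
  | nil => rw [del_nil]; rfl
  | cons e v ih =>
    rw [← consMap_single (k := k), del_consMap, ih, List.length_cons, Finset.sum_range_succ',
      map_sum, sub_eq_add_neg, ← Finset.sum_neg_distrib, add_comm]
    congr 1
    · refine sum_congr rfl fun i _ => ?_
      rw [map_smul, consMap_single, List.eraseIdx_cons_succ, pow_succ, mul_neg_one, neg_smul]
    · rw [pow_zero, one_smul]; rfl

variable {P : ℕ → Type*} (k M) in
/-- The alternating sum of the faces, linearised. -/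
def faceSum (face : ∀ n, Fin (n + 2) → P (n + 1) → P n) (n : ℕ) :
    (P (n + 1) →₀ M) →ₗ[k] (P n →₀ M) :=
  ∑ i : Fin (n + 2), (-1 : k) ^ (i : ℕ) • lmapDomain M k (face n i)

variable {P : ℕ → Type*} {face : ∀ n, Fin (n + 2) → P (n + 1) → P n} {L : List E → Prop}
  {emb : ∀ n, P n → List E}

lemma lmapDomain_faceSum (hlen : ∀ n x, (emb n x).length = n + 1)
    (hface : ∀ n i x, emb n (face n i x) = (emb (n + 1) x).eraseIdx i) (n : ℕ)
    (x : P (n + 1) →₀ M) : lmapDomain M k (emb n) (faceSum k M face n x) =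
      del k M (lmapDomain M k (emb (n + 1)) x) := by
  induction x using induction_linear with
  | zero => simp
  | add x y hx hy => simp only [map_add, hx, hy]
  | single v m =>
    rw [lmapDomain_apply (R := k) (l := Finsupp.single v m), mapDomain_single,
      del_single_eq_sum, hlen, Finset.sum_range, faceSum]
    simp only [LinearMap.sum_apply, LinearMap.smul_apply, map_sum, map_smul,
      lmapDomain_apply, mapDomain_single, hface]

lemma exact_of_emb (hinj : ∀ n, Injective (emb n)) (hL : ∀ n x, L (emb n x))
    (hlen : ∀ n x, (emb n x).length = n + 1)
    (hrange : ∀ n l, L l → l.length = n + 1 → ∃ x, emb n x = l)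
    (hface : ∀ n i x, emb n (face n i x) = (emb (n + 1) x).eraseIdx i)
    (hex : ∀ (ℓ : ℕ) (x : List E →₀ M), x ∈ listChains k M (fun w => L w ∧ w.length = ℓ) →
      del k M x = 0 → ∃ y ∈ listChains k M (fun w => L w ∧ w.length = ℓ + 1), del k M y = x) :
    (∀ n (x : P (n + 1) →₀ M), faceSum k M face n x = 0 → ∃ y, faceSum k M face (n + 1) y = x) ∧
      ∀ x : P 0 →₀ M, Finsupp.lsum k (fun _ => (𝟙 : M →ₗ[k] M)) x = 0 →
        ∃ y, faceSum k M face 0 y = x := by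
  have mem : ∀ n (x : P n →₀ M), lmapDomain M k (emb n) x ∈
      listChains k M (fun w => L w ∧ w.length = n + 1) := by
    intro n x
    induction x using induction_linear with
    | zero => simp
    | add x y hx hy => rw [map_add]; exact add_mem hx hy
    | single v m =>
      rw [lmapDomain_apply, mapDomain_single]
      exact single_mem_listChains ⟨hL n v, hlen n v⟩ m
  have lift : ∀ n (x : P n →₀ M), del k M (lmapDomain M k (emb n) x) = 0 →
      ∃ y, faceSum k M face n y = x := by
    intro n x h0
    obtain ⟨y, hy, hy'⟩ := hex _ _ (mem n x) h0
    obtain ⟨z, rfl⟩ : ∃ z, lmapDomain M k (emb (n + 1)) z = y := by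
      refine listChains_induction (C := fun y => ∃ z, lmapDomain M k (emb (n + 1)) z = y)
        ⟨0, map_zero _⟩ ?_ ?_ hy
      · rintro _ _ ⟨z, rfl⟩ ⟨z', rfl⟩
        exact ⟨z + z', map_add _ _ _⟩
      · intro v m hv
        obtain ⟨x, rfl⟩ := hrange _ v hv.1 hv.2
        exact ⟨Finsupp.single x m, by rw [lmapDomain_apply, mapDomain_single]⟩
    refine ⟨z, Finsupp.mapDomain_injective (hinj n) ?_⟩
    rw [← lmapDomain_faceSum hlen hface] at hy'
    exact hy'
  refine ⟨fun n x hx => lift _ x ?_, fun x hx => lift 0 x ?_⟩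
  · rw [← lmapDomain_faceSum hlen hface, hx, map_zero]
  · have : ∀ x : P 0 →₀ M, del k M (lmapDomain M k (emb 0) x) =
        Finsupp.single [] (Finsupp.lsum k (fun _ => (𝟙 : M →ₗ[k] M)) x) := by
      intro x
      induction x using induction_linear with
      | zero => simp
      | add x y hx hy => simp only [map_add, hx, hy, Finsupp.single_add]
      | single v m =>
        obtain ⟨e, he⟩ := List.length_eq_one_iff.1 (hlen 0 v)
        rw [lmapDomain_apply, mapDomain_single, he, del_single_eq_sum]
        simp
    rw [this, hx, Finsupp.single_zero]

end Emb

lemma ofFn_comp_succAbove {E : Type*} : ∀ {n : ℕ} (v : Fin (n + 1) → E) (i : Fin (n + 1)),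
    List.ofFn (v ∘ i.succAbove) = (List.ofFn v).eraseIdx i
  | n, v, i => by
    induction i using Fin.cases with
    | zero => rw [List.ofFn_succ (f := v)]; simp [Function.comp_def]
    | succ i =>
      match n with
      | 0 => exact i.elim0
      | n + 1 =>
        have := ofFn_comp_succAbove (Fin.tail v) i
        rw [List.ofFn_succ (f := v), List.ofFn_succ]
        simp only [Fin.val_succ, List.eraseIdx_cons_succ]
        congr 1
        rw [show (fun i : Fin (n + 1) => v i.succ) = Fin.tail v from rfl, ← this]
        congr 1
        funext j
        simp [Fin.tail]

lemma ofFn_get_cast {E : Type*} (l : List E) : ∀ {n : ℕ} (h : l.length = n),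
    List.ofFn (fun j : Fin n => l.get (j.cast h.symm)) = l := by
  rintro _ rfl
  simp

lemma valid_iff_pairwise {p n : ℕ} (v : Fin (n + 1) → ℤ) :
    Valid p v ↔ (List.ofFn v).Pairwise (Near₁ p) := by
  rw [List.pairwise_ofFn]
  constructor
  · intro h i j hij
    refine ⟨h.mono hij.le, ?_⟩
    have := h.wrap
    have := h.mono (Fin.zero_le i)
    have := h.mono (Fin.le_last j)
    omega
  · intro h
    refine ⟨fun i j hij => ?_, ?_⟩
    · rcases hij.lt_or_eq with hij | rfl
      · exact (h hij).1
      · exact le_rfl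
    · rcases (Fin.zero_le (Fin.last n)).lt_or_eq with h' | h'
      · exact (h h').2
      · rw [← h']; omega

/-- The vertices of a valid sequence. -/
def Seq.toList {p n : ℕ} (v : Seq.{w} p n) : List ℤ := List.ofFn v.val

/-- The vertices of a pair of valid sequences. -/
def Seq.pairList {p q n : ℕ} (v : Seq.{w} p n × Seq.{w} q n) : List (ℤ × ℤ) :=
  List.ofFn fun j => (v.1.val j, v.2.val j)

lemma Seq.exact (p : ℕ) (M : Type*) [AddCommGroup M] [Module k M] :
    (∀ n (x : Seq.{w} p (n + 1) →₀ M), faceSum k M (fun n i => Seq.face (d := n) i) n x = 0 →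
      ∃ y, faceSum k M (fun n i => Seq.face (d := n) i) (n + 1) y = x) ∧
      ∀ x : Seq.{w} p 0 →₀ M, Finsupp.lsum k (fun _ => (𝟙 : M →ₗ[k] M)) x = 0 →
        ∃ y, faceSum k M (fun n i => Seq.face (d := n) i) 0 y = x := by
  refine exact_of_emb (E := ℤ) (L := fun l => l.Pairwise (Near₁ p)) (emb := fun n => Seq.toList)
    (fun n v w h => Seq.ext (List.ofFn_injective h)) (fun n v => (valid_iff_pairwise _).1 v.valid)
    (fun n v => List.length_ofFn) (fun n l hl hlen => ?_)
    (fun n i v => ofFn_comp_succAbove v.val i) (fun ℓ x hx h0 => exact_near₁ p ℓ hx h0)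
  have h : List.ofFn (fun j : Fin (n + 1) => l.get (j.cast hlen.symm)) = l := ofFn_get_cast l hlen
  exact ⟨⟨_, (valid_iff_pairwise _).2 (h.symm ▸ hl)⟩, h⟩

lemma Seq.pair_exact (p q n : ℕ) (x : Seq.{w} p (n + 1) × Seq.{w} q (n + 1) →₀ k)
    (h0 : faceSum k k (P := fun n => Seq.{w} p n × Seq.{w} q n)
      (fun n i => Prod.map (Seq.face (d := n) i) (Seq.face (d := n) i)) n x = 0) :
    ∃ y, faceSum k k (P := fun n => Seq.{w} p n × Seq.{w} q n)
      (fun n i => Prod.map (Seq.face (d := n) i) (Seq.face (d := n) i)) (n + 1) y = x := by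
  have hpq : ∀ {n : ℕ} (v : Fin (n + 1) → ℤ × ℤ), (List.ofFn v).Pairwise (Near p q) ↔
      Valid p (fun j => (v j).1) ∧ Valid q (fun j => (v j).2) := by
    intro n v
    rw [valid_iff_pairwise, valid_iff_pairwise, List.pairwise_ofFn, List.pairwise_ofFn,
      List.pairwise_ofFn]
    exact ⟨fun h => ⟨fun i j hij => (h hij).1, fun i j hij => (h hij).2⟩,
      fun h i j hij => ⟨h.1 hij, h.2 hij⟩⟩
  refine (exact_of_emb (E := ℤ × ℤ) (L := fun l => l.Pairwise (Near p q))
    (P := fun n => Seq.{w} p n × Seq.{w} q n)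
    (face := fun n i => Prod.map (Seq.face (d := n) i) (Seq.face (d := n) i))
    (emb := fun n => Seq.pairList) (fun n v w h => ?_) (fun n v => (hpq _).2 ⟨v.1.valid, v.2.valid⟩)
    (fun n v => List.length_ofFn) (fun n l hl hlen => ?_)
    (fun n i v => ofFn_comp_succAbove (fun j => (v.1.val j, v.2.val j)) i)
    (fun ℓ x hx h0 => exact_near p q ℓ hx h0)).1 n x h0
  · have := List.ofFn_injective h
    exact Prod.ext (Seq.ext (funext fun j => congrArg Prod.fst (congrFun this j)))
      (Seq.ext (funext fun j => congrArg Prod.snd (congrFun this j)))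
  · have h : List.ofFn (fun j : Fin (n + 1) => l.get (j.cast hlen.symm)) = l := ofFn_get_cast l hlen
    have h' := (hpq _).1 (h.symm ▸ hl)
    exact ⟨(⟨_, h'.1⟩, ⟨_, h'.2⟩), h⟩

section Free

variable (p q : ℕ)

lemma free_diag_exact (n : ℕ) (x : FreeBi.{w} k p q (n + 1) (n + 1))
    (h0 : (diagOps (freeH.{w} k p q) (freeA.{w} k p q)).b n x = 0) :
    ∃ y, (diagOps (freeH.{w} k p q) (freeA.{w} k p q)).b (n + 1) y = x := by
  have : ∀ n, (diagOps (freeH.{w} k p q) (freeA.{w} k p q)).b n =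
      faceSum k k (P := fun n => Seq.{w} p n × Seq.{w} q n)
      (fun n i => Prod.map (Seq.face (d := n) i) (Seq.face (d := n) i)) n := by
    intro n
    refine sum_congr rfl fun i _ => ?_
    congr 1
    simp only [diagOps, freeH, freeA, ← lmapDomain_comp]
    rfl
  rw [this] at h0 ⊢
  exact Seq.pair_exact p q n x h0

lemma curry_lmapDomain {α α' β : Type*} (f : α → α') (x : α × β →₀ k) :
    curryLinearEquiv k (lmapDomain k k (Prod.map f id) x) =
      lmapDomain (β →₀ k) k f (curryLinearEquiv k x) := by
  induction x using induction_linear with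
  | zero => simp only [map_zero]
  | add x y hx hy => simp only [map_add, hx, hy]
  | single s c =>
    obtain ⟨a, b⟩ := s
    simp [mapDomain_single, curryLinearEquiv, Finsupp.curry_single]

lemma curry_freeH_b (m n : ℕ) (x : FreeBi.{w} k p q (m + 1) n) :
    curryLinearEquiv k ((freeH.{w} k p q n).b m x) =
      faceSum k (Seq.{w} q n →₀ k) (fun n i => Seq.face (d := n) i) m
        (curryLinearEquiv k x) := by
  simp only [CycOps.b, faceSum, LinearMap.sum_apply, map_sum, LinearMap.smul_apply, map_smul]
  exact sum_congr rfl fun i _ => congrArg _ (curry_lmapDomain _ x)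

lemma free_h_exact (m n : ℕ) (x : FreeBi.{w} k p q (m + 1) n)
    (h0 : (freeH.{w} k p q n).b m x = 0) : ∃ y, (freeH.{w} k p q n).b (m + 1) y = x := by
  obtain ⟨y, hy⟩ := (Seq.exact (k := k) p (Seq.{w} q n →₀ k)).1 m
    (curryLinearEquiv k x) (by rw [← curry_freeH_b, h0, map_zero])
  refine ⟨(curryLinearEquiv k).symm y, (curryLinearEquiv k).injective ?_⟩
  rw [curry_freeH_b, LinearEquiv.apply_symm_apply, hy]

/-- The augmentation of the first direction. -/
def freeAug (n : ℕ) : FreeBi.{w} k p q 0 n →ₗ[k] (Seq.{w} q n →₀ k) := lmapDomain k k Prod.snd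

lemma free_h_exact_zero (n : ℕ) (x : FreeBi.{w} k p q 0 n)
    (h0 : freeAug p q n x = 0) : ∃ y, (freeH.{w} k p q n).b 0 y = x := by
  have h : ∀ x : FreeBi.{w} k p q 0 n, Finsupp.lsum k (fun _ => (𝟙 :
      (Seq.{w} q n →₀ k) →ₗ[k] _)) (curryLinearEquiv k x) = freeAug p q n x := by
    intro x
    induction x using induction_linear with
    | zero => simp only [map_zero]
    | add x y hx hy => simp only [map_add, hx, hy]
    | single s c =>
      obtain ⟨a, b⟩ := s
      simp [freeAug, mapDomain_single, curryLinearEquiv, Finsupp.curry_single]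
  obtain ⟨y, hy⟩ := (Seq.exact (k := k) p (Seq.{w} q n →₀ k)).2
    (curryLinearEquiv k x) (by rw [h, h0])
  refine ⟨(curryLinearEquiv k).symm y, (curryLinearEquiv k).injective ?_⟩
  rw [curry_freeH_b, LinearEquiv.apply_symm_apply, hy]

lemma freeAug_surjective (n : ℕ) : Surjective (freeAug (k := k) p q n) :=
  Finsupp.mapDomain_surjective fun w =>
    ⟨(⟨fun _ => 0, ⟨fun _ _ _ => le_rfl, by simp; omega⟩⟩, w), rfl⟩

lemma freeAug_h_b (n : ℕ) (x : FreeBi.{w} k p q 1 n) :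
    freeAug p q n ((freeH.{w} k p q n).b 0 x) = 0 := by
  have h : ∀ i, freeAug (k := k) p q n ∘ₗ (freeH.{w} k p q n).d 0 i =
      lmapDomain k k Prod.snd := fun i => by
    rw [freeAug, freeH, ← lmapDomain_comp]; rfl
  have h' : ∀ i, freeAug (k := k) p q n ((freeH.{w} k p q n).d 0 i x) =
      lmapDomain k k Prod.snd x := fun i => app_eq (h i) x
  simp [CycOps.b, h', Fin.sum_univ_two]

lemma freeAug_a_b (n : ℕ) (x : FreeBi.{w} k p q 0 (n + 1)) :
    freeAug p q n ((freeA.{w} k p q 0).b n x) =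
      faceSum k k (fun n i => Seq.face (d := n) i) n (freeAug p q (n + 1) x) := by
  simp only [CycOps.b, faceSum, LinearMap.sum_apply, map_sum, LinearMap.smul_apply, map_smul]
  refine sum_congr rfl fun i _ => congrArg _ ?_
  rw [freeAug, freeAug, ← comp_apply, ← comp_apply, freeA, ← lmapDomain_comp, ← lmapDomain_comp]
  rfl

lemma free_tot_exact (N : ℕ) (x : ∀ i : ℕ × ℕ, FreeBi.{w} k p q i.1 i.2)
    (hx : ∀ m n, m + n = N → (freeH.{w} k p q n).b m (x (m + 1, n)) +
      (-1 : k) ^ m • (freeA.{w} k p q m).b n (x (m, n + 1)) = 0) :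
    ∃ y : ∀ i : ℕ × ℕ, FreeBi.{w} k p q i.1 i.2, ∀ m n, m + n = N + 1 →
      (freeH.{w} k p q n).b m (y (m + 1, n)) +
        (-1 : k) ^ m • (freeA.{w} k p q m).b n (y (m, n + 1)) = x (m, n) := by
  have hF := free_isBiPara.{w} k p q
  suffices H : ∀ M, M ≤ N + 2 → ∃ y : ∀ i : ℕ × ℕ, FreeBi.{w} k p q i.1 i.2,
      (∀ m n, m + n = N + 1 → m < M → (freeH.{w} k p q n).b m (y (m + 1, n)) +
        (-1 : k) ^ m • (freeA.{w} k p q m).b n (y (m, n + 1)) = x (m, n)) ∧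
      freeAug p q (N + 1) ((freeA.{w} k p q 0).b (N + 1) (y (0, N + 2))) =
        freeAug p q (N + 1) (x (0, N + 1)) by
    obtain ⟨y, hy, -⟩ := H (N + 2) le_rfl
    exact ⟨y, fun m n h => hy m n h (by omega)⟩
  intro M
  induction M with
  | zero =>
    intro _
    obtain ⟨μ, hμ⟩ := (Seq.exact (k := k) q k).1 N (freeAug p q (N + 1) (x (0, N + 1))) (by
      rw [← freeAug_a_b]
      have h1 := congrArg (freeAug p q N) (hx 0 N (zero_add N))
      rwa [map_add, freeAug_h_b, zero_add, pow_zero, one_smul, map_zero] at h1)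
    obtain ⟨y, rfl⟩ := freeAug_surjective p q (N + 2) μ
    classical
    refine ⟨Function.update 0 (0, N + 2) y, fun m n _ h => absurd h (by omega), ?_⟩
    rw [Function.update_self, freeAug_a_b, hμ]
  | succ M ih =>
    intro hM
    obtain ⟨y, hy, hy0⟩ := ih (by omega)
    obtain ⟨n, hn⟩ : ∃ n, M + n = N + 1 := ⟨N + 1 - M, by omega⟩
    obtain ⟨z, hz⟩ : ∃ z, (freeH.{w} k p q n).b M z =
        x (M, n) - (-1 : k) ^ M • (freeA.{w} k p q M).b n (y (M, n + 1)) := by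
      cases M with
      | zero =>
        obtain rfl : n = N + 1 := by omega
        refine free_h_exact_zero p q (N + 1) _ ?_
        rw [map_sub, pow_zero, one_smul, sub_eq_zero]
        exact hy0.symm
      | succ M =>
        refine free_h_exact p q M n _ ?_
        have h1 := hx M n (by omega)
        have h2 := congrArg ((freeA.{w} k p q M).b n) (hy M (n + 1) (by omega) (by omega))
        rw [map_add, map_smul, (hF.a M).b_b, smul_zero, add_zero] at h2
        rw [map_sub, map_smul, (hF.hom_b M).b, h2, eq_neg_of_add_eq_zero_left h1, pow_succ]
        simp
    classical
    refine ⟨Function.update y (M + 1, n) z, fun m n' h hm => ?_, ?_⟩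
    · have hne : ∀ l, ((m, l) : ℕ × ℕ) ≠ (M + 1, n) := fun l h => by
        have := congrArg Prod.fst h; simp only at this; omega
      rw [Function.update_of_ne (hne _)]
      rcases (Nat.lt_succ_iff_lt_or_eq.1 hm) with hm | rfl
      · have hne' : ((m + 1, n') : ℕ × ℕ) ≠ (M + 1, n) := fun h => by
          have := congrArg Prod.fst h; simp only at this; omega
        rw [Function.update_of_ne hne']
        exact hy m n' h hm
      · obtain rfl : n' = n := by omega
        rw [Function.update_self, hz, sub_add_cancel]
    · rw [Function.update_of_ne (by simp)]
      exact hy0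

end Free

end Exactness

section AcyclicModels

/-- Bi-paracyclic modules. -/
structure BiMod (k : Type uk) [CommRing k] where
  X : ℕ → ℕ → Type (max w uk)
  [grp : ∀ m n, AddCommGroup (X m n)]
  [mod : ∀ m n, Module k (X m n)]
  oh : ∀ n, CycOps k (fun m => X m n)
  oa : ∀ m, CycOps k (fun n => X m n)
  para : IsBiPara oh oa

attribute [instance] BiMod.grp BiMod.mod

variable {k : Type uk} [CommRing k]

/-- Maps of bi-paracyclic modules. -/
structure BiMod.Hom (M M' : BiMod.{w} k) where
  f : ∀ m n, M.X m n →ₗ[k] M'.X m n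
  h : ∀ n, CycHom (M.oh n) (M'.oh n) (fun m => f m n)
  a : ∀ m, CycHom (M.oa m) (M'.oa m) (fun n => f m n)

/-- A way of forming a product of the terms of a bi-paracyclic module. -/
structure Shape where
  S : Type
  o : S → ℕ × ℕ
  deg : S → ℕ
  below : ℕ → Finset S
  mem_below : ∀ s N, s ∈ below N ↔ deg s ≤ N

/-- The product of the terms. -/
abbrev BiMod.V (M : BiMod.{w} k) (σ : Shape) : Type (max w uk) := ∀ s : σ.S, M.X (σ.o s).1 (σ.o s).2

/-- The map of products induced by a map of bi-paracyclic modules. -/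
def BiMod.Hom.on {M M' : BiMod.{w} k} (f : M.Hom M') (σ : Shape) : M.V σ →ₗ[k] M'.V σ :=
  LinearMap.pi fun s => f.f _ _ ∘ₗ proj s

@[simp] lemma BiMod.Hom.on_apply {M M' : BiMod.{w} k} (f : M.Hom M') (σ : Shape) (x : M.V σ)
    (s : σ.S) : f.on σ x s = f.f _ _ (x s) := rfl

/-- Natural families of linear maps. -/
structure NatOp (k : Type uk) [CommRing k] (σ σ' : Shape) where
  app : ∀ M : BiMod.{w} k, M.V σ →ₗ[k] M.V σ'
  nat : ∀ {M M' : BiMod.{w} k} (f : M.Hom M') (x : M.V σ), app M' (f.on σ x) = f.on σ' (app M x)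

/-- The family raises degrees by `c`, `c + 2`, … -/
def NatOp.Deg {σ σ' : Shape} (c : ℤ) (z : NatOp.{w} k σ σ') : Prop :=
  ∀ (M : BiMod.{w} k) (x : M.V σ) (s' : σ'.S),
    (∀ s, (σ.deg s : ℤ) + c ≤ σ'.deg s' → Even ((σ'.deg s' : ℤ) - σ.deg s - c) → x s = 0) →
      z.app M x s' = 0

lemma NatOp.Deg.congr {σ σ' : Shape} {c : ℤ} {z : NatOp.{w} k σ σ'} (hz : z.Deg c)
    {M : BiMod.{w} k} {x y : M.V σ} {s' : σ'.S}
    (h : ∀ s, (σ.deg s : ℤ) + c ≤ σ'.deg s' → Even ((σ'.deg s' : ℤ) - σ.deg s - c) → x s = y s) :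
    z.app M x s' = z.app M y s' := by
  rw [← sub_eq_zero, ← Pi.sub_apply, ← map_sub]
  exact hz M _ s' fun s h1 h2 => sub_eq_zero.2 (h s h1 h2)

lemma NatOp.Deg.comp {σ σ' σ'' : Shape} {c c' : ℤ} {z : NatOp.{w} k σ σ'}
    {z' : NatOp.{w} k σ' σ''} (hz : z.Deg c) (hz' : z'.Deg c') {M : BiMod.{w} k} {x : M.V σ}
    {s' : σ''.S} (h : ∀ s, (σ.deg s : ℤ) + (c + c') ≤ σ''.deg s' →
      Even ((σ''.deg s' : ℤ) - σ.deg s - (c + c')) → x s = 0) : z'.app M (z.app M x) s' = 0 := by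
  refine hz' M _ s' fun t h1 h2 => hz M _ t fun s h3 h4 => h s (by omega) ?_
  have := h2.add h4
  rwa [show (σ''.deg s' : ℤ) - σ'.deg t - c' + ((σ'.deg t : ℤ) - σ.deg s - c) =
    (σ''.deg s' : ℤ) - σ.deg s - (c + c') by ring] at this

/-- The free bi-paracyclic module on a generator. -/
@[reducible] def BiMod.free (k : Type uk) [CommRing k] (p q : ℕ) : BiMod.{w} k where
  X := FreeBi.{w} k p q
  oh := freeH.{w} k p q
  oa := freeA.{w} k p q
  para := free_isBiPara.{w} k p q

/-- The map from the free bi-paracyclic module that sends the generator to `x`. -/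
def BiMod.ev (M : BiMod.{w} k) {p q : ℕ} (x : M.X p q) : (BiMod.free.{w} k p q).Hom M where
  f m n := M.para.ev x m n
  h := M.para.ev_h x
  a := M.para.ev_a x

/-- `ev` is linear in `x`. -/
def BiMod.evL (M : BiMod.{w} k) {p q m n : ℕ} (y : (BiMod.free.{w} k p q).X m n) :
    M.X p q →ₗ[k] M.X m n where
  toFun x := (M.ev x).f m n y
  map_add' x x' := by
    show M.para.ev (x + x') m n y = M.para.ev x m n y + M.para.ev x' m n y
    induction y using induction_linear with
    | zero => simp
    | add y z hy hz => simp only [map_add, hy, hz]; abel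
    | single s c => simp only [IsBiPara.ev_single, map_add, smul_add]
  map_smul' c x := by
    show M.para.ev (c • x) m n y = c • M.para.ev x m n y
    induction y using induction_linear with
    | zero => simp
    | add y z hy hz => simp only [map_add, hy, hz, smul_add]
    | single s c' => simp only [IsBiPara.ev_single, map_smul, smul_comm c]

lemma BiMod.Hom.evL {M M' : BiMod.{w} k} (f : M.Hom M') {p q m n : ℕ}
    (y : (BiMod.free.{w} k p q).X m n) (x : M.X p q) :
    f.f m n (M.evL y x) = M'.evL y (f.f p q x) := by
  show f.f m n (M.para.ev x m n y) = M'.para.ev (f.f p q x) m n y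
  induction y using induction_linear with
  | zero => simp
  | add y z hy hz => simp only [map_add, hy, hz]
  | single s c =>
    simp only [IsBiPara.ev_single, map_smul]
    rw [(f.a m).op (M.para.a m) (M'.para.a m) s.2.valid,
      (f.h q).op (M.para.h q) (M'.para.h q) s.1.valid]

/-- The generator. -/
def BiMod.gen (k : Type uk) [CommRing k] (p q : ℕ) : (BiMod.free.{w} k p q).X p q :=
  FreeBi.gen.{w} k p q

lemma BiMod.ev_gen (M : BiMod.{w} k) {p q : ℕ} (x : M.X p q) :
    (M.ev x).f p q (BiMod.gen.{w} k p q) = x := M.para.ev_gen x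

open Classical in
/-- The generator in position `s`. -/
def genAt (k : Type uk) [CommRing k] (σ : Shape) (s : σ.S) :
    (BiMod.free.{w} k (σ.o s).1 (σ.o s).2).V σ :=
  Pi.single s (BiMod.gen.{w} k _ _)

open Classical in
lemma on_ev_genAt {M : BiMod.{w} k} {σ : Shape} (s : σ.S) (x : M.X (σ.o s).1 (σ.o s).2) :
    (M.ev x).on σ (genAt k σ s) = Pi.single s x := by
  funext t
  rw [BiMod.Hom.on_apply, genAt]
  by_cases h : t = s
  · subst h
    rw [Pi.single_eq_same, Pi.single_eq_same]
    exact M.ev_gen x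
  · rw [Pi.single_eq_of_ne h, Pi.single_eq_of_ne h, map_zero]

/-- A natural family is determined by its values on generators. -/
lemma NatOp.Deg.eq_sum {σ σ' : Shape} {c : ℤ} {z : NatOp.{w} k σ σ'} (hz : z.Deg c)
    {M : BiMod.{w} k} (x : M.V σ) (s' : σ'.S) {N : ℕ} (hN : (σ'.deg s' : ℤ) - c ≤ N) :
    z.app M x s' =
      ∑ s ∈ σ.below N, M.evL (z.app (BiMod.free.{w} k _ _) (genAt k σ s) s') (x s) := by
  classical
  have h : z.app M x s' = z.app M (∑ s ∈ σ.below N, Pi.single s (x s)) s' := by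
    refine hz.congr fun s h1 h2 => ?_
    rw [Finset.sum_apply, Finset.sum_eq_single s]
    · rw [Pi.single_eq_same]
    · intro t _ ht
      rw [Pi.single_eq_of_ne (Ne.symm ht)]
    · intro hs
      exact absurd ((σ.mem_below s N).2 (by omega)) hs
  rw [h, map_sum, Finset.sum_apply]
  refine sum_congr rfl fun s _ => ?_
  rw [← on_ev_genAt, z.nat]
  rfl

/-- The natural family with given values on generators. -/
def NatOp.ofGen (σ σ' : Shape) (N : ℕ)
    (v : ∀ s : σ.S, (BiMod.free.{w} k (σ.o s).1 (σ.o s).2).V σ') : NatOp.{w} k σ σ' where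
  app M := LinearMap.pi fun s' => ∑ s ∈ σ.below N, M.evL (v s s') ∘ₗ proj s
  nat {M M'} f x := by
    funext s'
    simp only [pi_apply, LinearMap.sum_apply, comp_apply, proj_apply,
      BiMod.Hom.on_apply, map_sum, f.evL]

lemma NatOp.ofGen_apply {σ σ' : Shape} {N : ℕ}
    {v : ∀ s : σ.S, (BiMod.free.{w} k (σ.o s).1 (σ.o s).2).V σ'} (M : BiMod.{w} k) (x : M.V σ) :
    (NatOp.ofGen σ σ' N v).app M x = ∑ s ∈ σ.below N, (M.ev (x s)).on σ' (v s) := by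
  funext s'
  simp only [NatOp.ofGen, pi_apply, LinearMap.sum_apply, Finset.sum_apply]
  rfl

/-- The sum of natural families. -/
def NatOp.add {σ σ' : Shape} (y y' : NatOp.{w} k σ σ') : NatOp.{w} k σ σ' where
  app M := y.app M + y'.app M
  nat f x := by rw [LinearMap.add_apply, LinearMap.add_apply, y.nat, y'.nat, map_add]

/-- The composition of natural families. -/
def NatOp.comp {σ σ' σ'' : Shape} (y' : NatOp.{w} k σ' σ'') (y : NatOp.{w} k σ σ') :
    NatOp.{w} k σ σ'' where
  app M := y'.app M ∘ₗ y.app M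
  nat f x := by rw [comp_apply, comp_apply, y.nat, y'.nat]

/-- Linear combinations of natural families. -/
def NatOp.smul {σ σ' : Shape} (c : k) (y : NatOp.{w} k σ σ') : NatOp.{w} k σ σ' where
  app M := c • y.app M
  nat f x := by rw [LinearMap.smul_apply, LinearMap.smul_apply, y.nat, map_smul]

/-- The product of the two central automorphisms. -/
def BiMod.T (M : BiMod.{w} k) : M.Hom M where
  f m n := ((M.oa m).t n ^ (n + 1)) ∘ₗ ((M.oh n).t m ^ (m + 1))
  h n := ((M.para.a_t n).pow (n + 1)).comp (M.para.h n).hom_T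
  a m := (M.para.a m).hom_T.comp ((M.para.t m).pow (m + 1))

lemma NatOp.Deg.ofGen {σ σ' : Shape} {c : ℤ} {N : ℕ}
    {v : ∀ s : σ.S, (BiMod.free.{w} k (σ.o s).1 (σ.o s).2).V σ'}
    (hv : ∀ s s', v s s' ≠ 0 → (σ.deg s : ℤ) + c ≤ σ'.deg s' ∧
      Even ((σ'.deg s' : ℤ) - σ.deg s - c)) : (NatOp.ofGen σ σ' N v).Deg c := by
  intro M x s' h
  rw [NatOp.ofGen_apply, Finset.sum_apply]
  refine Finset.sum_eq_zero fun s _ => ?_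
  by_cases h0 : v s s' = 0
  · rw [BiMod.Hom.on_apply, h0, map_zero]
  · obtain ⟨h1, h2⟩ := hv s s' h0
    show M.evL _ _ = 0
    rw [h s h1 h2, map_zero]

section Lift

variable {σ σ' : Shape} {D : NatOp.{w} k σ σ} {D' : NatOp.{w} k σ' σ'}

/-- The defect of `y` as a solution of `D' y + η y D = z`. -/
def NatOp.err (D : NatOp.{w} k σ σ) (D' : NatOp.{w} k σ' σ') (η : k) (z y : NatOp.{w} k σ σ') :
    NatOp.{w} k σ σ' :=
  z.add ((D'.comp y).add ((y.comp D).smul η) |>.smul (-1))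

lemma NatOp.err_apply (η : k) (z y : NatOp.{w} k σ σ') (M : BiMod.{w} k) (x : M.V σ) :
    (NatOp.err D D' η z y).app M x =
      z.app M x - (D'.app M (y.app M x) + η • y.app M (D.app M x)) := by
  simp only [NatOp.err, NatOp.add, NatOp.comp, NatOp.smul, LinearMap.add_apply,
    comp_apply, LinearMap.smul_apply, neg_smul, one_smul, sub_eq_add_neg]

lemma NatOp.Deg.err {η : k} {z y : NatOp.{w} k σ σ'} {c : ℤ} (hD : D.Deg (-1))
    (hD' : D'.Deg (-1)) (hz : z.Deg c) (hy : y.Deg (c + 1)) : (NatOp.err D D' η z y).Deg c := by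
  intro M x s' h
  rw [NatOp.err_apply, Pi.sub_apply, Pi.add_apply, Pi.smul_apply, hz M x s' h,
    hy.comp hD' (by rwa [add_neg_cancel_right]),
    hD.comp hy (by rwa [show -1 + (c + 1) = c by ring])]
  simp

lemma NatOp.err_comm {η : k} (hη : η * η = 1)
    (hDD : ∀ (M : BiMod.{w} k) (x : M.V σ), D.app M (D.app M x) = x - M.T.on σ x)
    (hDD' : ∀ (M : BiMod.{w} k) (x : M.V σ'), D'.app M (D'.app M x) = x - M.T.on σ' x)
    {z : NatOp.{w} k σ σ'}
    (hz : ∀ (M : BiMod.{w} k) (x : M.V σ), D'.app M (z.app M x) = η • z.app M (D.app M x))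
    (y : NatOp.{w} k σ σ') (M : BiMod.{w} k) (x : M.V σ) :
    D'.app M ((NatOp.err D D' η z y).app M x) = η • (NatOp.err D D' η z y).app M (D.app M x) := by
  simp only [NatOp.err_apply, map_sub, map_add, map_smul, hDD, hDD', hz, y.nat, smul_sub, smul_add,
    smul_smul, hη, one_smul]
  abel

variable {η : k} {z : NatOp.{w} k σ σ'} {c : ℤ}

/-- `y` solves the equation in degrees `< m`, and vanishes in degree `0` and in degrees `> m`. -/
structure NatOp.Partial (D : NatOp.{w} k σ σ) (D' : NatOp.{w} k σ' σ') (η : k)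
    (z : NatOp.{w} k σ σ') (c : ℤ) (m : ℕ) (y : NatOp.{w} k σ σ') : Prop where
  deg : y.Deg (c + 1)
  zero : ∀ (M : BiMod.{w} k) (x : M.V σ) s', σ'.deg s' = 0 → y.app M x s' = 0
  gt : ∀ (M : BiMod.{w} k) (x : M.V σ) s', m < σ'.deg s' → y.app M x s' = 0
  err : ∀ (M : BiMod.{w} k) (x : M.V σ) s', σ'.deg s' < m → (NatOp.err D D' η z y).app M x s' = 0

lemma NatOp.Partial.step (hD : D.Deg (-1)) (hD' : D'.Deg (-1))
    (hDD : ∀ (M : BiMod.{w} k) (x : M.V σ), D.app M (D.app M x) = x - M.T.on σ x)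
    (hDD' : ∀ (M : BiMod.{w} k) (x : M.V σ'), D'.app M (D'.app M x) = x - M.T.on σ' x)
    (hη : η * η = 1) (hc : -1 ≤ c) (hz : z.Deg c)
    (hzD : ∀ (M : BiMod.{w} k) (x : M.V σ), D'.app M (z.app M x) = η • z.app M (D.app M x))
    (hex : ∀ (p q m : ℕ) (x : (BiMod.free.{w} k p q).V σ'),
      (∀ s', σ'.deg s' ≠ m + 1 → x s' = 0) → (∀ s', σ'.deg s' = m → D'.app _ x s' = 0) →
      ∃ y, (∀ s', σ'.deg s' ≠ m + 2 → y s' = 0) ∧ ∀ s', σ'.deg s' = m + 1 → D'.app _ y s' = x s')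
    (h0 : ∀ (M : BiMod.{w} k) (x : M.V σ), ∃ y, (∀ s', σ'.deg s' ≠ 1 → y s' = 0) ∧
      ∀ s', σ'.deg s' = 0 → D'.app M y s' = z.app M x s')
    {m : ℕ} {y : NatOp.{w} k σ σ'} (hy : NatOp.Partial D D' η z c m y) :
    ∃ y', NatOp.Partial D D' η z c (m + 1) y' ∧
      ∀ (M : BiMod.{w} k) (x : M.V σ) s', σ'.deg s' ≤ m → y'.app M x s' = y.app M x s' := by
  classical
  have hE := NatOp.Deg.err (η := η) hD hD' hz hy.deg
  set E := NatOp.err D D' η z y with hEdef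
  have key : ∀ s : σ.S, ∃ v : (BiMod.free.{w} k (σ.o s).1 (σ.o s).2).V σ',
      (∀ s', σ'.deg s' ≠ m + 1 → v s' = 0) ∧
      (∀ s', σ'.deg s' = m → D'.app _ v s' = E.app _ (genAt k σ s) s') ∧
      (v ≠ 0 → (σ.deg s : ℤ) + c ≤ m ∧ Even ((m : ℤ) - σ.deg s - c)) := by
    intro s
    by_cases hs : (σ.deg s : ℤ) + c ≤ m ∧ Even ((m : ℤ) - σ.deg s - c)
    · suffices H : ∃ v : (BiMod.free.{w} k (σ.o s).1 (σ.o s).2).V σ',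
          (∀ s', σ'.deg s' ≠ m + 1 → v s' = 0) ∧
          (∀ s', σ'.deg s' = m → D'.app _ v s' = E.app _ (genAt k σ s) s') by
        obtain ⟨v, h1, h2⟩ := H
        exact ⟨v, h1, h2, fun _ => hs⟩
      cases m with
      | zero =>
        obtain ⟨v, h1, h2⟩ := h0 _ (genAt k σ s)
        have hy0 : ∀ (M : BiMod.{w} k) (x : M.V σ), y.app M x = 0 := fun M x => by
          funext s'
          rcases Nat.eq_zero_or_pos (σ'.deg s') with h | h
          · exact hy.zero M x s' h
          · exact hy.gt M x s' h
        refine ⟨v, h1, fun s' hs' => ?_⟩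
        rw [h2 s' hs', hEdef, NatOp.err_apply, hy0, hy0, map_zero, smul_zero, add_zero, sub_zero]
      | succ m =>
        set e := E.app _ (genAt k σ s) with he
        obtain ⟨v, h1, h2⟩ := hex _ _ m (fun s' => if σ'.deg s' = m + 1 then e s' else 0)
          (fun s' h => if_neg h) (fun s' h => by
            have h3 : D'.app _ e s' = 0 := by
              rw [he, hEdef, NatOp.err_comm hη hDD hDD' hzD, Pi.smul_apply,
                hy.err _ _ s' (by omega), smul_zero]
            rw [← h3]
            refine hD'.congr fun t ht _ => ?_
            by_cases h4 : σ'.deg t = m + 1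
            · rw [if_pos h4]
            · rw [if_neg h4, he]
              exact (hy.err _ _ t (by omega)).symm)
        exact ⟨v, h1, fun s' hs' => by rw [h2 s' hs', if_pos hs']⟩
    · refine ⟨0, fun _ _ => rfl, fun s' h => ?_, fun h => absurd rfl h⟩
      rw [map_zero]
      refine (hE (BiMod.free.{w} k _ _) (genAt k σ s) s' fun t h1 h2 => ?_).symm
      have : t ≠ s := by
        rintro rfl
        rw [h] at h1 h2
        exact hs ⟨h1, h2⟩
      rw [genAt, Pi.single_eq_of_ne this]
  choose v hv1 hv2 hv3 using key
  have hv0 : ∀ (M : BiMod.{w} k) (x : M.V σ) s', σ'.deg s' ≠ m + 1 →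
      (NatOp.ofGen σ σ' (m + 1) v).app M x s' = 0 := fun M x s' h => by
    rw [NatOp.ofGen_apply, Finset.sum_apply]
    exact Finset.sum_eq_zero fun s _ => by rw [BiMod.Hom.on_apply, hv1 s s' h, map_zero]
  have hvdeg : (NatOp.ofGen σ σ' (m + 1) v).Deg (c + 1) := by
    refine NatOp.Deg.ofGen fun s s' h => ?_
    have e1 : σ'.deg s' = m + 1 := by
      by_contra h'
      exact h (hv1 s s' h')
    obtain ⟨h1, h2⟩ := hv3 s fun h' => h (congrFun h' s')
    rw [e1]
    refine ⟨by push_cast; omega, ?_⟩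
    convert h2 using 1
    push_cast
    ring
  refine ⟨y.add (NatOp.ofGen σ σ' (m + 1) v), ⟨fun M x s' h => ?_, fun M x s' h => ?_,
    fun M x s' h => ?_, fun M x s' h => ?_⟩, fun M x s' h => ?_⟩
  · show y.app M x s' + _ = 0
    rw [hy.deg M x s' h, hvdeg M x s' h, add_zero]
  · show y.app M x s' + _ = 0
    rw [hy.zero M x s' h, hv0 M x s' (by omega), add_zero]
  · show y.app M x s' + _ = 0
    rw [hy.gt M x s' (by omega), hv0 M x s' (by omega), add_zero]
  · have e1 : (NatOp.err D D' η z (y.add (NatOp.ofGen σ σ' (m + 1) v))).app M x s' =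
        E.app M x s' - D'.app M ((NatOp.ofGen σ σ' (m + 1) v).app M x) s' := by
      have h3 := hv0 M (D.app M x) s' (by omega)
      rw [hEdef, NatOp.err_apply, NatOp.err_apply]
      simp only [NatOp.add, LinearMap.add_apply, map_add, Pi.sub_apply, Pi.add_apply, Pi.smul_apply,
        h3, add_zero]
      abel
    rw [e1]
    rcases Nat.lt_succ_iff_lt_or_eq.1 h with h | h
    · rw [hy.err M x s' h, hD' M _ s' fun t ht _ => hv0 M x t (by omega), sub_zero]
    · rw [hE.eq_sum (N := m + 1) x s' (by rw [h]; push_cast; omega), NatOp.ofGen_apply, map_sum,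
        Finset.sum_apply, sub_eq_zero]
      refine sum_congr rfl fun s _ => ?_
      rw [D'.nat, BiMod.Hom.on_apply, hv2 s s' h]
      rfl
  · show y.app M x s' + _ = _
    rw [hv0 M x s' (by omega), add_zero]

/-- The method of acyclic models. -/
lemma NatOp.exists_lift (hD : D.Deg (-1)) (hD' : D'.Deg (-1))
    (hDD : ∀ (M : BiMod.{w} k) (x : M.V σ), D.app M (D.app M x) = x - M.T.on σ x)
    (hDD' : ∀ (M : BiMod.{w} k) (x : M.V σ'), D'.app M (D'.app M x) = x - M.T.on σ' x)
    (hη : η * η = 1) (hc : -1 ≤ c) (hz : z.Deg c)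
    (hzD : ∀ (M : BiMod.{w} k) (x : M.V σ), D'.app M (z.app M x) = η • z.app M (D.app M x))
    (hex : ∀ (p q m : ℕ) (x : (BiMod.free.{w} k p q).V σ'),
      (∀ s', σ'.deg s' ≠ m + 1 → x s' = 0) → (∀ s', σ'.deg s' = m → D'.app _ x s' = 0) →
      ∃ y, (∀ s', σ'.deg s' ≠ m + 2 → y s' = 0) ∧ ∀ s', σ'.deg s' = m + 1 → D'.app _ y s' = x s')
    (h0 : ∀ (M : BiMod.{w} k) (x : M.V σ), ∃ y, (∀ s', σ'.deg s' ≠ 1 → y s' = 0) ∧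
      ∀ s', σ'.deg s' = 0 → D'.app M y s' = z.app M x s') : ∃ y : NatOp.{w} k σ σ', y.Deg (c + 1) ∧
      (∀ (M : BiMod.{w} k) (x : M.V σ) s', σ'.deg s' = 0 → y.app M x s' = 0) ∧
      ∀ (M : BiMod.{w} k) (x : M.V σ),
        D'.app M (y.app M x) + η • y.app M (D.app M x) = z.app M x := by
  choose! next hnext hnext' using fun (m : ℕ) (y : NatOp.{w} k σ σ')
    (hy : NatOp.Partial D D' η z c m y) => hy.step hD hD' hDD hDD' hη hc hz hzD hex h0
  let Y : ℕ → NatOp.{w} k σ σ' := fun m => Nat.rec (z.smul 0) (fun m y => next m y) m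
  have hY : ∀ m, NatOp.Partial D D' η z c m (Y m) := by
    intro m
    induction m with
    | zero =>
      have : ∀ (M : BiMod.{w} k) (x : M.V σ) s', (Y 0).app M x s' = 0 := fun M x s' => by
        simp [Y, NatOp.smul]
      exact ⟨fun M x s' _ => this M x s', fun M x s' _ => this M x s', fun M x s' _ => this M x s',
        fun M x s' h => absurd h (by omega)⟩
    | succ m ih => exact hnext m _ ih
  have hst : ∀ m n, m ≤ n → ∀ (M : BiMod.{w} k) (x : M.V σ) s', σ'.deg s' ≤ m →
      (Y n).app M x s' = (Y m).app M x s' := by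
    intro m n hmn
    induction n, hmn using Nat.le_induction with
    | base => exact fun _ _ _ _ => rfl
    | succ n hmn ih =>
      intro M x s' h
      rw [← ih M x s' h]
      exact hnext' n _ (hY n) M x s' (by omega)
  refine ⟨⟨fun M => LinearMap.pi fun s' => proj s' ∘ₗ (Y (σ'.deg s')).app M,
    fun f x => ?_⟩, fun M x s' h => (hY _).deg M x s' h, fun M x s' h => (hY _).zero M x s' h,
    fun M x => ?_⟩
  · funext s'
    exact congrFun ((Y (σ'.deg s')).nat f x) s'
  · funext s'
    have h1 := (hY (σ'.deg s' + 1)).err M x s' (by omega)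
    rw [NatOp.err_apply, Pi.sub_apply, sub_eq_zero] at h1
    rw [h1]
    simp only [Pi.add_apply, Pi.smul_apply]
    congr 1
    · refine hD'.congr fun t ht _ => ?_
      exact (hst (σ'.deg t) (σ'.deg s' + 1) (by omega) M x t le_rfl).symm
    · exact congrArg (η • ·) (hst (σ'.deg s') (σ'.deg s' + 1) (by omega) M (D.app M x) s' le_rfl).symm

end Lift

end AcyclicModels

section EilenbergZilber

variable {k : Type uk} [CommRing k]

/-- Natural curved differentials, acyclic on free modules. -/
structure Shape.IsModel (σ : Shape) (D : NatOp.{w} k σ σ) : Prop where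
  deg : D.Deg (-1)
  sq : ∀ (M : BiMod.{w} k) (x : M.V σ), D.app M (D.app M x) = x - M.T.on σ x
  exact : ∀ (p q m : ℕ) (x : (BiMod.free.{w} k p q).V σ),
    (∀ s, σ.deg s ≠ m + 1 → x s = 0) → (∀ s, σ.deg s = m → D.app _ x s = 0) →
      ∃ y, (∀ s, σ.deg s ≠ m + 2 → y s = 0) ∧ ∀ s, σ.deg s = m + 1 → D.app _ y s = x s

variable {σ σ' : Shape} {D : NatOp.{w} k σ σ} {D' : NatOp.{w} k σ' σ'}

lemma NatOp.Deg.add {z z' : NatOp.{w} k σ σ'} {c : ℤ} (hz : z.Deg c) (hz' : z'.Deg c) :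
    (z.add z').Deg c := fun M x s' h => by
  show z.app M x s' + z'.app M x s' = 0
  rw [hz M x s' h, hz' M x s' h, add_zero]

lemma NatOp.Deg.smul {z : NatOp.{w} k σ σ'} {c : ℤ} (hz : z.Deg c) (a : k) :
    (z.smul a).Deg c := fun M x s' h => by
  show a • z.app M x s' = 0
  rw [hz M x s' h, smul_zero]

lemma Shape.IsModel.exists_hom (hD : σ.IsModel D) (hD' : σ'.IsModel D') (ι : NatOp.{w} k σ σ')
    (hι : ι.Deg 0) (h0 : ∀ (M : BiMod.{w} k) (x : M.V σ), ∃ y, (∀ s', σ'.deg s' ≠ 1 → y s' = 0) ∧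
      ∀ s', σ'.deg s' = 0 → D'.app M y s' = ι.app M (D.app M x) s' - D'.app M (ι.app M x) s') :
    ∃ f : NatOp.{w} k σ σ', f.Deg 0 ∧
      (∀ (M : BiMod.{w} k) (x : M.V σ) s', σ'.deg s' = 0 → f.app M x s' = ι.app M x s') ∧
      ∀ (M : BiMod.{w} k) (x : M.V σ), D'.app M (f.app M x) = f.app M (D.app M x) := by
  have hz : ∀ (M : BiMod.{w} k) (x : M.V σ), ((ι.comp D).add ((D'.comp ι).smul (-1))).app M x =
      ι.app M (D.app M x) - D'.app M (ι.app M x) := fun M x => by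
    simp only [NatOp.add, NatOp.comp, NatOp.smul, LinearMap.add_apply, comp_apply,
      LinearMap.smul_apply, neg_smul, one_smul, sub_eq_add_neg]
  obtain ⟨y, hy, hy0, hyD⟩ := NatOp.exists_lift (η := -1)
    (z := (ι.comp D).add ((D'.comp ι).smul (-1))) (c := -1) hD.deg hD'.deg hD.sq hD'.sq (by ring)
    le_rfl (NatOp.Deg.add (fun M x s' h => hD.deg.comp hι (by simpa using h))
      (NatOp.Deg.smul (fun M x s' h => hι.comp hD'.deg (by simpa using h)) _))
    (fun M x => by
      rw [hz, hz, map_sub, hD'.sq, hD.sq, map_sub, ι.nat, neg_smul, one_smul]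
      abel) hD'.exact (fun M x => by
      obtain ⟨y, h1, h2⟩ := h0 M x
      exact ⟨y, h1, fun s' h => by rw [hz, h2 s' h, Pi.sub_apply]⟩)
  refine ⟨ι.add y, hι.add (by simpa using hy), fun M x s' h => ?_, fun M x => ?_⟩
  · show ι.app M x s' + y.app M x s' = _
    rw [hy0 M x s' h, add_zero]
  · have := hyD M x
    rw [hz, neg_smul, one_smul] at this
    show D'.app M (ι.app M x + y.app M x) = ι.app M (D.app M x) + y.app M (D.app M x)
    rw [map_add, ← sub_eq_zero]
    rw [← sub_eq_zero] at this
    rw [← this]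
    abel

/-- The identity. -/
def NatOp.one (k : Type uk) [CommRing k] (σ : Shape) : NatOp.{w} k σ σ :=
  ⟨fun _ => 𝟙, fun _ _ => rfl⟩

lemma Shape.IsModel.exists_homotopy (hD : σ.IsModel D) {f : NatOp.{w} k σ σ} (hf : f.Deg 0)
    (h0 : ∀ (M : BiMod.{w} k) (x : M.V σ) s, σ.deg s = 0 → f.app M x s = x s)
    (hfD : ∀ (M : BiMod.{w} k) (x : M.V σ), D.app M (f.app M x) = f.app M (D.app M x)) :
    ∃ h : NatOp.{w} k σ σ, h.Deg 1 ∧ ∀ (M : BiMod.{w} k) (x : M.V σ),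
      x - f.app M x = D.app M (h.app M x) + h.app M (D.app M x) := by
  have hz : ∀ (M : BiMod.{w} k) (x : M.V σ), ((NatOp.one k σ).add (f.smul (-1))).app M x =
      x - f.app M x := fun M x => by
    simp only [NatOp.one, NatOp.add, NatOp.smul, LinearMap.add_apply, id_apply,
      LinearMap.smul_apply, neg_smul, one_smul, sub_eq_add_neg]
  have h1 : (NatOp.one.{w} k σ).Deg 0 := fun M x s h => h s (by simp) (by simp)
  obtain ⟨y, hy, -, hyD⟩ := NatOp.exists_lift (η := 1)
    (z := (NatOp.one k σ).add (f.smul (-1))) (c := 0) hD.deg hD.deg hD.sq hD.sq (by ring)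
    (by norm_num) (h1.add (hf.smul _)) (fun M x => by rw [hz, hz, map_sub, hfD, one_smul]) hD.exact
    (fun M x => ⟨0, fun _ _ => rfl, fun s h => by
      rw [hz, Pi.sub_apply, h0 M x s h, sub_self, map_zero]; rfl⟩)
  refine ⟨y, hy, fun M x => ?_⟩
  rw [← hz, ← hyD, one_smul]

/-- The pairs of indices of degree at most `N`. -/
def totBelow (N : ℕ) : Finset (ℕ × ℕ) :=
  (Finset.range (N + 1) ×ˢ Finset.range (N + 1)).filter fun i => totDeg i ≤ N

lemma mem_totBelow (s : ℕ × ℕ) (N : ℕ) : s ∈ totBelow N ↔ totDeg s ≤ N := by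
  rw [totBelow, Finset.mem_filter, Finset.mem_product, Finset.mem_range, Finset.mem_range]
  unfold totDeg
  omega

/-- All pairs of indices. -/
@[reducible] def totShape : Shape where
  S := ℕ × ℕ
  o := id
  deg := totDeg
  below := totBelow
  mem_below := mem_totBelow

/-- The diagonal. -/
@[reducible] def diagShape : Shape where
  S := ℕ
  o n := (n, n)
  deg := id
  below N := Finset.range (N + 1)
  mem_below s N := by simp [Nat.lt_succ_iff]

/-- `totD` as a natural family. -/
def totOp (k : Type uk) [CommRing k] : NatOp.{w} k totShape totShape where
  app M := totD M.oh M.oa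
  nat {M M'} f x := by
    funext ⟨m, n⟩
    cases m with
    | zero =>
      cases n with
      | zero =>
        refine (totD_zero_zero _).trans (Eq.trans ?_ (congrArg (f.f 0 0) (totD_zero_zero x).symm))
        rw [map_add, (f.h 0).b, (f.a 0).b]
        rfl
      | succ n =>
        refine (totD_zero_succ _ n).trans
          (Eq.trans ?_ (congrArg (f.f 0 (n + 1)) (totD_zero_succ x n).symm))
        rw [map_add, map_add, (f.h (n + 1)).b, (f.a 0).b, (f.a 0).B']
        rfl
    | succ m =>
      cases n with
      | zero =>
        refine (totD_succ_zero _ m).trans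
          (Eq.trans ?_ (congrArg (f.f (m + 1) 0) (totD_succ_zero x m).symm))
        rw [map_add, map_add, map_smul, (f.h 0).b, (f.a (m + 1)).b, (f.a (m + 1)).t_pow, (f.h 0).B']
        rfl
      | succ n =>
        refine (totD_succ_succ _ m n).trans
          (Eq.trans ?_ (congrArg (f.f (m + 1) (n + 1)) (totD_succ_succ x m n).symm))
        rw [map_add, map_add, map_add, map_smul, map_smul, (f.h (n + 1)).b, (f.a (m + 1)).b,
          (f.a (m + 1)).B', (f.a (m + 1)).t_pow, (f.h (n + 1)).B']
        rfl

lemma BiMod.Hom.diag {M M' : BiMod.{w} k} (f : M.Hom M') :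
    CycHom (diagOps M.oh M.oa) (diagOps M'.oh M'.oa) (fun n => f.f n n) where
  d n i x := by simp [diagOps, (f.h _).d, (f.a _).d]
  s n i x := by simp [diagOps, (f.h _).s, (f.a _).s]
  t n x := by simp [diagOps, (f.h _).t, (f.a _).t]

/-- `b + B'` on the diagonal, as a natural family. -/
def diagOp (k : Type uk) [CommRing k] : NatOp.{w} k diagShape diagShape where
  app M := (diagOps M.oh M.oa).mixedD'
  nat f x := funext fun n => (f.diag.mixedD' x n).symm

lemma totD_eq_b {X : ℕ → ℕ → Type*} [∀ m n, AddCommGroup (X m n)] [∀ m n, Module k (X m n)]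
    (Oh : ∀ n, CycOps k (fun m => X m n)) (Oa : ∀ m, CycOps k (fun n => X m n))
    {x : ∀ i : ℕ × ℕ, X i.1 i.2} {m n : ℕ} (hx : ∀ i, totDeg i + 1 = m + n → x i = 0) :
    totD Oh Oa x (m, n) = (Oh n).b m (x (m + 1, n)) + (-1 : k) ^ m • (Oa m).b n (x (m, n + 1)) := by
  cases m with
  | zero =>
    cases n with
    | zero => rw [totD_zero_zero, pow_zero, one_smul]
    | succ n =>
      rw [totD_zero_succ, hx (0, n) (by simp [totDeg]), map_zero, add_zero, pow_zero, one_smul]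
  | succ m =>
    cases n with
    | zero => rw [totD_succ_zero, hx (m, 0) (by simp [totDeg]), map_zero, map_zero, add_zero]
    | succ n =>
      rw [totD_succ_succ, hx (m, n + 1) (by simp only [totDeg]; omega),
        hx (m + 1, n) (by simp only [totDeg]; omega)]
      simp

lemma totOp_isModel : totShape.IsModel (totOp.{w} k) where
  deg := by
    rintro M x ⟨m, n⟩ h
    have h' : ∀ i : ℕ × ℕ, totDeg i = m + n + 1 ∨ totDeg i + 1 = m + n → x i = 0 := by
      intro i hi
      have e1 : (totShape.deg i : ℤ) = totDeg i := rfl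
      have e2 : (totShape.deg (m, n) : ℤ) = m + n := by simp [totShape, totDeg]
      refine h i ?_ ?_ <;> rw [e1, e2]
      · omega
      · rcases hi with hi | hi
        · exact ⟨0, by omega⟩
        · exact ⟨1, by omega⟩
    refine (totD_eq_b M.oh M.oa fun i hi => h' i (Or.inr hi)).trans ?_
    rw [h' (m + 1, n) (Or.inl (by simp only [totDeg]; omega)),
      h' (m, n + 1) (Or.inl (by simp only [totDeg]; omega))]
    simp
  sq M x := funext fun ⟨m, n⟩ => M.para.totD_totD x m n
  exact p q N x hx h0 := by
    obtain ⟨y, hy⟩ := free_tot_exact.{w} (k := k) p q N x fun m n h => by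
      rw [← totD_eq_b (freeH.{w} k p q) (freeA.{w} k p q) (x := x) (m := m) (n := n)]
      · exact h0 (m, n) h
      · intro i hi
        exact hx i (show totDeg i ≠ N + 1 by omega)
    refine ⟨fun i => if totDeg i = N + 2 then y i else 0, fun i hi => if_neg hi, ?_⟩
    rintro ⟨m, n⟩ h
    have h' : m + n = N + 1 := h
    rw [← hy m n h']
    refine (totD_eq_b (freeH.{w} k p q) (freeA.{w} k p q) fun i hi => if_neg (by omega)).trans ?_
    rw [if_pos (show totDeg (m + 1, n) = N + 2 by simp only [totDeg]; omega),
      if_pos (show totDeg (m, n + 1) = N + 2 by simp only [totDeg]; omega)]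

lemma b_zero_apply {X : ℕ → Type*} [∀ n, AddCommGroup (X n)] [∀ n, Module k (X n)]
    (O : CycOps k X) (x : X 1) : O.b 0 x = O.d 0 0 x - O.d 0 1 x := by
  show (∑ i : Fin 2, (-1 : k) ^ (i : ℕ) • O.d 0 i) x = _
  simp [Fin.sum_univ_two, sub_eq_add_neg]

lemma mixedD'_eq_b {X : ℕ → Type*} [∀ n, AddCommGroup (X n)] [∀ n, Module k (X n)]
    (O : CycOps k X) {x : ∀ n, X n} {n : ℕ} (hx : ∀ m, m + 1 = n → x m = 0) :
    O.mixedD' x n = O.b n (x (n + 1)) := by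
  cases n with
  | zero => rw [CycOps.mixedD'_zero]
  | succ n => rw [CycOps.mixedD'_succ, hx n rfl, map_zero, add_zero]

lemma diagOp_isModel : diagShape.IsModel (diagOp.{w} k) where
  deg := by
    intro M x (n : ℕ) h
    have h' : ∀ m : ℕ, m = n + 1 ∨ m + 1 = n → x m = 0 := by
      intro m hm
      have e1 : ∀ m, (diagShape.deg m : ℤ) = (m : ℕ) := fun _ => rfl
      refine h m ?_ ?_ <;> rw [e1, e1]
      · omega
      · rcases hm with hm | hm
        · exact ⟨0, by omega⟩
        · exact ⟨1, by omega⟩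
    refine (mixedD'_eq_b _ fun m hm => h' m (Or.inr hm)).trans ?_
    rw [h' (n + 1) (Or.inl rfl), map_zero]
  sq M x := by
    funext n
    refine (M.para.diag.mixedD'_mixedD' x n).trans ?_
    rw [M.para.diag_t_pow]
    rfl
  exact p q N x hx h0 := by
    obtain ⟨y, hy⟩ := free_diag_exact.{w} (k := k) p q N (x (N + 1)) (by
      exact (mixedD'_eq_b _ fun m hm => hx m (show m ≠ N + 1 by omega)).symm.trans (h0 N rfl))
    classical
    let v : (BiMod.free.{w} k p q).V diagShape :=
      Function.update (β := fun s => (BiMod.free.{w} k p q).X s s) 0 (N + 2) y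
    refine ⟨v, fun n hn => Function.update_of_ne (β := fun s => (BiMod.free.{w} k p q).X s s) hn _ _,
      ?_⟩
    rintro n rfl
    have h1 : ∀ m, m + 1 = N + 1 → v m = 0 := fun m hm =>
      Function.update_of_ne (β := fun s => (BiMod.free.{w} k p q).X s s) (by omega) _ _
    refine (mixedD'_eq_b _ h1).trans ?_
    have h2 : v (N + 2) = y :=
      Function.update_self (β := fun s => (BiMod.free.{w} k p q).X s s) _ _ _
    rw [← hy, ← h2]

/-- The projection to bidegree `(0, 0)`. -/
def totToDiag (k : Type uk) [CommRing k] : NatOp.{w} k totShape diagShape where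
  app M := LinearMap.pi (φ := fun n => M.X n n) fun
    | 0 => proj (φ := fun i : ℕ × ℕ => M.X i.1 i.2) (0, 0)
    | _ + 1 => 0
  nat {M M'} f x := by
    funext n
    cases n with
    | zero => rfl
    | succ n => exact (map_zero (f.f (n + 1) (n + 1))).symm

/-- The projection to bidegree `(0, 0)`. -/
def diagToTot (k : Type uk) [CommRing k] : NatOp.{w} k diagShape totShape where
  app M := LinearMap.pi (φ := fun i : ℕ × ℕ => M.X i.1 i.2) fun
    | (0, 0) => proj (φ := fun n => M.X n n) 0
    | (_, _) => 0
  nat {M M'} f x := by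
    funext ⟨m, n⟩
    rcases m with _ | m <;> rcases n with _ | n
    · rfl
    all_goals exact (map_zero (f.f _ _)).symm

lemma exists_totToDiag : ∃ f : NatOp.{w} k totShape diagShape, f.Deg 0 ∧
    (∀ (M : BiMod.{w} k) (x : M.V totShape), f.app M x (0 : ℕ) = x ((0, 0) : ℕ × ℕ)) ∧
    ∀ (M : BiMod.{w} k) (x : M.V totShape),
      (diagOp k).app M (f.app M x) = f.app M ((totOp k).app M x) := by
  obtain ⟨f, hf, hf0, hfD⟩ := totOp_isModel.exists_hom diagOp_isModel (totToDiag.{w} k)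
    (fun M x n h => by
      match n with
      | (0 : ℕ) => exact h ((0, 0) : ℕ × ℕ) le_rfl ⟨0, rfl⟩
      | (n + 1 : ℕ) => rfl)
    (fun M x => by
      classical
      let y1 : M.X 1 1 := (M.oa 1).s 0 0 (x ((1, 0) : ℕ × ℕ)) + (M.oh 1).s 0 0 (x ((0, 1) : ℕ × ℕ))
      let y : M.V diagShape := Function.update (β := fun s => M.X s s) 0 1 y1
      have hy1 : y (1 : ℕ) = y1 := Function.update_self (β := fun s => M.X s s) _ _ _
      refine ⟨y, fun n hn => Function.update_of_ne (β := fun s => M.X s s) hn _ _, ?_⟩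
      rintro n (rfl : n = 0)
      have e1 : (diagOp k).app M ((totToDiag k).app M x) (0 : ℕ) = 0 :=
        (CycOps.mixedD'_zero _ _).trans (map_zero _)
      have e2 : (totToDiag k).app M ((totOp k).app M x) (0 : ℕ) =
          (M.oh 0).b 0 (x ((1, 0) : ℕ × ℕ)) + (M.oa 0).b 0 (x ((0, 1) : ℕ × ℕ)) :=
        totD_zero_zero x
      have e3 : (diagOp k).app M y (0 : ℕ) = (diagOps M.oh M.oa).b 0 y1 := by
        rw [← hy1]; exact CycOps.mixedD'_zero _ _
      refine e3.trans (Eq.trans ?_ (congrArg₂ (· - ·) e2 e1).symm)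
      have a0 : ∀ z, (M.oa 1).d 0 0 ((M.oa 1).s 0 0 z) = z := app_eq ((M.para.a 1).d_s_eq 0 0)
      have a1 : ∀ z, (M.oa 1).d 0 1 ((M.oa 1).s 0 0 z) = z := app_eq ((M.para.a 1).d_s_eq' 0 0)
      have b0 : ∀ z, (M.oh 0).d 0 0 ((M.oh 0).s 0 0 z) = z := app_eq ((M.para.h 0).d_s_eq 0 0)
      have b1 : ∀ z, (M.oh 0).d 0 1 ((M.oh 0).s 0 0 z) = z := app_eq ((M.para.h 0).d_s_eq' 0 0)
      have c0 : ∀ i z, (M.oa 1).d 0 i ((M.oh 1).s 0 0 z) = (M.oh 0).s 0 0 ((M.oa 0).d 0 i z) :=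
        fun i z => ((M.para.s 0 0).d 0 i z).symm
      simp only [y1, b_zero_apply, diagOps, comp_apply, map_add, a0, a1, c0, b0, b1, sub_zero])
  exact ⟨f, hf, fun M x => hf0 M x (0 : ℕ) rfl, hfD⟩

lemma exists_diagToTot : ∃ f : NatOp.{w} k diagShape totShape, f.Deg 0 ∧
    (∀ (M : BiMod.{w} k) (x : M.V diagShape), f.app M x ((0, 0) : ℕ × ℕ) = x (0 : ℕ)) ∧
    ∀ (M : BiMod.{w} k) (x : M.V diagShape),
      (totOp k).app M (f.app M x) = f.app M ((diagOp k).app M x) := by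
  obtain ⟨f, hf, hf0, hfD⟩ := diagOp_isModel.exists_hom totOp_isModel (diagToTot.{w} k)
    (fun M x i h => by
      match i with
      | ((0, 0) : ℕ × ℕ) => exact h (0 : ℕ) le_rfl ⟨0, rfl⟩
      | ((_ + 1, 0) : ℕ × ℕ) => rfl
      | ((0, _ + 1) : ℕ × ℕ) => rfl
      | ((_ + 1, _ + 1) : ℕ × ℕ) => rfl)
    (fun M x => by
      let x1 : M.X 1 1 := x (1 : ℕ)
      let y : M.V totShape := fun
        | ((1, 0) : ℕ × ℕ) => (M.oa 1).d 0 0 x1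
        | ((0, 1) : ℕ × ℕ) => (M.oh 1).d 0 1 x1
        | (_, _) => 0
      have hy : ∀ i : ℕ × ℕ, totDeg i ≠ 1 → y i = 0 := by
        rintro ⟨m, n⟩ h
        match m, n with
        | 0, 0 => rfl
        | 1, 0 => exact absurd rfl h
        | 0, 1 => exact absurd rfl h
        | 1, n + 1 => rfl
        | 0, n + 2 => rfl
        | m + 2, n => rfl
      refine ⟨y, hy, ?_⟩
      rintro ⟨m, n⟩ h
      obtain ⟨rfl, rfl⟩ : m = 0 ∧ n = 0 := by
        have h : m + n = 0 := h
        omega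
      have e1 : (totOp k).app M ((diagToTot k).app M x) ((0, 0) : ℕ × ℕ) = 0 :=
        (totD_zero_zero _).trans ((congrArg₂ (· + ·) (map_zero _) (map_zero _)).trans (add_zero 0))
      have e2 : (diagToTot k).app M ((diagOp k).app M x) ((0, 0) : ℕ × ℕ) =
          (diagOps M.oh M.oa).b 0 x1 := CycOps.mixedD'_zero _ x
      have e3 : (totOp k).app M y ((0, 0) : ℕ × ℕ) =
          (M.oh 0).b 0 ((M.oa 1).d 0 0 x1) + (M.oa 0).b 0 ((M.oh 1).d 0 1 x1) := totD_zero_zero _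
      refine e3.trans (Eq.trans ?_ (congrArg₂ (· - ·) e2 e1).symm)
      have c0 : ∀ z, (M.oa 0).d 0 0 ((M.oh 1).d 0 1 z) = (M.oh 0).d 0 1 ((M.oa 1).d 0 0 z) :=
        fun z => ((M.para.d 0 1).d 0 0 z).symm
      have c1 : ∀ z, (M.oa 0).d 0 1 ((M.oh 1).d 0 1 z) = (M.oh 0).d 0 1 ((M.oa 1).d 0 1 z) :=
        fun z => ((M.para.d 0 1).d 0 1 z).symm
      simp only [b_zero_apply, diagOps, comp_apply, c0, c1, sub_zero]
      abel)
  exact ⟨f, hf, fun M x => hf0 M x ((0, 0) : ℕ × ℕ) rfl, hfD⟩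

/-- `Θ` lowers the degree by `c`. -/
def LowersTo (k : Type*) [CommRing k] {I I' : Type*} (deg : I → ℕ) (deg' : I' → ℕ) {V : I → Type*}
    [∀ i, AddCommGroup (V i)] [∀ i, Module k (V i)] {V' : I' → Type*} [∀ i, AddCommGroup (V' i)]
    [∀ i, Module k (V' i)] (c : ℤ) (Θ : (∀ i, V i) →ₗ[k] (∀ i, V' i)) : Prop :=
  ∀ m m' : ℤ, m' + c = m → ∀ x ∈ PS k deg V m, Θ x ∈ PS k deg' V' m'

lemma NatOp.Deg.lowersTo {f : NatOp.{w} k σ σ'} {c : ℤ} (hf : f.Deg c) (M : BiMod.{w} k) :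
    LowersTo k σ.deg σ'.deg (-c) (f.app M) := by
  intro m m' h x hx s' hs'
  refine hf M x s' fun s h1 h2 => hx s fun h3 => hs' ⟨by omega, ?_⟩
  have := h3.2.add h2
  rwa [show (σ.deg s : ℤ) - m + ((σ'.deg s' : ℤ) - σ.deg s - c) = (σ'.deg s' : ℤ) - m' by
    rw [← h]; ring] at this

lemma eilenbergZilber {X : ℕ → ℕ → Type (max w uk)} [∀ m n, AddCommGroup (X m n)]
    [∀ m n, Module k (X m n)] {Oh : ∀ n, CycOps k (fun m => X m n)}
    {Oa : ∀ m, CycOps k (fun n => X m n)} (hX : IsBiPara Oh Oa) :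
    ∃ (f : (∀ i : ℕ × ℕ, X i.1 i.2) →ₗ[k] (∀ n, X n n))
      (g : (∀ n, X n n) →ₗ[k] (∀ i : ℕ × ℕ, X i.1 i.2))
      (h : (∀ i : ℕ × ℕ, X i.1 i.2) →ₗ[k] (∀ i : ℕ × ℕ, X i.1 i.2))
      (h' : (∀ n, X n n) →ₗ[k] (∀ n, X n n)),
      (LowersTo k totDeg (id : ℕ → ℕ) 0 f ∧ LowersTo k (id : ℕ → ℕ) totDeg 0 g ∧
        LowersTo k totDeg totDeg (-1) h ∧ LowersTo k (id : ℕ → ℕ) (id : ℕ → ℕ) (-1) h') ∧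
      (∀ x, (diagOps Oh Oa).mixedD' (f x) = f (totD Oh Oa x)) ∧
      (∀ x, totD Oh Oa (g x) = g ((diagOps Oh Oa).mixedD' x)) ∧
      (∀ x, x - g (f x) = totD Oh Oa (h x) + h (totD Oh Oa x)) ∧
      (∀ x, x - f (g x) = (diagOps Oh Oa).mixedD' (h' x) + h' ((diagOps Oh Oa).mixedD' x)) := by
  obtain ⟨f, hf, hf0, hfD⟩ := exists_totToDiag.{w} (k := k)
  obtain ⟨g, hg, hg0, hgD⟩ := exists_diagToTot.{w} (k := k)
  obtain ⟨h, hh, hhD⟩ := totOp_isModel.exists_homotopy (f := g.comp f)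
    (fun M x s hs => hf.comp hg hs)
    (fun M x i hi => by
      obtain ⟨m, n⟩ := i
      obtain ⟨rfl, rfl⟩ : m = 0 ∧ n = 0 := by
        have h : m + n = 0 := hi
        omega
      exact (hg0 M _).trans (hf0 M x))
    (fun M x => (hgD M _).trans (congrArg _ (hfD M x)))
  obtain ⟨h', hh', hhD'⟩ := diagOp_isModel.exists_homotopy (f := f.comp g)
    (fun M x s hs => hg.comp hf hs)
    (fun M x n hn => by
      obtain rfl : n = (0 : ℕ) := hn
      exact (hf0 M _).trans (hg0 M x))
    (fun M x => (hfD M _).trans (congrArg _ (hgD M x)))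
  let M : BiMod.{w} k := ⟨X, Oh, Oa, hX⟩
  exact ⟨f.app M, g.app M, h.app M, h'.app M, ⟨hf.lowersTo M, hg.lowersTo M, hh.lowersTo M,
    hh'.lowersTo M⟩, hfD M, hgD M, hhD M, hhD' M⟩

end EilenbergZilber

/-! ### Tensor powers: first and last entries -/

section TensorPowers

variable {m n : ℕ} {k : Type*} [CommRing k] {M : Type*} [AddCommGroup M] [Module k M]

/-- `(a, (a_0, …, a_{n-1})) ↦ (a, a_0, …, a_{n-1})`. -/
def tcons (a : M) (x : TPow k M n) : TPow k M (n + 1) := (consEquiv k M n).symm (a ⊗ₜ x)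

@[simp] lemma consEquiv_tcons (a : M) (x : TPow k M n) :
    consEquiv k M n (tcons a x) = a ⊗ₜ x := LinearEquiv.apply_symm_apply _ _

lemma consEquiv_symm_tmul (a : M) (x : TPow k M n) :
    (consEquiv k M n).symm (a ⊗ₜ x) = tcons a x := rfl

lemma tcons_ind {C : TPow k M (n + 1) → Prop} (x : TPow k M (n + 1))
    (tcons : ∀ a y, C (tcons a y)) (add : ∀ x y, C x → C y → C (x + y) := by
      intro x y hx hy
      simp only [map_add, tcons_add, add_tsnoc, add_tmul, tmul_add, sum_add_distrib, hx, hy]) :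
    C x := by
  obtain ⟨x, rfl⟩ := (consEquiv k M n).symm.surjective x
  exact tmul_ind (C := fun x => C ((consEquiv k M n).symm x)) x tcons fun x y hx hy => by
    rw [map_add]; exact add _ _ hx hy

lemma tpow_ext {N : Type*} [AddCommGroup N] [Module k N] {f g : TPow k M (n + 1) →ₗ[k] N}
    (h : ∀ a x, f (tcons a x) = g (tcons a x)) : f = g := by
  ext1
  refine MultilinearMap.ext fun a => ?_
  have : PiTensorProduct.tprod k a =
      tcons (a 0) (PiTensorProduct.tprod k (fun i : Fin n => a i.succ)) := by
    rw [tcons, LinearEquiv.eq_symm_apply, consEquiv_tprod]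
  show f (PiTensorProduct.tprod k a) = g (PiTensorProduct.tprod k a)
  rw [this, h]

/-- `frontLast` as an isomorphism. -/
def snocEquiv : ∀ n : ℕ, TPow k M (n + 1) ≃ₗ[k] M ⊗[k] TPow k M n
  | 0 => consEquiv k M 0
  | n + 1 => (consEquiv k M (n + 1)).trans <|
      (TensorProduct.congr (LinearEquiv.refl k M) (snocEquiv n)).trans <|
        (leftComm k M M (TPow k M n)).trans <|
          TensorProduct.congr (LinearEquiv.refl k M) (consEquiv k M n).symm

lemma snocEquiv_eq : ∀ n : ℕ, (snocEquiv n).toLinearMap = frontLast (M := M) k n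
  | 0 => rfl
  | n + 1 => by
    rw [frontLast, ← snocEquiv_eq n]
    rfl

lemma snocEquiv_apply (x : TPow k M (n + 1)) : snocEquiv n x = frontLast k n x := by
  rw [← snocEquiv_eq]; rfl

/-- `((a_0, …, a_{n-1}), a) ↦ (a_0, …, a_{n-1}, a)`. -/
def tsnoc (x : TPow k M n) (a : M) : TPow k M (n + 1) := (snocEquiv n).symm (a ⊗ₜ x)

@[simp] lemma frontLast_tsnoc (x : TPow k M n) (a : M) :
    frontLast k n (tsnoc x a) = a ⊗ₜ x := by
  rw [← snocEquiv_apply]; exact LinearEquiv.apply_symm_apply _ _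

@[simp] lemma rot_tsnoc (x : TPow k M n) (a : M) : rot k n (tsnoc x a) = tcons a x := by
  simp [rot, consEquiv_symm_tmul]

lemma tsnoc_zero (x : TPow k M 0) (a : M) : tsnoc x a = tcons a x := rfl

@[simp] lemma tsnoc_tcons (a : M) (x : TPow k M n) (b : M) :
    tsnoc (tcons a x) b = tcons a (tsnoc x b) := by
  rw [tsnoc, LinearEquiv.symm_apply_eq]
  simp only [snocEquiv, LinearEquiv.trans_apply, consEquiv_tcons, congr_tmul,
    LinearEquiv.refl_apply, snocEquiv_apply, frontLast_tsnoc, leftComm_tmul, consEquiv_symm_tmul]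

@[simp] lemma tcons_add (a : M) (x y : TPow k M n) :
    tcons a (x + y) = tcons a x + tcons a y := by
  rw [tcons, tmul_add, map_add]; rfl

@[simp] lemma tcons_zero (a : M) : tcons a (0 : TPow k M n) = 0 := by
  rw [tcons, tmul_zero, map_zero]

@[simp] lemma tcons_smul (c : k) (a : M) (x : TPow k M n) :
    tcons a (c • x) = c • tcons a x := by
  rw [tcons, tmul_smul, map_smul]; rfl

@[simp] lemma smul_tcons (c : k) (a : M) (x : TPow k M n) :
    tcons (c • a) x = c • tcons a x := by
  rw [tcons, ← smul_tmul', map_smul]; rfl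

@[simp] lemma tsnoc_smul (c : k) (x : TPow k M n) (a : M) :
    tsnoc x (c • a) = c • tsnoc x a := by
  rw [tsnoc, ← smul_tmul', map_smul]; rfl

@[simp] lemma add_tsnoc (x y : TPow k M n) (a : M) :
    tsnoc (x + y) a = tsnoc x a + tsnoc y a := by
  simp [tsnoc, tmul_add]

@[simp] lemma insertAt_zero (c : M) (x : TPow k M n) : insertAt k c n 0 x = tcons c x := by
  cases n <;> rfl

@[simp] lemma insertAt_succ (c a : M) (i : ℕ) (x : TPow k M n) :
    insertAt k c (n + 1) (i + 1) (tcons a x) = tcons a (insertAt k c n i x) := by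
  simp [insertAt, consEquiv_symm_tmul]

@[simp] lemma insertAt_one (c a : M) (x : TPow k M n) :
    insertAt k c (n + 1) 1 (tcons a x) = tcons a (tcons c x) :=
  (insertAt_succ c a 0 x).trans (by rw [insertAt_zero])

lemma insertAt_last (c : M) : ∀ {n : ℕ} (x : TPow k M n), insertAt k c n n x = tsnoc x c
  | 0, x => by rw [insertAt_zero, tsnoc_zero]
  | n + 1, x => by
    apply tcons_ind x; intro a y
    rw [insertAt_succ, tsnoc_tcons, insertAt_last]

lemma insertAt_tsnoc (c b : M) : ∀ {n i : ℕ} (_ : i ≤ n) (x : TPow k M n),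
    insertAt k c (n + 1) i (tsnoc x b) = tsnoc (insertAt k c n i x) b
  | n, 0, _, x => by rw [insertAt_zero, insertAt_zero, tsnoc_tcons]
  | 0, i + 1, h, _ => absurd h (by omega)
  | n + 1, i + 1, h, x => by
    apply tcons_ind x; intro a y
    rw [tsnoc_tcons, insertAt_succ, insertAt_tsnoc c b (by omega), insertAt_succ, tsnoc_tcons]

section Algebra

variable {R : Type*} [Ring R] [Algebra k R]

@[simp] lemma mulAt_zero (a b : R) (x : TPow k R n) :
    mulAt k (n + 1) 0 (tcons a (tcons b x)) = tcons (a * b) x := by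
  simp [mulAt, consEquiv_symm_tmul]

@[simp] lemma mulAt_succ (i : ℕ) (a : R) (x : TPow k R (n + 1)) :
    mulAt k (n + 1) (i + 1) (tcons a x) = tcons a (mulAt k n i x) := by
  simp [mulAt, consEquiv_symm_tmul]

@[simp] lemma mulAt_one (a b c : R) (x : TPow k R n) :
    mulAt k (n + 2) 1 (tcons a (tcons b (tcons c x))) = tcons a (tcons (b * c) x) :=
  (mulAt_succ 0 a _).trans (by rw [mulAt_zero])

lemma mulAt_tsnoc (b : R) : ∀ {n i : ℕ} (_ : i < n) (x : TPow k R (n + 1)),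
    mulAt k (n + 1) i (tsnoc x b) = tsnoc (mulAt k n i x) b
  | 0, i, h, _ => absurd h (by omega)
  | n + 1, 0, _, x => by
    apply tcons_ind x; intro a y
    apply tcons_ind y; intro a' y
    rw [tsnoc_tcons, tsnoc_tcons, mulAt_zero, mulAt_zero, tsnoc_tcons]
  | n + 1, i + 1, h, x => by
    apply tcons_ind x; intro a y
    rw [tsnoc_tcons, mulAt_succ, mulAt_tsnoc b (by omega), mulAt_succ, tsnoc_tcons]

lemma mulAt_last (a b : R) : ∀ {n : ℕ} (x : TPow k R n),
    mulAt k (n + 1) n (tsnoc (tsnoc x a) b) = tsnoc x (a * b)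
  | 0, x => by rw [tsnoc_zero, tsnoc_tcons, tsnoc_zero, mulAt_zero, tsnoc_zero]
  | n + 1, x => by
    apply tcons_ind x; intro a' y
    rw [tsnoc_tcons, tsnoc_tcons, mulAt_succ, mulAt_last, tsnoc_tcons]

lemma mulAt_zero_mulAt {n j : ℕ} (x : TPow k R (n + 3)) :
    mulAt k (n + 1) 0 (mulAt k (n + 2) (j + 1) x) = mulAt k (n + 1) j (mulAt k (n + 2) 0 x) := by
  apply tcons_ind x; intro a y
  apply tcons_ind y; intro b y
  cases j with
  | zero =>
    apply tcons_ind y; intro c y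
    simp [mul_assoc]
  | succ j => simp

lemma insertAt_one_insertAt {n j : ℕ} (x : TPow k R (n + 1)) :
    insertAt k 1 (n + 2) 1 (insertAt k 1 (n + 1) (j + 1) x) =
      insertAt k 1 (n + 2) (j + 2) (insertAt k 1 (n + 1) 1 x) := by
  apply tcons_ind x; intro a y
  rw [insertAt_succ, insertAt_one, insertAt_one, insertAt_succ, insertAt_succ]

lemma mulAt_zero_insertAt {n j : ℕ} (x : TPow k R (n + 2)) :
    mulAt k (n + 2) 0 (insertAt k 1 (n + 2) (j + 2) x) =
      insertAt k 1 (n + 1) (j + 1) (mulAt k (n + 1) 0 x) := by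
  apply tcons_ind x; intro a y
  apply tcons_ind y; intro b y
  simp

lemma mulAt_zero_insertAt_one (x : TPow k R (n + 1)) :
    mulAt k (n + 1) 0 (insertAt k 1 (n + 1) 1 x) = x := by
  apply tcons_ind x; intro a y
  rw [insertAt_one, mulAt_zero, mul_one]

lemma mulAt_one_insertAt_one (x : TPow k R (n + 2)) :
    mulAt k (n + 2) 1 (insertAt k 1 (n + 2) 1 x) = x := by
  apply tcons_ind x; intro a y
  apply tcons_ind y; intro b y
  rw [insertAt_one, mulAt_one, one_mul]

lemma mulAt_succ_insertAt_one {n i : ℕ} (x : TPow k R (n + 2)) :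
    mulAt k (n + 2) (i + 2) (insertAt k 1 (n + 2) 1 x) =
      insertAt k 1 (n + 1) 1 (mulAt k (n + 1) (i + 1) x) := by
  apply tcons_ind x; intro a y
  rw [insertAt_one, mulAt_succ, mulAt_succ, mulAt_succ, insertAt_one]

end Algebra

end TensorPowers

/-! ### A criterion for paracyclic modules -/

section Criterion

variable {k : Type*} [CommRing k] {X : ℕ → Type*} [∀ n, AddCommGroup (X n)]
  [∀ n, Module k (X n)] {O : CycOps k X}

lemma CycOps.IsParacyclic.of (bij : ∀ n, Bijective (O.t n))
    (zt : ∀ n x, O.d n 0 (O.t (n + 1) x) = O.d n (Fin.last (n + 1)) x)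
    (dt : ∀ n (i : Fin (n + 1)) x, O.d n i.succ (O.t (n + 1) x) = O.t n (O.d n i.castSucc x))
    (st : ∀ n (i : Fin n) x, O.s n i.succ (O.t n x) = O.t (n + 1) (O.s n i.castSucc x))
    (s0t : ∀ n x, O.s n 0 (O.t n x) = O.t (n + 1) (O.t (n + 1) (O.s n (Fin.last n) x)))
    (dd : ∀ n (j : Fin (n + 1)) x,
      O.d n 0 (O.d (n + 1) j.castSucc.succ x) = O.d n j.castSucc (O.d (n + 1) 0 x))
    (ss : ∀ n (j : Fin (n + 1)) x, O.s (n + 1) 0 (O.s n j x) = O.s (n + 1) j.succ (O.s n 0 x))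
    (lt : ∀ n (j : Fin (n + 1)) x, O.d (n + 1) 0 (O.s (n + 1) j.succ x) = O.s n j (O.d n 0 x))
    (eq : ∀ n x, O.d n 0 (O.s n 0 x) = x) (eq' : ∀ n x, O.d (n + 1) 1 (O.s (n + 1) 0 x) = x)
    (eq0 : ∀ x, O.d 0 1 (O.s 0 0 x) = x)
    (gt : ∀ n (i : Fin n) x, O.d (n + 1) i.succ.castSucc.succ (O.s (n + 1) 0 x) =
      O.s n 0 (O.d n i.succ.castSucc x)) : O.IsParacyclic := by
  have dd' : ∀ n (j : Fin (n + 2)) x, O.d n 0 (O.d (n + 1) j.succ x) = O.d n j (O.d (n + 1) 0 x) := by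
    intro n j x
    induction j using Fin.lastCases with
    | last =>
      rw [Fin.succ_last, ← zt, ← zt]
      have := dd n 0 (O.t (n + 2) x)
      rw [Fin.castSucc_zero] at this
      rw [← this]
      congr 1
      exact dt (n + 1) 0 x
    | cast j => exact dd n j x
  have gt' : ∀ n (i : Fin (n + 1)) x,
      O.d (n + 1) i.succ.succ (O.s (n + 1) 0 x) = O.s n 0 (O.d n i.succ x) := by
    intro n i x
    induction i using Fin.lastCases with
    | last =>
      rw [Fin.succ_last, Fin.succ_last, ← zt, ← zt, ← lt]
      congr 1
      exact (st (n + 1) 0 x).symm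
    | cast i => exact gt n i x
  have surj : ∀ n x, ∃ y, O.t n y = x := fun n x => (bij n).2 x
  refine ⟨?_, ?_, ?_, ?_, ?_, ?_, fun n i => LinearMap.ext (dt n i), fun n => LinearMap.ext (zt n),
    fun n i => LinearMap.ext (st n i), fun n => LinearMap.ext (s0t n), bij⟩
  · intro n i j h
    refine LinearMap.ext fun x => ?_
    simp only [comp_apply]
    induction i using Fin.induction generalizing j x with
    | zero => exact dd' n j x
    | succ i ih =>
      obtain ⟨j, rfl⟩ := Fin.exists_succ_eq.2 (show j ≠ 0 by rintro rfl; exact absurd h (by simp))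
      obtain ⟨y, rfl⟩ := surj _ x
      have := ih j.castSucc (by simpa using h) y
      rw [Fin.succ_castSucc] at this
      rw [dt, dt, this, ← Fin.succ_castSucc i, dt, dt]
  · intro n i j h
    refine LinearMap.ext fun x => ?_
    simp only [comp_apply]
    induction i using Fin.induction generalizing j x with
    | zero => exact ss n j x
    | succ i ih =>
      obtain ⟨j, rfl⟩ := Fin.exists_succ_eq.2 (show j ≠ 0 by rintro rfl; exact absurd h (by simp))
      obtain ⟨y, rfl⟩ := surj _ x
      have := ih j.castSucc (by simpa using h) y
      rw [Fin.succ_castSucc] at this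
      rw [st, st, st, ← Fin.succ_castSucc i, st, this]
  · intro n i j h
    refine LinearMap.ext fun x => ?_
    simp only [comp_apply]
    induction i using Fin.induction generalizing j x with
    | zero => exact lt n j x
    | succ i ih =>
      obtain ⟨j, rfl⟩ := Fin.exists_succ_eq.2 (show j ≠ 0 by rintro rfl; exact absurd h (by simp))
      obtain ⟨y, rfl⟩ := surj _ x
      have := ih j.castSucc (by simpa [Fin.le_iff_val_le_val] using h) y
      rw [Fin.succ_castSucc] at this
      rw [st, dt, st, ← Fin.succ_castSucc i, dt, this]
  · intro n i
    refine LinearMap.ext fun x => ?_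
    simp only [comp_apply]
    induction i using Fin.induction generalizing x with
    | zero => exact eq n x
    | succ i ih =>
      obtain ⟨y, rfl⟩ := surj _ x
      rw [st, ← Fin.succ_castSucc i, dt, ih]
      rfl
  · intro n i
    refine LinearMap.ext fun x => ?_
    simp only [comp_apply]
    induction i using Fin.induction generalizing x with
    | zero =>
      cases n with
      | zero => exact eq0 x
      | succ n => exact eq' n x
    | succ i ih =>
      obtain ⟨y, rfl⟩ := surj _ x
      have := ih y
      rw [Fin.succ_castSucc] at this
      rw [st, dt, this]
      rfl
  · intro n i j h
    refine LinearMap.ext fun x => ?_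
    simp only [comp_apply]
    induction j using Fin.induction generalizing i x with
    | zero =>
      obtain ⟨i, rfl⟩ := Fin.exists_succ_eq.2 (show i ≠ 0 by rintro rfl; exact absurd h (by simp))
      exact gt' n i x
    | succ j ih =>
      obtain ⟨i, rfl⟩ := Fin.exists_succ_eq.2 (show i ≠ 0 by rintro rfl; exact absurd h (by simp))
      obtain ⟨y, rfl⟩ := surj _ x
      have := ih i.castSucc (by simpa [Fin.lt_def] using h) y
      rw [Fin.succ_castSucc] at this
      rw [← Fin.succ_castSucc j, st, dt, dt, st, this]

end Criterion

/-! ### Operators twisted by a coaction -/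

section Twisted

variable {k H : Type*} [CommRing k] [Ring H] [HopfAlgebra k H]
  {Y : Type*} [AddCommGroup Y] [Module k Y] {Y' : Type*} [AddCommGroup Y'] [Module k Y']
  {Z : Type*} [AddCommGroup Z] [Module k Z] {Z' : Type*} [AddCommGroup Z'] [Module k Z']
  {Z'' : Type*} [AddCommGroup Z''] [Module k Z'']

open Coalgebra

/-- `h ⊗ y ↦ y ⊗ V h z`. -/
def twv (Y : Type*) [AddCommGroup Y] [Module k Y] (V : H →ₗ[k] Z →ₗ[k] Z') (z : Z) :
    H ⊗[k] Y →ₗ[k] Y ⊗[k] Z' :=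
  (TensorProduct.comm k Z' Y).toLinearMap ∘ₗ map (V.flip z) 𝟙

@[simp] lemma twv_tmul (V : H →ₗ[k] Z →ₗ[k] Z') (z : Z) (h : H) (y : Y) :
    twv Y V z (h ⊗ₜ y) = y ⊗ₜ V h z := rfl

lemma twv_add (V : H →ₗ[k] Z →ₗ[k] Z') (z z' : Z) (t : H ⊗[k] Y) :
    twv Y V (z + z') t = twv Y V z t + twv Y V z' t := by
  refine t.induction_on (by simp) (fun h y => by simp [tmul_add]) fun x y hx hy => ?_
  simp only [map_add, hx, hy]; abel

lemma twv_smul (V : H →ₗ[k] Z →ₗ[k] Z') (c : k) (z : Z) (t : H ⊗[k] Y) :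
    twv Y V (c • z) t = c • twv Y V z t := by
  refine t.induction_on (by simp) (fun h y => by simp) fun x y hx hy => ?_
  simp only [map_add, hx, hy, smul_add]

/-- `y ⊗ z ↦ y⁽¹⁾ ⊗ V(y⁽⁰⁾) z`. -/
def tws (ρ : Y →ₗ[k] H ⊗[k] Y) (V : H →ₗ[k] Z →ₗ[k] Z') : Y ⊗[k] Z →ₗ[k] Y ⊗[k] Z' :=
  TensorProduct.lift (LinearMap.mk₂ k (fun y z => twv Y V z (ρ y))
    (fun y y' z => by rw [map_add, map_add]) (fun c y z => by rw [map_smul, map_smul])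
    (fun y z z' => twv_add V z z' _) (fun c y z => twv_smul V c z _))

lemma tws_tmul (ρ : Y →ₗ[k] H ⊗[k] Y) (V : H →ₗ[k] Z →ₗ[k] Z') (y : Y) (z : Z) :
    tws ρ V (y ⊗ₜ z) = twv Y V z (ρ y) := rfl

lemma tws_tmul_sum (ρ : Y →ₗ[k] H ⊗[k] Y) (V : H →ₗ[k] Z →ₗ[k] Z') (y : Y) (z : Z)
    {ι : Type*} (s : Finset ι) (p : ι → H) (y' : ι → Y) (h : ρ y = ∑ i ∈ s, p i ⊗ₜ y' i) :
    tws ρ V (y ⊗ₜ z) = ∑ i ∈ s, y' i ⊗ₜ V (p i) z := by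
  rw [tws_tmul, h, map_sum]
  rfl

/-- Post-composition on `Z`. -/
lemma map_tws (ρ : Y →ₗ[k] H ⊗[k] Y) (V : H →ₗ[k] Z →ₗ[k] Z') (f : Z' →ₗ[k] Z'') (x : Y ⊗[k] Z) :
    map 𝟙 f (tws ρ V x) = tws ρ (llcomp k Z Z' Z'' f ∘ₗ V) x := by
  apply tmul_ind x; intro y z
  rw [tws_tmul, tws_tmul]
  generalize ρ y = t
  apply tmul_ind t; intro h y
  rfl

/-- Pre-composition on `Z`. -/
lemma tws_map (ρ : Y →ₗ[k] H ⊗[k] Y) (V : H →ₗ[k] Z' →ₗ[k] Z'') (f : Z →ₗ[k] Z') (x : Y ⊗[k] Z) :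
    tws ρ V (map 𝟙 f x) = tws ρ (lcomp k Z'' f ∘ₗ V) x := by
  apply tmul_ind x; intro y z
  rw [map_tmul, tws_tmul, tws_tmul]
  rfl

/-- Maps of comodules. -/
lemma tws_map_left (ρ : Y →ₗ[k] H ⊗[k] Y) (ρ' : Y' →ₗ[k] H ⊗[k] Y') (f : Y →ₗ[k] Y')
    (hf : ∀ y, ρ' (f y) = map 𝟙 f (ρ y)) (V : H →ₗ[k] Z →ₗ[k] Z') (x : Y ⊗[k] Z) :
    tws ρ' V (map f 𝟙 x) = map f 𝟙 (tws ρ V x) := by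
  apply tmul_ind x; intro y z
  rw [map_tmul, tws_tmul, tws_tmul, hf]
  generalize ρ y = t
  apply tmul_ind t; intro h y
  rfl

/-- `h ↦ ∑ V(h⁽¹⁾) V'(h⁽⁰⁾)`. -/
def twConv (V : H →ₗ[k] Z' →ₗ[k] Z'') (V' : H →ₗ[k] Z →ₗ[k] Z') : H →ₗ[k] Z →ₗ[k] Z'' :=
  TensorProduct.lift ((llcomp k Z Z' Z'').compl₁₂ V V').flip ∘ₗ comul

lemma twConv_apply (V : H →ₗ[k] Z' →ₗ[k] Z'') (V' : H →ₗ[k] Z →ₗ[k] Z') (h : H) {ι : Type*}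
    (r : Repr k h ι) (z : Z) :
    twConv V V' h z = ∑ i ∈ r.index, V (r.right i) (V' (r.left i) z) := by
  rw [twConv, comp_apply, ← r.eq, map_sum, LinearMap.sum_apply]
  rfl

/-- A coassociative and counital left coaction. -/
structure IsCoaction (ρ : Y →ₗ[k] H ⊗[k] Y) : Prop where
  coassoc : ∀ y, map 𝟙 ρ (ρ y) = assoc k H H Y (map comul 𝟙 (ρ y))
  counit : ∀ y, lid k Y (map counit 𝟙 (ρ y)) = y

lemma isCoaction_comul : IsCoaction (comul : H →ₗ[k] H ⊗[k] H) where
  coassoc y := (Coalgebra.coassoc_apply y).symm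
  counit y := by
    have := Coalgebra.rTensor_counit_comul (R := k) y
    rw [show map counit 𝟙 (comul y) = (1 : k) ⊗ₜ[k] y from this]
    simp

lemma tws_tws {ρ : Y →ₗ[k] H ⊗[k] Y} (hρ : IsCoaction ρ) (V : H →ₗ[k] Z' →ₗ[k] Z'')
    (V' : H →ₗ[k] Z →ₗ[k] Z') (x : Y ⊗[k] Z) : tws ρ V (tws ρ V' x) = tws ρ (twConv V V') x := by
  apply tmul_ind x; intro y z
  rw [tws_tmul, tws_tmul]
  let Ω : H ⊗[k] (H ⊗[k] Y) →ₗ[k] Y ⊗[k] Z'' := TensorProduct.lift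
    (LinearMap.mk₂ k (fun p t => twv Y V (V' p z) t)
      (fun p p' t => by rw [map_add, LinearMap.add_apply, twv_add])
      (fun c p t => by rw [map_smul, LinearMap.smul_apply, twv_smul])
      (fun p t t' => map_add _ _ _) (fun c p t => map_smul _ _ _))
  have h1 : ∀ t : H ⊗[k] Y, tws ρ V (twv Y V' z t) = Ω (map 𝟙 ρ t) := by
    intro t
    apply tmul_ind t; intro h y
    rfl
  have h2 : ∀ t : H ⊗[k] Y, twv Y (twConv V V') z t = Ω (assoc k H H Y (map comul 𝟙 t)) := by
    intro t
    apply tmul_ind t; intro h y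
    rw [twv_tmul, twConv_apply V V' h (ℛ k h), map_tmul, ← (ℛ k h).eq,
      sum_tmul, map_sum, map_sum, tmul_sum]
    rfl
  rw [h1, h2, hρ.coassoc]

lemma tws_counit {ρ : Y →ₗ[k] H ⊗[k] Y} (hρ : IsCoaction ρ) (V : H →ₗ[k] Z →ₗ[k] Z')
    (y : Y) (z : Z) (w : Z') (hV : ∀ h, V h z = counit (R := k) h • w) :
    tws ρ V (y ⊗ₜ z) = y ⊗ₜ w := by
  rw [tws_tmul]
  conv_rhs => rw [← hρ.counit y]
  generalize ρ y = t
  apply tmul_ind t; intro h y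
  simp [hV, smul_tmul]

lemma tws_eq_id {ρ : Y →ₗ[k] H ⊗[k] Y} (hρ : IsCoaction ρ) (V : H →ₗ[k] Z →ₗ[k] Z)
    (hV : ∀ h z, V h z = counit (R := k) h • z) (x : Y ⊗[k] Z) : tws ρ V x = x := by
  apply tmul_ind x; intro y z
  exact tws_counit hρ V y z z fun h => hV h z

variable (hS : Bijective (HopfAlgebra.antipode k : H →ₗ[k] H))

@[simp] lemma antipode_antipodeInv (h : H) : HopfAlgebra.antipode k (antipodeInv hS h) = h :=
  (LinearEquiv.ofBijective (HopfAlgebra.antipode k) hS).apply_symm_apply h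

lemma sum_antipodeInv_mul (h : H) {ι : Type*} (r : Repr k h ι) :
    ∑ i ∈ r.index, antipodeInv hS (r.right i) * r.left i = counit (R := k) h • 1 := by
  apply hS.1
  rw [map_sum, map_smul, HopfAlgebra.antipode_one, ← HopfAlgebra.sum_antipode_mul_eq_smul r]
  refine sum_congr rfl fun i _ => ?_
  rw [HopfAlgebra.antipode_mul_antidistrib, antipode_antipodeInv]

lemma sum_mul_antipodeInv (h : H) {ι : Type*} (r : Repr k h ι) :
    ∑ i ∈ r.index, r.right i * antipodeInv hS (r.left i) = counit (R := k) h • 1 := by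
  apply hS.1
  rw [map_sum, map_smul, HopfAlgebra.antipode_one, ← HopfAlgebra.sum_mul_antipode_eq_smul r]
  refine sum_congr rfl fun i _ => ?_
  rw [HopfAlgebra.antipode_mul_antidistrib, antipode_antipodeInv]

lemma counit_antipodeInv (h : H) : counit (R := k) (antipodeInv hS h) = counit (R := k) h := by
  rw [← HopfAlgebra.counit_antipode, antipode_antipodeInv]

end Twisted

lemma tsnoc_ind {k : Type*} [CommRing k] {M : Type*} [AddCommGroup M] [Module k M]
    {C : TPow k M (n + 1) → Prop} (x : TPow k M (n + 1)) (tsnoc : ∀ y a, C (tsnoc y a))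
    (add : ∀ x y, C x → C y → C (x + y) := by
      intro x y hx hy
      simp only [map_add, tcons_add, add_tsnoc, add_tmul, tmul_add, sum_add_distrib, hx, hy]) :
    C x := by
  obtain ⟨x, rfl⟩ := (snocEquiv n).symm.surjective x
  exact tmul_ind (C := fun x => C ((snocEquiv n).symm x)) x (fun a y => tsnoc y a)
    fun x y hx hy => by rw [map_add]; exact add _ _ hx hy

section ASide

open Coalgebra

variable {m n : ℕ} {k H A : Type*} [CommRing k] [Ring H] [HopfAlgebra k H] [Ring A] [Algebra k A]
  [Module H A] [IsScalarTower k H A] {Y : Type*} [AddCommGroup Y] [Module k Y]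

/-- `(x, a) ↦ (a, x)` as an isomorphism. -/
def rotEquiv (k : Type*) [CommRing k] (M : Type*) [AddCommGroup M] [Module k M] (n : ℕ) :
    TPow k M (n + 1) ≃ₗ[k] TPow k M (n + 1) :=
  (snocEquiv n).trans (consEquiv k M n).symm

lemma rotEquiv_apply {M : Type*} [AddCommGroup M] [Module k M] (n : ℕ) (x : TPow k M (n + 1)) :
    rotEquiv k M n x = rot k n x := by
  rw [rotEquiv, LinearEquiv.trans_apply, snocEquiv_apply]; rfl

@[simp] lemma rotEquiv_tsnoc {M : Type*} [AddCommGroup M] [Module k M] (x : TPow k M n)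
    (a : M) : rotEquiv k M n (tsnoc x a) = tcons a x := by
  rw [rotEquiv_apply, rot_tsnoc]

@[simp] lemma rotEquiv_symm_tcons {M : Type*} [AddCommGroup M] [Module k M]
    (x : TPow k M n) (a : M) : (rotEquiv k M n).symm (tcons a x) = tsnoc x a := by
  rw [LinearEquiv.symm_apply_eq, rotEquiv_tsnoc]

variable (k H A) in
/-- The action of `H` on the first entry. -/
def headHom (n : ℕ) : H →ₗ[k] TPow k A (n + 1) →ₗ[k] TPow k A (n + 1) :=
  TensorProduct.curry (headAct k H A n)

@[simp] lemma headHom_tcons (h : H) (a : A) (x : TPow k A n) :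
    headHom k H A n h (tcons a x) = tcons (h • a) x := by
  simp only [headHom, TensorProduct.curry_apply, headAct, comp_apply,
    map_tmul, LinearEquiv.coe_coe, consEquiv_tcons, id_apply,
    assoc_symm_tmul, TensorProduct.lift.tmul]
  rfl

lemma headHom_mul (g h : H) (x : TPow k A (n + 1)) :
    headHom k H A n (g * h) x = headHom k H A n g (headHom k H A n h x) := by
  apply tcons_ind x; intro a x
  simp [mul_smul]

lemma headHom_one (x : TPow k A (n + 1)) : headHom k H A n 1 x = x := by
  apply tcons_ind x; intro a x
  simp

variable (hS : Bijective (HopfAlgebra.antipode k : H →ₗ[k] H))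

/-- `(x, a) ↦ (S⁻¹(h) a, x)`. -/
def tauHom (A : Type*) [Ring A] [Algebra k A] [Module H A] [IsScalarTower k H A] (n : ℕ) :
    H →ₗ[k] TPow k A (n + 1) →ₗ[k] TPow k A (n + 1) :=
  lcomp k _ (rot k n) ∘ₗ headHom k H A n ∘ₗ antipodeInv hS

lemma tauHom_apply (h : H) (z : TPow k A (n + 1)) :
    tauHom hS A n h z = headHom k H A n (antipodeInv hS h) (rot k n z) := rfl

variable (k H A) in
/-- `(a, x) ↦ (x, h a)`. -/
def tauInvHom (n : ℕ) : H →ₗ[k] TPow k A (n + 1) →ₗ[k] TPow k A (n + 1) :=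
  llcomp k _ _ _ (rotEquiv k A n).symm.toLinearMap ∘ₗ headHom k H A n

lemma tauInvHom_apply (h : H) (z : TPow k A (n + 1)) :
    tauInvHom k H A n h z = (rotEquiv k A n).symm (headHom k H A n h z) := rfl

@[simp] lemma tauInvHom_tcons (h : H) (a : A) (x : TPow k A n) :
    tauInvHom k H A n h (tcons a x) = tsnoc x (h • a) := by
  rw [tauInvHom_apply, headHom_tcons, rotEquiv_symm_tcons]

variable (A) in
lemma aOps_t (ρ : Y →ₗ[k] H ⊗[k] Y) (n : ℕ) : (aOps A hS ρ).t n = tws ρ (tauHom hS A n) := by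
  refine ext' fun y z => ?_
  show map 𝟙 _ (assoc k Y H _
    (map ((TensorProduct.comm k H Y).toLinearMap ∘ₗ ρ) (rot k n) (y ⊗ₜ z))) = _
  rw [map_tmul, tws_tmul, comp_apply]
  generalize ρ y = t
  apply tmul_ind t; intro h y
  rfl

variable {ρ : Y →ₗ[k] H ⊗[k] Y} (hρ : IsCoaction ρ)

variable (A) (ρ) in
/-- The inverse of the cyclic operator. -/
def aInv (n : ℕ) : Y ⊗[k] TPow k A (n + 1) →ₗ[k] Y ⊗[k] TPow k A (n + 1) :=
  tws ρ (tauInvHom k H A n)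

include hρ in
lemma aInv_t (n : ℕ) (x : Y ⊗[k] TPow k A (n + 1)) : aInv A ρ n ((aOps A hS ρ).t n x) = x := by
  rw [aOps_t, aInv, tws_tws hρ]
  refine tws_eq_id hρ _ (fun h z => ?_) x
  rw [twConv_apply _ _ h (ℛ k h)]
  simp only [tauInvHom_apply, tauHom_apply, ← headHom_mul]
  rw [← map_sum, ← LinearMap.sum_apply, ← map_sum, sum_mul_antipodeInv, map_smul,
    LinearMap.smul_apply, headHom_one, map_smul, ← rotEquiv_apply, LinearEquiv.symm_apply_apply]

include hρ in
lemma t_aInv (n : ℕ) (x : Y ⊗[k] TPow k A (n + 1)) : (aOps A hS ρ).t n (aInv A ρ n x) = x := by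
  rw [aOps_t, aInv, tws_tws hρ]
  refine tws_eq_id hρ _ (fun h z => ?_) x
  rw [twConv_apply _ _ h (ℛ k h)]
  simp only [tauInvHom_apply, tauHom_apply, ← rotEquiv_apply, LinearEquiv.apply_symm_apply,
    ← headHom_mul]
  rw [← LinearMap.sum_apply, ← map_sum, sum_antipodeInv_mul, map_smul, LinearMap.smul_apply,
    headHom_one]

variable (A) (ρ) in
lemma aOps_d_of_lt (i : Fin (n + 2)) (hi : (i : ℕ) < n + 1) :
    (aOps A hS ρ).d n i = map 𝟙 (mulAt k (n + 1) i) := if_pos hi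

variable (A) (ρ) in
lemma aOps_d_last (n : ℕ) (x : Y ⊗[k] TPow k A (n + 2)) : (aOps A hS ρ).d n (Fin.last (n + 1)) x =
      (aOps A hS ρ).d n 0 ((aOps A hS ρ).t (n + 1) x) := by
  have h1 : (aOps A hS ρ).d n (Fin.last (n + 1)) =
    map 𝟙 (mulAt k (n + 1) 0) ∘ₗ (aOps A hS ρ).t (n + 1) :=
    if_neg (by simp)
  rw [h1, aOps_d_of_lt A hS ρ 0 (by simp)]
  rfl

variable (A) (ρ) in
lemma aOps_s (i : Fin (n + 1)) :
    (aOps A hS ρ).s n i = map 𝟙 (insertAt k 1 (n + 1) (i + 1)) := rfl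

lemma aOps_t_tsnoc_one [IsModuleAlgebra k H A] (hρ : IsCoaction ρ) (y : Y)
    (x : TPow k A n) : (aOps A hS ρ).t n (y ⊗ₜ tsnoc x 1) = y ⊗ₜ tcons 1 x := by
  rw [aOps_t]
  refine tws_counit hρ _ y _ _ fun h => ?_
  rw [tauHom_apply, rot_tsnoc, headHom_tcons, IsModuleAlgebra.smul_one (k := k),
    counit_antipodeInv, smul_tcons]

lemma id_map_tmul {Z Z' : Type*} [AddCommGroup Z] [Module k Z] [AddCommGroup Z'] [Module k Z']
    (f : Z →ₗ[k] Z') (y : Y) (z : Z) : map (𝟙 : Y →ₗ[k] Y) f (y ⊗ₜ z) = y ⊗ₜ f z := rfl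

lemma tensor_map_id_ext {Z Z' : Type*} [AddCommGroup Z] [Module k Z] [AddCommGroup Z']
    [Module k Z'] {f g : Z →ₗ[k] Z'} (h : ∀ z, f z = g z) : map (𝟙 : Y →ₗ[k] Y) f = map 𝟙 g := by
  rw [LinearMap.ext h]

lemma map_id_map_id {Z Z' Z'' : Type*} [AddCommGroup Z] [Module k Z] [AddCommGroup Z']
    [Module k Z'] [AddCommGroup Z''] [Module k Z''] (g : Z' →ₗ[k] Z'') (f : Z →ₗ[k] Z')
    (x : Y ⊗[k] Z) : map (𝟙 : Y →ₗ[k] Y) g (map 𝟙 f x) = map 𝟙 (g ∘ₗ f) x := by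
  rw [← comp_apply, ← TensorProduct.map_comp, LinearMap.id_comp]

lemma tws_congr {Z Z' : Type*} [AddCommGroup Z] [Module k Z] [AddCommGroup Z'] [Module k Z']
    {V V' : H →ₗ[k] Z →ₗ[k] Z'} (h : ∀ g z, V g z = V' g z) (x : Y ⊗[k] Z) :
    tws ρ V x = tws ρ V' x := by
  rw [show V = V' from LinearMap.ext fun g => LinearMap.ext fun z => h g z]

variable [IsModuleAlgebra k H A]

lemma aInv_mulAt_zero (hρ : IsCoaction ρ) (n : ℕ) (x : Y ⊗[k] TPow k A (n + 2)) :
    aInv A ρ n (map 𝟙 (mulAt k (n + 1) 0) x) =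
      map 𝟙 (mulAt k (n + 1) n) (aInv A ρ (n + 1) (aInv A ρ (n + 1) x)) := by
  rw [aInv, aInv, tws_tws hρ, tws_map, map_tws]
  refine tws_congr (fun h z => ?_) x
  simp only [comp_apply, lcomp_apply, llcomp_apply]
  rw [twConv_apply _ _ h (ℛ k h)]
  apply tcons_ind z; intro a z
  apply tcons_ind z; intro b z
  simp only [mulAt_zero, tauInvHom_tcons, tsnoc_tcons, map_sum, mulAt_last]
  have := IsModuleAlgebra.smul_mul (k := k) h a b (ℛ k h)
  rw [this]
  exact map_sum ((snocEquiv n).symm.toLinearMap ∘ₗ (mk k A _).flip z) _ _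

lemma aInv_aInv_insertAt_one (hρ : IsCoaction ρ) (n : ℕ) (x : Y ⊗[k] TPow k A (n + 1)) :
    aInv A ρ (n + 1) (aInv A ρ (n + 1) (map 𝟙 (insertAt k 1 (n + 1) 1) x)) =
      map 𝟙 (insertAt k 1 (n + 1) (n + 1)) (aInv A ρ n x) := by
  rw [aInv, aInv, tws_tws hρ, tws_map, map_tws]
  refine tws_congr (fun h z => ?_) x
  simp only [comp_apply, lcomp_apply, llcomp_apply]
  rw [twConv_apply _ _ h (ℛ k h)]
  apply tcons_ind z; intro a z
  simp only [insertAt_one, tauInvHom_tcons, tsnoc_tcons, insertAt_last,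
    IsModuleAlgebra.smul_one (k := k), tsnoc_smul]
  let f : H →ₗ[k] TPow k A (n + 2) := (snocEquiv (n + 1)).symm.toLinearMap ∘ₗ mk k A _ 1 ∘ₗ
      (snocEquiv n).symm.toLinearMap ∘ₗ (mk k A _).flip z ∘ₗ
        (LinearMap.toSpanSingleton H A a).restrictScalars k
  have hf : ∀ g : H, tsnoc (tsnoc z (g • a)) 1 = f g := fun _ => rfl
  simp only [hf]
  simp only [← map_smul, ← map_sum]
  congr 1
  have := congrArg (rid k H) (sum_tmul_counit_eq (R := k) (ℛ k h))
  simpa only [map_sum, rid_tmul, one_smul] using this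

/-- The operators in the `A`-direction form a paracyclic module. -/
lemma aOps_isParacyclic (hρ : IsCoaction ρ) : (aOps A hS ρ).IsParacyclic := by
  have inj : ∀ n, Injective (aInv A ρ n) := fun n => Function.LeftInverse.injective (t_aInv hS hρ n)
  have surj : ∀ n x, ∃ y, aInv A ρ n y = x := fun n x => ⟨_, aInv_t hS hρ n x⟩
  refine CycOps.IsParacyclic.of
    (fun n => Function.bijective_iff_has_inverse.2 ⟨aInv A ρ n, aInv_t hS hρ n, t_aInv hS hρ n⟩)
    (fun n x => (aOps_d_last A hS ρ n x).symm) ?_ ?_ ?_ ?_ ?_ ?_ ?_ ?_ ?_ ?_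
  · intro n i x
    induction i using Fin.lastCases with
    | last =>
      rw [Fin.succ_last, aOps_d_last, aOps_d_of_lt A hS ρ 0 (by simp),
        aOps_d_of_lt A hS ρ (Fin.last n).castSucc (by simp)]
      apply inj
      rw [Fin.val_zero, aInv_mulAt_zero hρ, aInv_t hS hρ, aInv_t hS hρ, aInv_t hS hρ]
      rfl
    | cast i =>
      rw [aOps_d_of_lt A hS ρ i.castSucc.succ (by simp),
        aOps_d_of_lt A hS ρ i.castSucc.castSucc (by simp), aOps_t, aOps_t, map_tws, tws_map]
      refine tws_congr (fun h z => ?_) x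
      simp only [comp_apply, lcomp_apply, llcomp_apply]
      apply tsnoc_ind z; intro z a
      simp only [tauHom_apply, rot_tsnoc, headHom_tcons, Fin.val_succ, Fin.val_castSucc, mulAt_succ]
      rw [mulAt_tsnoc a i.2, rot_tsnoc, headHom_tcons]
  · intro n i x
    rw [aOps_s, aOps_s, aOps_t, aOps_t, map_tws, tws_map]
    refine tws_congr (fun h z => ?_) x
    simp only [comp_apply, lcomp_apply, llcomp_apply]
    apply tsnoc_ind z; intro z a
    simp only [tauHom_apply, rot_tsnoc, headHom_tcons, Fin.val_succ, Fin.val_castSucc,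
      insertAt_succ]
    rw [insertAt_tsnoc 1 a (by omega), rot_tsnoc, headHom_tcons]
  · intro n x
    apply inj
    apply inj
    rw [aOps_s, aOps_s, Fin.val_zero, aInv_aInv_insertAt_one hρ, aInv_t hS hρ, aInv_t hS hρ,
      aInv_t hS hρ]
    rfl
  · intro n j x
    rw [aOps_d_of_lt A hS ρ 0 (by simp), aOps_d_of_lt A hS ρ 0 (by simp),
      aOps_d_of_lt A hS ρ j.castSucc.succ (by simp; omega), aOps_d_of_lt A hS ρ j.castSucc (by simp; omega),
      map_id_map_id, map_id_map_id]
    exact app_eq (tensor_map_id_ext fun z => mulAt_zero_mulAt z) x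
  · intro n j x
    rw [aOps_s, aOps_s, aOps_s, aOps_s, map_id_map_id, map_id_map_id]
    exact app_eq (tensor_map_id_ext fun z => insertAt_one_insertAt z) x
  · intro n j x
    rw [aOps_s, aOps_s, aOps_d_of_lt A hS ρ 0 (by simp), aOps_d_of_lt A hS ρ 0 (by simp),
      map_id_map_id, map_id_map_id]
    exact app_eq (tensor_map_id_ext fun z => mulAt_zero_insertAt z) x
  · intro n x
    rw [aOps_s, aOps_d_of_lt A hS ρ 0 (by simp), map_id_map_id,
      tensor_map_id_ext (g := 𝟙) fun z => mulAt_zero_insertAt_one z,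
      TensorProduct.map_id]
    rfl
  · intro n x
    rw [aOps_s, aOps_d_of_lt A hS ρ 1 (by simp), map_id_map_id,
      tensor_map_id_ext (g := 𝟙) fun z => mulAt_one_insertAt_one z,
      TensorProduct.map_id]
    rfl
  · intro x
    rw [show (1 : Fin 2) = Fin.last 1 from rfl, aOps_d_last, aOps_s,
      aOps_d_of_lt A hS ρ 0 (by simp)]
    apply tmul_ind x; intro y z
    rw [id_map_tmul, show ((0 : Fin 1) : ℕ) + 1 = 0 + 1 from rfl, insertAt_last, aOps_t_tsnoc_one hS hρ, id_map_tmul]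
    congr 1
    apply tcons_ind z; intro a z
    rw [Fin.val_zero, mulAt_zero, one_mul]
  · intro n i x
    rw [aOps_s, aOps_s, aOps_d_of_lt A hS ρ i.succ.castSucc (by simp),
      aOps_d_of_lt A hS ρ i.succ.castSucc.succ (by simp), map_id_map_id, map_id_map_id]
    exact app_eq (tensor_map_id_ext fun z => mulAt_succ_insertAt_one z) x

end ASide

section HSide

open Coalgebra

variable {m n : ℕ} {k H : Type*} [CommRing k] [Ring H] [HopfAlgebra k H]
  {Z : Type*} [AddCommGroup Z] [Module k Z]

variable (k H Z) in
/-- `((g, G), z) ↦ (G, (g, z))`. -/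
def consSplit (m : ℕ) : TPow k H (m + 1) ⊗[k] Z ≃ₗ[k] TPow k H m ⊗[k] (H ⊗[k] Z) :=
  (TensorProduct.congr ((consEquiv k H m).trans (TensorProduct.comm k H (TPow k H m)))
    (LinearEquiv.refl k Z)).trans (assoc k (TPow k H m) H Z)

variable (k H Z) in
/-- `((G, g), z) ↦ (G, (g, z))`. -/
def snocSplit (m : ℕ) : TPow k H (m + 1) ⊗[k] Z ≃ₗ[k] TPow k H m ⊗[k] (H ⊗[k] Z) :=
  (TensorProduct.congr ((snocEquiv m).trans (TensorProduct.comm k H (TPow k H m)))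
    (LinearEquiv.refl k Z)).trans (assoc k (TPow k H m) H Z)

lemma snocSplit_tsnoc (G : TPow k H m) (g : H) (z : Z) :
    snocSplit k H Z m (tsnoc G g ⊗ₜ z) = G ⊗ₜ (g ⊗ₜ z) := by
  simp [snocSplit, snocEquiv_apply]

/-- `(g, z) ↦ ((g, G), z)`. -/
def tconsMap (G : TPow k H m) : H ⊗[k] Z →ₗ[k] TPow k H (m + 1) ⊗[k] Z :=
  map ((consEquiv k H m).symm.toLinearMap ∘ₗ (mk k H _).flip G)
    𝟙

@[simp] lemma tconsMap_tmul (G : TPow k H m) (g : H) (z : Z) :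
    tconsMap G (g ⊗ₜ[k] z) = tcons g G ⊗ₜ z := rfl

lemma consSplit_symm (G : TPow k H m) (x : H ⊗[k] Z) :
    (consSplit k H Z m).symm (G ⊗ₜ x) = tconsMap G x := by
  apply tmul_ind x; intro g z
  rfl

variable (α : H →ₗ[k] Module.End k Z)

set_option synthInstance.maxHeartbeats 200000 in
lemma hOps_t_eq (m : ℕ) (x : TPow k H (m + 1) ⊗[k] Z) : (hOps α).t m x =
    (consSplit k H Z m).symm (map 𝟙 (tws comul α) (snocSplit k H Z m x)) := by
  refine app_eq (f := (hOps α).t m)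
    (g := (consSplit k H Z m).symm.toLinearMap ∘ₗ map 𝟙 (tws comul α) ∘ₗ
      (snocSplit k H Z m).toLinearMap) (ext' fun G z => ?_) x
  apply tsnoc_ind G; intro G g
  simp only [comp_apply, LinearEquiv.coe_coe, snocSplit_tsnoc, map_tmul,
    id_apply, consSplit_symm, tws_tmul]
  simp only [hOps, comp_apply, LinearEquiv.coe_coe, map_tmul, frontLast_tsnoc, id_apply]
  generalize (comul g : H ⊗[k] H) = t
  apply tmul_ind t; intro p p'
  rfl

lemma hOps_t_tsnoc (G : TPow k H m) (g : H) (z : Z) :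
    (hOps α).t m (tsnoc G g ⊗ₜ z) = tconsMap G (tws comul α (g ⊗ₜ z)) := by
  rw [hOps_t_eq, snocSplit_tsnoc, map_tmul, consSplit_symm]
  rfl

lemma hOps_t_tsnoc_sum (G : TPow k H m) (g : H) (z : Z) {ι : Type*} (r : Repr k g ι) :
    (hOps α).t m (tsnoc G g ⊗ₜ z) = ∑ i ∈ r.index, tcons (r.right i) G ⊗ₜ α (r.left i) z := by
  rw [hOps_t_tsnoc, tws_tmul_sum _ _ _ _ r.index r.left r.right r.eq.symm, map_sum]
  rfl

lemma hOps_t_tsnoc_mul (G : TPow k H m) (g h : H) (z : Z) {ι : Type*} (r : Repr k g ι)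
    {ι' : Type*} (r' : Repr k h ι') :
    (hOps α).t m (tsnoc G (g * h) ⊗ₜ z) = ∑ i ∈ r.index, ∑ j ∈ r'.index,
      tcons (r.right i * r'.right j) G ⊗ₜ α (r.left i * r'.left j) z := by
  rw [hOps_t_tsnoc, tws_tmul, Bialgebra.comul_mul, ← r.eq, ← r'.eq, Finset.sum_mul_sum]
  simp only [map_sum, Algebra.TensorProduct.tmul_mul_tmul, twv_tmul, tconsMap_tmul]

lemma hOps_d_of_lt (i : Fin (m + 2)) (hi : (i : ℕ) < m + 1) :
    (hOps α).d m i = map (mulAt k (m + 1) i) 𝟙 := if_pos hi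

lemma hOps_d_last (m : ℕ) (x : TPow k H (m + 2) ⊗[k] Z) :
    (hOps α).d m (Fin.last (m + 1)) x = (hOps α).d m 0 ((hOps α).t (m + 1) x) := by
  have h1 : (hOps α).d m (Fin.last (m + 1)) = map (mulAt k (m + 1) 0) 𝟙 ∘ₗ (hOps α).t (m + 1) :=
    if_neg (by simp)
  rw [h1, hOps_d_of_lt α 0 (by simp)]
  rfl

lemma hOps_s (i : Fin (m + 1)) :
    (hOps α).s m i = map (insertAt k 1 (m + 1) (i + 1)) 𝟙 := rfl

lemma tensor_map_ext_id {Y Y' : Type*} [AddCommGroup Y] [Module k Y] [AddCommGroup Y']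
    [Module k Y'] {f g : Y →ₗ[k] Y'} (h : ∀ z, f z = g z) : map f (𝟙 : Z →ₗ[k] Z) = map g 𝟙 := by
  rw [LinearMap.ext h]

lemma map_map_id_id {Y Y' Y'' : Type*} [AddCommGroup Y] [Module k Y] [AddCommGroup Y']
    [Module k Y'] [AddCommGroup Y''] [Module k Y''] (g : Y' →ₗ[k] Y'') (f : Y →ₗ[k] Y')
    (x : Y ⊗[k] Z) : map g (𝟙 : Z →ₗ[k] Z) (map f 𝟙 x) = map (g ∘ₗ f) 𝟙 x := by
  rw [← comp_apply, ← TensorProduct.map_comp, LinearMap.id_comp]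

/-- Induction on `(G, g) ⊗ z`. -/
lemma tsnoc_tmul_ind {C : TPow k H (m + 1) ⊗[k] Z → Prop}
    (x : TPow k H (m + 1) ⊗[k] Z) (tmul : ∀ G g z, C (tsnoc G g ⊗ₜ z))
    (add : ∀ x y, C x → C y → C (x + y) := by
      intro x y hx hy
      simp only [map_add, tcons_add, add_tsnoc, add_tmul, tmul_add, sum_add_distrib, hx, hy]) :
    C x :=
  tmul_ind x (fun G z => tsnoc_ind (C := fun G => C (G ⊗ₜ z)) G (fun G g => tmul G g z)
    fun x y hx hy => by rw [add_tmul]; exact add _ _ hx hy) add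

variable (α : H →ₐ[k] Module.End k Z)

lemma tws_bijective (hS : Bijective (HopfAlgebra.antipode k : H →ₗ[k] H))
    {Y : Type*} [AddCommGroup Y] [Module k Y] {ρ : Y →ₗ[k] H ⊗[k] Y} (hρ : IsCoaction ρ) :
    Bijective (tws ρ α.toLinearMap : Y ⊗[k] Z →ₗ[k] Y ⊗[k] Z) := by
  refine Function.bijective_iff_has_inverse.2
    ⟨tws ρ (α.toLinearMap ∘ₗ antipodeInv hS), fun x => ?_, fun x => ?_⟩
  all_goals
    rw [tws_tws hρ]
    refine tws_eq_id hρ _ (fun h z => ?_) x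
    rw [twConv_apply _ _ h (ℛ k h)]
    simp only [comp_apply, AlgHom.toLinearMap_apply, ← Module.End.mul_apply, ← map_mul]
    rw [← LinearMap.sum_apply, ← map_sum]
  · rw [sum_antipodeInv_mul, map_smul, map_one]; rfl
  · rw [sum_mul_antipodeInv, map_smul, map_one]; rfl

lemma hOps_t_tsnoc_one (G : TPow k H m) (z : Z) :
    (hOps α.toLinearMap).t m (tsnoc G 1 ⊗ₜ z) = tcons 1 G ⊗ₜ z := by
  rw [hOps_t_tsnoc, tws_tmul, Bialgebra.comul_one, Algebra.TensorProduct.one_def, twv_tmul,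
    AlgHom.toLinearMap_apply, map_one]
  rfl

/-- The operators in the `H`-direction form a paracyclic module. -/
lemma hOps_isParacyclic (hS : Bijective (HopfAlgebra.antipode k : H →ₗ[k] H)) :
    (hOps α.toLinearMap).IsParacyclic := by
  refine CycOps.IsParacyclic.of ?_
    (fun n x => (hOps_d_last _ n x).symm) ?_ ?_ ?_ ?_ ?_ ?_ ?_ ?_ ?_ ?_
  · intro m
    have : ⇑((hOps α.toLinearMap).t m) = (consSplit k H Z m).symm ∘
        TensorProduct.congr (LinearEquiv.refl k (TPow k H m))
          (LinearEquiv.ofBijective _ (tws_bijective α hS isCoaction_comul)) ∘ (snocSplit k H Z m) :=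
      funext fun x => hOps_t_eq _ m x
    rw [this]
    exact (LinearEquiv.bijective _).comp ((LinearEquiv.bijective _).comp (LinearEquiv.bijective _))
  · intro m i x
    apply tsnoc_tmul_ind x; intro G g z
    rw [hOps_t_tsnoc_sum _ _ _ _ (ℛ k g), map_sum]
    induction i using Fin.lastCases with
    | last =>
      apply tsnoc_ind G ?_ ?_; swap
      · intro x y hx hy
        simp only [add_tsnoc, add_tmul, tcons_add, map_add, ← hx, ← hy, sum_add_distrib]
      intro G h
      rw [hOps_d_of_lt _ (Fin.last m).castSucc (by simp), map_tmul]
      simp only [Fin.succ_last, hOps_d_last, ← tsnoc_tcons]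
      simp only [hOps_t_tsnoc_sum _ _ _ _ (ℛ k h), hOps_d_of_lt _ 0 (Nat.succ_pos _), map_sum,
        map_tmul, Fin.val_zero, mulAt_zero]
      rw [Fin.val_castSucc, Fin.val_last, mulAt_last,
        hOps_t_tsnoc_mul _ _ _ _ _ (ℛ k h) (ℛ k g), sum_comm]
      simp only [AlgHom.toLinearMap_apply, map_mul]
      rfl
    | cast i =>
      rw [hOps_d_of_lt _ i.castSucc.succ (by simp), hOps_d_of_lt _ i.castSucc.castSucc (by simp),
        map_tmul, Fin.val_castSucc, Fin.val_castSucc, mulAt_tsnoc _ i.2,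
        hOps_t_tsnoc_sum _ _ _ _ (ℛ k g)]
      refine sum_congr rfl fun j _ => ?_
      rw [map_tmul, Fin.val_succ, Fin.val_castSucc, mulAt_succ]
      rfl
  · intro n i x
    apply tsnoc_tmul_ind x; intro G g z
    rw [hOps_s, hOps_s, map_tmul, Fin.val_castSucc, insertAt_tsnoc 1 g (by omega),
      hOps_t_tsnoc_sum _ _ _ _ (ℛ k g), hOps_t_tsnoc_sum _ _ _ _ (ℛ k g), map_sum]
    refine sum_congr rfl fun j _ => ?_
    rw [map_tmul, Fin.val_succ, insertAt_succ]
    rfl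
  · intro n x
    apply tsnoc_tmul_ind x; intro G g z
    rw [hOps_s, hOps_s, map_tmul, Fin.val_last, insertAt_last, hOps_t_tsnoc_one,
      ← tsnoc_tcons, hOps_t_tsnoc_sum _ _ _ _ (ℛ k g), hOps_t_tsnoc_sum _ _ _ _ (ℛ k g), map_sum]
    refine sum_congr rfl fun j _ => ?_
    rw [map_tmul, Fin.val_zero, insertAt_one]
    rfl
  · intro n j x
    rw [hOps_d_of_lt _ 0 (by simp), hOps_d_of_lt _ 0 (by simp),
      hOps_d_of_lt _ j.castSucc.succ (by simp; omega), hOps_d_of_lt _ j.castSucc (by simp; omega),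
      map_map_id_id, map_map_id_id]
    exact app_eq (tensor_map_ext_id fun z => mulAt_zero_mulAt z) x
  · intro n j x
    rw [hOps_s, hOps_s, hOps_s, hOps_s, map_map_id_id, map_map_id_id]
    exact app_eq (tensor_map_ext_id fun z => insertAt_one_insertAt z) x
  · intro n j x
    rw [hOps_s, hOps_s, hOps_d_of_lt _ 0 (by simp), hOps_d_of_lt _ 0 (by simp),
      map_map_id_id, map_map_id_id]
    exact app_eq (tensor_map_ext_id fun z => mulAt_zero_insertAt z) x
  · intro n x
    rw [hOps_s, hOps_d_of_lt _ 0 (by simp), map_map_id_id,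
      tensor_map_ext_id (g := 𝟙) fun z => mulAt_zero_insertAt_one z,
      TensorProduct.map_id]
    rfl
  · intro n x
    rw [hOps_s, hOps_d_of_lt _ 1 (by simp), map_map_id_id,
      tensor_map_ext_id (g := 𝟙) fun z => mulAt_one_insertAt_one z,
      TensorProduct.map_id]
    rfl
  · intro x
    rw [show (1 : Fin 2) = Fin.last 1 from rfl, hOps_d_last, hOps_s,
      hOps_d_of_lt _ 0 (by simp)]
    apply tmul_ind x; intro y z
    rw [map_tmul, show ((0 : Fin 1) : ℕ) + 1 = 0 + 1 from rfl, insertAt_last,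
      id_apply, hOps_t_tsnoc_one, map_tmul, id_apply]
    congr 1
    apply tcons_ind y; intro a z
    rw [Fin.val_zero, mulAt_zero, one_mul]
  · intro n i x
    rw [hOps_s, hOps_s, hOps_d_of_lt _ i.succ.castSucc (by simp),
      hOps_d_of_lt _ i.succ.castSucc.succ (by simp), map_map_id_id, map_map_id_id]
    exact app_eq (tensor_map_ext_id fun z => mulAt_succ_insertAt_one z) x

end HSide

section CoactDiag

open Coalgebra

variable {m n : ℕ} {k H A : Type*} [CommRing k] [Ring H] [HopfAlgebra k H] [Ring A] [Algebra k A]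
  [Module H A] [IsScalarTower k H A]

/-! ### The coaction on `H^{⊗m}` -/

variable (k H) in
/-- `(p ⊗ q) ⊗ (p' ⊗ G) ↦ p p' ⊗ (q, G)`. -/
def coactMul (m : ℕ) :
    (H ⊗[k] H) ⊗[k] (H ⊗[k] TPow k H m) →ₗ[k] H ⊗[k] TPow k H (m + 1) :=
  map (LinearMap.mul' k H) (consEquiv k H m).symm.toLinearMap ∘ₗ
    (tensorTensorTensorComm k H H H (TPow k H m)).toLinearMap

@[simp] lemma coactMul_tmul (p q p' : H) (G : TPow k H m) :
    coactMul k H m ((p ⊗ₜ q) ⊗ₜ (p' ⊗ₜ G)) = (p * p') ⊗ₜ tcons q G := rfl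

lemma coact_tcons (g : H) (G : TPow k H m) :
    coact k H (m + 1) (tcons g G) = coactMul k H m (comul g ⊗ₜ coact k H m G) := by
  simp only [coact, coactMul, comp_apply, LinearEquiv.coe_coe, consEquiv_tcons, map_tmul]

/-- Equality of linear maps on `(X ⊗ Y) ⊗ (X' ⊗ Y')`, tested on pure tensors. -/
lemma fourfold_congr {X Y X' Y' N : Type*} [AddCommGroup X] [Module k X] [AddCommGroup Y]
    [Module k Y] [AddCommGroup X'] [Module k X'] [AddCommGroup Y'] [Module k Y'] [AddCommGroup N]
    [Module k N] (f g : (X ⊗[k] Y) ⊗[k] (X' ⊗[k] Y') →ₗ[k] N)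
    (h : ∀ p q p' q', f ((p ⊗ₜ q) ⊗ₜ (p' ⊗ₜ q')) = g ((p ⊗ₜ q) ⊗ₜ (p' ⊗ₜ q')))
    (t : (X ⊗[k] Y) ⊗[k] (X' ⊗[k] Y')) : f t = g t :=
  app_eq (TensorProduct.ext_fourfold' h) t

variable (k H) in
/-- `(p ⊗ t) ⊗ (p' ⊗ s) ↦ p p' ⊗ coactMul (t ⊗ s)`. -/
def coactMul₂ (m : ℕ) :
    (H ⊗[k] (H ⊗[k] H)) ⊗[k] (H ⊗[k] (H ⊗[k] TPow k H m)) →ₗ[k] H ⊗[k] (H ⊗[k] TPow k H (m + 1)) :=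
  map (LinearMap.mul' k H) (coactMul k H m) ∘ₗ
    (tensorTensorTensorComm k H (H ⊗[k] H) H (H ⊗[k] TPow k H m)).toLinearMap

lemma coactMul₂_tmul (p p' : H) (t : H ⊗[k] H) (s : H ⊗[k] TPow k H m) :
    coactMul₂ k H m ((p ⊗ₜ t) ⊗ₜ (p' ⊗ₜ s)) = (p * p') ⊗ₜ coactMul k H m (t ⊗ₜ s) := rfl

lemma coactMul_map_right {m m' : ℕ} (f : TPow k H m →ₗ[k] TPow k H m')
    (f' : TPow k H (m + 1) →ₗ[k] TPow k H (m' + 1)) (hf : ∀ g G, f' (tcons g G) = tcons g (f G))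
    (t : H ⊗[k] H) (s : H ⊗[k] TPow k H m) : map 𝟙 f' (coactMul k H m (t ⊗ₜ s)) =
      coactMul k H m' (t ⊗ₜ map 𝟙 f s) :=
  fourfold_congr (map 𝟙 f' ∘ₗ coactMul k H m)
    (coactMul k H m' ∘ₗ map 𝟙 (map 𝟙 f))
    (fun p q p' G => by simp only [comp_apply, map_tmul, id_apply, coactMul_tmul, hf]) _

lemma isCoaction_coact : ∀ m : ℕ, IsCoaction (coact k H m)
  | 0 => by
    refine ⟨fun y => ?_, fun y => ?_⟩
    · simp only [coact, mk_apply, map_tmul, Bialgebra.comul_one, Algebra.TensorProduct.one_def]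
      rfl
    · simp [coact]
  | m + 1 => by
    have ih := isCoaction_coact m
    refine ⟨fun y => ?_, fun y => ?_⟩
    · apply tcons_ind y; intro g G
      have h1 : ∀ (t : H ⊗[k] H) (s : H ⊗[k] TPow k H m),
          map 𝟙 (coact k H (m + 1)) (coactMul k H m (t ⊗ₜ s)) = coactMul₂ k H m (map 𝟙 comul t ⊗ₜ
              map 𝟙 (coact k H m) s) := fun t s =>
        fourfold_congr (map 𝟙 (coact k H (m + 1)) ∘ₗ coactMul k H m)
          (coactMul₂ k H m ∘ₗ map (map 𝟙 comul) (map 𝟙 (coact k H m)))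
          (fun p q p' G => by simp only [comp_apply, map_tmul, id_apply,
              coactMul_tmul, coact_tcons, coactMul₂_tmul]) _
      have h2 : ∀ (t : H ⊗[k] H) (s : H ⊗[k] TPow k H m),
          assoc k H H _ (map comul 𝟙 (coactMul k H m (t ⊗ₜ s))) =
            coactMul₂ k H m (assoc k H H _ (map comul 𝟙 t) ⊗ₜ
              assoc k H H _ (map comul 𝟙 s)) := fun t s =>
        fourfold_congr ((assoc k H H _).toLinearMap ∘ₗ map comul 𝟙 ∘ₗ coactMul k H m)
          (coactMul₂ k H m ∘ₗ map ((assoc k H H _).toLinearMap ∘ₗ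
            map comul 𝟙) ((assoc k H H _).toLinearMap ∘ₗ map comul 𝟙))
          (fun p q p' G => by
            simp only [comp_apply, map_tmul, id_apply,
              coactMul_tmul, Bialgebra.comul_mul, LinearEquiv.coe_coe]
            rw [← (ℛ k p).eq, ← (ℛ k p').eq, Finset.sum_mul_sum]
            simp only [sum_tmul, tmul_sum, map_sum,
              Algebra.TensorProduct.tmul_mul_tmul, assoc_tmul, coactMul₂_tmul, coactMul_tmul]
            exact sum_comm) _
      rw [coact_tcons, h1, h2, ← ih.coassoc, ← isCoaction_comul.coassoc]
    · apply tcons_ind y; intro g G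
      have h1 : ∀ (t : H ⊗[k] H) (s : H ⊗[k] TPow k H m),
          lid k _ (map counit 𝟙 (coactMul k H m (t ⊗ₜ s))) =
            (consEquiv k H m).symm (lid k _ (map counit 𝟙 t) ⊗ₜ
              lid k _ (map counit 𝟙 s)) := fun t s =>
        fourfold_congr ((lid k _).toLinearMap ∘ₗ map counit 𝟙 ∘ₗ coactMul k H m)
          ((consEquiv k H m).symm.toLinearMap ∘ₗ map ((lid k _).toLinearMap ∘ₗ map counit 𝟙)
            ((lid k _).toLinearMap ∘ₗ map counit 𝟙))
          (fun p q p' G => by simp only [comp_apply, map_tmul, id_apply,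
              coactMul_tmul, LinearEquiv.coe_coe, lid_tmul, consEquiv_symm_tmul,
              Bialgebra.counit_mul, smul_tcons, tcons_smul, smul_smul, mul_comm (counit p')]) _
      rw [coact_tcons, h1, ih.counit, isCoaction_comul.counit, consEquiv_symm_tmul]

lemma coact_mulAt : ∀ (m i : ℕ) (G : TPow k H (m + 1)), i < m →
    coact k H m (mulAt k m i G) = map 𝟙 (mulAt k m i) (coact k H (m + 1) G)
  | 0, i, _, h => absurd h (by omega)
  | m + 1, 0, G, _ => by
    apply tcons_ind G; intro g G
    apply tcons_ind G; intro h G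
    rw [mulAt_zero, coact_tcons, coact_tcons, coact_tcons, Bialgebra.comul_mul]
    generalize (comul g : H ⊗[k] H) = t
    refine fourfold_congr (coactMul k H m ∘ₗ map (mulLeft k t) 𝟙)
      (map 𝟙 (mulAt k (m + 1) 0) ∘ₗ coactMul k H (m + 1) ∘ₗ
        mk k _ _ t ∘ₗ coactMul k H m) (fun p q p' G => ?_) (comul h ⊗ₜ coact k H m G)
    simp only [comp_apply, map_tmul, id_apply, mulLeft_apply, mk_apply, coactMul_tmul]
    refine t.induction_on (by simp) (fun r s => by simp [mul_assoc]) fun x y hx hy => ?_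
    simp only [add_tmul, add_mul, map_add, hx, hy]
  | m + 1, i + 1, G, hi => by
    apply tcons_ind G; intro g G
    rw [mulAt_succ, coact_tcons, coact_tcons, coact_mulAt m i G (by omega),
      coactMul_map_right (mulAt k m i) _ fun g G => mulAt_succ i g G]

lemma coact_insertAt : ∀ (m i : ℕ) (G : TPow k H m), i ≤ m →
    coact k H (m + 1) (insertAt k 1 m i G) = map 𝟙 (insertAt k 1 m i) (coact k H m G)
  | m, 0, G, _ => by
    rw [insertAt_zero, coact_tcons, Bialgebra.comul_one, Algebra.TensorProduct.one_def]
    generalize coact k H m G = s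
    apply tmul_ind s; intro p G
    simp
  | 0, i + 1, _, h => absurd h (by omega)
  | m + 1, i + 1, G, hi => by
    apply tcons_ind G; intro g G
    rw [insertAt_succ, coact_tcons, coact_tcons, coact_insertAt m i G (by omega),
      coactMul_map_right (insertAt k 1 m i) _ fun g G => insertAt_succ 1 g i G]

variable (k H) in
/-- `(p ⊗ G) ⊗ (p' ⊗ q) ↦ p p' ⊗ (G, q)`. -/
def coactMulLast (m : ℕ) :
    (H ⊗[k] TPow k H m) ⊗[k] (H ⊗[k] H) →ₗ[k] H ⊗[k] TPow k H (m + 1) :=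
  map (LinearMap.mul' k H)
    ((snocEquiv m).symm.toLinearMap ∘ₗ (TensorProduct.comm k _ _).toLinearMap) ∘ₗ
    (tensorTensorTensorComm k H (TPow k H m) H H).toLinearMap

@[simp] lemma coactMulLast_tmul (p q p' : H) (G : TPow k H m) :
    coactMulLast k H m ((p ⊗ₜ G) ⊗ₜ (p' ⊗ₜ q)) = (p * p') ⊗ₜ tsnoc G q := rfl

lemma coact_tsnoc : ∀ {m : ℕ} (G : TPow k H m) (g : H),
    coact k H (m + 1) (tsnoc G g) = coactMulLast k H m (coact k H m G ⊗ₜ comul g)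
  | 0, G, g => by
    rw [tsnoc_zero, coact_tcons, show coact k H 0 G = (1 : H) ⊗ₜ G from rfl]
    generalize (comul g : H ⊗[k] H) = t
    apply tmul_ind t; intro p q
    simp [tsnoc_zero]
  | m + 1, G, g => by
    apply tcons_ind G; intro h G
    rw [tsnoc_tcons, coact_tcons, coact_tcons, coact_tsnoc]
    generalize (comul h : H ⊗[k] H) = t
    refine fourfold_congr (coactMul k H (m + 1) ∘ₗ mk k _ _ t ∘ₗ coactMulLast k H m)
      (coactMulLast k H (m + 1) ∘ₗ map (coactMul k H m ∘ₗ mk k _ _ t)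
        𝟙) (fun p q p' G => ?_) (coact k H m G ⊗ₜ comul g)
    simp only [comp_apply, map_tmul, id_apply, mk_apply, coactMulLast_tmul]
    apply tmul_ind t; intro r s
    simp [mul_assoc]

/-! ### The diagonal action -/

lemma diagAct_tcons (h : H) (a : A) (x : TPow k A n) {ι : Type*} (r : Repr k h ι) :
    diagAct k H A (n + 1) h (tcons a x) =
      ∑ i ∈ r.index, tcons (r.left i • a) (diagAct k H A n (r.right i) x) := by
  have h1 : diagAct k H A (n + 1) h (tcons a x) = (consEquiv k A n).symm
      (Module.endTensorEndAlgHom (R := k) (S := k) (A := k) (M := A) (N := TPow k A n)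
        (Algebra.TensorProduct.map (Algebra.lsmul k k A) (diagAct k H A n) (comul h))
        (consEquiv k A n (tcons a x))) := rfl
  rw [h1, consEquiv_tcons, ← r.eq, map_sum, map_sum, LinearMap.sum_apply, map_sum]
  rfl

lemma coassoc_sum {N : Type*} [AddCommGroup N] [Module k N] (Φ : H ⊗[k] (H ⊗[k] H) →ₗ[k] N)
    (h : H) : ∑ i ∈ (ℛ k h).index, ∑ j ∈ (ℛ k ((ℛ k h).left i)).index,
      Φ ((ℛ k ((ℛ k h).left i)).left j ⊗ₜ ((ℛ k ((ℛ k h).left i)).right j ⊗ₜ (ℛ k h).right i)) =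
    ∑ i ∈ (ℛ k h).index, ∑ j ∈ (ℛ k ((ℛ k h).right i)).index,
      Φ ((ℛ k h).left i ⊗ₜ ((ℛ k ((ℛ k h).right i)).left j ⊗ₜ
        (ℛ k ((ℛ k h).right i)).right j)) := by
  have := congrArg Φ (sum_tmul_tmul_eq (ℛ k h) (fun i => ℛ k ((ℛ k h).left i))
    (fun i => ℛ k ((ℛ k h).right i)))
  simpa only [map_sum] using this

variable (k H) in
/-- `h ↦ h a`. -/
def smulMap (a : A) : H →ₗ[k] A :=
  (LinearMap.toSpanSingleton H A a).restrictScalars k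

variable (k H) in
/-- `h ↦ h x` for the diagonal action. -/
def diagMap (x : TPow k A n) : H →ₗ[k] TPow k A n :=
  (diagAct k H A n).toLinearMap.flip x

lemma diagAct_zero (h : H) (x : TPow k A 0) : diagAct k H A 0 h x = counit (R := k) h • x := rfl

lemma diagAct_tsnoc : ∀ {n : ℕ} (h : H) (x : TPow k A n) (a : A),
    diagAct k H A (n + 1) h (tsnoc x a) =
      ∑ i ∈ (ℛ k h).index, tsnoc (diagAct k H A n ((ℛ k h).left i) x) ((ℛ k h).right i • a)
  | 0, h, x, a => by
    rw [tsnoc_zero, diagAct_tcons h a x (ℛ k h)]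
    simp only [diagAct_zero, tcons_smul, tsnoc_zero]
    have h1 : ∀ g : H, tcons (g • a) x =
      ((consEquiv k A 0).symm.toLinearMap ∘ₗ (mk k A _).flip x ∘ₗ smulMap k H a) g :=
      fun g => rfl
    simp only [h1, ← map_smul, ← map_sum]
    congr 1
    have := congrArg (rid k H) (sum_tmul_counit_eq (R := k) (ℛ k h))
    simp only [map_sum, rid_tmul, one_smul] at this
    rw [this, sum_counit_smul]
  | n + 1, h, x, a => by
    apply tcons_ind x; intro b x
    rw [tsnoc_tcons, diagAct_tcons h b _ (ℛ k h)]
    let Φ : H ⊗[k] (H ⊗[k] H) →ₗ[k] TPow k A (n + 2) := (consEquiv k A (n + 1)).symm.toLinearMap ∘ₗ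
      map (smulMap k H b) ((snocEquiv n).symm.toLinearMap ∘ₗ
        (TensorProduct.comm k _ _).toLinearMap ∘ₗ map (diagMap k H x) (smulMap k H a))
    have hΦ : ∀ p q r : H, Φ (p ⊗ₜ (q ⊗ₜ r)) =
      tcons (p • b) (tsnoc (diagAct k H A n q x) (r • a)) := fun _ _ _ => rfl
    have key := coassoc_sum Φ h
    simp only [hΦ] at key
    refine Eq.trans ?_ (key.symm.trans ?_)
    · refine sum_congr rfl fun i _ => ?_
      rw [diagAct_tsnoc]
      exact map_sum ((consEquiv k A (n + 1)).symm.toLinearMap ∘ₗ mk k A _ _) _ _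
    · refine sum_congr rfl fun i _ => ?_
      rw [diagAct_tcons _ b x (ℛ k ((ℛ k h).left i))]
      simp only [← tsnoc_tcons]
      exact (map_sum ((snocEquiv (n + 1)).symm.toLinearMap ∘ₗ mk k A _ _) _ _).symm

section ModuleAlgebra

variable [IsModuleAlgebra k H A]

lemma diagAct_mulAt : ∀ (n i : ℕ) (h : H) (x : TPow k A (n + 1)), i < n →
    diagAct k H A n h (mulAt k n i x) = mulAt k n i (diagAct k H A (n + 1) h x)
  | 0, i, _, _, h => absurd h (by omega)
  | n + 1, 0, h, x, _ => by
    apply tcons_ind x; intro a x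
    apply tcons_ind x; intro b x
    let Φ : H ⊗[k] (H ⊗[k] H) →ₗ[k] TPow k A (n + 1) := mulAt k (n + 1) 0 ∘ₗ
      (consEquiv k A (n + 1)).symm.toLinearMap ∘ₗ map (smulMap k H a)
        ((consEquiv k A n).symm.toLinearMap ∘ₗ map (smulMap k H b) (diagMap k H x))
    have hΦ : ∀ p q r : H, Φ (p ⊗ₜ (q ⊗ₜ r)) =
        tcons ((p • a) * (q • b)) (diagAct k H A n r x) := fun p q r => by
      rw [← mulAt_zero]; rfl
    have key := coassoc_sum Φ h
    simp only [hΦ] at key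
    rw [mulAt_zero, diagAct_tcons h _ _ (ℛ k h), diagAct_tcons h _ _ (ℛ k h), map_sum]
    refine Eq.trans ?_ (key.trans ?_)
    · refine sum_congr rfl fun i _ => ?_
      rw [IsModuleAlgebra.smul_mul (k := k) _ _ _ (ℛ k ((ℛ k h).left i))]
      exact map_sum ((consEquiv k A n).symm.toLinearMap ∘ₗ (mk k A _).flip _) _ _
    · refine sum_congr rfl fun i _ => ?_
      rw [diagAct_tcons _ b x (ℛ k ((ℛ k h).right i))]
      simp only [← mulAt_zero]
      exact (map_sum (mulAt k (n + 1) 0 ∘ₗ (consEquiv k A (n + 1)).symm.toLinearMap ∘ₗ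
        mk k A _ _) _ _).symm
  | n + 1, i + 1, h, x, hi => by
    apply tcons_ind x; intro a x
    rw [mulAt_succ, diagAct_tcons h a _ (ℛ k h), diagAct_tcons h a _ (ℛ k h), map_sum]
    refine sum_congr rfl fun j _ => ?_
    rw [mulAt_succ, diagAct_mulAt n i _ x (by omega)]

lemma diagAct_insertAt : ∀ (n i : ℕ) (h : H) (x : TPow k A n), i ≤ n →
    diagAct k H A (n + 1) h (insertAt k 1 n i x) = insertAt k 1 n i (diagAct k H A n h x)
  | n, 0, h, x, _ => by
    rw [insertAt_zero, insertAt_zero, diagAct_tcons h 1 x (ℛ k h)]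
    simp only [IsModuleAlgebra.smul_one (k := k), smul_tcons, ← tcons_smul]
    have h1 : ∀ (c : k) (g : H), tcons (1 : A) (c • diagAct k H A n g x) =
      ((consEquiv k A n).symm.toLinearMap ∘ₗ mk k A _ 1 ∘ₗ diagMap k H x) (c • g) :=
      fun c g => by rw [map_smul, tcons_smul]; rfl
    simp only [h1, ← map_sum]
    rw [sum_counit_smul]
    rfl
  | 0, i + 1, _, _, h => absurd h (by omega)
  | n + 1, i + 1, h, x, hi => by
    apply tcons_ind x; intro a x
    rw [insertAt_succ, diagAct_tcons h a _ (ℛ k h), diagAct_tcons h a _ (ℛ k h), map_sum]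
    refine sum_congr rfl fun j _ => ?_
    rw [insertAt_succ, diagAct_insertAt n i _ x (by omega)]

end ModuleAlgebra

/-- `∑ h⁽¹⁾ V(x h⁽⁰⁾) = ∑ V(h⁽¹⁾ x) h⁽⁰⁾` for `V(h) (a, w) = (w, h a)`. -/
lemma twConv_diagAct_tauInvHom (x h : H) (z : TPow k A (n + 1)) :
    twConv (diagAct k H A (n + 1)).toLinearMap (tauInvHom k H A n ∘ₗ mulLeft k x) h z =
      twConv (tauInvHom k H A n ∘ₗ mulRight k x) (diagAct k H A (n + 1)).toLinearMap h z := by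
  rw [twConv_apply _ _ h (ℛ k h), twConv_apply _ _ h (ℛ k h)]
  apply tcons_ind z; intro a w
  simp only [comp_apply, AlgHom.toLinearMap_apply, mulLeft_apply,
    LinearMap.mulRight_apply, tauInvHom_tcons]
  let Φ : H ⊗[k] (H ⊗[k] H) →ₗ[k] TPow k A (n + 1) := (snocEquiv n).symm.toLinearMap ∘ₗ
    (TensorProduct.comm k _ _).toLinearMap ∘ₗ map (diagMap k H w)
      (smulMap k H a ∘ₗ LinearMap.mul' k H ∘ₗ (TensorProduct.comm k _ _).toLinearMap ∘ₗ
        map (mulLeft k x) 𝟙) ∘ₗ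
      (leftComm k H H H).toLinearMap
  have hΦ : ∀ p q r : H, Φ (p ⊗ₜ (q ⊗ₜ r)) =
    tsnoc (diagAct k H A n q w) ((r * (x * p)) • a) := fun _ _ _ => rfl
  have key := coassoc_sum Φ h
  simp only [hΦ] at key
  refine Eq.trans ?_ (key.symm.trans ?_)
  · refine sum_congr rfl fun i _ => ?_
    rw [diagAct_tsnoc]
    simp only [mul_smul]
  · refine sum_congr rfl fun i _ => ?_
    rw [diagAct_tcons _ a w (ℛ k ((ℛ k h).left i)), map_sum]
    refine sum_congr rfl fun j _ => ?_
    rw [tauInvHom_tcons, ← mul_smul, mul_assoc]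

end CoactDiag

section CylBiPara

open Coalgebra

variable {k H A : Type*} [CommRing k] [Ring H] [HopfAlgebra k H] [Ring A] [Algebra k A]
  [Module H A] [IsScalarTower k H A] (hS : Bijective (HopfAlgebra.antipode k : H →ₗ[k] H))
  {Y : Type*} [AddCommGroup Y] [Module k Y] {Y' : Type*} [AddCommGroup Y'] [Module k Y']

lemma aOps_hom {ρ : Y →ₗ[k] H ⊗[k] Y} {ρ' : Y' →ₗ[k] H ⊗[k] Y'}
    (f : ∀ n, Y ⊗[k] TPow k A (n + 1) →ₗ[k] Y' ⊗[k] TPow k A (n + 1))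
    (hd : ∀ n i x, i < n + 1 → f n (map 𝟙 (mulAt k (n + 1) i) x) =
      map 𝟙 (mulAt k (n + 1) i) (f (n + 1) x))
    (hs : ∀ n i x, i ≤ n + 1 → f (n + 1) (map 𝟙 (insertAt k 1 (n + 1) i) x) =
      map 𝟙 (insertAt k 1 (n + 1) i) (f n x))
    (ht : ∀ n x, f n ((aOps A hS ρ).t n x) = (aOps A hS ρ').t n (f n x)) :
    CycHom (aOps A hS ρ) (aOps A hS ρ') f where
  d n i x := by
    induction i using Fin.lastCases with
    | last => rw [aOps_d_last, aOps_d_last, aOps_d_of_lt A hS _ 0 (by simp),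
        aOps_d_of_lt A hS _ 0 (by simp), hd n _ _ (by simp), ht]
    | cast i =>
      rw [aOps_d_of_lt A hS _ i.castSucc i.2, aOps_d_of_lt A hS _ i.castSucc i.2]
      exact hd n i x i.2
  s n i x := by rw [aOps_s, aOps_s, hs n _ _ i.2]
  t := ht

lemma aOps_hom_map {ρ : Y →ₗ[k] H ⊗[k] Y} {ρ' : Y' →ₗ[k] H ⊗[k] Y'} (f : Y →ₗ[k] Y')
    (hf : ∀ y, ρ' (f y) = map 𝟙 f (ρ y)) :
    CycHom (aOps A hS ρ) (aOps A hS ρ') (fun _ => map f 𝟙) := by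
  have comm : ∀ {Z Z' : Type _} [AddCommGroup Z] [Module k Z] [AddCommGroup Z'] [Module k Z']
      (g : Z →ₗ[k] Z') (x : Y ⊗[k] Z), map f 𝟙
        (map 𝟙 g x) = map 𝟙 g (map f 𝟙 x) := by
    intro Z Z' _ _ _ _ g x
    rw [← comp_apply, ← comp_apply, ← TensorProduct.map_comp, ← TensorProduct.map_comp]
    rfl
  refine aOps_hom hS _ (fun n i x _ => comm _ x) (fun n i x _ => comm _ x) fun n x => ?_
  rw [aOps_t, aOps_t, tws_map_left ρ ρ' f hf]

variable {Z : Type*} [AddCommGroup Z] [Module k Z] {Z' : Type*} [AddCommGroup Z'] [Module k Z']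

/-- `τ̄` is natural in the module. -/
lemma hOps_t_map (α : H →ₗ[k] Module.End k Z) (α' : H →ₗ[k] Module.End k Z') (f : Z →ₗ[k] Z')
    (hf : ∀ h z, f (α h z) = α' h (f z)) (m : ℕ) (x : TPow k H (m + 1) ⊗[k] Z) :
    map 𝟙 f ((hOps α).t m x) = (hOps α').t m (map 𝟙 f x) := by
  apply tsnoc_tmul_ind x; intro G g z
  rw [map_tmul, id_apply, hOps_t_tsnoc_sum _ _ _ _ (ℛ k g),
    hOps_t_tsnoc_sum _ _ _ _ (ℛ k g), map_sum]
  refine sum_congr rfl fun i _ => ?_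
  rw [map_tmul, hf]
  rfl

lemma sum_tsnoc_tmul {m : ℕ} {ι ι' : Type*} (s : Finset ι) (s' : Finset ι') (p : ι → H)
    (G : ι → TPow k H m) (p' q : ι' → H) :
    coactMulLast k H m ((∑ i ∈ s, p i ⊗ₜ G i) ⊗ₜ (∑ j ∈ s', p' j ⊗ₜ q j)) =
      ∑ i ∈ s, ∑ j ∈ s', (p i * p' j) ⊗ₜ tsnoc (G i) (q j) := by
  simp only [sum_tmul, tmul_sum, map_sum, coactMulLast_tmul]
  exact sum_comm

/-- `τ̄` commutes with the cyclic operator in the `A`-direction. -/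
lemma hOps_t_aInv (m n : ℕ) (x : Cyl k H A m n) :
    (hOps (diagAct k H A (n + 1)).toLinearMap).t m (aInv A (coact k H (m + 1)) n x) =
      aInv A (coact k H (m + 1)) n ((hOps (diagAct k H A (n + 1)).toLinearMap).t m x) := by
  apply tsnoc_tmul_ind x; intro G g z
  obtain ⟨S, hG⟩ := TensorProduct.exists_finset (coact k H m G)
  have e1 : (hOps (diagAct k H A (n + 1)).toLinearMap).t m
      (aInv A (coact k H (m + 1)) n (tsnoc G g ⊗ₜ z)) =
      ∑ i ∈ S, tconsMap i.2 (tws comul (diagAct k H A (n + 1)).toLinearMap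
        (tws comul (tauInvHom k H A n ∘ₗ mulLeft k i.1) (g ⊗ₜ z))) := by
    rw [aInv, tws_tmul, coact_tsnoc, hG, ← (ℛ k g).eq, sum_tsnoc_tmul, map_sum, map_sum]
    refine sum_congr rfl fun i _ => ?_
    rw [tws_tmul_sum _ _ g z (ℛ k g).index (ℛ k g).left (ℛ k g).right (ℛ k g).eq.symm]
    simp only [map_sum, twv_tmul, hOps_t_tsnoc]
    rfl
  have e2 : aInv A (coact k H (m + 1)) n
      ((hOps (diagAct k H A (n + 1)).toLinearMap).t m (tsnoc G g ⊗ₜ z)) =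
      ∑ i ∈ S, tconsMap i.2 (tws comul (tauInvHom k H A n ∘ₗ mulRight k i.1)
        (tws comul (diagAct k H A (n + 1)).toLinearMap (g ⊗ₜ z))) := by
    rw [hOps_t_tsnoc]
    generalize tws comul (diagAct k H A (n + 1)).toLinearMap (g ⊗ₜ z) = t
    apply tmul_ind t; intro p w
    rw [tconsMap_tmul, aInv, tws_tmul, coact_tcons, hG, ← (ℛ k p).eq, tmul_sum, map_sum, map_sum]
    refine sum_congr rfl fun i _ => ?_
    rw [tws_tmul_sum _ _ p w (ℛ k p).index (ℛ k p).left (ℛ k p).right (ℛ k p).eq.symm]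
    simp only [map_sum, sum_tmul, coactMul_tmul, twv_tmul]
    rfl
  rw [e1, e2]
  refine sum_congr rfl fun i _ => ?_
  rw [tws_tws isCoaction_comul, tws_tws isCoaction_comul]
  congr 1
  exact tws_congr (fun h w => twConv_diagAct_tauInvHom i.1 h w) _

variable [IsModuleAlgebra k H A]

lemma hOps_t_hom (m : ℕ) : CycHom (aOps A hS (coact k H (m + 1))) (aOps A hS (coact k H (m + 1)))
    (fun n => (hOps (diagAct k H A (n + 1)).toLinearMap).t m) := by
  refine aOps_hom hS _ (fun n i x hi => ?_) (fun n i x hi => ?_) (fun n x => ?_)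
  · exact (hOps_t_map (diagAct k H A (n + 1 + 1)).toLinearMap (diagAct k H A (n + 1)).toLinearMap
      (mulAt k (n + 1) i) (fun h z => (diagAct_mulAt (n + 1) i h z hi).symm) m x).symm
  · exact (hOps_t_map (diagAct k H A (n + 1)).toLinearMap (diagAct k H A (n + 1 + 1)).toLinearMap
      (insertAt k 1 (n + 1) i) (fun h z => (diagAct_insertAt (n + 1) i h z hi).symm) m x).symm
  · apply Function.LeftInverse.injective (t_aInv (A := A) hS (isCoaction_coact (m + 1)) n)
    rw [← hOps_t_aInv, aInv_t hS (isCoaction_coact _), aInv_t hS (isCoaction_coact _)]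

/-- `A^op ♮ H^cop` is a pair of commuting paracyclic structures. -/
lemma cyl_isBiPara : IsBiPara (X := Cyl k H A)
    (fun n => hOps (diagAct k H A (n + 1)).toLinearMap)
    (fun m => aOps A hS (coact k H (m + 1))) where
  h n := hOps_isParacyclic _ hS
  a m := aOps_isParacyclic hS (isCoaction_coact _)
  d m i := by
    have h1 : ∀ i : ℕ, i < m + 1 → CycHom (aOps A hS (coact k H (m + 1 + 1)))
        (aOps A hS (coact k H (m + 1))) (fun _ => map (mulAt k (m + 1) i)
          𝟙) := fun i hi => aOps_hom_map hS _ fun y => coact_mulAt (m + 1) i y hi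
    induction i using Fin.lastCases with
    | last =>
      have e : (fun n => (hOps (diagAct k H A (n + 1)).toLinearMap).d m (Fin.last (m + 1))) =
          fun n => map (mulAt k (m + 1) 0) 𝟙 ∘ₗ
            (hOps (diagAct k H A (n + 1)).toLinearMap).t (m + 1) := funext fun n => if_neg (by simp)
      rw [e]
      exact (h1 0 (by omega)).comp (hOps_t_hom hS (m + 1))
    | cast i =>
      have e : (fun n => (hOps (diagAct k H A (n + 1)).toLinearMap).d m i.castSucc) =
          fun n => map (mulAt k (m + 1) i) 𝟙 :=
        funext fun n => hOps_d_of_lt _ i.castSucc i.2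
      rw [e]
      exact h1 i i.2
  s m i := aOps_hom_map hS _ fun y => coact_insertAt (m + 1) (i + 1) y i.2
  t m := hOps_t_hom hS m

end CylBiPara

section Rotation

variable {m n : ℕ} {k : Type*} [CommRing k] {M : Type*} [AddCommGroup M] [Module k M]

lemma tcons_tprod (a : M) (f : Fin n → M) :
    tcons a (PiTensorProduct.tprod k f) = PiTensorProduct.tprod k (Fin.cons a f : Fin (n + 1) → M) := by
  rw [tcons, LinearEquiv.symm_apply_eq, consEquiv_tprod]
  simp

lemma tprod_eq_tsnoc : ∀ {n : ℕ} (f : Fin (n + 1) → M), PiTensorProduct.tprod k f =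
    tsnoc (PiTensorProduct.tprod k (fun i : Fin n => f i.castSucc)) (f (Fin.last n))
  | 0, f => by
    rw [tsnoc_zero, tcons_tprod]
    congr 1
    funext i
    fin_cases i
    rfl
  | n + 1, f => by
    have h : (fun i : Fin (n + 1) => f i.castSucc) =
        (Fin.cons (f 0) (fun i : Fin n => f i.succ.castSucc) : Fin (n + 1) → M) := by
      funext i
      refine Fin.cases rfl (fun i => rfl) i
    rw [h, ← tcons_tprod, tsnoc_tcons]
    have := tprod_eq_tsnoc (fun i : Fin (n + 1) => f i.succ)
    rw [show f (Fin.last (n + 1)) = f (Fin.last n).succ from rfl]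
    simp only [Fin.succ_castSucc] at this
    rw [← this, tcons_tprod]
    congr 1
    funext i
    refine Fin.cases rfl (fun i => rfl) i

lemma rot_tprod (f : Fin (n + 1) → M) :
    rot k n (PiTensorProduct.tprod k f) = PiTensorProduct.tprod k (fun i => f (i - 1)) := by
  rw [tprod_eq_tsnoc, rot_tsnoc, tcons_tprod]
  congr 1
  funext i
  refine Fin.cases ?_ (fun i => ?_) i
  · rw [Fin.cons_zero]
    congr 1
    rw [zero_sub, eq_neg_iff_add_eq_zero, Fin.last_add_one]
  · rw [Fin.cons_succ]
    congr 1
    rw [eq_sub_iff_add_eq, Fin.coeSucc_eq_succ]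

lemma rot_pow_tprod (j : ℕ) (f : Fin (n + 1) → M) :
    (rot k n ^ j) (PiTensorProduct.tprod k f) =
      PiTensorProduct.tprod k (fun i => f (i - j • 1)) := by
  induction j with
  | zero => simp
  | succ j ih =>
    rw [pow_succ', Module.End.mul_apply, ih, rot_tprod]
    congr 1
    funext i
    congr 1
    rw [succ_nsmul]
    abel

lemma rot_pow_succ (n : ℕ) : (rot k n : Module.End k (TPow k M (n + 1))) ^ (n + 1) = 1 := by
  refine PiTensorProduct.ext (MultilinearMap.ext fun f => ?_)
  show (rot k n ^ (n + 1)) (PiTensorProduct.tprod k f) = PiTensorProduct.tprod k f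
  rw [rot_pow_tprod]
  have := card_nsmul_eq_zero (x := (1 : Fin (n + 1)))
  rw [Fintype.card_fin] at this
  simp [this]

end Rotation

section Crossed

lemma LinearEquiv.map_sum' {k : Type*} [CommRing k] {M N : Type*} [AddCommMonoid M] [Module k M]
    [AddCommMonoid N] [Module k N] (e : M ≃ₗ[k] N) {ι : Type*} (s : Finset ι) (f : ι → M) :
    e (∑ i ∈ s, f i) = ∑ i ∈ s, e (f i) := map_sum e f s

open Coalgebra

variable {m n : ℕ} {k H A : Type*} [CommRing k] [Ring H] [HopfAlgebra k H] [Ring A] [Algebra k A]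
  [Module H A] [IsScalarTower k H A]

/-- A decomposition of `ρ y`. -/
def coRep {Y : Type*} [AddCommGroup Y] [Module k Y] (ρ : Y →ₗ[k] H ⊗[k] Y) (y : Y) :
    Finset (H × Y) :=
  (TensorProduct.exists_finset (ρ y)).choose

lemma coRep_eq {Y : Type*} [AddCommGroup Y] [Module k Y] (ρ : Y →ₗ[k] H ⊗[k] Y) (y : Y) :
    ρ y = ∑ s ∈ coRep ρ y, s.1 ⊗ₜ s.2 :=
  (TensorProduct.exists_finset (ρ y)).choose_spec

lemma IsCoaction.sum {Y : Type*} [AddCommGroup Y] [Module k Y] {ρ : Y →ₗ[k] H ⊗[k] Y}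
    (hρ : IsCoaction ρ) {N : Type*} [AddCommGroup N] [Module k N]
    (Φ : H ⊗[k] (H ⊗[k] Y) →ₗ[k] N) (y : Y) :
    ∑ s ∈ coRep ρ y, ∑ r ∈ coRep ρ s.2, Φ (s.1 ⊗ₜ (r.1 ⊗ₜ r.2)) =
      ∑ s ∈ coRep ρ y, ∑ j ∈ (ℛ k s.1).index,
        Φ ((ℛ k s.1).left j ⊗ₜ ((ℛ k s.1).right j ⊗ₜ s.2)) := by
  have := congrArg Φ (hρ.coassoc y)
  rw [coRep_eq ρ y, map_sum, map_sum, map_sum, map_sum, map_sum] at this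
  refine Eq.trans ?_ (this.trans ?_)
  · refine sum_congr rfl fun s _ => ?_
    rw [map_tmul, coRep_eq ρ s.2, tmul_sum, map_sum]
    rfl
  · refine sum_congr rfl fun s _ => ?_
    rw [map_tmul, ← (ℛ k s.1).eq, sum_tmul, map_sum, map_sum]
    rfl

lemma coact_tcons_sum (g : H) (G : TPow k H m) :
    coact k H (m + 1) (tcons g G) = ∑ i ∈ (ℛ k g).index, ∑ s ∈ coRep (coact k H m) G,
      ((ℛ k g).left i * s.1) ⊗ₜ tcons ((ℛ k g).right i) s.2 := by
  rw [coact_tcons, coRep_eq (coact k H m) G, ← (ℛ k g).eq]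
  simp only [sum_tmul, tmul_sum, map_sum, coactMul_tmul]
  exact sum_comm

lemma coact_tsnoc_sum (G : TPow k H m) (g : H) :
    coact k H (m + 1) (tsnoc G g) = ∑ s ∈ coRep (coact k H m) G, ∑ i ∈ (ℛ k g).index,
      (s.1 * (ℛ k g).left i) ⊗ₜ tsnoc s.2 ((ℛ k g).right i) := by
  rw [coact_tsnoc, coRep_eq (coact k H m) G, ← (ℛ k g).eq, sum_tsnoc_tmul]

variable (k H A) in
/-- `a ↦ a ⊗ 1`. -/
def inclA : A →ₗ[k] CrossedProduct k H A := (mk k A H).flip 1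

variable (k H A) in
/-- `h ↦ 1 ⊗ h`. -/
def inclH : H →ₗ[k] CrossedProduct k H A := mk k A H 1

local notation "ιA" => inclA k H A
local notation "ιH" => inclH k H A

variable [IsModuleAlgebra k H A]

lemma inclA_mul_inclH (a : A) (h : H) :
    ιA a * ιH h = (show CrossedProduct k H A from a ⊗ₜ[k] h) := by
  show CrossedProduct.mulHom k H A (a ⊗ₜ 1) (1 ⊗ₜ h) = a ⊗ₜ h
  rw [CrossedProduct.mulHom_tmul, map_one, mul_one]
  show (a * 1) ⊗ₜ[k] h = _
  rw [mul_one]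

lemma inclH_mul_inclA (a : A) (h : H) {ι : Type*} (r : Repr k h ι) : ιH h * ιA a =
      ∑ i ∈ r.index, ιA (r.left i • a) * ιH (r.right i) := by
  simp only [inclA_mul_inclH]
  show CrossedProduct.mulHom k H A (1 ⊗ₜ h) (a ⊗ₜ 1) = _
  rw [CrossedProduct.mulHom_tmul_tmul 1 h a 1 r]
  simp only [one_mul, mul_one]
  rfl

lemma inclA_mul (a b : A) : ιA (a * b) = ιA a * ιA b := by
  symm
  show CrossedProduct.mulHom k H A (a ⊗ₜ 1) (b ⊗ₜ 1) = (a * b) ⊗ₜ 1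
  rw [CrossedProduct.mulHom_tmul, map_one, mul_one]
  rfl

lemma inclH_mul (g h : H) : ιH (g * h) = ιH g * ιH h := by
  symm
  show CrossedProduct.mulHom k H A (1 ⊗ₜ g) (1 ⊗ₜ h) = 1 ⊗ₜ (g * h)
  rw [CrossedProduct.mulHom_tmul_tmul 1 g 1 h (ℛ k g)]
  simp only [IsModuleAlgebra.smul_one (k := k) (H := H) (A := A), one_mul, smul_tmul]
  rw [← tmul_sum]
  simp only [← smul_mul_assoc]
  rw [← Finset.sum_mul, sum_counit_smul]

lemma inclH_mul_mul_inclA (g h p : H) (a c : A) : ιH (g * h) * ιA ((p • a) * c) =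
      ∑ i ∈ (ℛ k h).index, ιH g * ιA (((ℛ k h).left i * p) • a) *
        (ιH ((ℛ k h).right i) * ιA c) := by
  rw [inclH_mul, inclA_mul, mul_assoc, ← mul_assoc (ιH h),
    inclH_mul_inclA _ h (ℛ k h), Finset.sum_mul, Finset.mul_sum]
  refine sum_congr rfl fun i _ => ?_
  rw [mul_smul, mul_assoc, mul_assoc]

lemma inclA_one : ιA 1 = 1 := rfl

lemma inclH_one : ιH 1 = 1 := rfl

lemma tcons_sum_left {M : Type*} [AddCommGroup M] [Module k M] {ι : Type*} (s : Finset ι)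
    (f : ι → M) (x : TPow k M n) : tcons (∑ i ∈ s, f i) x = ∑ i ∈ s, tcons (f i) x :=
  map_sum ((consEquiv k M n).symm.toLinearMap ∘ₗ (mk k M _).flip x) _ _

lemma tcons_sum_right {M : Type*} [AddCommGroup M] [Module k M] {ι : Type*} (s : Finset ι)
    (a : M) (f : ι → TPow k M n) : tcons a (∑ i ∈ s, f i) = ∑ i ∈ s, tcons a (f i) :=
  map_sum ((consEquiv k M n).symm.toLinearMap ∘ₗ mk k M _ a) _ _

variable (hS : Bijective (HopfAlgebra.antipode k : H →ₗ[k] H))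

/-- `h ⊗ a ↦ h a`. -/
def prodEquiv (A : Type*) [Ring A] [Algebra k A] [Module H A] [IsScalarTower k H A] :
    H ⊗[k] A ≃ₗ[k] CrossedProduct k H A :=
  (LinearEquiv.ofBijective _ (tws_bijective (Algebra.lsmul k k A) hS isCoaction_comul)).trans
    (TensorProduct.comm k H A)

lemma prodEquiv_tmul (h : H) (a : A) : prodEquiv hS A (h ⊗ₜ a) = ιH h * ιA a := by
  rw [inclH_mul_inclA a h (ℛ k h)]
  simp only [inclA_mul_inclH]
  show TensorProduct.comm k H A (tws comul _ (h ⊗ₜ a)) = _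
  rw [tws_tmul_sum _ _ h a (ℛ k h).index (ℛ k h).left (ℛ k h).right (ℛ k h).eq.symm, map_sum]
  rfl

/-- `(G ⊗ (a ⊗ x)) ↦ a ⊗ (G ⊗ x)`, twisted by the coaction on `G`. -/
def psiStep (A : Type*) [Ring A] [Algebra k A] [Module H A] [IsScalarTower k H A] (n : ℕ) :
    TPow k H n ⊗[k] (A ⊗[k] TPow k A n) ≃ₗ[k] A ⊗[k] (TPow k H n ⊗[k] TPow k A n) :=
  (assoc k _ _ _).symm.trans <|
    (TensorProduct.congr ((LinearEquiv.ofBijective _ (tws_bijective (Algebra.lsmul k k A) hS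
      (isCoaction_coact n))).trans (TensorProduct.comm k _ _)) (LinearEquiv.refl k _)).trans <|
        assoc k _ _ _

lemma psiStep_tmul (G : TPow k H n) (a : A) (x : TPow k A n) :
    psiStep hS A n (G ⊗ₜ (a ⊗ₜ x)) = ∑ s ∈ coRep (coact k H n) G, (s.1 • a) ⊗ₜ (s.2 ⊗ₜ x) := by
  show assoc k _ _ _ (TensorProduct.comm k _ _ (tws _ _ (G ⊗ₜ a)) ⊗ₜ x) = _
  rw [tws_tmul_sum _ _ G a _ (fun s : H × TPow k H n => s.1)
    (fun s => s.2) (coRep_eq (coact k H n) G), LinearEquiv.map_sum', sum_tmul]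
  exact LinearEquiv.map_sum' (assoc k A (TPow k H n) (TPow k A n)) _ _

/-- `(g_0, … | a_0, …) ↦ (g_0 (g_1⁽⁰⁾ ⋯ a_0), …)`, from `H^{⊗n} ⊗ A^{⊗n}` to `(A ⋊ H)^{⊗n}`. -/
def psi (A : Type*) [Ring A] [Algebra k A] [Module H A] [IsScalarTower k H A]
    [IsModuleAlgebra k H A] :
    ∀ n : ℕ, TPow k H n ⊗[k] TPow k A n ≃ₗ[k] TPow k (CrossedProduct k H A) n
  | 0 => (TensorProduct.congr (PiTensorProduct.isEmptyEquiv (Fin 0))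
      (PiTensorProduct.isEmptyEquiv (Fin 0))).trans <|
        (lid k k).trans (PiTensorProduct.isEmptyEquiv (Fin 0)).symm
  | n + 1 => (TensorProduct.congr (consEquiv k H n) (consEquiv k A n)).trans <|
      (assoc k H _ _).trans <|
        (TensorProduct.congr (LinearEquiv.refl k H) (psiStep hS A n)).trans <|
          (assoc k H A _).symm.trans <| (TensorProduct.congr (prodEquiv hS A) (psi A n)).trans
              (consEquiv k (CrossedProduct k H A) n).symm

lemma psi_tcons (g : H) (G : TPow k H n) (a : A) (x : TPow k A n) :
    psi hS A (n + 1) (tcons g G ⊗ₜ tcons a x) = ∑ s ∈ coRep (coact k H n) G,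
      tcons (ιH g * ιA (s.1 • a)) (psi hS A n (s.2 ⊗ₜ x)) := by
  simp only [psi, LinearEquiv.trans_apply, congr_tmul, consEquiv_tcons,
    assoc_tmul, psiStep_tmul, tmul_sum, map_sum, LinearEquiv.refl_apply,
    assoc_symm_tmul, prodEquiv_tmul, consEquiv_symm_tmul]

/-- `p ⊗ G ↦ (g (p a), ψ (G | x))`. -/
def psiMap (g : H) (a : A) (x : TPow k A n) :
    H ⊗[k] TPow k H n →ₗ[k] TPow k (CrossedProduct k H A) (n + 1) :=
  (consEquiv k _ n).symm.toLinearMap ∘ₗ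
    map (mulLeft k (ιH g) ∘ₗ ιA ∘ₗ smulMap k H a)
      ((psi hS A n).toLinearMap ∘ₗ (mk k _ _).flip x)

lemma psiMap_tmul (g : H) (a : A) (x : TPow k A n) (p : H) (G : TPow k H n) :
    psiMap hS g a x (p ⊗ₜ G) =
      tcons (ιH g * ιA (p • a)) (psi hS A n (G ⊗ₜ x)) := rfl

lemma psi_tcons_eq (g : H) (G : TPow k H n) (a : A) (x : TPow k A n) :
    psi hS A (n + 1) (tcons g G ⊗ₜ tcons a x) = psiMap hS g a x (coact k H n G) := by
  rw [coRep_eq (coact k H n) G, map_sum, psi_tcons]; rfl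

lemma psi_mulAt_zero (g h : H) (G : TPow k H n) (a b : A) (x : TPow k A n) :
    psi hS A (n + 1) (mulAt k (n + 1) 0 (tcons g (tcons h G)) ⊗ₜ
      mulAt k (n + 1) 0 (tcons a (tcons b x))) =
    mulAt k (n + 1) 0 (psi hS A (n + 2) (tcons g (tcons h G) ⊗ₜ tcons a (tcons b x))) := by
  let Φ : H ⊗[k] (H ⊗[k] TPow k H n) →ₗ[k] TPow k (CrossedProduct k H A) (n + 1) :=
    (consEquiv k _ n).symm.toLinearMap ∘ₗ map
      (mulLeft k (ιH (g * h)) ∘ₗ ιA ∘ₗ LinearMap.mul' k A ∘ₗ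
        map (smulMap k H a) (smulMap k H b))
      ((psi hS A n).toLinearMap ∘ₗ (mk k _ _).flip x) ∘ₗ (assoc k H H _).symm.toLinearMap
  have hΦ : ∀ p q (K : TPow k H n), Φ (p ⊗ₜ (q ⊗ₜ K)) =
    tcons (ιH (g * h) * ιA ((p • a) * (q • b))) (psi hS A n (K ⊗ₜ x)) :=
    fun _ _ _ => rfl
  have key := (isCoaction_coact n).sum Φ G
  simp only [hΦ] at key
  rw [mulAt_zero, mulAt_zero, psi_tcons]
  have e1 : ∀ K : TPow k H n ,∀ p : H, tcons (ιH (g * h) * ιA (p • (a * b)))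
      (psi hS A n (K ⊗ₜ x)) = ∑ j ∈ (ℛ k p).index, tcons (ιH (g * h) *
        ιA (((ℛ k p).left j • a) * ((ℛ k p).right j • b))) (psi hS A n (K ⊗ₜ x)) := by
    intro K p
    rw [IsModuleAlgebra.smul_mul (k := k) p a b (ℛ k p), map_sum, Finset.mul_sum, tcons_sum_left]
  simp only [e1]
  rw [← key]
  rw [psi_tcons_eq, coact_tcons_sum]
  simp only [map_sum, psiMap_tmul, psi_tcons, tcons_sum_right, mulAt_zero]
  rw [sum_comm]
  refine sum_congr rfl fun s _ => ?_
  rw [sum_comm]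
  refine sum_congr rfl fun r _ => ?_
  rw [inclH_mul_mul_inclA g h s.1 a (r.1 • b), tcons_sum_left]

lemma psi_mulAt : ∀ (n i : ℕ) (t : TPow k H (n + 1) ⊗[k] TPow k A (n + 1)), i < n →
    psi hS A n (map (mulAt k n i) (mulAt k n i) t) = mulAt k n i (psi hS A (n + 1) t)
  | 0, i, _, h => absurd h (by omega)
  | n + 1, i, t, hi => by
    apply tmul_ind t; intro y x
    apply tcons_ind y; intro g G
    apply tcons_ind x; intro a x
    rw [map_tmul]
    cases i with
    | succ i =>
      rw [mulAt_succ, mulAt_succ, psi_tcons_eq, psi_tcons_eq, coact_mulAt n i G (by omega)]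
      generalize coact k H (n + 1) G = t
      apply tmul_ind t; intro p K
      simp only [map_tmul, psiMap_tmul, id_apply, mulAt_succ, ← psi_mulAt n i _ (by omega : i < n)]
    | zero =>
      apply tcons_ind G; intro h G
      apply tcons_ind x; intro b x
      exact psi_mulAt_zero hS g h G a b x

lemma psi_insertAt : ∀ (n i : ℕ) (t : TPow k H n ⊗[k] TPow k A n), i ≤ n →
    psi hS A (n + 1) (map (insertAt k 1 n i) (insertAt k 1 n i) t) = insertAt k 1 n i (psi hS A n t)
  | n, 0, t, _ => by
    apply tmul_ind t; intro G x
    rw [map_tmul, insertAt_zero, insertAt_zero, insertAt_zero, psi_tcons_eq]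
    have h : ∀ t, psiMap hS 1 (1 : A) x t =
        tcons 1 (psi hS A n (lid k _ (map counit 𝟙 t) ⊗ₜ x)) := fun t => by
      apply tmul_ind t ?_ ?_; swap
      · intro x y hx hy
        simp only [map_add, add_tmul, tcons_add, hx, hy]
      intro p K
      rw [psiMap_tmul, inclH_one, one_mul, IsModuleAlgebra.smul_one (k := k), map_smul, inclA_one,
        smul_tcons, ← tcons_smul, ← map_smul, smul_tmul']
      rfl
    rw [h, (isCoaction_coact n).counit]
  | 0, i + 1, _, h => absurd h (by omega)
  | n + 1, i + 1, t, hi => by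
    apply tmul_ind t; intro y x
    apply tcons_ind y; intro g G
    apply tcons_ind x; intro a x
    rw [map_tmul, insertAt_succ, insertAt_succ, psi_tcons_eq, psi_tcons_eq,
      coact_insertAt n i G (by omega)]
    generalize coact k H n G = t
    apply tmul_ind t; intro p K
    simp only [map_tmul, psiMap_tmul, id_apply, insertAt_succ,
      ← psi_insertAt n i _ (by omega : i ≤ n)]

lemma tsnoc_sum_left {M : Type*} [AddCommGroup M] [Module k M] {ι : Type*} (s : Finset ι)
    (f : ι → TPow k M n) (a : M) : tsnoc (∑ i ∈ s, f i) a = ∑ i ∈ s, tsnoc (f i) a :=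
  map_sum ((snocEquiv n).symm.toLinearMap ∘ₗ mk k M _ a) _ _

lemma psi_tsnoc : ∀ {n : ℕ} (G : TPow k H n) (g : H) (x : TPow k A n) (a : A),
    psi hS A (n + 1) (tsnoc G g ⊗ₜ tsnoc x a) = ∑ i ∈ (ℛ k g).index,
      tsnoc (psi hS A n (G ⊗ₜ diagAct k H A n ((ℛ k g).left i) x))
        (ιH ((ℛ k g).right i) * ιA a)
  | 0, G, g, x, a => by
    rw [tsnoc_zero, tsnoc_zero, psi_tcons_eq, show coact k H 0 G = (1 : H) ⊗ₜ G from rfl,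
      psiMap_tmul, one_smul]
    simp only [diagAct_zero, tmul_smul, map_smul, tsnoc_zero, tcons_smul]
    simp only [← smul_tcons]
    rw [← tcons_sum_left]
    simp only [← smul_mul_assoc, ← map_smul]
    rw [← Finset.sum_mul, ← map_sum, sum_counit_smul]
  | n + 1, G, g, x, a => by
    apply tcons_ind G; intro h G
    apply tcons_ind x; intro b x
    rw [tsnoc_tcons, tsnoc_tcons, psi_tcons_eq, coact_tsnoc_sum]
    simp only [map_sum, psiMap_tmul, diagAct_tcons _ b x (ℛ k _), tmul_sum,
      LinearEquiv.map_sum', psi_tcons, psi_tsnoc, tsnoc_sum_left, tsnoc_tcons, tcons_sum_right]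
    have key : ∀ s : H × TPow k H n, _ := fun s => coassoc_sum
      ((consEquiv k _ (n + 1)).symm.toLinearMap ∘ₗ map
        (mulLeft k (ιH h) ∘ₗ ιA ∘ₗ smulMap k H b ∘ₗ mulLeft k s.1)
        ((snocEquiv n).symm.toLinearMap ∘ₗ (TensorProduct.comm k _ _).toLinearMap ∘ₗ
          map ((psi hS A n).toLinearMap ∘ₗ mk k _ _ s.2 ∘ₗ diagMap k H x)
            ((mulRight k (ιA a)) ∘ₗ ιH))) g
    rw [show (∑ i ∈ (ℛ k g).index, ∑ j ∈ (ℛ k ((ℛ k g).left i)).index,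
      ∑ s ∈ coRep (coact k H n) G, tcons (ιH h * ιA
        (s.1 • (ℛ k ((ℛ k g).left i)).left j • b)) (tsnoc (psi hS A n (s.2 ⊗ₜ
          diagAct k H A n ((ℛ k ((ℛ k g).left i)).right j) x)) (ιH ((ℛ k g).right i) *
            ιA a))) = ∑ s ∈ coRep (coact k H n) G, ∑ i ∈ (ℛ k g).index,
              ∑ j ∈ (ℛ k ((ℛ k g).left i)).index, tcons (ιH h * ιA
        (s.1 • (ℛ k ((ℛ k g).left i)).left j • b)) (tsnoc (psi hS A n (s.2 ⊗ₜ
          diagAct k H A n ((ℛ k ((ℛ k g).left i)).right j) x)) (ιH ((ℛ k g).right i) *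
            ιA a)) from by
      rw [sum_comm]
      exact sum_congr rfl fun i _ => sum_comm]
    refine sum_congr rfl fun s _ => ?_
    simp only [← mul_smul]
    exact (key s).symm

lemma psi_rot (w : Cyl k H A n n) :
    psi hS A (n + 1) ((hOps (diagAct k H A (n + 1)).toLinearMap).t n w) =
      rot k n (psi hS A (n + 1) (aInv A (coact k H (n + 1)) n w)) := by
  apply tsnoc_tmul_ind w; intro G g z
  apply tcons_ind z; intro a x
  rw [hOps_t_tsnoc_sum _ G g _ (ℛ k g), aInv, tws_tmul, coact_tsnoc_sum]
  simp only [map_sum, twv_tmul, tauInvHom_tcons, LinearEquiv.map_sum', psi_tsnoc, rot_tsnoc,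
    AlgHom.toLinearMap_apply, diagAct_tcons _ a x (ℛ k _), tmul_sum, psi_tcons]
  have key : ∀ s : H × TPow k H n, _ := fun s => coassoc_sum
    ((consEquiv k (CrossedProduct k H A) n).symm.toLinearMap ∘ₗ
      map (LinearMap.mul' k (CrossedProduct k H A) ∘ₗ (TensorProduct.comm k _ _).toLinearMap ∘ₗ map
          (ιA ∘ₗ smulMap k H a ∘ₗ mulLeft k s.1) (ιH))
        ((psi hS A n).toLinearMap ∘ₗ mk k _ _ s.2 ∘ₗ diagMap k H x) ∘ₗ
          (assoc k H H H).symm.toLinearMap ∘ₗ map 𝟙 (TensorProduct.comm k H H).toLinearMap) g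
  rw [sum_congr rfl fun i _ => sum_comm, sum_comm]
  refine sum_congr rfl fun s _ => ?_
  simp only [← mul_smul]
  exact key s

end Crossed

section TwistPower

open Coalgebra

variable {k H A : Type*} [CommRing k] [Ring H] [HopfAlgebra k H] [Ring A] [Algebra k A]
  [Module H A] [IsScalarTower k H A] [IsModuleAlgebra k H A]
  (hS : Bijective (HopfAlgebra.antipode k : H →ₗ[k] H))

/-- The operators of `A^op ♮ H^cop` in the `H`-direction. -/
abbrev cylH (k H A : Type*) [CommRing k] [Ring H] [HopfAlgebra k H] [Ring A] [Algebra k A]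
    [Module H A] [IsScalarTower k H A] (n : ℕ) : CycOps k (fun m => Cyl k H A m n) :=
  hOps (diagAct k H A (n + 1)).toLinearMap

/-- The operators of `A^op ♮ H^cop` in the `A`-direction. -/
abbrev cylA (A : Type*) [Ring A] [Algebra k A] [Module H A] [IsScalarTower k H A] (m : ℕ) :
    CycOps k (fun n => Cyl k H A m n) :=
  aOps A hS (coact k H (m + 1))

lemma algOps_d_last (R : Type*) [Ring R] [Algebra k R] (n : ℕ) (x : TPow k R (n + 2)) :
    (algOps k R).d n (Fin.last (n + 1)) x = mulAt k (n + 1) 0 (rot k (n + 1) x) := by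
  have h1 : (algOps k R).d n (Fin.last (n + 1)) = mulAt k (n + 1) 0 ∘ₗ rot k (n + 1) :=
    if_neg (by simp)
  rw [h1]
  rfl

lemma algOps_d_of_lt (R : Type*) [Ring R] [Algebra k R] {n : ℕ} (i : Fin (n + 2))
    (hi : (i : ℕ) < n + 1) : (algOps k R).d n i = mulAt k (n + 1) i := if_pos hi

lemma cyl_diag_d_of_lt {n : ℕ} (i : Fin (n + 2)) (hi : (i : ℕ) < n + 1)
    (x : Cyl k H A (n + 1) (n + 1)) : (diagOps (cylH k H A) (cylA hS A)).d n i x =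
      map (mulAt k (n + 1) i) (mulAt k (n + 1) i) x := by
  show (cylH k H A n).d n i ((cylA hS A (n + 1)).d n i x) = _
  rw [hOps_d_of_lt _ i hi, aOps_d_of_lt A hS _ i hi, ← comp_apply, ← TensorProduct.map_comp]
  rfl

lemma psi_t (n : ℕ) (x : Cyl k H A n n) :
    psi hS A (n + 1) ((diagOps (cylH k H A) (cylA hS A)).t n x) = rot k n (psi hS A (n + 1) x) := by
  show psi hS A (n + 1) ((cylH k H A n).t n ((cylA hS A n).t n x)) = _
  rw [psi_rot, aInv_t hS (isCoaction_coact _)]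

/-- The diagonal of `A^op ♮ H^cop` is the cyclic module of the crossed product. -/
lemma psi_hom : CycHom (diagOps (cylH k H A) (cylA hS A)) (algOps k (CrossedProduct k H A))
    (fun n => (psi hS A (n + 1)).toLinearMap) where
  d n i x := by
    induction i using Fin.lastCases with
    | last =>
      rw [algOps_d_last, ← app_eq ((cyl_isBiPara hS).diag.d_zero_t n) x]
      rw [comp_apply, cyl_diag_d_of_lt hS 0 (by simp)]
      refine (psi_mulAt hS (n + 1) 0 _ (by omega)).trans ?_
      rw [psi_t]
      rfl
    | cast i =>
      rw [cyl_diag_d_of_lt hS i.castSucc i.2, algOps_d_of_lt _ i.castSucc i.2]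
      exact psi_mulAt hS (n + 1) i _ i.2
  s n i x := by
    show psi hS A (n + 2) ((cylH k H A (n + 1)).s n i ((cylA hS A n).s n i x)) = _
    rw [hOps_s, aOps_s, ← comp_apply, ← TensorProduct.map_comp]
    exact psi_insertAt hS (n + 1) (i + 1) x (by omega)
  t := psi_t hS

lemma CycHom.of_inverse {X X' : ℕ → Type*} [∀ n, AddCommGroup (X n)] [∀ n, Module k (X n)]
    [∀ n, AddCommGroup (X' n)] [∀ n, Module k (X' n)] {O : CycOps k X} {O' : CycOps k X'}
    (e : ∀ n, X n ≃ₗ[k] X' n) (he : CycHom O O' (fun n => (e n).toLinearMap)) :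
    CycHom O' O (fun n => (e n).symm.toLinearMap) where
  d n i x := by
    have := he.d n i ((e (n + 1)).symm x)
    simp only [LinearEquiv.coe_coe, LinearEquiv.apply_symm_apply] at this ⊢
    rw [← this, LinearEquiv.symm_apply_apply]
  s n i x := by
    have := he.s n i ((e n).symm x)
    simp only [LinearEquiv.coe_coe, LinearEquiv.apply_symm_apply] at this ⊢
    rw [← this, LinearEquiv.symm_apply_apply]
  t n x := by
    have := he.t n ((e n).symm x)
    simp only [LinearEquiv.coe_coe, LinearEquiv.apply_symm_apply] at this ⊢
    rw [← this, LinearEquiv.symm_apply_apply]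

/-- `T T̄ = 1` for `A^op ♮ H^cop`. -/
lemma cyl_t_pow_t_pow (m n : ℕ) (x : Cyl k H A m n) :
    ((cylA hS A m).t n ^ (n + 1)) (((cylH k H A n).t m ^ (m + 1)) x) = x := by
  have hX := cyl_isBiPara (A := A) hS
  have diag : ∀ (n : ℕ) (x : Cyl k H A n n),
      ((cylA hS A n).t n ^ (n + 1)) (((cylH k H A n).t n ^ (n + 1)) x) = x := by
    intro n x
    rw [← hX.diag_t_pow n (n + 1) x]
    apply (psi hS A (n + 1)).injective
    refine ((psi_hom hS).t_pow n (n + 1) x).trans ?_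
    rw [show (algOps k (CrossedProduct k H A)).t n = rot k n from rfl, rot_pow_succ]
    rfl
  have stepH : ∀ (m n : ℕ), (∀ x : Cyl k H A (m + 1) n,
      ((cylA hS A (m + 1)).t n ^ (n + 1)) (((cylH k H A n).t (m + 1) ^ (m + 1 + 1)) x) = x) →
      ∀ x : Cyl k H A m n, ((cylA hS A m).t n ^ (n + 1)) (((cylH k H A n).t m ^ (m + 1)) x) = x := by
    intro m n h x
    have h1 := h ((cylH k H A n).s m 0 x)
    rw [show ((cylH k H A n).t (m + 1) ^ (m + 1 + 1)) ((cylH k H A n).s m 0 x) = (cylH k H A n).s m 0 (((cylH k H A n).t m ^ (m + 1)) x) from (hX.h n).hom_T.s m 0 x, ← (hX.s m 0).t_pow] at h1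
    have := congrArg ((cylH k H A n).d m (Fin.castSucc 0)) h1
    rwa [← comp_apply, ← comp_apply ((cylH k H A n).d m (Fin.castSucc 0)),
      (hX.h n).d_s_eq m 0] at this
  have stepA : ∀ (m n : ℕ), (∀ x : Cyl k H A m (n + 1),
      ((cylA hS A m).t (n + 1) ^ (n + 1 + 1)) (((cylH k H A (n + 1)).t m ^ (m + 1)) x) = x) →
      ∀ x : Cyl k H A m n, ((cylA hS A m).t n ^ (n + 1)) (((cylH k H A n).t m ^ (m + 1)) x) = x := by
    intro m n h x
    have h1 := h ((cylA hS A m).s n 0 x)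
    rw [← (hX.a_s n 0).t_pow, show ∀ y, ((cylA hS A m).t (n + 1) ^ (n + 1 + 1)) ((cylA hS A m).s n 0 y) = (cylA hS A m).s n 0 (((cylA hS A m).t n ^ (n + 1)) y) from fun y => (hX.a m).hom_T.s n 0 y] at h1
    have := congrArg ((cylA hS A m).d n (Fin.castSucc 0)) h1
    rwa [← comp_apply, ← comp_apply ((cylA hS A m).d n (Fin.castSucc 0)),
      (hX.a m).d_s_eq n 0] at this
  have upA : ∀ j m n, (∀ x : Cyl k H A m (n + j), ((cylA hS A m).t (n + j) ^ (n + j + 1))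
      (((cylH k H A (n + j)).t m ^ (m + 1)) x) = x) → ∀ x : Cyl k H A m n,
        ((cylA hS A m).t n ^ (n + 1)) (((cylH k H A n).t m ^ (m + 1)) x) = x := by
    intro j
    induction j with
    | zero => exact fun m n h => h
    | succ j ih => exact fun m n h => ih m n (stepA m (n + j) h)
  have upH : ∀ j m n, (∀ x : Cyl k H A (m + j) n, ((cylA hS A (m + j)).t n ^ (n + 1))
      (((cylH k H A n).t (m + j) ^ (m + j + 1)) x) = x) → ∀ x : Cyl k H A m n,
        ((cylA hS A m).t n ^ (n + 1)) (((cylH k H A n).t m ^ (m + 1)) x) = x := by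
    intro j
    induction j with
    | zero => exact fun m n h => h
    | succ j ih => exact fun m n h => ih m n (stepH (m + j) n h)
  refine upA m m n (upH n m (n + m) ?_) x
  rw [Nat.add_comm m n]
  exact diag (n + m)

lemma cyl_totD_totD (x : ∀ i : ℕ × ℕ, Cyl k H A i.1 i.2) :
    totD (cylH k H A) (cylA hS A) (totD (cylH k H A) (cylA hS A) x) = 0 := by
  funext ⟨m, n⟩
  rw [(cyl_isBiPara hS).totD_totD, cyl_t_pow_t_pow, sub_self]
  rfl

end TwistPower

section Rows

open Coalgebra

variable {k H A : Type*} [CommRing k] [Ring H] [HopfAlgebra k H] [Ring A] [Algebra k A]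
  [Module H A] [IsScalarTower k H A] (hS : Bijective (HopfAlgebra.antipode k : H →ₗ[k] H))

lemma tcons_tmul_ext {m : ℕ} {Z N : Type*} [AddCommGroup Z] [Module k Z] [AddCommGroup N]
    [Module k N] {f g : TPow k H (m + 1) ⊗[k] Z →ₗ[k] N}
    (h : ∀ p G z, f (tcons p G ⊗ₜ z) = g (tcons p G ⊗ₜ z)) : f = g :=
  TensorProduct.ext (tpow_ext fun p G => LinearMap.ext fun z => h p G z)

section RightMul

variable {Z : Type*} [AddCommGroup Z] [Module k Z]

variable (k H Z) in
/-- `h ↦ (g ⊗ z ↦ g h ⊗ z)`. -/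
def rightMul : H →ₗ[k] Module.End k (H ⊗[k] Z) :=
  LinearMap.rTensorHom Z ∘ₗ (LinearMap.mul k H).flip

@[simp] lemma rightMul_tmul (h g : H) (z : Z) : rightMul k H Z h (g ⊗ₜ z) = (g * h) ⊗ₜ z := rfl

lemma rightMul_mul (g h : H) (x : H ⊗[k] Z) :
    rightMul k H Z (g * h) x = rightMul k H Z h (rightMul k H Z g x) :=
  app_eq (f := rightMul k H Z (g * h)) (g := rightMul k H Z h ∘ₗ rightMul k H Z g)
    (ext' fun p z => by simp [mul_assoc]) x

lemma rightMul_counit_smul (h : H) (x : H ⊗[k] Z) :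
    rightMul k H Z (counit (R := k) h • 1) x = counit (R := k) h • x :=
  app_eq (f := rightMul k H Z (counit (R := k) h • 1)) (g := counit (R := k) h • .id)
    (ext' fun p z => by simp [smul_tmul']) x

variable {Y : Type*} [AddCommGroup Y] [Module k Y] {ρ : Y →ₗ[k] H ⊗[k] Y} (hρ : IsCoaction ρ)

/-- `(y, g, z) ↦ (y⁽¹⁾, g y⁽⁰⁾, z)`. -/
def shear (Z : Type*) [AddCommGroup Z] [Module k Z] : Y ⊗[k] (H ⊗[k] Z) ≃ₗ[k] Y ⊗[k] (H ⊗[k] Z) :=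
  LinearEquiv.ofLinear (tws ρ (rightMul k H Z))
    (tws ρ (rightMul k H Z ∘ₗ HopfAlgebra.antipode k))
    (LinearMap.ext fun x => (tws_tws hρ _ _ x).trans <| tws_eq_id hρ _ (fun h z => by
      rw [twConv_apply _ _ h (ℛ k h)]
      simp only [comp_apply, ← rightMul_mul, ← LinearMap.sum_apply, ← map_sum,
        HopfAlgebra.sum_antipode_mul_eq_smul (ℛ k h), rightMul_counit_smul]) x)
    (LinearMap.ext fun x => (tws_tws hρ _ _ x).trans <| tws_eq_id hρ _ (fun h z => by
      rw [twConv_apply _ _ h (ℛ k h)]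
      simp only [comp_apply, ← rightMul_mul, ← LinearMap.sum_apply, ← map_sum,
        HopfAlgebra.sum_mul_antipode_eq_smul (ℛ k h), rightMul_counit_smul]) x)

end RightMul

variable (k H A) in
/-- `(g_0, G | a) ↦ (G⁽¹⁾ | g_0 G⁽⁰⁾ | a)`, the comparison of the columns of `A^op ♮ H^cop` with the
Hopf complexes of `C(A^♮_H)`. -/
def phi (q n : ℕ) : Cyl k H A q n ≃ₗ[k] HopfNat k H A q n :=
  (consSplit k H (TPow k A (n + 1)) q).trans (shear (isCoaction_coact q) _)

lemma phi_tcons {q n : ℕ} (g : H) (G : TPow k H q) (z : TPow k A (n + 1)) :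
    phi k H A q n (tcons g G ⊗ₜ z) = tws (coact k H q) (rightMul k H _) (G ⊗ₜ (g ⊗ₜ z)) := by
  rw [phi, LinearEquiv.trans_apply, show consSplit k H (TPow k A (n + 1)) q (tcons g G ⊗ₜ z) =
    G ⊗ₜ (g ⊗ₜ z) from by rw [← LinearEquiv.eq_symm_apply, consSplit_symm, tconsMap_tmul]]
  rfl

lemma phi_map {q n n' : ℕ} (f : TPow k A (n + 1) →ₗ[k] TPow k A (n' + 1)) (x : Cyl k H A q n) :
    phi k H A q n' (map 𝟙 f x) = map 𝟙 (map 𝟙 f) (phi k H A q n x) :=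
  app_eq (f := (phi k H A q n').toLinearMap ∘ₗ map 𝟙 f)
    (g := map 𝟙 (map 𝟙 f) ∘ₗ (phi k H A q n).toLinearMap) (tcons_tmul_ext fun p G z => by
    show phi k H A q n' (tcons p G ⊗ₜ f z) = map 𝟙 _
      (phi k H A q n (tcons p G ⊗ₜ z))
    rw [phi_tcons, phi_tcons, map_tws, tws_tmul, tws_tmul]
    refine app_eq (f := twv _ _ _) (g := twv _ _ _)
      (ext' fun h y => ?_) _
    rfl) x

lemma phi_t (q n : ℕ) (x : Cyl k H A q n) :
    phi k H A q n ((cylA hS A q).t n x) = (rowOps A hS q).t n (phi k H A q n x) := by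
  refine app_eq (f := (phi k H A q n).toLinearMap ∘ₗ (cylA hS A q).t n)
    (g := (rowOps A hS q).t n ∘ₗ (phi k H A q n).toLinearMap) (tcons_tmul_ext fun p G z => ?_) x
  show phi k H A q n ((cylA hS A q).t n (tcons p G ⊗ₜ z)) = map 𝟙 _
      (phi k H A q n (tcons p G ⊗ₜ z))
  rw [phi_tcons, map_tws, aOps_t, aOps_t, tws_tmul, coact_tcons, ← (ℛ k p).eq]
  let V : H → H → H →ₗ[k] TPow k A (n + 1) →ₗ[k] H ⊗[k] TPow k A (n + 1) := fun l r =>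
    llcomp k _ _ _ (mk k H _ r) ∘ₗ tauHom hS A n ∘ₗ mulLeft k l
  have e1 : ∀ l r : H, phi k H A q n (twv _ (tauHom hS A n) z
      (coactMul k H q ((l ⊗ₜ r) ⊗ₜ coact k H q G))) =
      tws (coact k H q) (twConv (rightMul k H _) (V l r)) (G ⊗ₜ z) := by
    intro l r
    rw [← tws_tws (isCoaction_coact q), tws_tmul _ (V l r)]
    generalize coact k H q G = t
    refine app_eq (f := (phi k H A q n).toLinearMap ∘ₗ twv _ (tauHom hS A n) z ∘ₗ
      coactMul k H q ∘ₗ mk k _ _ (l ⊗ₜ r))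
      (g := tws (coact k H q) (rightMul k H _) ∘ₗ twv _ (V l r) z)
      (ext' fun h y => ?_) t
    simp only [comp_apply, mk_apply, coactMul_tmul, twv_tmul, LinearEquiv.coe_coe, phi_tcons]
    rfl
  rw [sum_tmul, map_sum, map_sum, LinearEquiv.map_sum']
  simp only [e1]
  simp only [tws_tmul]
  generalize coact k H q G = t
  rw [← LinearMap.sum_apply]
  refine app_eq (ext' fun h y => ?_) t
  rw [LinearMap.sum_apply]
  simp only [twv_tmul]
  rw [← tmul_sum]
  congr 1
  simp only [twConv_apply _ _ h (ℛ k h)]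
  show _ = tws comul (tauHom hS A n) ((p * h) ⊗ₜ z)
  rw [tws_tmul, Bialgebra.comul_mul, ← (ℛ k p).eq, ← (ℛ k h).eq, Finset.sum_mul_sum, map_sum]
  refine sum_congr rfl fun i _ => ?_
  rw [map_sum]
  simp only [Algebra.TensorProduct.tmul_mul_tmul, twv_tmul]
  rfl

lemma phi_hom (q : ℕ) : CycHom (cylA hS A q) (rowOps A hS q)
    (fun n => (phi k H A q n).toLinearMap) where
  d n i x := by
    show phi k H A q n ((cylA hS A q).d n i x) = map 𝟙 _ _
    induction i using Fin.lastCases with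
    | last =>
      rw [aOps_d_last, aOps_d_of_lt A hS _ 0 (by simp)]
      refine (phi_map _ _).trans ?_
      rw [phi_t, show (aOps A hS comul).d n (Fin.last (n + 1)) =
        map 𝟙 (mulAt k (n + 1) 0) ∘ₗ (aOps A hS comul).t (n + 1) from
          LinearMap.ext fun y => by rw [aOps_d_last, aOps_d_of_lt A hS _ 0 (by simp)]; rfl,
        ← map_id_map_id]
      rfl
    | cast i =>
      rw [aOps_d_of_lt A hS _ i.castSucc i.2, aOps_d_of_lt A hS _ i.castSucc i.2]
      exact phi_map _ _
  s n i x := phi_map _ _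
  t := phi_t hS q

/-! ### The boundary of the Hopf complex -/

lemma counitHead_tcons {q : ℕ} (g : H) (G : TPow k H q) :
    counitHead k H q (tcons g G) = counit (R := k) g • G := by
  simp [counitHead]

lemma actLast_tsnoc {M : Type*} [AddCommGroup M] [Module k M] (α : H →ₗ[k] Module.End k M) {q : ℕ}
    (G : TPow k H q) (g : H) (m : M) : actLast α q (tsnoc G g ⊗ₜ m) = G ⊗ₜ α g m := by
  simp [actLast]

lemma sum_counit_smul' (h : H) {ι : Type*} (r : Repr k h ι) :
    ∑ i ∈ r.index, counit (R := k) (r.right i) • r.left i = h := by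
  have := congrArg (rid k H) (sum_tmul_counit_eq r)
  simpa only [map_sum, rid_tmul, one_smul] using this

lemma phi_d_zero (q n : ℕ) (x : Cyl k H A (q + 1) n) : phi k H A q n ((cylH k H A n).d q 0 x) =
      map (counitHead k H q) 𝟙 (phi k H A (q + 1) n x) := by
  rw [hOps_d_of_lt _ 0 (by simp)]
  refine app_eq
    (f := (phi k H A q n).toLinearMap ∘ₗ map (mulAt k (q + 1) 0) 𝟙)
    (g := map (counitHead k H q) 𝟙 ∘ₗ (phi k H A (q + 1) n).toLinearMap)
    (tcons_tmul_ext fun p F z => ?_) x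
  apply tcons_ind F; intro g G
  show phi k H A q n (mulAt k (q + 1) 0 (tcons p (tcons g G)) ⊗ₜ z) =
    map (counitHead k H q) 𝟙 (phi k H A (q + 1) n (tcons p (tcons g G) ⊗ₜ z))
  rw [mulAt_zero, phi_tcons, phi_tcons, tws_tmul, tws_tmul, coact_tcons]
  generalize coact k H q G = t
  refine app_eq (f := twv _ _ _) (g := map (counitHead k H q) 𝟙 ∘ₗ
    twv _ _ _ ∘ₗ coactMul k H q ∘ₗ mk k _ _ (comul g))
    (ext' fun h y => ?_) t
  simp only [comp_apply, mk_apply]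
  rw [← (ℛ k g).eq, sum_tmul, map_sum, map_sum, map_sum, twv_tmul, rightMul_tmul]
  conv_lhs => rw [← sum_counit_smul' g (ℛ k g)]
  simp only [coactMul_tmul, twv_tmul, rightMul_tmul, map_tmul, counitHead_tcons,
    Finset.mul_sum, Finset.sum_mul, sum_tmul, tmul_sum, mul_smul_comm,
    smul_mul_assoc, smul_tmul, tmul_smul, id_apply, mul_assoc]

lemma phi_d_succ (q n : ℕ) {i : ℕ} (hi : i < q) (x : Cyl k H A (q + 1) n) :
    phi k H A q n (map (mulAt k (q + 1) (i + 1)) 𝟙 x) =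
      map (mulAt k q i) 𝟙 (phi k H A (q + 1) n x) := by
  refine app_eq
    (f := (phi k H A q n).toLinearMap ∘ₗ map (mulAt k (q + 1) (i + 1)) 𝟙)
    (g := map (mulAt k q i) 𝟙 ∘ₗ (phi k H A (q + 1) n).toLinearMap)
    (tcons_tmul_ext fun p G z => ?_) x
  show phi k H A q n (mulAt k (q + 1) (i + 1) (tcons p G) ⊗ₜ z) = map _ 𝟙
    (phi k H A (q + 1) n (tcons p G ⊗ₜ z))
  obtain ⟨q, rfl⟩ : ∃ r, q = r + 1 := ⟨q - 1, by omega⟩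
  rw [mulAt_succ, phi_tcons, phi_tcons, ← tws_map_left (coact k H (q + 1 + 1)) _ _
    fun y => coact_mulAt (q + 1) i y hi]
  rfl

variable (k H A) in
/-- `h ↦ (g ⊗ z ↦ h⁽¹⁾ g ⊗ h⁽⁰⁾ z)`. -/
def diagLeft (n : ℕ) : H →ₗ[k] Module.End k (NatC k H A n) :=
  LinearMap.mul' k (Module.End k (NatC k H A n)) ∘ₗ map
    (LinearMap.lTensorHom H ∘ₗ (diagAct k H A (n + 1)).toLinearMap)
    (LinearMap.rTensorHom (TPow k A (n + 1)) ∘ₗ LinearMap.mul k H) ∘ₗ comul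

lemma diagLeft_tmul (n : ℕ) (h g : H) (z : TPow k A (n + 1)) :
    diagLeft k H A n h (g ⊗ₜ z) = ∑ i ∈ (ℛ k h).index,
      ((ℛ k h).right i * g) ⊗ₜ diagAct k H A (n + 1) ((ℛ k h).left i) z := by
  simp only [diagLeft, comp_apply]
  rw [← (ℛ k h).eq, map_sum, map_sum, LinearMap.sum_apply]
  rfl

lemma diagLeft_rightMul (n : ℕ) (h g : H) (x : NatC k H A n) :
    diagLeft k H A n h (rightMul k H _ g x) = rightMul k H _ g (diagLeft k H A n h x) :=
  app_eq (f := diagLeft k H A n h ∘ₗ rightMul k H _ g)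
    (g := rightMul k H _ g ∘ₗ diagLeft k H A n h) (ext' fun p z => by
      simp only [comp_apply, rightMul_tmul, diagLeft_tmul, map_sum, mul_assoc]) x

lemma natAct_apply (n : ℕ) (h : H) (x : NatC k H A n) :
    natAct k H A n h x = ∑ i ∈ (ℛ k h).index, rightMul k H _
      (HopfAlgebra.antipode k ((ℛ k h).left i)) (diagLeft k H A n ((ℛ k h).right i) x) := by
  simp only [natAct, comp_apply]
  rw [← (ℛ k h).eq, map_sum, map_sum, LinearMap.sum_apply]
  rfl

lemma sum_natAct_rightMul (n : ℕ) (h : H) (x : NatC k H A n) :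
    ∑ i ∈ (ℛ k h).index, natAct k H A n ((ℛ k h).right i) (rightMul k H _ ((ℛ k h).left i) x) =
      diagLeft k H A n h x := by
  let Φ : H ⊗[k] (H ⊗[k] H) →ₗ[k] NatC k H A n :=
    TensorProduct.lift ((diagLeft k H A n).flip ∘ₗ (rightMul k H _).flip x) ∘ₗ
      map (LinearMap.mul' k H ∘ₗ map 𝟙
        (HopfAlgebra.antipode k)) 𝟙 ∘ₗ (assoc k H H H).symm.toLinearMap
  have hΦ : ∀ a b c : H, Φ (a ⊗ₜ (b ⊗ₜ c)) =
    diagLeft k H A n c (rightMul k H _ (a * HopfAlgebra.antipode k b) x) := fun _ _ _ => rfl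
  simp only [natAct_apply, diagLeft_rightMul, ← rightMul_mul]
  refine Eq.trans ?_ ((coassoc_sum Φ h).symm.trans ?_)
  · simp only [hΦ, diagLeft_rightMul]
  · simp only [hΦ, ← map_sum, ← LinearMap.sum_apply,
      HopfAlgebra.sum_mul_antipode_eq_smul (ℛ k ((ℛ k h).left _)), rightMul_counit_smul]
    conv_rhs => rw [← sum_counit_smul (ℛ k h)]
    simp only [map_sum, map_smul, LinearMap.sum_apply, LinearMap.smul_apply]

lemma phi_d_last (q n : ℕ) (x : Cyl k H A (q + 1) n) :
    phi k H A q n ((cylH k H A n).d q (Fin.last (q + 1)) x) =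
      actLast (natAct k H A n) q (phi k H A (q + 1) n x) := by
  refine app_eq
    (f := (phi k H A q n).toLinearMap ∘ₗ (cylH k H A n).d q (Fin.last (q + 1)))
    (g := actLast (natAct k H A n) q ∘ₗ (phi k H A (q + 1) n).toLinearMap)
    (tcons_tmul_ext fun p F z => ?_) x
  apply tsnoc_ind F; intro G g
  show phi k H A q n ((cylH k H A n).d q (Fin.last (q + 1)) (tcons p (tsnoc G g) ⊗ₜ z)) =
    actLast (natAct k H A n) q (phi k H A (q + 1) n (tcons p (tsnoc G g) ⊗ₜ z))
  rw [phi_tcons, tws_tmul, coact_tsnoc, ← tsnoc_tcons, hOps_d_last, hOps_t_tsnoc_sum _ _ _ _ (ℛ k g),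
    hOps_d_of_lt _ 0 (by simp), map_sum, LinearEquiv.map_sum']
  have e : ∀ i, phi k H A q n (map (mulAt k (q + 1) 0) 𝟙 (tcons ((ℛ k g).right i) (tcons p G) ⊗ₜ
        (diagAct k H A (n + 1)).toLinearMap ((ℛ k g).left i) z)) =
      twv _ (rightMul k H _) (((ℛ k g).right i * p) ⊗ₜ diagAct k H A (n + 1) ((ℛ k g).left i) z)
        (coact k H q G) := fun i => by
    rw [map_tmul, mulAt_zero, id_apply, phi_tcons, tws_tmul]
    rfl
  refine (sum_congr rfl fun i _ => e i).trans ?_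
  generalize coact k H q G = t
  rw [← LinearMap.sum_apply]
  refine app_eq (g := actLast (natAct k H A n) q ∘ₗ
    twv _ _ _ ∘ₗ coactMulLast k H q ∘ₗ (mk k _ _).flip (comul g))
    (ext' fun h y => ?_) t
  simp only [comp_apply, LinearMap.flip_apply, mk_apply]
  rw [LinearMap.sum_apply]
  conv_rhs => rw [← (ℛ k g).eq]
  rw [tmul_sum, map_sum, map_sum, map_sum]
  simp only [twv_tmul, coactMulLast_tmul, actLast_tsnoc, rightMul_mul, ← tmul_sum]
  rw [sum_natAct_rightMul, rightMul_tmul, diagLeft_tmul]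
  simp only [rightMul_tmul, mul_assoc]

lemma phi_b (q n : ℕ) (x : Cyl k H A (q + 1) n) :
    phi k H A q n ((cylH k H A n).b q x) = hopfδ (natAct k H A n) q (phi k H A (q + 1) n x) := by
  rw [CycOps.b, Fin.sum_univ_succ, Fin.sum_univ_castSucc, hopfδ, Finset.sum_range]
  simp only [LinearMap.add_apply, LinearMap.sum_apply, LinearMap.smul_apply, LinearEquiv.map_add,
    LinearEquiv.map_smul, LinearEquiv.map_sum', Fin.val_zero, pow_zero, one_smul, phi_d_zero, add_assoc]
  congr 2
  · refine sum_congr rfl fun i _ => ?_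
    rw [hOps_d_of_lt _ i.castSucc.succ (by simp), ← phi_d_succ q n i.2]
    rfl
  · rw [Fin.succ_last, phi_d_last]
    rfl

end Rows

section Descent

/-- The identities of a paracyclic module pass to a module that is covered by the first one. -/
lemma CycOps.IsParacyclic.transport {k : Type*} [CommRing k] {X X' : ℕ → Type*}
    [∀ n, AddCommGroup (X n)] [∀ n, Module k (X n)] [∀ n, AddCommGroup (X' n)]
    [∀ n, Module k (X' n)] {O : CycOps k X} {O' : CycOps k X'} (hO : O.IsParacyclic)
    (R : ∀ n, X n → X' n → Prop) (ex : ∀ n y, ∃ x, R n x y)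
    (un : ∀ n x y y', R n x y → R n x y' → y = y')
    (hd : ∀ n i x y, R (n + 1) x y → R n (O.d n i x) (O'.d n i y))
    (hs : ∀ n i x y, R n x y → R (n + 1) (O.s n i x) (O'.s n i y))
    (ht : ∀ n x y, R n x y → R n (O.t n x) (O'.t n y)) (hb : ∀ n, Bijective (O'.t n)) :
    O'.IsParacyclic where
  d_d n i j h := LinearMap.ext fun y => by
    obtain ⟨x, hx⟩ := ex _ y
    refine un _ _ _ _ (hd _ _ _ _ (hd _ _ _ _ hx)) ?_
    have e : O.d n i (O.d (n + 1) j.succ x) = _ := app_eq (hO.d_d n i j h) x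
    rw [e]
    exact hd _ _ _ _ (hd _ _ _ _ hx)
  s_s n i j h := LinearMap.ext fun y => by
    obtain ⟨x, hx⟩ := ex _ y
    refine un _ _ _ _ (hs _ _ _ _ (hs _ _ _ _ hx)) ?_
    have e : O.s (n + 1) i.castSucc (O.s n j x) = _ := app_eq (hO.s_s n i j h) x
    rw [e]
    exact hs _ _ _ _ (hs _ _ _ _ hx)
  d_s_lt n i j h := LinearMap.ext fun y => by
    obtain ⟨x, hx⟩ := ex _ y
    refine un _ _ _ _ (hd _ _ _ _ (hs _ _ _ _ hx)) ?_
    have e : O.d (n + 1) i.castSucc (O.s (n + 1) j.succ x) = _ := app_eq (hO.d_s_lt n i j h) x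
    rw [e]
    exact hs _ _ _ _ (hd _ _ _ _ hx)
  d_s_eq n i := LinearMap.ext fun y => by
    obtain ⟨x, hx⟩ := ex _ y
    refine un _ _ _ _ (hd _ _ _ _ (hs _ _ _ _ hx)) ?_
    have e : O.d n i.castSucc (O.s n i x) = x := app_eq (hO.d_s_eq n i) x
    rw [e]
    exact hx
  d_s_eq' n i := LinearMap.ext fun y => by
    obtain ⟨x, hx⟩ := ex _ y
    refine un _ _ _ _ (hd _ _ _ _ (hs _ _ _ _ hx)) ?_
    have e : O.d n i.succ (O.s n i x) = x := app_eq (hO.d_s_eq' n i) x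
    rw [e]
    exact hx
  d_s_gt n i j h := LinearMap.ext fun y => by
    obtain ⟨x, hx⟩ := ex _ y
    refine un _ _ _ _ (hd _ _ _ _ (hs _ _ _ _ hx)) ?_
    have e : O.d (n + 1) i.succ (O.s (n + 1) j.castSucc x) = _ := app_eq (hO.d_s_gt n i j h) x
    rw [e]
    exact hs _ _ _ _ (hd _ _ _ _ hx)
  d_t n i := LinearMap.ext fun y => by
    obtain ⟨x, hx⟩ := ex _ y
    refine un _ _ _ _ (hd _ _ _ _ (ht _ _ _ hx)) ?_
    have e : O.d n i.succ (O.t (n + 1) x) = _ := app_eq (hO.d_t n i) x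
    rw [e]
    exact ht _ _ _ (hd _ _ _ _ hx)
  d_zero_t n := LinearMap.ext fun y => by
    obtain ⟨x, hx⟩ := ex _ y
    refine un _ _ _ _ (hd _ _ _ _ (ht _ _ _ hx)) ?_
    have e : O.d n 0 (O.t (n + 1) x) = _ := app_eq (hO.d_zero_t n) x
    rw [e]
    exact hd _ _ _ _ hx
  s_t n i := LinearMap.ext fun y => by
    obtain ⟨x, hx⟩ := ex _ y
    refine un _ _ _ _ (hs _ _ _ _ (ht _ _ _ hx)) ?_
    have e : O.s n i.succ (O.t n x) = _ := app_eq (hO.s_t n i) x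
    rw [e]
    exact ht _ _ _ (hs _ _ _ _ hx)
  s_zero_t n := LinearMap.ext fun y => by
    obtain ⟨x, hx⟩ := ex _ y
    refine un _ _ _ _ (hs _ _ _ _ (ht _ _ _ hx)) ?_
    have e : O.s n 0 (O.t n x) = _ := app_eq (hO.s_zero_t n) x
    rw [e]
    exact ht _ _ _ (ht _ _ _ (hs _ _ _ _ hx))
  t_bijective := hb

section Subq

variable {k : Type*} [CommRing k] {X : Type*} [AddCommGroup X] [Module k X]
  {Y : Type*} [AddCommGroup Y] [Module k Y]

lemma Subq.mk_surjective (Z B : Submodule k X) : Surjective (Subq.mk Z B) :=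
  Submodule.mkQ_surjective _

lemma Subq.mk_eq_zero {Z B : Submodule k X} (x : Z) : Subq.mk Z B x = 0 ↔ (x : X) ∈ B :=
  Submodule.Quotient.mk_eq_zero _

lemma Subq.mk_eq_mk {Z B : Submodule k X} (x y : Z) :
    Subq.mk Z B x = Subq.mk Z B y ↔ (x - y : X) ∈ B := by
  rw [← sub_eq_zero, ← map_sub, Subq.mk_eq_zero]
  rfl

lemma Subq.map_mk {f : X →ₗ[k] Y} {Z B : Submodule k X} {Z' B' : Submodule k Y}
    (h : Descends f Z B Z' B') (x : Z) :
    Subq.map f Z B Z' B' (Subq.mk Z B x) = Subq.mk Z' B' ⟨f x, h.1 x.2⟩ := by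
  have e : Subq.map f Z B Z' B' = @id (Subq Z B →ₗ[k] Subq Z' B')
      (Submodule.mapQ (B.submoduleOf Z) (B'.submoduleOf Z')
        (f.restrict (p := Z) (q := Z') fun _ hx => h.1 hx)
        (fun x hx => h.2 (show (x : X) ∈ B ⊓ Z from ⟨hx, x.2⟩))) := dif_pos h
  rw [e]
  rfl

end Subq

variable {k H A : Type*} [CommRing k] [Ring H] [HopfAlgebra k H] [Ring A] [Algebra k A]
  [Module H A] [IsScalarTower k H A] [IsModuleAlgebra k H A]
  (hS : Bijective (HopfAlgebra.antipode k : H →ₗ[k] H))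

lemma hopfδ_eq (q n : ℕ) (x : HopfNat k H A (q + 1) n) : hopfδ (natAct k H A n) q x =
    phi k H A q n ((cylH k H A n).b q ((phi k H A (q + 1) n).symm x)) := by
  rw [phi_b, LinearEquiv.apply_symm_apply]

/-- The boundary of the Hopf complex is compatible with the operators of `A^♮_H`. -/
lemma hopfδ_hom (q : ℕ) : CycHom (rowOps A hS (q + 1)) (rowOps A hS q)
    (fun n => hopfδ (natAct k H A n) q) := by
  have := CycHom.comp (phi_hom hS q) (CycHom.comp ((cyl_isBiPara (A := A) hS).hom_b q)
    (CycHom.of_inverse _ (phi_hom hS (q + 1))))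
  convert this using 2 with n
  exact LinearMap.ext fun x => hopfδ_eq q n x

/-- A contracting homotopy for `1 - 𝔱^{n+1}` on the Hopf complex. -/
def rowHtpy (q n : ℕ) : HopfNat k H A q n →ₗ[k] HopfNat k H A (q + 1) n :=
  (phi k H A (q + 1) n).toLinearMap ∘ₗ ((cylA hS A (q + 1)).t n ^ (n + 1)) ∘ₗ
    (-(cylH k H A n).B' q) ∘ₗ (phi k H A q n).symm.toLinearMap

lemma rowHtpy_phi (q n : ℕ) (x : Cyl k H A q n) : rowHtpy hS q n (phi k H A q n x) =
    phi k H A (q + 1) n ((cylA hS A (q + 1)).t n ^ (n + 1) <| -(cylH k H A n).B' q x) := by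
  simp only [rowHtpy, comp_apply, LinearEquiv.coe_coe, LinearEquiv.symm_apply_apply]
  rfl

lemma hopfδ_rowHtpy (q n : ℕ) (x : Cyl k H A q n) :
    hopfδ (natAct k H A n) q (rowHtpy hS q n (phi k H A q n x)) =
      phi k H A q n ((cylA hS A q).t n ^ (n + 1) <| -(cylH k H A n).b q ((cylH k H A n).B' q x)) := by
  rw [rowHtpy_phi, ← phi_b, ((cyl_isBiPara hS).hom_b q).t_pow, LinearMap.map_neg]

lemma phi_sub_t_pow (q n : ℕ) (x : Cyl k H A q n) :
    phi k H A q n x - ((rowOps A hS q).t n ^ (n + 1)) (phi k H A q n x) =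
      phi k H A q n ((cylA hS A q).t n ^ (n + 1) <| -(x - ((cylH k H A n).t q ^ (q + 1)) x)) := by
  rw [neg_sub, LinearMap.map_sub, cyl_t_pow_t_pow]
  refine Eq.trans ?_ ((phi k H A q n).toLinearMap.map_sub _ _).symm
  exact congrArg _ ((phi_hom hS q).t_pow n (n + 1) x).symm

lemma rowHtpy_zero (n : ℕ) (x : HopfNat k H A 0 n) :
    x - ((rowOps A hS 0).t n ^ (n + 1)) x = hopfδ (natAct k H A n) 0 (rowHtpy hS 0 n x) := by
  obtain ⟨x, rfl⟩ := (phi k H A 0 n).surjective x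
  rw [hopfδ_rowHtpy, ((cyl_isBiPara (A := A) hS).h n).b_B'_zero x, phi_sub_t_pow]

lemma rowHtpy_succ (q n : ℕ) (x : HopfNat k H A (q + 1) n) :
    x - ((rowOps A hS (q + 1)).t n ^ (n + 1)) x =
      hopfδ (natAct k H A n) (q + 1) (rowHtpy hS (q + 1) n x) +
        rowHtpy hS q n (hopfδ (natAct k H A n) q x) := by
  obtain ⟨x, rfl⟩ := (phi k H A (q + 1) n).surjective x
  rw [hopfδ_rowHtpy, ← phi_b, rowHtpy_phi, phi_sub_t_pow,
    ← ((cyl_isBiPara (A := A) hS).h n).b_B'_succ q x, neg_add, LinearMap.map_add]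
  exact (phi k H A (q + 1) n).toLinearMap.map_add _ _

lemma sub_t_pow_mem (q n : ℕ) (x : HopfNat k H A q n) (hx : x ∈ hopfCycles (natAct k H A n) q) :
    x - ((rowOps A hS q).t n ^ (n + 1)) x ∈ LinearMap.range (hopfδ (natAct k H A n) q) := by
  cases q with
  | zero => exact ⟨_, (rowHtpy_zero hS n x).symm⟩
  | succ q =>
    rw [rowHtpy_succ, show hopfδ (natAct k H A n) q x = 0 from hx, map_zero, add_zero]
    exact ⟨_, rfl⟩

lemma descends_of_hopfδ {n n' : ℕ} (f : ∀ q, HopfNat k H A q n →ₗ[k] HopfNat k H A q n')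
    (hf : ∀ q x, hopfδ (natAct k H A n') q (f (q + 1) x) = f q (hopfδ (natAct k H A n) q x)) (q : ℕ) :
    Descends (f q) (hopfCycles (natAct k H A n) q) (LinearMap.range (hopfδ (natAct k H A n) q))
      (hopfCycles (natAct k H A n') q) (LinearMap.range (hopfδ (natAct k H A n') q)) := by
  refine ⟨?_, ?_⟩
  · cases q with
    | zero => exact fun _ _ => trivial
    | succ q =>
      intro x hx
      show hopfδ _ q _ = 0
      rw [hf, show hopfδ (natAct k H A n) q x = 0 from hx, map_zero]
  · rintro _ ⟨⟨x, rfl⟩, -⟩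
    exact ⟨_, hf q x⟩

lemma rowDescends (q : ℕ) : RowDescends A hS q where
  d n i := descends_of_hopfδ (fun q => (rowOps A hS q).d n i) (fun q x => (hopfδ_hom hS q).d n i x) q
  s n i := descends_of_hopfδ (fun q => (rowOps A hS q).s n i) (fun q x => (hopfδ_hom hS q).s n i x) q
  t n := descends_of_hopfδ (fun q => (rowOps A hS q).t n) (fun q x => (hopfδ_hom hS q).t n x) q

lemma hopfHOps_isCyclic (q : ℕ) : (hopfHOps A hS q).IsCyclic := by
  have hD := rowDescends (A := A) hS q
  have tp : ∀ n j (x : hopfCycles (natAct k H A n) q), ∃ h, ((hopfHOps A hS q).t n ^ j)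
      (Subq.mk _ _ x) = Subq.mk _ _ ⟨((rowOps A hS q).t n ^ j) x, h⟩ := by
    intro n j x
    induction j with
    | zero => exact ⟨x.2, rfl⟩
    | succ j ih =>
      obtain ⟨h, e⟩ := ih
      simp only [pow_succ', Module.End.mul_apply, e]
      exact ⟨(hD.t n).1 h, Subq.map_mk (hD.t n) _⟩
  have tpow : ∀ n, (hopfHOps A hS q).t n ^ (n + 1) = 1 := by
    intro n
    refine LinearMap.ext fun y => ?_
    obtain ⟨x, rfl⟩ := Subq.mk_surjective _ _ y
    obtain ⟨h, e⟩ := tp n (n + 1) x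
    have h0 := sub_t_pow_mem hS q n x.1 x.2
    have h1 := (Subq.mk_eq_mk (B := LinearMap.range (hopfδ (natAct k H A n) q)) x
      ⟨((rowOps A hS q).t n ^ (n + 1)) x, h⟩)
    have h2 := h1.2 h0
    exact e.trans h2.symm
  refine { toIsParacyclic := ?_, t_pow := tpow }
  refine CycOps.IsParacyclic.transport ((cyl_isBiPara (A := A) hS).a q)
    (fun n x y => ∃ h, y = Subq.mk _ _ ⟨phi k H A q n x, h⟩) ?_ ?_ ?_ ?_ ?_ ?_
  · intro n y
    obtain ⟨x, rfl⟩ := Subq.mk_surjective _ _ y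
    obtain ⟨z, hz⟩ := (phi k H A q n).surjective x.1
    exact ⟨z, by rw [hz]; exact x.2, by simp only [hz]⟩
  · rintro n x _ _ ⟨h, rfl⟩ ⟨h', rfl⟩
    rfl
  · rintro n i x _ ⟨h, rfl⟩
    have e := (phi_hom hS q).d n i x
    exact ⟨e ▸ (hD.d n i).1 h, (Subq.map_mk (hD.d n i) _).trans (congrArg _ (Subtype.ext e.symm))⟩
  · rintro n i x _ ⟨h, rfl⟩
    have e := (phi_hom hS q).s n i x
    exact ⟨e ▸ (hD.s n i).1 h, (Subq.map_mk (hD.s n i) _).trans (congrArg _ (Subtype.ext e.symm))⟩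
  · rintro n x _ ⟨h, rfl⟩
    have e := (phi_hom hS q).t n x
    exact ⟨e ▸ (hD.t n).1 h, (Subq.map_mk (hD.t n) _).trans (congrArg _ (Subtype.ext e.symm))⟩
  · intro n
    refine (Module.End.isUnit_iff _).1 ?_
    exact IsUnit.of_pow_eq_one (tpow n) (by omega)

end Descent

/-! ### Functoriality of `V ⊠ W` -/

section BoxMaps

variable {k : Type*} [CommRing k]
  {I : Type*} {deg : I → ℕ} {V : I → Type*} [∀ i, AddCommGroup (V i)] [∀ i, Module k (V i)]
  {I' : Type*} {deg' : I' → ℕ} {V' : I' → Type*} [∀ i, AddCommGroup (V' i)] [∀ i, Module k (V' i)]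
  {I'' : Type*} {deg'' : I'' → ℕ} {V'' : I'' → Type*} [∀ i, AddCommGroup (V'' i)]
  [∀ i, Module k (V'' i)] {Θ : (∀ i, V i) →ₗ[k] (∀ i, V' i)} {c : ℤ}

lemma LowersTo.comp {c' c'' : ℤ} {Θ' : (∀ i, V' i) →ₗ[k] (∀ i, V'' i)}
    (hΘ' : LowersTo k deg' deg'' c' Θ') (hΘ : LowersTo k deg deg' c Θ) (h : c' + c = c'') :
    LowersTo k deg deg'' c'' (Θ' ∘ₗ Θ) :=
  fun m m' hm x hx => hΘ' (m - c) m' (by omega) _ (hΘ m (m - c) (by omega) x hx)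

lemma LowersTo.sub {Θ' : (∀ i, V i) →ₗ[k] (∀ i, V' i)} (hΘ : LowersTo k deg deg' c Θ)
    (hΘ' : LowersTo k deg deg' c Θ') : LowersTo k deg deg' c (Θ - Θ') :=
  fun m m' hm x hx => Submodule.sub_mem _ (hΘ m m' hm x hx) (hΘ' m m' hm x hx)

lemma LowersTo.of_apply (h : ∀ x i', (∀ i, (∃ r : ℕ, (deg i : ℤ) + 2 * r = deg' i' + c) → x i = 0) →
    Θ x i' = 0) : LowersTo k deg deg' c Θ := by
  intro m m' hm x hx i' hi'
  refine h x i' fun i ⟨r, hr⟩ => hx i fun ⟨h1, s, hs⟩ => hi' ⟨by omega, r + s, by omega⟩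

variable {W : ℤ → Type*} [∀ j, AddCommGroup (W j)] [∀ j, Module k (W j)]
  (u : ∀ j, W j →ₗ[k] W (j - 2))

variable (deg V) in
/-- `Box.tmul` as a bilinear map. -/
def Box.tmulHom (n j : ℤ) : PS k deg V (n - j) →ₗ[k] W j →ₗ[k] Box k u deg V n :=
  (mk k (PS k deg V (n - j)) (W j)).compr₂
    ((boxRel k u deg V n).mkQ ∘ₗ DirectSum.lof k ℤ (fun j => Piece k deg V W (n - j) j) j)

lemma Box.tmulHom_apply {n j : ℤ} (x : PS k deg V (n - j)) (w : W j) :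
    Box.tmulHom deg V u n j x w = Box.tmul k u deg V n j x w := rfl

variable {u} {n : ℤ} {M : Type*} [AddCommGroup M] [Module k M]

lemma Box.hom_ext {f g : Box k u deg V n →ₗ[k] M}
    (h : ∀ j x w, f (Box.tmul k u deg V n j x w) = g (Box.tmul k u deg V n j x w)) : f = g :=
  Submodule.linearMap_qext _ (DirectSum.linearMap_ext k fun j => ext' fun x w => h j x w)

lemma Box.eq_top {S : Submodule k (Box k u deg V n)}
    (h : ∀ j x w, Box.tmul k u deg V n j x w ∈ S) : S = ⊤ := by
  have : S.mkQ = 0 := Box.hom_ext fun j x w => (Submodule.Quotient.mk_eq_zero _).2 (h j x w)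
  rw [← S.ker_mkQ, this, LinearMap.ker_zero]

/-- The map of `V[[u]] ⊗ W` given by a family of bilinear maps. -/
def PreBox.desc (φ : ∀ j, PS k deg V (n - j) →ₗ[k] W j →ₗ[k] M) : PreBox k deg V W n →ₗ[k] M :=
  DirectSum.toModule k ℤ M fun j =>
    show Piece k deg V W (n - j) j →ₗ[k] M from TensorProduct.lift (φ j)

lemma PreBox.desc_tmul (φ : ∀ j, PS k deg V (n - j) →ₗ[k] W j →ₗ[k] M) (j : ℤ)
    (x : PS k deg V (n - j)) (w : W j) : PreBox.desc φ (PreBox.tmul k deg V n j x w) = φ j x w :=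
  DirectSum.toModule_lof (M := fun j => Piece k deg V W (n - j) j) k j _

variable (u) in
/-- The universal property of `V ⊠ W`. -/
def Box.desc (φ : ∀ j, PS k deg V (n - j) →ₗ[k] W j →ₗ[k] M)
    (hφ : ∀ j (x : PS k deg V (n - (j - 2))) (w : W j),
      φ j (Submodule.inclusion (PS_le k deg V (by ring)) x) w = φ (j - 2) x (u j w)) :
    Box k u deg V n →ₗ[k] M :=
  Submodule.liftQ (boxRel k u deg V n) (PreBox.desc φ) (by
    rw [boxRel, Submodule.span_le]
    rintro _ ⟨j, x, w, rfl⟩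
    refine (map_sub (PreBox.desc φ) _ _).trans (sub_eq_zero.2 ?_)
    rw [PreBox.desc_tmul, PreBox.desc_tmul, hφ])

lemma Box.desc_tmul (φ : ∀ j, PS k deg V (n - j) →ₗ[k] W j →ₗ[k] M) (hφ) (j : ℤ)
    (x : PS k deg V (n - j)) (w : W j) : Box.desc u φ hφ (Box.tmul k u deg V n j x w) = φ j x w :=
  PreBox.desc_tmul φ j x w

lemma Box.tmul_incl {j : ℤ} (x : PS k deg V (n - (j - 2))) (w : W j) :
    Box.tmul k u deg V n j (Submodule.inclusion (PS_le k deg V (by ring)) x) w =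
      Box.tmul k u deg V n (j - 2) x (u j w) := by
  rw [← sub_eq_zero]
  exact (Submodule.Quotient.mk_eq_zero _).2 (Submodule.subset_span ⟨j, x, w, rfl⟩)

lemma Box.tmul_congr {j : ℤ} {x y : PS k deg V (n - j)} (h : x.1 = y.1) (w : W j) :
    Box.tmul k u deg V n j x w = Box.tmul k u deg V n j y w := by
  rw [Subtype.ext h]

variable {n' n'' : ℤ}

variable (u) in
/-- The map `(V ⊠ W)_n → (V' ⊠ W)_{n'}` induced by `Θ`, which lowers the degree by `c = n - n'`. -/
def Box.mapTo (hΘ : LowersTo k deg deg' c Θ) (h : n' + c = n) :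
    Box k u deg V n →ₗ[k] Box k u deg' V' n' :=
  Box.desc u (fun j => Box.tmulHom deg' V' u n' j ∘ₗ Θ.restrict (p := PS k deg V (n - j))
    (q := PS k deg' V' (n' - j)) fun x hx => hΘ _ _ (by omega) x hx)
    fun j x w => Box.tmul_incl (u := u) (deg := deg') (V := V') (n := n')
      ⟨Θ x, hΘ _ _ (by omega) x x.2⟩ w

lemma Box.mapTo_tmul (hΘ : LowersTo k deg deg' c Θ) (h : n' + c = n) (j : ℤ)
    (x : PS k deg V (n - j)) (w : W j) : Box.mapTo u hΘ h (Box.tmul k u deg V n j x w) =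
      Box.tmul k u deg' V' n' j ⟨Θ x, hΘ _ _ (by omega) x x.2⟩ w :=
  Box.desc_tmul _ _ j x w

lemma Box.map_eq {V' : I → Type*} [∀ i, AddCommGroup (V' i)] [∀ i, Module k (V' i)]
    {Θ : (∀ i, V i) →ₗ[k] (∀ i, V' i)} (hΘ : Lowers k deg c Θ) (h : n' + c = n) :
    Box.map k u deg hΘ h = Box.mapTo u (Θ := Θ) (deg' := deg) hΘ h := by
  refine Box.hom_ext fun j x w => Eq.trans ?_ (Box.mapTo_tmul _ h j x w).symm
  exact congrArg (boxRel k u deg V' n').mkQ (DirectSum.lmap_lof _ _ _)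

lemma Box.mapTo_mapTo {c' c'' : ℤ} {Θ' : (∀ i, V' i) →ₗ[k] (∀ i, V'' i)}
    {Θ'' : (∀ i, V i) →ₗ[k] (∀ i, V'' i)} {hΘ : LowersTo k deg deg' c Θ}
    {hΘ' : LowersTo k deg' deg'' c' Θ'} (hΘ'' : LowersTo k deg deg'' c'' Θ'') {h : n' + c = n}
    {h' : n'' + c' = n'} (h'' : n'' + c'' = n) (e : ∀ x, Θ' (Θ x) = Θ'' x) (z : Box k u deg V n) :
    Box.mapTo u hΘ' h' (Box.mapTo u hΘ h z) = Box.mapTo u hΘ'' h'' z := by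
  refine app_eq (f := Box.mapTo u hΘ' h' ∘ₗ Box.mapTo u hΘ h)
    (Box.hom_ext fun j x w => ?_) z
  rw [comp_apply, Box.mapTo_tmul, Box.mapTo_tmul, Box.mapTo_tmul]
  exact Box.tmul_congr (e x) w

lemma Box.mapTo_id {hΘ : LowersTo k deg deg c (𝟙 : (∀ i, V i) →ₗ[k] _)} {h : n + c = n}
    (z : Box k u deg V n) : Box.mapTo u hΘ h z = z :=
  app_eq (g := 𝟙) (Box.hom_ext fun j x w => Box.mapTo_tmul hΘ h j x w) z

lemma Box.tmul_add {j : ℤ} (x y : PS k deg V (n - j)) (w : W j) :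
    Box.tmul k u deg V n j (x + y) w = Box.tmul k u deg V n j x w + Box.tmul k u deg V n j y w := by
  rw [← tmulHom_apply, map_add]; rfl

lemma Box.tmul_sub {j : ℤ} (x y : PS k deg V (n - j)) (w : W j) :
    Box.tmul k u deg V n j (x - y) w = Box.tmul k u deg V n j x w - Box.tmul k u deg V n j y w := by
  rw [← tmulHom_apply, map_sub]; rfl

lemma Box.tmul_smul {j : ℤ} (r : k) (x : PS k deg V (n - j)) (w : W j) :
    Box.tmul k u deg V n j (r • x) w = r • Box.tmul k u deg V n j x w := by
  rw [← tmulHom_apply, map_smul]; rfl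

lemma Box.tmul_eq_zero {j : ℤ} {x : PS k deg V (n - j)} (hx : x.1 = 0) (w : W j) :
    Box.tmul k u deg V n j x w = 0 := by
  obtain rfl : x = 0 := Subtype.ext hx
  rw [← tmulHom_apply, map_zero]; rfl

end BoxMaps

section Twist

variable {k : Type*} [CommRing k] {X : ℕ → Type*} [∀ n, AddCommGroup (X n)] [∀ n, Module k (X n)]
  {X' : ℕ → Type*} [∀ n, AddCommGroup (X' n)] [∀ n, Module k (X' n)] {O : CycOps k X}
  {O' : CycOps k X'}

/-- The map of products given by a family of maps. -/
abbrev piMap (f : ∀ n, X n →ₗ[k] X' n) : (∀ n, X n) →ₗ[k] (∀ n, X' n) :=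
  LinearMap.pi fun n => f n ∘ₗ proj n

lemma CycHom.mixedD {f : ∀ n, X n →ₗ[k] X' n} (hf : CycHom O O' f) (x : ∀ n, X n) :
    piMap f (O.mixedD x) = O'.mixedD (piMap f x) := by
  funext n
  cases n with
  | zero =>
    rw [CycOps.mixedD_zero]
    exact (congrArg (f 0) (O.mixedD_zero x)).trans (hf.b 0 _)
  | succ n =>
    rw [CycOps.mixedD_succ]
    exact (congrArg (f (n + 1)) (O.mixedD_succ x n)).trans
      ((map_add _ _ _).trans (congrArg₂ _ (hf.b _ _) (hf.B _ _)))

lemma CycHom.twist {f : ∀ n, X n →ₗ[k] X' n} (hf : CycHom O O' f) (x : ∀ n, X n) :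
    piMap f (O.twist x) = O'.twist (piMap f x) := by
  funext n
  match n with
  | 0 => rfl
  | 1 => rfl
  | n + 2 =>
    rw [CycOps.twist_add_two]
    exact (map_add _ _ _).trans (congrArg _ (hf.corr n (x n)))

lemma CycHom.untwist {f : ∀ n, X n →ₗ[k] X' n} (hf : CycHom O O' f) (x : ∀ n, X n) :
    piMap f (O.untwist x) = O'.untwist (piMap f x) := by
  rw [← O'.untwist_twist (piMap f (O.untwist x)), ← hf.twist, O.twist_untwist]

/-- `Q x`, where `defect x = (1 - τ^{n+1}) Q x`. -/
def CycOps.defectRoot (O : CycOps k X) : (∀ n, X n) →ₗ[k] (∀ n, X n) :=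
  LinearMap.pi fun n => match n with
    | 0 => 0
    | 1 => 0
    | 2 => 0
    | n + 3 => O.corrRest n ∘ₗ proj n

lemma CycOps.defect_eq (x : ∀ n, X n) : O.defect x =
    O.defectRoot x - piMap (fun n => O.t n ^ (n + 1)) (O.defectRoot x) := by
  funext n
  match n with
  | 0 => exact ((congrArg (0 - ·) (LinearMap.map_zero (O.t 0 ^ 1))).trans (sub_zero 0)).symm
  | 1 => exact ((congrArg (0 - ·) (LinearMap.map_zero (O.t 1 ^ 2))).trans (sub_zero 0)).symm
  | 2 => exact ((congrArg (0 - ·) (LinearMap.map_zero (O.t 2 ^ 3))).trans (sub_zero 0)).symm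
  | n + 3 => rfl

lemma CycHom.defectRoot {f : ∀ n, X n →ₗ[k] X' n} (hf : CycHom O O' f) (x : ∀ n, X n) :
    piMap f (O.defectRoot x) = O'.defectRoot (piMap f x) := by
  funext n
  match n with
  | 0 => exact (f 0).map_zero
  | 1 => exact (f 1).map_zero
  | 2 => exact (f 2).map_zero
  | n + 3 => exact hf.corrRest n (x n)

lemma lowersTo_twist : LowersTo k (id : ℕ → ℕ) (id : ℕ → ℕ) 0 O.twist := by
  refine LowersTo.of_apply fun x n hx => ?_
  match n with
  | 0 => exact hx 0 ⟨0, by simp⟩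
  | 1 => exact hx 1 ⟨0, by simp⟩
  | n + 2 =>
    rw [CycOps.twist_add_two, hx (n + 2) ⟨0, by simp⟩, hx n ⟨1, by simp⟩, map_zero, add_zero]

lemma lowersTo_untwist : LowersTo k (id : ℕ → ℕ) (id : ℕ → ℕ) 0 O.untwist := by
  have key : ∀ (x : ∀ n, X n) n, (∀ i, (∃ r : ℕ, i + 2 * r = n) → x i = 0) → O.untwist x n = 0 := by
    intro x n
    induction n using Nat.twoStepInduction with
    | zero => exact fun hx => hx 0 ⟨0, by simp⟩
    | one => exact fun hx => hx 1 ⟨0, by simp⟩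
    | more n ih _ =>
      intro hx
      rw [CycOps.untwist_add_two, hx (n + 2) ⟨0, by simp⟩,
        ih fun i ⟨r, hr⟩ => hx i ⟨r + 1, by omega⟩, map_zero, sub_zero]
  exact LowersTo.of_apply fun x n hx => key x n fun i ⟨r, hr⟩ => hx i ⟨r, by simp; omega⟩

lemma lowersTo_defectRoot : LowersTo k (id : ℕ → ℕ) (id : ℕ → ℕ) 1 O.defectRoot := by
  refine LowersTo.of_apply fun x n hx => ?_
  match n with
  | 0 | 1 | 2 => rfl
  | n + 3 =>
    refine (congrArg (O.corrRest n) (hx n ⟨2, ?_⟩)).trans (map_zero _)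
    simp only [id]
    push_cast
    ring

end Twist

section Columns

variable {k H A : Type*} [CommRing k] [Ring H] [HopfAlgebra k H] [Ring A] [Algebra k A]
  [Module H A] [IsScalarTower k H A] (hS : Bijective (HopfAlgebra.antipode k : H →ₗ[k] H))

variable (k H A) in
/-- The `q`-th row of an element of the total complex. -/
def rowProj (q : ℕ) :
    (∀ i : ℕ × ℕ, Cyl k H A i.1 i.2) →ₗ[k] (∀ n, Cyl k H A q n) :=
  LinearMap.pi fun n => proj ((q, n) : ℕ × ℕ)

variable (k H A) in
/-- The inclusion of the `q`-th row. -/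
def rowIncl (q : ℕ) :
    (∀ n, Cyl k H A q n) →ₗ[k] (∀ i : ℕ × ℕ, Cyl k H A i.1 i.2) :=
  LinearMap.pi fun i => if h : q = i.1 then h ▸ proj i.2 else 0

lemma rowIncl_self (q n : ℕ) (x : ∀ n, Cyl k H A q n) : rowIncl k H A q x (q, n) = x n :=
  app_eq (show rowIncl k H A q |> (proj ((q, n) : ℕ × ℕ) ∘ₗ ·) |>
    (· = proj n) from dif_pos rfl) x

lemma rowIncl_ne {q m : ℕ} (h : q ≠ m) (n : ℕ) (x : ∀ n, Cyl k H A q n) :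
    rowIncl k H A q x (m, n) = 0 := by
  show (if h : q = m then h ▸ proj n else 0 : (∀ n, Cyl k H A q n) →ₗ[k] Cyl k H A m n) x = 0
  rw [dif_neg h]
  rfl

/-- The maps `phi` on a row. -/
abbrev piPhi (k H A : Type*) [CommRing k] [Ring H] [HopfAlgebra k H] [Ring A] [Algebra k A]
    [Module H A] [IsScalarTower k H A] (q : ℕ) :
    (∀ n, Cyl k H A q n) →ₗ[k] (∀ n, HopfNat k H A q n) :=
  piMap fun n => (phi k H A q n).toLinearMap

/-- The inverse of `piPhi`. -/
abbrev piPhiInv (k H A : Type*) [CommRing k] [Ring H] [HopfAlgebra k H] [Ring A] [Algebra k A]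
    [Module H A] [IsScalarTower k H A] (q : ℕ) :
    (∀ n, HopfNat k H A q n) →ₗ[k] (∀ n, Cyl k H A q n) :=
  piMap fun n => (phi k H A q n).symm.toLinearMap

lemma piPhiInv_piPhi (q : ℕ) (x : ∀ n, Cyl k H A q n) :
    piPhiInv k H A q (piPhi k H A q x) = x := funext fun n => (phi k H A q n).symm_apply_apply (x n)

lemma piPhi_piPhiInv (q : ℕ) (y : ∀ n, HopfNat k H A q n) :
    piPhi k H A q (piPhiInv k H A q y) = y := funext fun n => (phi k H A q n).apply_symm_apply (y n)

/-- The comparison of the `q`-th row with the `q`-chains of the Hopf complex. -/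
def toRow (q : ℕ) : (∀ i : ℕ × ℕ, Cyl k H A i.1 i.2) →ₗ[k] (∀ n, HopfNat k H A q n) :=
  piPhi k H A q ∘ₗ (cylA hS A q).twist ∘ₗ rowProj k H A q

/-- A section of `toRow`. -/
def ofRow (q : ℕ) : (∀ n, HopfNat k H A q n) →ₗ[k] (∀ i : ℕ × ℕ, Cyl k H A i.1 i.2) :=
  rowIncl k H A q ∘ₗ (cylA hS A q).untwist ∘ₗ piPhiInv k H A q

lemma rowProj_rowIncl (q : ℕ) (x : ∀ n, Cyl k H A q n) :
    rowProj k H A q (rowIncl k H A q x) = x := funext fun n => rowIncl_self q n x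

lemma toRow_ofRow (q : ℕ) (y : ∀ n, HopfNat k H A q n) :
    toRow (A := A) hS q (ofRow hS q y) = y := by
  show piPhi k H A q ((cylA hS A q).twist (rowProj k H A q (rowIncl k H A q _))) = y
  rw [rowProj_rowIncl]
  exact (congrArg _ (CycOps.twist_untwist _ _)).trans (piPhi_piPhiInv q y)

lemma ofRow_toRow (q : ℕ) (x : ∀ i : ℕ × ℕ, Cyl k H A i.1 i.2) :
    ofRow (A := A) hS q (toRow hS q x) = rowIncl k H A q (rowProj k H A q x) := by
  show rowIncl k H A q ((cylA hS A q).untwist (piPhiInv k H A q (piPhi k H A q _))) = _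
  rw [piPhiInv_piPhi]
  exact congrArg _ (CycOps.untwist_twist _ _)

lemma lowersTo_piMap {X X' : ℕ → Type*} [∀ n, AddCommGroup (X n)] [∀ n, Module k (X n)]
    [∀ n, AddCommGroup (X' n)] [∀ n, Module k (X' n)] (f : ∀ n, X n →ₗ[k] X' n) :
    LowersTo k (id : ℕ → ℕ) (id : ℕ → ℕ) 0 (piMap f) := lowers_pi id f

lemma lowersTo_toRow (q : ℕ) : LowersTo k totDeg (id : ℕ → ℕ) q (toRow (A := A) hS q) := by
  refine (lowersTo_piMap _).comp (lowersTo_twist.comp (c' := 0) (c := q) (c'' := q) ?_ (by simp)) (by simp)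
  exact LowersTo.of_apply fun x n hx => hx (q, n) ⟨0, by simp [totDeg]; ring⟩

lemma lowersTo_ofRow (q : ℕ) : LowersTo k (id : ℕ → ℕ) totDeg (-q) (ofRow (A := A) hS q) := by
  refine LowersTo.comp (c' := -q) ?_
    ((lowersTo_untwist.comp (lowersTo_piMap _) (zero_add 0))) (by simp)
  refine LowersTo.of_apply fun x i hx => ?_
  obtain ⟨m, n⟩ := i
  by_cases h : q = m
  · subst h
    rw [rowIncl_self]
    exact hx n ⟨0, by simp [totDeg]⟩
  · exact rowIncl_ne h n x

/-- The boundary of the Hopf complexes. -/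
abbrev piδ (k H A : Type*) [CommRing k] [Ring H] [HopfAlgebra k H] [Ring A] [Algebra k A]
    [Module H A] [IsScalarTower k H A] (q : ℕ) :
    (∀ n, HopfNat k H A (q + 1) n) →ₗ[k] (∀ n, HopfNat k H A q n) :=
  piMap fun n => hopfδ (natAct k H A n) q

variable [IsModuleAlgebra k H A]

/-- `Q`, transported to the Hopf complex. -/
def rowRoot (q : ℕ) : (∀ n, HopfNat k H A q n) →ₗ[k] (∀ n, HopfNat k H A q n) :=
  piPhi k H A q ∘ₗ (cylA hS A q).defectRoot ∘ₗ (cylA hS A q).untwist ∘ₗ piPhiInv k H A q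

/-- The failure of `toRow` to intertwine `b + B'` with `𝔟 + 𝔅`. -/
def rowDefect (q : ℕ) : (∀ n, HopfNat k H A q n) →ₗ[k] (∀ n, HopfNat k H A q n) :=
  (𝟙 - piMap fun n => (rowOps A hS q).t n ^ (n + 1)) ∘ₗ rowRoot hS q

/-- The homotopy that kills `rowDefect`. -/
def rowDefectHtpy (q : ℕ) : (∀ n, HopfNat k H A q n) →ₗ[k] (∀ n, HopfNat k H A (q + 1) n) :=
  piMap (rowHtpy hS q) ∘ₗ rowRoot hS q

lemma lowersTo_rowRoot (q : ℕ) : LowersTo k (id : ℕ → ℕ) (id : ℕ → ℕ) 1 (rowRoot (A := A) hS q) :=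
  (lowersTo_piMap _).comp (lowersTo_defectRoot.comp (lowersTo_untwist.comp (lowersTo_piMap _)
    (zero_add 0)) (add_zero 1)) (zero_add 1)

lemma lowersTo_rowDefect (q : ℕ) :
    LowersTo k (id : ℕ → ℕ) (id : ℕ → ℕ) 1 (rowDefect (A := A) hS q) :=
  LowersTo.comp (c' := 0) (LowersTo.sub (fun m m' h x hx => by
    obtain rfl : m' = m := by omega
    exact hx) (lowersTo_piMap _)) (lowersTo_rowRoot hS q) (zero_add 1)

lemma lowersTo_rowDefectHtpy (q : ℕ) :
    LowersTo k (id : ℕ → ℕ) (id : ℕ → ℕ) 1 (rowDefectHtpy (A := A) hS q) :=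
  (lowersTo_piMap _).comp (lowersTo_rowRoot hS q) (zero_add 1)

lemma piδ_rowRoot (q : ℕ) (y : ∀ n, HopfNat k H A (q + 1) n) :
    piδ k H A q (rowRoot hS (q + 1) y) = rowRoot hS q (piδ k H A q y) := by
  have hb := (cyl_isBiPara (A := A) hS).hom_b q
  rw [← piPhi_piPhiInv (q + 1) y]
  generalize piPhiInv k H A (q + 1) y = x
  have e1 : ∀ x : ∀ n, Cyl k H A (q + 1) n, piδ k H A q (piPhi k H A (q + 1) x) = piPhi k H A q
        (piMap (fun n => (cylH k H A n).b q) x) := fun x => funext fun n => (phi_b q n (x n)).symm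
  have e2 : ∀ q (x : ∀ n, Cyl k H A q n), rowRoot hS q (piPhi k H A q x) = piPhi k H A q
        ((cylA hS A q).defectRoot ((cylA hS A q).untwist x)) := fun q x => by
    show piPhi k H A q ((cylA hS A q).defectRoot ((cylA hS A q).untwist
      (piPhiInv k H A q (piPhi k H A q x)))) = _
    rw [piPhiInv_piPhi]
  rw [e2, e1, e1, e2, hb.defectRoot, hb.untwist]

lemma rowDefect_zero (y : ∀ n, HopfNat k H A 0 n) :
    rowDefect hS 0 y = piδ k H A 0 (rowDefectHtpy hS 0 y) :=
  funext fun n => rowHtpy_zero hS n (rowRoot hS 0 y n)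

lemma rowDefect_succ (q : ℕ) (y : ∀ n, HopfNat k H A (q + 1) n) : rowDefect hS (q + 1) y =
    piδ k H A (q + 1) (rowDefectHtpy hS (q + 1) y) + rowDefectHtpy hS q (piδ k H A q y) := by
  funext n
  refine (rowHtpy_succ hS q n (rowRoot hS (q + 1) y n)).trans ?_
  show _ + _ = _ + rowHtpy hS q n (rowRoot hS q (piδ k H A q y) n)
  rw [← piδ_rowRoot]
  rfl

/-- The total differential, seen from the rows. -/
lemma toRow_totD (q : ℕ) (x : ∀ i : ℕ × ℕ, Cyl k H A i.1 i.2) (hx : ∀ m n, m < q → x (m, n) = 0) :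
    toRow hS q (totD (cylH k H A) (cylA hS A) x) = piδ k H A q (toRow hS (q + 1) x) +
      (-1 : k) ^ q • ((rowOps A hS q).mixedD (toRow hS q x) - rowDefect hS q (toRow hS q x)) := by
  have hX := cyl_isBiPara (A := A) hS
  have e1 : rowProj k H A q (totD (cylH k H A) (cylA hS A) x) =
      piMap (fun n => (cylH k H A n).b q) (rowProj k H A (q + 1) x) +
        (-1 : k) ^ q • (cylA hS A q).mixedD' (rowProj k H A q x) := by
    funext n
    refine (totD_eq _ _ x q n).trans (congrArg (· + _) ?_)
    show (cylH k H A n).b q (x (q + 1, n)) + totBbarInto _ _ q n x = (cylH k H A n).b q (x (q + 1, n))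
    rw [add_eq_left]
    cases q with
    | zero => rfl
    | succ q =>
      show ((cylA hS A (q + 1)).t n ^ (n + 1)) ((cylH k H A n).B' q (x (q, n))) = 0
      rw [hx q n (by omega), LinearMap.map_zero, LinearMap.map_zero]
  have e2 : (cylA hS A q).twist ((cylA hS A q).mixedD' (rowProj k H A q x)) =
      (cylA hS A q).mixedD ((cylA hS A q).twist (rowProj k H A q x)) -
        (cylA hS A q).defect (rowProj k H A q x) := by
    rw [(hX.a q).mixedD_twist, add_sub_cancel_right]
  have e3 : piPhi k H A q ((cylA hS A q).defect (rowProj k H A q x)) =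
      rowDefect hS q (toRow hS q x) := by
    have e4 : rowRoot hS q (toRow hS q x) = piPhi k H A q
        ((cylA hS A q).defectRoot (rowProj k H A q x)) := by
      show piPhi k H A q ((cylA hS A q).defectRoot ((cylA hS A q).untwist
        (piPhiInv k H A q (piPhi k H A q _)))) = _
      rw [piPhiInv_piPhi]
      exact congrArg (fun y => piPhi k H A q ((cylA hS A q).defectRoot y)) (CycOps.untwist_twist _ _)
    show _ = rowRoot hS q (toRow hS q x) - piMap _ (rowRoot hS q (toRow hS q x))
    rw [e4, CycOps.defect_eq, map_sub]
    exact congrArg (_ - ·) (funext fun n => (phi_hom hS q).t_pow n (n + 1) _)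
  have e5 : ∀ y, toRow hS q y = piPhi k H A q
    ((cylA hS A q).twist (rowProj k H A q y)) := fun y => rfl
  rw [e5 (totD _ _ x), e1, map_add, map_smul, e2, map_add, map_smul, map_sub, e3,
    (phi_hom hS q).mixedD, ← (hX.hom_b q).twist]
  refine congrArg (· + _) (funext fun n => phi_b q n _)

end Columns

section FilteredComplex

variable {k : Type*} [CommRing k] {X : Type*} [AddCommGroup X] [Module k X] {Y : Type*}
  [AddCommGroup Y] [Module k Y]

/-- A subquotient `Z / B` is the image of every map on `Z` with kernel `B ∩ Z`. -/
def Subq.liftEquiv {Z B : Submodule k X} (g : Z →ₗ[k] Y) (hker : ∀ z, g z = 0 ↔ (z : X) ∈ B)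
    (hsurj : Surjective g) : Subq Z B ≃ₗ[k] Y :=
  (Submodule.quotEquivOfEq (B.submoduleOf Z) (LinearMap.ker g)
    (Submodule.ext fun z => (hker z).symm)).trans (g.quotKerEquivOfSurjective hsurj)

namespace FiltOps

variable {K : ℤ → Type*} [∀ n, AddCommGroup (K n)] [∀ n, Module k (K n)] {C : FiltOps k K}

lemma mem_Z {r p p' n n' : ℤ} (h : n' + 1 = n) (hp : p' + r = p) {x : K n} :
    x ∈ C.Z r p n ↔ x ∈ C.F n p ∧ C.d h x ∈ C.F n' p' := by
  obtain rfl : n' = n - 1 := by omega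
  obtain rfl : p' = p - r := by omega
  rw [Z, Submodule.mem_inf, Submodule.mem_iInf]
  refine and_congr_right fun _ => ⟨fun hx => ?_, fun hx n'' => ?_⟩
  · exact (Submodule.mem_iInf _).1 (hx (n - 1)) h
  · refine (Submodule.mem_iInf _).2 fun h'' => ?_
    obtain rfl : n'' = n - 1 := by omega
    exact hx

lemma mem_Bd {r r' p p' p'' n n' : ℤ} (h : n + 1 = n') (hr : r' + 1 = r) (hp : p' + 1 = p)
    (hp' : p + r' = p'') {x : K n} :
    x ∈ C.Bd r p n ↔ ∃ a ∈ C.Z r' p' n, ∃ y ∈ C.Z r' p'' n', a + C.d h y = x := by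
  obtain rfl : r' = r - 1 := by omega
  obtain rfl : p' = p - 1 := by omega
  obtain rfl : p'' = p + r - 1 := by omega
  have e : (⨆ (n' : ℤ) (h : n + 1 = n'), (C.Z (r - 1) (p + r - 1) n').map (C.d h)) =
      (C.Z (r - 1) (p + r - 1) n').map (C.d h) := by
    refine le_antisymm (iSup_le fun n'' => iSup_le fun h'' => ?_)
      (le_iSup_of_le n' (le_iSup_of_le h le_rfl))
    obtain rfl : n'' = n' := by omega
    exact le_rfl
  rw [Bd, e, Submodule.mem_sup]
  simp only [Submodule.mem_map, exists_exists_and_eq_and]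

lemma IsFilteredComplex.descends (hC : C.IsFilteredComplex) {r p p' n n' : ℤ} (h : n' + 1 = n)
    (hp : p' + r = p) : Descends (C.d h) (C.Z r p n) (C.Bd r p n) (C.Z r p' n') (C.Bd r p' n') := by
  refine ⟨fun x hx => ?_, fun x hx => ?_⟩
  · refine (mem_Z (p' := p' - r) (n' := n' - 1) (by omega) (by omega)).2 ⟨((mem_Z h hp).1 hx).2, ?_⟩
    rw [show C.d _ (C.d h x) = 0 from app_eq (hC.d_d h _) x]
    exact zero_mem _
  · obtain ⟨a, ha, y, -, rfl⟩ := (mem_Bd (r' := r - 1) (p' := p - 1) (n' := n + 1) (p'' := p + r - 1)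
      rfl (by omega) (by omega) (by omega)).1 hx.1
    refine (mem_Bd (r' := r - 1) (p' := p' - 1) (p'' := p - 1) h (by omega) (by omega) (by omega)).2
      ⟨0, zero_mem _, a, ha, ?_⟩
    rw [map_add, show C.d h (C.d _ y) = 0 from app_eq (hC.d_d _ h) y, add_zero, zero_add]

lemma IsFilteredComplex.dE_mk (hC : C.IsFilteredComplex) {r : ℕ} {p q p' q' : ℤ} (hp : p' + r = p)
    (hq : q' + 1 = q + r) (x : C.Z r p (p + q)) : C.dE r hp hq (Subq.mk _ _ x) =
      Subq.mk (C.Z r p' (p' + q')) (C.Bd r p' (p' + q'))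
        ⟨C.d (show p' + q' + 1 = p + q by omega) x.1, (hC.descends (by omega) hp).1 x.2⟩ :=
  Subq.map_mk (hC.descends (by omega) hp) x

end FiltOps

end FilteredComplex

section TotalComplex

variable {k H A : Type*} [CommRing k] [Ring H] [HopfAlgebra k H] [Ring A] [Algebra k A]
  [Module H A] [IsScalarTower k H A] (hS : Bijective (HopfAlgebra.antipode k : H →ₗ[k] H))
  {W : ℤ → Type*} [∀ j, AddCommGroup (W j)] [∀ j, Module k (W j)]
  (u : ∀ j, W j →ₗ[k] W (j - 2)) {M : Type*} [AddCommGroup M] [Module k M]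

variable {u hS}

lemma cycD_tmul {X : ℕ → Type*} [∀ n, AddCommGroup (X n)] [∀ n, Module k (X n)] (O : CycOps k X)
    {n n' : ℤ} (h : n' + 1 = n) (j : ℤ) (x : PS k (id : ℕ → ℕ) X (n - j)) (w : W j) :
    cycD u O h (Box.tmul k u id X n j x w) =
      Box.tmul k u id X n' j ⟨O.mixedD x, lowers_mixedD O _ _ (by omega) _ x.2⟩ w :=
  (app_eq (Box.map_eq _ h) _).trans (Box.mapTo_tmul _ h j x w)

lemma rowδ_tmul (p : ℤ) (q : ℕ) (j : ℤ) (x : PS k (id : ℕ → ℕ) (HopfNat k H A (q + 1)) (p - j))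
    (w : W j) : rowδ k H A u p q (Box.tmul k u id _ p j x w) = Box.tmul k u id _ p j
      ⟨piδ k H A q x, lowers_pi id _ _ _ (by omega) _ x.2⟩ w :=
  (app_eq (Box.map_eq _ (add_zero p)) _).trans (Box.mapTo_tmul _ (add_zero p) j x w)

lemma totFilt_ext {n p : ℤ} {f g : TotBox k H A u n →ₗ[k] M}
    (h : ∀ j (x : PS k totDeg (fun i : ℕ × ℕ => Cyl k H A i.1 i.2) (n - j)) w,
      (∀ i : ℕ × ℕ, (i.1 : ℤ) < n - p → x.1 i = 0) →
        f (Box.tmul k u totDeg _ n j x w) = g (Box.tmul k u totDeg _ n j x w)) :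
    ∀ z ∈ (totFilt A u hS).F n p, f z = g z := by
  refine LinearMap.eqOn_span' ?_
  rintro _ ⟨j, x, w, hx, rfl⟩
  exact h j x w hx

lemma totFilt_le {n p : ℤ} {S : Submodule k (TotBox k H A u n)}
    (h : ∀ j (x : PS k totDeg (fun i : ℕ × ℕ => Cyl k H A i.1 i.2) (n - j)) w,
      (∀ i : ℕ × ℕ, (i.1 : ℤ) < n - p → x.1 i = 0) → Box.tmul k u totDeg _ n j x w ∈ S) :
    (totFilt A u hS).F n p ≤ S := by
  refine Submodule.span_le.2 ?_
  rintro _ ⟨j, x, w, hx, rfl⟩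
  exact h j x w hx

lemma totFilt_d_tmul {n n' : ℤ} (h : n' + 1 = n) (j : ℤ)
    (x : PS k totDeg (fun i : ℕ × ℕ => Cyl k H A i.1 i.2) (n - j)) (w : W j) :
    (totFilt A u hS).d h (Box.tmul k u totDeg _ n j x w) = Box.tmul k u totDeg _ n' j
      ⟨totD (cylH k H A) (cylA hS A) x, lowers_totD _ _ _ _ (by omega) _ x.2⟩ w :=
  (app_eq (Box.map_eq _ h) _).trans (Box.mapTo_tmul _ h j x w)

lemma totFilt_eq_top {n p : ℤ} (h : n ≤ p) : (totFilt A u hS).F n p = ⊤ :=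
  Box.eq_top fun j x w => Submodule.subset_span ⟨j, x, w, fun i hi => by omega, rfl⟩

lemma totD_eq_zero {x : ∀ i : ℕ × ℕ, Cyl k H A i.1 i.2} {c : ℤ}
    (hx : ∀ i : ℕ × ℕ, (i.1 : ℤ) < c → x i = 0) (i : ℕ × ℕ) (hi : (i.1 : ℤ) < c - 1) :
    totD (cylH k H A) (cylA hS A) x i = 0 := by
  obtain ⟨m, n⟩ := i
  simp only at hi
  have h1 : totBInto (cylA hS A) m n x = 0 := by
    cases n with
    | zero => rfl
    | succ n => simp [totBInto, hx (m, n) (by simp only; omega)]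
  have h2 : totBbarInto (cylH k H A) (cylA hS A) m n x = 0 := by
    cases m with
    | zero => rfl
    | succ m =>
      show ((cylA hS A (m + 1)).t n ^ (n + 1)) ((cylH k H A n).B' m (x (m, n))) = 0
      rw [hx (m, n) (by simp only; omega), LinearMap.map_zero, LinearMap.map_zero]
  show (cylH k H A n).b m (x (m + 1, n)) + (-1 : k) ^ m • (cylA hS A m).b n (x (m, n + 1)) +
    totBInto _ m n x + totBbarInto _ _ m n x = 0
  rw [h1, h2, hx (m + 1, n) (by simp only; omega), hx (m, n + 1) (by simp only; omega),
    LinearMap.map_zero, LinearMap.map_zero, smul_zero, add_zero, add_zero, add_zero]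

lemma totFilt_isFilteredComplex [IsModuleAlgebra k H A] : (totFilt A u hS).IsFilteredComplex where
  d_d h h' := Box.hom_ext fun j x w => by
    rw [comp_apply, totFilt_d_tmul, totFilt_d_tmul]
    exact Box.tmul_eq_zero (cyl_totD_totD hS x.1) w
  mono n p p' hp := totFilt_le fun j x w hx =>
    Submodule.subset_span ⟨j, x, w, fun i hi => hx i (by omega), rfl⟩
  stable {n n'} h p := totFilt_le fun j x w hx => by
    show (totFilt A u hS).d h _ ∈ (totFilt A u hS).F n' p
    rw [totFilt_d_tmul]
    exact Submodule.subset_span ⟨j, _, w, fun i hi => totD_eq_zero hx i (by omega), rfl⟩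

variable (hS u)

/-- The projection to the `q`-th row. -/
def boxR {n p : ℤ} {q : ℕ} (h : p + q = n) : TotBox k H A u n →ₗ[k] RowBox k H A u p q :=
  Box.mapTo u (lowersTo_toRow hS q) h

/-- The inclusion of the `q`-th row. -/
def boxL {n p : ℤ} {q : ℕ} (h : p + q = n) : RowBox k H A u p q →ₗ[k] TotBox k H A u n :=
  Box.mapTo u (lowersTo_ofRow hS q) (show n + -q = p by omega)

variable {n p : ℤ} {q : ℕ} (h : p + q = n)

lemma boxR_boxL (y : RowBox k H A u p q) : boxR hS u h (boxL hS u h y) = y := by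
  refine (Box.mapTo_mapTo (c'' := 0) (Θ'' := 𝟙) (fun m m' h x hx => ?_) (add_zero p)
    (toRow_ofRow hS q) y).trans (Box.mapTo_id y)
  obtain rfl : m' = m := by omega
  exact hx

lemma boxL_mem (y : RowBox k H A u p q) : boxL hS u h y ∈ (totFilt A u hS).F n p := by
  have : ((totFilt A u hS).F n p).comap (boxL hS u h) = ⊤ := Box.eq_top fun j x w => by
    refine Submodule.subset_span ⟨j, _, w, fun i hi => ?_, Box.mapTo_tmul _ _ j x w⟩
    obtain ⟨m, n⟩ := i
    exact rowIncl_ne (by rintro rfl; simp only at hi; omega) _ _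
  exact this.ge (Submodule.mem_top (x := y))

lemma toRow_eq_zero {x : ∀ i : ℕ × ℕ, Cyl k H A i.1 i.2} (hx : ∀ n, x (q, n) = 0) :
    toRow hS q x = 0 := by
  have : rowProj k H A q x = 0 := funext hx
  show piPhi k H A q ((cylA hS A q).twist (rowProj k H A q x)) = 0
  rw [this, map_zero, map_zero]

lemma boxR_eq_zero {p' : ℤ} (hp : p' < p) {z : TotBox k H A u n}
    (hz : z ∈ (totFilt A u hS).F n p') : boxR hS u h z = 0 := by
  refine totFilt_ext (g := 0) (fun j x w hx => ?_) z hz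
  refine (Box.mapTo_tmul _ h j x w).trans (Box.tmul_eq_zero (toRow_eq_zero hS fun m => ?_) w)
  exact hx (q, m) (by simp only; omega)

lemma sub_boxL_boxR_mem {p' : ℤ} (hp : p' + 1 = p) {z : TotBox k H A u n}
    (hz : z ∈ (totFilt A u hS).F n p) :
    z - boxL hS u h (boxR hS u h z) ∈ (totFilt A u hS).F n p' := by
  refine totFilt_le (hS := hS) (S := ((totFilt A u hS).F n p').comap
    (𝟙 - boxL hS u h ∘ₗ boxR hS u h)) (fun j x w hx => ?_) hz
  show Box.tmul k u totDeg _ n j x w - boxL hS u h (boxR hS u h _) ∈ (totFilt A u hS).F n p'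
  rw [boxR, boxL, Box.mapTo_tmul, Box.mapTo_tmul, ← Box.tmul_sub]
  refine Submodule.subset_span ⟨j, _, w, fun i hi => ?_, rfl⟩
  obtain ⟨m, l⟩ := i
  show x.1 (m, l) - ofRow hS q (toRow hS q x.1) (m, l) = 0
  rw [ofRow_toRow]
  by_cases e : q = m
  · subst e
    rw [rowIncl_self]
    exact sub_self _
  · rw [rowIncl_ne e, sub_zero]
    exact hx _ (by simp only at hi ⊢; omega)

lemma mem_of_boxR_eq_zero {p' : ℤ} (hp : p' + 1 = p) {z : TotBox k H A u n}
    (hz : z ∈ (totFilt A u hS).F n p) (h0 : boxR hS u h z = 0) : z ∈ (totFilt A u hS).F n p' := by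
  have := sub_boxL_boxR_mem hS u h hp hz
  rwa [h0, map_zero, sub_zero] at this

variable [IsModuleAlgebra k H A]

/-- The map induced by `rowDefect`. -/
def boxDefect (q : ℕ) {p p' : ℤ} (h : p' + 1 = p) : RowBox k H A u p q →ₗ[k] RowBox k H A u p' q :=
  Box.mapTo u (lowersTo_rowDefect hS q) h

lemma boxDefect_mem {p p' : ℤ} (h : p' + 1 = p) : ∀ {q : ℕ} (y : RowBox k H A u p q),
    y ∈ rowCycles k H A u p q → boxDefect hS u q h y ∈ LinearMap.range (rowδ k H A u p' q)
  | 0, y, _ => by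
    refine ⟨Box.mapTo u (lowersTo_rowDefectHtpy hS 0) h y, ?_⟩
    refine app_eq (f := rowδ k H A u p' 0 ∘ₗ Box.mapTo u (lowersTo_rowDefectHtpy hS 0) h)
      (Box.hom_ext fun j x w => ?_) y
    rw [comp_apply, boxDefect, Box.mapTo_tmul, Box.mapTo_tmul, rowδ_tmul]
    refine Box.tmul_congr ?_ w
    dsimp only
    rw [rowDefect_zero]
  | q + 1, y, hy => by
    refine ⟨Box.mapTo u (lowersTo_rowDefectHtpy hS (q + 1)) h y, ?_⟩
    have : boxDefect hS u (q + 1) h y = rowδ k H A u p' (q + 1)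
        (Box.mapTo u (lowersTo_rowDefectHtpy hS (q + 1)) h y) +
          Box.mapTo u (lowersTo_rowDefectHtpy hS q) h (rowδ k H A u p q y) := by
      refine app_eq (g := rowδ k H A u p' (q + 1) ∘ₗ
        Box.mapTo u (lowersTo_rowDefectHtpy hS (q + 1)) h +
          Box.mapTo u (lowersTo_rowDefectHtpy hS q) h ∘ₗ rowδ k H A u p q)
        (Box.hom_ext fun j x w => ?_) y
      rw [LinearMap.add_apply, comp_apply, comp_apply, boxDefect, rowδ_tmul,
        Box.mapTo_tmul, Box.mapTo_tmul, Box.mapTo_tmul, rowδ_tmul, ← Box.tmul_add]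
      refine Box.tmul_congr ?_ w
      rw [Submodule.coe_add]
      dsimp only
      rw [rowDefect_succ]
    rw [this, show rowδ k H A u p q y = 0 from hy, map_zero, add_zero]

lemma rowδ_cycD (q : ℕ) {p p' : ℤ} (h : p' + 1 = p) (y : RowBox k H A u p (q + 1)) :
    rowδ k H A u p' q (cycD u (rowOps A hS (q + 1)) h y) =
      cycD u (rowOps A hS q) h (rowδ k H A u p q y) := by
  refine app_eq (f := rowδ k H A u p' q ∘ₗ cycD u (rowOps A hS (q + 1)) h)
    (g := cycD u (rowOps A hS q) h ∘ₗ rowδ k H A u p q) (Box.hom_ext fun j x w => ?_) y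
  rw [comp_apply, comp_apply, cycD_tmul, rowδ_tmul, rowδ_tmul, cycD_tmul]
  exact Box.tmul_congr ((hopfδ_hom hS q).mixedD x.1) w

lemma rowDDescends {p p' : ℤ} (h : p' + 1 = p) (q : ℕ) : RowDDescends A u hS h q := by
  refine ⟨fun y hy => ?_, ?_⟩
  · cases q with
    | zero => trivial
    | succ q =>
      show rowδ k H A u p' q _ = 0
      rw [rowδ_cycD, show rowδ k H A u p q y = 0 from hy, map_zero]
  · rintro _ ⟨⟨y, rfl⟩, -⟩
    exact ⟨_, rowδ_cycD hS u q h y⟩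

lemma boxR_d {n' p' : ℤ} (h' : p' + q = n') (hn : n' + 1 = n) {z : TotBox k H A u n}
    (hz : z ∈ (totFilt A u hS).F n p) (hp : p' + 1 = p) (h'' : p' + ((q + 1 : ℕ) : ℤ) = n) :
    boxR hS u h' ((totFilt A u hS).d hn z) = rowδ k H A u p' q (boxR hS u h'' z) +
      (-1 : k) ^ q • (cycD u (rowOps A hS q) hp (boxR hS u h z) -
        boxDefect hS u q hp (boxR hS u h z)) := by
  refine totFilt_ext (f := boxR hS u h' ∘ₗ (totFilt A u hS).d hn)
    (g := rowδ k H A u p' q ∘ₗ boxR hS u h'' + (-1 : k) ^ q • (cycD u (rowOps A hS q) hp ∘ₗ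
      boxR hS u h - boxDefect hS u q hp ∘ₗ boxR hS u h)) (fun j x w hx => ?_) z hz
  simp only [LinearMap.add_apply, LinearMap.smul_apply, LinearMap.sub_apply, comp_apply,
    boxR, boxDefect, totFilt_d_tmul, Box.mapTo_tmul, rowδ_tmul, cycD_tmul, ← Box.tmul_sub,
    ← Box.tmul_smul, ← Box.tmul_add]
  exact Box.tmul_congr (toRow_totD hS q x.1 fun m l hm => hx (m, l) (by simp only; omega)) w

lemma boxR_d_of_lt {n' p' : ℤ} (h' : p' + q = n') (hn : n' + 1 = n) {z : TotBox k H A u n}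
    (hz : z ∈ (totFilt A u hS).F n p') (h'' : p' + ((q + 1 : ℕ) : ℤ) = n) :
    boxR hS u h' ((totFilt A u hS).d hn z) = rowδ k H A u p' q (boxR hS u h'' z) := by
  have e : p' + 1 + (q : ℤ) = n := by omega
  rw [boxR_d hS u e h' hn (totFilt_isFilteredComplex.mono n (by omega) hz) rfl h'',
    boxR_eq_zero hS u e (by omega) hz, map_zero, map_zero, sub_zero, smul_zero, add_zero]

end TotalComplex

section FilteredComplex

variable {k : Type*} [CommRing k] {K : ℤ → Type*} [∀ n, AddCommGroup (K n)] [∀ n, Module k (K n)]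
  {C : FiltOps k K} {n n' p : ℤ}

lemma FiltOps.E_subsingleton (r : ℕ) {p q : ℤ} (h : C.F (p + q) (p - 1) = ⊤) :
    Subsingleton (C.E r p q) := by
  refine subsingleton_of_forall_eq 0 fun x => ?_
  obtain ⟨z, rfl⟩ := Subq.mk_surjective _ _ x
  refine (Subq.mk_eq_zero z).2 ((FiltOps.mem_Bd rfl (sub_add_cancel _ 1) (sub_add_cancel _ 1)
    rfl).2 ⟨z.1, ?_, 0, zero_mem _, by rw [map_zero, add_zero]⟩)
  have hz := (FiltOps.mem_Z (sub_add_cancel _ 1) (sub_add_cancel _ _)).1 z.2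
  refine (FiltOps.mem_Z (sub_add_cancel _ 1) (p' := p - r) (by omega)).2 ⟨?_, hz.2⟩
  rw [h]
  trivial

namespace FiltOps.IsFilteredComplex

lemma d_mem (hC : C.IsFilteredComplex) (h : n' + 1 = n) {x : K n} (hx : x ∈ C.F n p) :
    C.d h x ∈ C.F n' p :=
  hC.stable h p hx

lemma mem_Z_zero (hC : C.IsFilteredComplex) {x : K n} : x ∈ C.Z 0 p n ↔ x ∈ C.F n p :=
  (FiltOps.mem_Z (sub_add_cancel _ 1) (add_zero p)).trans
    ⟨fun h => h.1, fun h => ⟨h, hC.d_mem _ h⟩⟩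

lemma mem_Bd_zero (hC : C.IsFilteredComplex) {x : K n} : x ∈ C.Bd 0 p n ↔ x ∈ C.F n (p - 1) := by
  refine (FiltOps.mem_Bd rfl (neg_add_cancel 1) (sub_add_cancel _ 1) rfl).trans ⟨?_, fun h => ?_⟩
  · rintro ⟨a, ha, y, hy, rfl⟩
    exact add_mem ha.1 (hC.d_mem _ hy.1)
  · exact ⟨x, (FiltOps.mem_Z (p' := p) (sub_add_cancel _ 1) (by omega)).2
      ⟨h, hC.mono _ (by omega) (hC.d_mem _ h)⟩, 0, zero_mem _, by rw [map_zero, add_zero]⟩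

end FiltOps.IsFilteredComplex

end FilteredComplex

section Pages

variable {k H A : Type*} [CommRing k] [Ring H] [HopfAlgebra k H] [Ring A] [Algebra k A]
  [Module H A] [IsScalarTower k H A] [IsModuleAlgebra k H A]
  {hS : Bijective (HopfAlgebra.antipode k : H →ₗ[k] H)}
  {W : ℤ → Type*} [∀ j, AddCommGroup (W j)] [∀ j, Module k (W j)] {u : ∀ j, W j →ₗ[k] W (j - 2)}

variable (A hS u) in
/-- `E⁰_{pq} ≅ C_q(H, C_p(A^♮_H) ⊠ W)`. -/
def pageZero (p : ℤ) (q : ℕ) : (totFilt A u hS).E 0 p q ≃ₗ[k] RowBox k H A u p q :=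
  Subq.liftEquiv (boxR hS u rfl ∘ₗ Submodule.subtype _)
    (fun z => (show boxR hS u rfl z.1 = 0 ↔ _ from
      ⟨fun h => totFilt_isFilteredComplex.mem_Bd_zero.2 (mem_of_boxR_eq_zero hS u rfl (sub_add_cancel _ 1)
        (totFilt_isFilteredComplex.mem_Z_zero.1 z.2) h), fun h =>
        boxR_eq_zero hS u rfl (sub_one_lt p) (totFilt_isFilteredComplex.mem_Bd_zero.1 h)⟩))
    fun y => ⟨⟨boxL hS u rfl y, totFilt_isFilteredComplex.mem_Z_zero.2 (boxL_mem hS u rfl y)⟩, boxR_boxL hS u rfl y⟩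

lemma boxR_mem_rowCycles {n p p' : ℤ} : ∀ {q : ℕ} (h : p + q = n), p' + 1 = p →
    ∀ {z : TotBox k H A u n}, z ∈ (totFilt A u hS).Z 1 p n → boxR hS u h z ∈ rowCycles k H A u p q
  | 0, _, _, _, _ => trivial
  | q + 1, h, _, z, hz => by
    have hz := (FiltOps.mem_Z (sub_add_cancel _ 1) (sub_add_cancel _ 1)).1 hz
    have e : p + (q : ℤ) = n - 1 := by push_cast at h; omega
    show rowδ k H A u p q (boxR hS u h z) = 0
    rw [← boxR_d_of_lt hS u e (sub_add_cancel _ 1) hz.1 h]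
    exact boxR_eq_zero hS u e (sub_one_lt p) hz.2

lemma boxL_mem_Z_one {n p : ℤ} : ∀ {q : ℕ} (h : p + q = n) {y : RowBox k H A u p q},
    y ∈ rowCycles k H A u p q → boxL hS u h y ∈ (totFilt A u hS).Z 1 p n
  | 0, h, y, _ => by
    refine (FiltOps.mem_Z (sub_add_cancel _ 1) (sub_add_cancel _ 1)).2 ⟨boxL_mem hS u h y, ?_⟩
    rw [totFilt_eq_top (by push_cast at h; omega)]
    trivial
  | q + 1, h, y, hy => by
    refine (FiltOps.mem_Z (sub_add_cancel _ 1) (sub_add_cancel _ 1)).2 ⟨boxL_mem hS u h y, ?_⟩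
    have e : p + (q : ℤ) = n - 1 := by push_cast at h; omega
    refine mem_of_boxR_eq_zero hS u e (sub_add_cancel _ 1) (totFilt_isFilteredComplex.d_mem _ (boxL_mem hS u h y)) ?_
    rw [boxR_d_of_lt hS u e (sub_add_cancel _ 1) (boxL_mem hS u h y) h, boxR_boxL]
    exact hy

lemma mem_totFilt_Bd_one {n p : ℤ} {q : ℕ} (h : p + q = n) {z : TotBox k H A u n}
    (hz : z ∈ (totFilt A u hS).F n p) : z ∈ (totFilt A u hS).Bd 1 p n ↔
      boxR hS u h z ∈ LinearMap.range (rowδ k H A u p q) := by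
  have e : p + ((q + 1 : ℕ) : ℤ) = n + 1 := by push_cast; omega
  refine (FiltOps.mem_Bd rfl (zero_add 1) (sub_add_cancel _ 1) (add_zero p)).trans ⟨?_, ?_⟩
  · rintro ⟨a, ha, y, hy, rfl⟩
    rw [map_add, boxR_eq_zero hS u h (sub_one_lt p) ha.1, zero_add, boxR_d_of_lt hS u h rfl hy.1 e]
    exact ⟨_, rfl⟩
  · rintro ⟨y, hy⟩
    have hd := (totFilt_isFilteredComplex (hS := hS)).d_mem rfl (boxL_mem hS u e y)
    refine ⟨_, totFilt_isFilteredComplex.mem_Z_zero.2 (mem_of_boxR_eq_zero hS u h (sub_add_cancel _ 1)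
      (sub_mem hz hd) ?_), boxL hS u e y, totFilt_isFilteredComplex.mem_Z_zero.2 (boxL_mem hS u e y),
      sub_add_cancel _ _⟩
    rw [map_sub, ← hy, boxR_d_of_lt hS u h rfl (boxL_mem hS u e y) e, boxR_boxL, sub_self]

variable (A hS u) in
/-- `E¹_{pq} ≅ H_q(H, C_p(A^♮_H) ⊠ W)`. -/
def pageOne (p : ℤ) (q : ℕ) : (totFilt A u hS).E 1 p q ≃ₗ[k] RowH k H A u p q :=
  Subq.liftEquiv (Subq.mk _ _ ∘ₗ (boxR hS u rfl).restrict fun _ hz =>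
      boxR_mem_rowCycles rfl (sub_add_cancel _ 1) hz)
    (fun z => (Subq.mk_eq_zero _).trans (mem_totFilt_Bd_one rfl z.2.1).symm)
    fun y => by
      obtain ⟨y, rfl⟩ := Subq.mk_surjective _ _ y
      exact ⟨⟨boxL hS u rfl y.1, boxL_mem_Z_one rfl y.2⟩,
        congrArg (Subq.mk _ _) (Subtype.ext (boxR_boxL hS u rfl y.1))⟩

lemma pageZero_d (p : ℤ) (q : ℕ) (x : (totFilt A u hS).E 0 p (q + 1 : ℕ)) :
    pageZero A hS u p q ((totFilt A u hS).dE 0 (p' := p) (q' := q) (by simp) (by push_cast; ring) x)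
      = rowδ k H A u p q (pageZero A hS u p (q + 1) x) := by
  obtain ⟨z, rfl⟩ := Subq.mk_surjective _ _ x
  rw [totFilt_isFilteredComplex.dE_mk]
  exact boxR_d_of_lt hS u rfl (by push_cast; ring) (totFilt_isFilteredComplex.mem_Z_zero.1 z.2) rfl

lemma pageOne_d (p : ℤ) (q : ℕ) (x : (totFilt A u hS).E 1 p q) :
    pageOne A hS u (p - 1) q ((totFilt A u hS).dE 1 (p' := p - 1) (q' := q) (by simp) (by simp) x) =
      (-1 : k) ^ q • rowHD A u hS (show (p - 1) + 1 = p by omega) q (pageOne A hS u p q x) := by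
  obtain ⟨z, rfl⟩ := Subq.mk_surjective _ _ x
  rw [totFilt_isFilteredComplex.dE_mk]
  let y : rowCycles k H A u p q :=
    ⟨boxR hS u rfl z.1, boxR_mem_rowCycles rfl (sub_add_cancel _ 1) z.2⟩
  have hd := rowDDescends (A := A) hS u (sub_add_cancel p 1) q
  refine Eq.trans ?_ (congrArg (fun w => (-1 : k) ^ q • w) (Subq.map_mk hd y)).symm
  refine Eq.trans ?_ (map_smul (Subq.mk _ _) _ _)
  refine (Subq.mk_eq_mk _ _).2 ?_
  show boxR hS u rfl ((totFilt A u hS).d (by omega) z.1) -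
    (-1 : k) ^ q • cycD u (rowOps A hS q) (sub_add_cancel p 1) y.1 ∈ _
  rw [boxR_d hS u rfl rfl _ z.2.1 (sub_add_cancel _ 1) (by push_cast; omega), smul_sub,
    add_sub_assoc, sub_sub_cancel_left]
  refine add_mem (LinearMap.mem_range_self _ _) (neg_mem (Submodule.smul_mem _ _ ?_))
  exact boxDefect_mem hS u (sub_add_cancel p 1) y.1 y.2

end Pages

/-! ### Exactness of `V ⊠ W` in `V` -/

section BoxExact

variable {k : Type*} [CommRing k] {V : ℕ → Type*} [∀ n, AddCommGroup (V n)] [∀ n, Module k (V n)]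
  {V' : ℕ → Type*} [∀ n, AddCommGroup (V' n)] [∀ n, Module k (V' n)]
  {V'' : ℕ → Type*} [∀ n, AddCommGroup (V'' n)] [∀ n, Module k (V'' n)]
  {W : ℤ → Type*} [∀ j, AddCommGroup (W j)] [∀ j, Module k (W j)]
  (f : ∀ n, V n →ₗ[k] V' n) {g : ∀ n, V' n →ₗ[k] V'' n} (a : ℤ → ℤ)

/-- The map `V[[u]]_m → V'[[u]]_m` given by a family of maps. -/
def psMap (m : ℤ) : PS k (id : ℕ → ℕ) V m →ₗ[k] PS k (id : ℕ → ℕ) V' m :=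
  (piMap f).restrict fun x hx => lowersTo_piMap f m m (add_zero m) x hx

lemma psMap_surjective (hf : ∀ n, Surjective (f n)) (m : ℤ) : Surjective (psMap f m) := fun y => by
  choose s hs using hf
  classical
  refine ⟨⟨fun n => if y.1 n = 0 then 0 else s n (y.1 n), fun n hn => if_pos (y.2 n hn)⟩,
    Subtype.ext (funext fun n => ?_)⟩
  show f n (if y.1 n = 0 then 0 else s n (y.1 n)) = y.1 n
  split_ifs with h
  · rw [map_zero, h]
  · exact hs n _

lemma psMap_injective (hf : ∀ n, Injective (f n)) (m : ℤ) : Injective (psMap f m) := fun x y h =>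
  Subtype.ext (funext fun n => hf n (congrFun (congrArg Subtype.val h) n))

variable {f} in
lemma psMap_exact (h : ∀ n, Function.Exact (f n) (g n)) (m : ℤ) :
    Function.Exact (psMap f m) (psMap g m) := by
  refine fun y => ⟨fun hy => ?_, ?_⟩
  · have hy' : ∀ n, ∃ x, f n x = y.1 n := fun n => (h n _).1 (congrFun (congrArg Subtype.val hy) n)
    choose x hx using hy'
    classical
    refine ⟨⟨fun n => if y.1 n = 0 then 0 else x n, fun n hn => if_pos (y.2 n hn)⟩,
      Subtype.ext (funext fun n => ?_)⟩
    show f n (if y.1 n = 0 then 0 else x n) = y.1 n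
    split_ifs with h
    · rw [map_zero, h]
    · exact hx n
  · rintro ⟨x, rfl⟩
    exact Subtype.ext (funext fun n => (h n).apply_apply_eq_zero (x.1 n))

variable (k V W) in
/-- `⨁ j, V[[u]]_{a j} ⊗ W_j`. -/
abbrev Pieces : Type _ := ⨁ j : ℤ, Piece k (id : ℕ → ℕ) V W (a j) j

variable (W) in
/-- The map `⨁ j, V[[u]]_{a j} ⊗ W_j → ⨁ j, V'[[u]]_{a j} ⊗ W_j` given by a family of maps. -/
def piecesMap : Pieces k V W a →ₗ[k] Pieces k V' W a := DirectSum.lmap fun j =>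
    show Piece k id V W (a j) j →ₗ[k] Piece k id V' W (a j) j from (psMap f (a j)).rTensor (W j)

variable {a} in
/-- `x ⊗ w` in the summand with index `j`. -/
def ptmul {j : ℤ} (x : PS k (id : ℕ → ℕ) V (a j)) (w : W j) : Pieces k V W a :=
  DirectSum.lof k ℤ (fun j => Piece k id V W (a j) j) j (x ⊗ₜ[k] w)

lemma piecesMap_ptmul {j : ℤ} (x : PS k (id : ℕ → ℕ) V (a j)) (w : W j) :
    piecesMap W f a (ptmul x w) = ptmul (psMap f _ x) w :=
  DirectSum.lmap_lof _ _ _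

variable {a} in
lemma pieces_ext {M : Type*} [AddCommGroup M] [Module k M] {F G : Pieces k V W a →ₗ[k] M}
    (h : ∀ j (x : PS k (id : ℕ → ℕ) V (a j)) (w : W j), F (ptmul x w) = G (ptmul x w)) : F = G :=
  DirectSum.linearMap_ext k fun j => ext' fun x w => h j x w

lemma piecesMap_surjective (hf : ∀ n, Surjective (f n)) : Surjective (piecesMap W f a) :=
  (DirectSum.lmap_surjective _).2 fun j => LinearMap.rTensor_surjective _ (psMap_surjective f hf _)

lemma piecesMap_injective [∀ j, Module.Flat k (W j)] (hf : ∀ n, Injective (f n)) :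
    Injective (piecesMap W f a) :=
  (DirectSum.lmap_injective _).2 fun j =>
    Module.Flat.rTensor_preserves_injective_linearMap _ (psMap_injective f hf _)

variable {f} in
lemma piecesMap_exact (h : ∀ n, Function.Exact (f n) (g n)) (hg : ∀ n, Surjective (g n)) :
    Function.Exact (piecesMap W f a) (piecesMap W g a) := by
  rw [LinearMap.exact_iff]
  refine (DirectSum.ker_lmap _).trans (Eq.trans ?_ (DirectSum.range_lmap _).symm)
  refine congrArg (fun s => Submodule.comap _ (Submodule.pi Set.univ s)) (funext fun j => ?_)
  exact LinearMap.exact_iff.1 (rTensor_exact (W j) (psMap_exact h _) (psMap_surjective g hg _))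

variable (u : ∀ j, W j →ₗ[k] W (j - 2)) (n : ℤ)

/-- `x ⊗ w ↦ x ⊗ u w`. -/
def pieceU (m j : ℤ) : Piece k (id : ℕ → ℕ) V W m j →ₗ[k] Piece k (id : ℕ → ℕ) V W m (j - 2) :=
  (u j).lTensor (PS k (id : ℕ → ℕ) V m)

/-- `x ⊗ w ↦ x ⊗ u w`. -/
def actRight : Pieces k V W (fun j => n - (j - 2)) →ₗ[k] PreBox k id V W n :=
  DirectSum.toModule k ℤ _ fun j =>
    DirectSum.lof k ℤ (fun j => Piece k id V W (n - j) j) (j - 2) ∘ₗ pieceU u _ j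

variable (V) in
/-- The inclusion `V[[u]]_{n-(j-2)} → V[[u]]_{n-j}`. -/
def psIncl (j : ℤ) : PS k (id : ℕ → ℕ) V (n - (j - 2)) →ₗ[k] PS k (id : ℕ → ℕ) V (n - j) :=
  Submodule.inclusion (PS_le k id V (by ring))

/-- `x ⊗ w ↦ u x ⊗ w`. -/
def actLeft : Pieces k V W (fun j => n - (j - 2)) →ₗ[k] PreBox k id V W n := DirectSum.lmap fun j =>
    show Piece k id V W (n - (j - 2)) j →ₗ[k] Piece k id V W (n - j) j from
      (psIncl V n j).rTensor (W j)

variable (V) in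
/-- `x ⊗ w ↦ u x ⊗ w - x ⊗ u w`. -/
def relMap : Pieces k V W (fun j => n - (j - 2)) →ₗ[k] PreBox k id V W n := actLeft n - actRight u n

lemma relMap_ptmul {j : ℤ} (x : PS k (id : ℕ → ℕ) V (n - (j - 2))) (w : W j) :
    relMap V u n (ptmul x w) =
      PreBox.tmul k id V n j (psIncl V n j x) w - PreBox.tmul k id V n (j - 2) x (u j w) :=
  congrArg₂ (fun a b : PreBox k id V W n => a - b) (DirectSum.lmap_lof _ _ _)
    (DirectSum.toModule_lof k j _)

lemma range_relMap : LinearMap.range (relMap V u n) = boxRel k u (id : ℕ → ℕ) V n := by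
  refine le_antisymm ?_ (Submodule.span_le.2 ?_)
  · rw [LinearMap.range_le_iff_comap, ← Submodule.ker_mkQ (boxRel k u id V n),
      ← LinearMap.ker_comp, LinearMap.ker_eq_top]
    refine pieces_ext fun j x w => ?_
    refine (congrArg (boxRel k u id V n).mkQ (relMap_ptmul u n x w)).trans ?_
    exact (Submodule.Quotient.mk_eq_zero _).2 (Submodule.subset_span ⟨j, x, w, rfl⟩)
  · rintro _ ⟨j, x, w, rfl⟩
    exact ⟨_, relMap_ptmul u n x w⟩

variable (V) in
lemma psIncl_rTensor_injective (j : ℤ) : Injective ((psIncl (k := k) V n j).rTensor (W j)) := by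
  let ρ : (∀ i, V i) →ₗ[k] (∀ i, V i) := LinearMap.pi fun i => if n - (j - 2) ≤ i then proj i else 0
  have h : ∀ x ∈ PS k (id : ℕ → ℕ) V (n - j), ρ x ∈ PS k (id : ℕ → ℕ) V (n - (j - 2)) := by
    intro x hx i hi
    show (if n - (j - 2) ≤ i then proj i else (0 : (∀ i, V i) →ₗ[k] V i)) x = 0
    split_ifs with h
    · refine hx i fun h' => hi ⟨h, ?_⟩
      obtain ⟨r, hr⟩ := h'.2
      exact ⟨r - 1, by omega⟩
    · rfl
  have e : ρ.restrict h ∘ₗ psIncl V n j = 𝟙 := by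
    refine LinearMap.ext fun x => Subtype.ext (funext fun i => ?_)
    show (if n - (j - 2) ≤ i then proj i else (0 : (∀ i, V i) →ₗ[k] V i)) x.1 = x.1 i
    split_ifs with h
    · rfl
    · exact (x.2 i fun h' => h h'.1).symm
  refine Function.LeftInverse.injective (g := (ρ.restrict h).rTensor (W j)) fun z => ?_
  rw [← comp_apply, ← LinearMap.rTensor_comp, e, LinearMap.rTensor_id]
  rfl

lemma actRight_apply (y : Pieces k V W (fun j => n - (j - 2))) (j : ℤ) :
    actRight u n y (j - 2) = pieceU u (n - (j - 2)) j (y j) := by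
  refine app_eq (f := DirectSum.component k ℤ _ (j - 2) ∘ₗ actRight u n)
    (g := pieceU u (n - (j - 2)) j ∘ₗ DirectSum.component k ℤ _ j) (DirectSum.linearMap_ext k fun i =>
      LinearMap.ext fun x => ?_) y
  simp only [comp_apply, actRight, DirectSum.toModule_lof]
  by_cases e : i = j
  · subst e
    rw [DirectSum.component.lof_self, DirectSum.component.lof_self]
  · rw [DirectSum.component.of, DirectSum.component.of, dif_neg e, dif_neg (by omega), map_zero]

lemma relMap_injective : Injective (relMap V u n) := by
  classical
  refine (injective_iff_map_eq_zero _).2 fun y hy => ?_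
  have step : ∀ j, y (j + 2) = 0 → y j = 0 := by
    intro j hj
    obtain ⟨j, rfl⟩ : ∃ i, j = i - 2 := ⟨j + 2, by ring⟩
    rw [sub_add_cancel] at hj
    refine psIncl_rTensor_injective V n (j - 2) (Eq.trans ?_ (map_zero _).symm)
    have e : actLeft n y (j - 2) = actRight u n y (j - 2) :=
      congrArg (fun z : PreBox k id V W n => z (j - 2)) (sub_eq_zero.1 (show _ - _ = _ from hy))
    rwa [actRight_apply, hj, map_zero] at e
  obtain ⟨N, hN⟩ := (DFinsupp.support y).bddAbove
  have key : ∀ m : ℕ, ∀ j, N < j + m → y j = 0 := by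
    intro m
    induction m with
    | zero =>
      intro j hj
      by_contra h
      exact absurd (hN (DFinsupp.mem_support_iff.2 h)) (by push_cast at hj; omega)
    | succ m ih =>
      intro j hj
      exact step j (ih (j + 2) (by push_cast at hj; omega))
  refine DFinsupp.ext fun j => key (N - j + 1).toNat j ?_
  have := Int.self_le_toNat (N - j + 1)
  omega

lemma piecesMap_relMap (y : Pieces k V W (fun j => n - (j - 2))) :
    piecesMap W f (n - ·) (relMap V u n y) = relMap V' u n (piecesMap W f _ y) := by
  refine app_eq (f := piecesMap W f (n - ·) ∘ₗ relMap V u n)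
    (g := relMap V' u n ∘ₗ piecesMap W f _) (pieces_ext fun j x w => ?_) y
  rw [comp_apply, comp_apply, relMap_ptmul, piecesMap_ptmul, relMap_ptmul, map_sub]
  exact congrArg₂ (fun a b : PreBox k id V' W n => a - b) (piecesMap_ptmul f _ _ _)
    (piecesMap_ptmul f _ _ _)

variable {n}

lemma Box.mapTo_mk (z : PreBox k id V W n) :
    Box.mapTo u (lowersTo_piMap f) (add_zero n) ((boxRel k u id V n).mkQ z) =
      (boxRel k u id V' n).mkQ (piecesMap W f (n - ·) z) := by
  refine app_eq (f := Box.mapTo u (lowersTo_piMap f) (add_zero n) ∘ₗ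
    (boxRel k u id V n).mkQ) (g := (boxRel k u id V' n).mkQ ∘ₗ piecesMap W f (n - ·))
    (pieces_ext fun j x w => ?_) z
  refine (Box.mapTo_tmul (u := u) (lowersTo_piMap f) (add_zero n) j x w).trans ?_
  exact congrArg (boxRel k u id V' n).mkQ (piecesMap_ptmul f (n - ·) x w).symm

lemma Box.mapTo_surjective (hf : ∀ n, Surjective (f n)) :
    Surjective (Box.mapTo u (lowersTo_piMap f) (add_zero n)) := fun y => by
  obtain ⟨y, rfl⟩ := Submodule.mkQ_surjective _ y
  obtain ⟨z, rfl⟩ := piecesMap_surjective f (n - ·) hf y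
  exact ⟨_, Box.mapTo_mk f u z⟩

variable {f} in
lemma Box.mapTo_exact (h : ∀ n, Function.Exact (f n) (g n)) (hg : ∀ n, Surjective (g n)) :
    Function.Exact (Box.mapTo u (lowersTo_piMap f) (add_zero n))
      (Box.mapTo u (lowersTo_piMap g) (add_zero n)) := by
  refine fun z => ⟨fun hz => ?_, ?_⟩
  · obtain ⟨z, rfl⟩ := Submodule.mkQ_surjective _ z
    have hz := (Submodule.Quotient.mk_eq_zero _).1 ((Box.mapTo_mk g u z).symm.trans hz)
    rw [← range_relMap] at hz
    obtain ⟨y, hy⟩ := hz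
    obtain ⟨y, rfl⟩ := piecesMap_surjective g _ hg y
    rw [← piecesMap_relMap, eq_comm, ← sub_eq_zero, ← map_sub] at hy
    obtain ⟨x, hx⟩ := (piecesMap_exact _ h hg _).1 hy
    refine ⟨(boxRel k u id V n).mkQ x, (Box.mapTo_mk f u x).trans ?_⟩
    rw [hx]
    refine (Submodule.Quotient.eq _).2 ?_
    rw [sub_sub_cancel_left, ← range_relMap]
    exact neg_mem ⟨y, rfl⟩
  · rintro ⟨x, rfl⟩
    rw [Box.mapTo_mapTo (c'' := 0) (Θ'' := 0) (fun _ _ _ _ _ => zero_mem _) (add_zero n) fun x =>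
      funext fun i => (h i).apply_apply_eq_zero (x i)]
    exact app_eq (g := 0) (Box.hom_ext fun j x w =>
      (Box.mapTo_tmul _ _ j x w).trans (Box.tmul_eq_zero rfl w)) x

lemma Box.mapTo_injective [∀ j, Module.Flat k (W j)] (hf : ∀ n, Injective (f n)) :
    Injective (Box.mapTo u (lowersTo_piMap f) (add_zero n)) := by
  refine (injective_iff_map_eq_zero _).2 fun z hz => ?_
  obtain ⟨z, rfl⟩ := Submodule.mkQ_surjective _ z
  have hz := (Submodule.Quotient.mk_eq_zero _).1 ((Box.mapTo_mk f u z).symm.trans hz)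
  rw [← range_relMap] at hz
  obtain ⟨y, hy⟩ := hz
  let g : ∀ n, V' n →ₗ[k] V' n ⧸ LinearMap.range (f n) := fun n => (LinearMap.range (f n)).mkQ
  have hg : ∀ n, Surjective (g n) := fun n => Submodule.mkQ_surjective _
  have h : ∀ n, Function.Exact (f n) (g n) := fun n => LinearMap.exact_map_mkQ_range (f n)
  have hy' : piecesMap W g _ y = 0 := by
    refine relMap_injective u n ?_
    rw [← piecesMap_relMap, hy, map_zero]
    exact (piecesMap_exact _ h hg).apply_apply_eq_zero z
  obtain ⟨y, rfl⟩ := (piecesMap_exact _ h hg _).1 hy'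
  rw [← piecesMap_relMap] at hy
  refine (Submodule.Quotient.mk_eq_zero _).2 ?_
  rw [← piecesMap_injective f _ hf hy, ← range_relMap]
  exact ⟨y, rfl⟩

end BoxExact

section PageTwo

variable {k : Type*} [CommRing k]

lemma exists_equiv_of_ker_eq {X Y Z : Type*} [AddCommGroup X] [Module k X] [AddCommGroup Y]
    [Module k Y] [AddCommGroup Z] [Module k Z] {s : X →ₗ[k] Y} {t : X →ₗ[k] Z}
    (hs : Surjective s) (ht : Surjective t) (h : ∀ x, s x = 0 ↔ t x = 0) :
    ∃ e : Y ≃ₗ[k] Z, ∀ x, e (s x) = t x :=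
  ⟨(s.quotKerEquivOfSurjective hs).symm.trans ((Submodule.quotEquivOfEq _ _
    (Submodule.ext h)).trans (t.quotKerEquivOfSurjective ht)), fun x => by
      rw [LinearEquiv.trans_apply, (LinearEquiv.symm_apply_eq _).2
        (s.quotKerEquivOfSurjective_apply_mk hs x).symm]
      rfl⟩

lemma FiltOps.IsFilteredComplex.pageTwo {K : ℤ → Type*} [∀ n, AddCommGroup (K n)]
    [∀ n, Module k (K n)] {C : FiltOps k K} (hC : C.IsFilteredComplex) {T : ℤ → Type*}
    [∀ p, AddCommGroup (T p)] [∀ p, Module k (T p)]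
    (D : ∀ {p p' : ℤ}, p' + 1 = p → (T p →ₗ[k] T p')) {q : ℤ} (e : ∀ p, C.E 1 p q ≃ₗ[k] T p) {c : k}
    (hc : c * c = 1) (he : ∀ {p p' : ℤ} (h : p' + 1 = p) (x : C.E 1 p q),
      e p' (C.dE 1 (by simpa using h) (by simp) x) = c • D h (e p x)) (p : ℤ) :
    Nonempty (C.E 2 p q ≃ₗ[k] Subq (LinearMap.ker (D (sub_add_cancel p 1)))
      (LinearMap.range (D (rfl : p + 1 = p + 1)))) := by
  have hcD : ∀ {p p' : ℤ} (h : p' + 1 = p) (z : C.Z (1 : ℕ) p (p + q)), D h (e p (Subq.mk _ _ z)) =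
      c • e p' (Subq.mk (C.Z (1 : ℕ) p' (p' + q)) (C.Bd (1 : ℕ) p' (p' + q))
        ⟨C.d (by omega) z.1, (hC.descends (by omega) h).1 z.2⟩) := by
    intro p p' h z
    have h1 := he h (Subq.mk _ _ z)
    rw [hC.dE_mk] at h1
    rw [h1, smul_smul, hc, one_smul]
  have hker : ∀ {p : ℤ} (z : C.Z (1 : ℕ) p (p + q)), e p (Subq.mk _ _ z) = 0 ↔
      (z : K (p + q)) ∈ C.Bd 1 p (p + q) := fun z =>
    (e _).map_eq_zero_iff.trans (Subq.mk_eq_zero z)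
  have bd : ∀ {p : ℤ} {z : K (p + q)} (p' n' : ℤ), p' + 1 = p → p + q + 1 = n' →
      (z ∈ C.Bd 1 p (p + q) ↔ ∃ a ∈ C.F (p + q) p', ∃ y ∈ C.F n' p, ∃ h, a + C.d h y = z) := by
    intro p z p' n' hp hn
    rw [FiltOps.mem_Bd hn (zero_add 1) hp (add_zero p)]
    simp only [hC.mem_Z_zero]
    exact ⟨fun ⟨a, ha, y, hy, h⟩ => ⟨a, ha, y, hy, hn, h⟩, fun ⟨a, ha, y, hy, _, h⟩ =>
      ⟨a, ha, y, hy, h⟩⟩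
  have hd : p - 1 + q + 1 = p + q := by omega
  have hd' : p + q + 1 = p + 1 + q := by omega
  have le : ∀ {z : K (p + q)}, z ∈ C.Z (2 : ℕ) p (p + q) → z ∈ C.Z (1 : ℕ) p (p + q) := by
    intro z hz
    obtain ⟨h1, h2⟩ := (FiltOps.mem_Z hd (p' := p - 2) (by push_cast; omega)).1 hz
    exact (FiltOps.mem_Z hd (p' := p - 1) (by push_cast; omega)).2 ⟨h1, hC.mono _ (by omega) h2⟩
  let g₀ : C.Z (2 : ℕ) p (p + q) →ₗ[k] T p :=
    (e p).toLinearMap ∘ₗ Subq.mk _ _ ∘ₗ Submodule.inclusion fun z hz => le hz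
  have hg₀ : ∀ z, D (sub_add_cancel p 1) (g₀ z) = 0 := by
    intro z
    refine (hcD (sub_add_cancel p 1) ⟨z.1, le z.2⟩).trans ?_
    have hz := ((FiltOps.mem_Z hd (p' := p - 2) (by push_cast; omega)).1 z.2).2
    rw [(hker _).2 ((bd (p - 2) (p + q) (by omega) hd).2 ⟨_, hz, 0, zero_mem _, hd, by
      rw [map_zero, add_zero]⟩), smul_zero]
  refine ⟨Subq.liftEquiv (Subq.mk _ _ ∘ₗ g₀.codRestrict (LinearMap.ker _) hg₀)
    (fun z => (Subq.mk_eq_zero _).trans (show g₀ z ∈ _ ↔ _ from ?_)) fun t => ?_⟩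
  · have hz := ((FiltOps.mem_Z hd (p' := p - 2) (by push_cast; omega)).1 z.2)
    refine Iff.trans ?_ (FiltOps.mem_Bd (r := (2 : ℕ)) (p' := p - 1) (p'' := p + 1) (r' := 1) hd' rfl
      (sub_add_cancel p 1) rfl).symm
    constructor
    · rintro ⟨t, ht⟩
      obtain ⟨y, rfl⟩ := (e (p + 1)).surjective t
      obtain ⟨y, rfl⟩ := Subq.mk_surjective _ _ y
      have h1 : g₀ z - D rfl (e (p + 1) (Subq.mk _ _ y)) = 0 := sub_eq_zero.2 ht.symm
      rw [hcD] at h1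
      have h2 : z.1 - c • C.d hd' y.1 ∈ C.Bd 1 p (p + q) :=
        (hker ((⟨z.1, le z.2⟩ - c • ⟨C.d hd' y.1, (hC.descends hd' rfl).1 y.2⟩ :
          C.Z (1 : ℕ) p (p + q)))).1 (by
          rw [map_sub, map_smul, map_sub, map_smul]
          exact h1)
      obtain ⟨a, ha, y', hy', _, h3⟩ := (bd (p - 1) (p + 1 + q) (by omega) hd').1 h2
      have h4 : a + C.d hd' (y' + c • y.1) = z.1 := by
        rw [map_add, map_smul, ← add_assoc, h3, sub_add_cancel]
      refine ⟨a, (FiltOps.mem_Z hd (p' := p - 2) (by omega)).2 ⟨ha, ?_⟩, _, add_mem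
        ((FiltOps.mem_Z hd' rfl).2 ⟨hC.mono _ (by omega) hy', hC.d_mem _ hy'⟩)
        (Submodule.smul_mem _ _ y.2), h4⟩
      have h5 := hz.2
      rwa [← h4, map_add (C.d hd), show C.d hd (C.d hd' _) = 0 from
        app_eq (hC.d_d hd' hd) _, add_zero] at h5
    · rintro ⟨a, ha, y, hy, h⟩
      refine ⟨c • e (p + 1) (Subq.mk _ _ ⟨y, hy⟩), ?_⟩
      rw [map_smul, hcD, smul_smul, hc, one_smul, eq_comm, ← sub_eq_zero]
      refine Eq.trans (Eq.symm ?_) ((hker ((⟨z.1, le z.2⟩ - ⟨C.d hd' y, (hC.descends hd' rfl).1 hy⟩ :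
        C.Z (1 : ℕ) p (p + q)))).2
        ((bd (p - 1) (p + 1 + q) (by omega) hd').2 ⟨a, ha.1, 0, zero_mem _, hd', ?_⟩))
      · rw [map_sub, map_sub]
        rfl
      · rw [map_zero, add_zero, ← add_sub_cancel_right a (C.d hd' y), h]
        rfl
  · obtain ⟨t, rfl⟩ := Subq.mk_surjective _ _ t
    obtain ⟨z, hz⟩ := (e p).surjective t.1
    obtain ⟨z, rfl⟩ := Subq.mk_surjective _ _ z
    have ht : D (sub_add_cancel p 1) t.1 = 0 := t.2
    rw [← hz, hcD] at ht
    have ht := congrArg (c • ·) ht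
    simp only [smul_smul, hc, one_smul, smul_zero] at ht
    obtain ⟨a, ha, y, hy, _, h⟩ := (bd (p - 2) (p + q) (by omega) hd).1 ((hker _).1 ht)
    have hy1 : y ∈ C.Bd 1 p (p + q) := (bd (p - 1) (p + 1 + q) (by omega) hd').2
      ⟨y, hy, 0, zero_mem _, hd', by rw [map_zero, add_zero]⟩
    have hyZ : y ∈ C.Z (1 : ℕ) p (p + q) := (FiltOps.mem_Z hd (p' := p - 1) (by push_cast; omega)).2
      ⟨hC.mono _ (by omega) hy, hC.d_mem _ hy⟩
    refine ⟨⟨z.1 - y, (FiltOps.mem_Z hd (p' := p - 2) (by push_cast; omega)).2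
      ⟨sub_mem z.2.1 hyZ.1, ?_⟩⟩, congrArg (Subq.mk _ _) (Subtype.ext ?_)⟩
    · rw [map_sub, ← show _ = C.d hd z.1 from h, add_sub_cancel_right]
      exact ha
    · refine Eq.trans ?_ hz
      refine (congrArg (e p) (map_sub (Subq.mk _ _) z ⟨y, hyZ⟩)).trans ((map_sub (e p) _ _).trans ?_)
      rw [(hker ⟨y, hyZ⟩).2 hy1, sub_zero]

variable {W : ℤ → Type*} [∀ j, AddCommGroup (W j)] [∀ j, Module k (W j)]
  {u : ∀ j, W j →ₗ[k] W (j - 2)}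

lemma mapTo_cycD {X : ℕ → Type*} [∀ n, AddCommGroup (X n)] [∀ n, Module k (X n)]
    {X' : ℕ → Type*} [∀ n, AddCommGroup (X' n)] [∀ n, Module k (X' n)] {O : CycOps k X}
    {O' : CycOps k X'} {f : ∀ n, X n →ₗ[k] X' n} (hf : CycHom O O' f) {n n' : ℤ} (h : n' + 1 = n)
    (z : Box k u id X n) : Box.mapTo u (lowersTo_piMap f) (add_zero n') (cycD u O h z) =
      cycD u O' h (Box.mapTo u (lowersTo_piMap f) (add_zero n) z) := by
  refine app_eq (f := Box.mapTo u (lowersTo_piMap f) (add_zero n') ∘ₗ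
    cycD u O h) (g := cycD u O' h ∘ₗ
      Box.mapTo u (lowersTo_piMap f) (add_zero n)) (Box.hom_ext fun j x w => ?_) z
  rw [comp_apply, comp_apply, cycD_tmul, Box.mapTo_tmul, Box.mapTo_tmul, cycD_tmul]
  exact Box.tmul_congr (hf.mixedD x.1) w

variable {H A : Type*} [Ring H] [HopfAlgebra k H] [Ring A] [Algebra k A] [Module H A]
  [IsScalarTower k H A]

/-- The cycles in `C_q(H, C_n(A^♮_H))`. -/
abbrev HopfZ (k H A : Type*) [CommRing k] [Ring H] [HopfAlgebra k H] [Ring A] [Algebra k A]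
    [Module H A] [IsScalarTower k H A] (q n : ℕ) : Type _ := hopfCycles (natAct k H A n) q

variable (H A u) in
/-- The map induced by the inclusion of the cycles. -/
def boxIncl (p : ℤ) (q : ℕ) : Box k u id (HopfZ k H A q) p →ₗ[k] RowBox k H A u p q :=
  Box.mapTo u (lowersTo_piMap (X := HopfZ k H A q) fun _ => Submodule.subtype _) (add_zero p)

variable (H A u) in
/-- The map induced by the projection from the cycles to homology. -/
def boxProj (p : ℤ) (q : ℕ) :
    Box k u id (HopfZ k H A q) p →ₗ[k] Box k u id (fun n => HopfH (natAct k H A n) q) p :=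
  Box.mapTo u (lowersTo_piMap (X := HopfZ k H A q) fun _ => Subq.mk _ _) (add_zero p)

lemma hopfδ_mem_hopfCycles (hS : Bijective (HopfAlgebra.antipode k : H →ₗ[k] H)) (n : ℕ) : ∀ (q : ℕ) (x : HopfNat k H A (q + 1) n),
    hopfδ (natAct k H A n) q x ∈ hopfCycles (natAct k H A n) q
  | 0, _ => trivial
  | q + 1, x => by
    obtain ⟨x, rfl⟩ := (phi k H A (q + 2) n).surjective x
    show hopfδ _ q _ = 0
    have h : (cylH k H A n).b q ((cylH k H A n).b (q + 1) x) = 0 := (hOps_isParacyclic _ hS).b_b q x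
    rw [← phi_b, ← phi_b, h, LinearEquiv.map_zero]

lemma rowδ_eq (p : ℤ) (q : ℕ) (y : RowBox k H A u p (q + 1)) : rowδ k H A u p q y =
    Box.mapTo u (lowersTo_piMap fun n => hopfδ (natAct k H A n) q) (add_zero p) y :=
  app_eq (Box.map_eq _ _) y

lemma mem_rowCycles_iff [∀ j, Module.Flat k (W j)] (p : ℤ) (q : ℕ) (y : RowBox k H A u p q) :
    y ∈ rowCycles k H A u p q ↔ ∃ z, boxIncl u H A p q z = y := by
  let g : ∀ n, HopfNat k H A q n →ₗ[k] HopfNat k H A q n ⧸ hopfCycles (natAct k H A n) q :=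
    fun n => Submodule.mkQ _
  have hg : ∀ n, Function.Exact (Submodule.subtype _) (g n) := fun n =>
    LinearMap.exact_subtype_mkQ _
  have hs : ∀ n, Surjective (g n) := fun n => Submodule.mkQ_surjective _
  refine Iff.trans ?_ (Box.mapTo_exact (V := HopfZ k H A q)
    (V'' := fun n => HopfNat k H A q n ⧸ hopfCycles (natAct k H A n) q) u hg hs y)
  cases q with
  | zero =>
    refine ⟨fun _ => ?_, fun _ => trivial⟩
    refine app_eq (g := 0) (Box.hom_ext fun j x w => ?_) y
    exact (Box.mapTo_tmul _ _ j x w).trans (Box.tmul_eq_zero (funext fun n =>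
      (Submodule.Quotient.mk_eq_zero _).2 (show x.1 n ∈ hopfCycles (natAct k H A n) 0 from trivial)) w)
  | succ q =>
    let i : ∀ n, (HopfNat k H A (q + 1) n ⧸ hopfCycles (natAct k H A n) (q + 1)) →ₗ[k]
        HopfNat k H A q n := fun n => Submodule.liftQ _ (hopfδ _ q) le_rfl
    have hi : ∀ n, Injective (i n) := fun n =>
      LinearMap.ker_eq_bot.1 (Submodule.ker_liftQ_eq_bot _ _ _ le_rfl)
    refine Iff.trans ?_ (map_eq_zero_iff _ (Box.mapTo_injective i u hi))
    rw [Box.mapTo_mapTo (lowersTo_piMap fun n => hopfδ (natAct k H A n) q) (add_zero p)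
      fun _ => rfl, ← rowδ_eq]
    rfl

lemma exists_rowH_equiv [∀ j, Module.Flat k (W j)]
    (hS : Bijective (HopfAlgebra.antipode k : H →ₗ[k] H)) (p : ℤ) (q : ℕ) :
    ∃ e : RowH k H A u p q ≃ₗ[k] Box k u id (fun n => HopfH (natAct k H A n) q) p,
      ∀ z (y : rowCycles k H A u p q),
        boxIncl u H A p q z = y.1 → e (Subq.mk _ _ y) = boxProj u H A p q z := by
  let s : Box k u id (HopfZ k H A q) p →ₗ[k] RowH k H A u p q :=
    Subq.mk _ _ ∘ₗ (boxIncl u H A p q).codRestrict _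
      fun z => (mem_rowCycles_iff p q _).2 ⟨z, rfl⟩
  let π : ∀ n, HopfZ k H A q n →ₗ[k] HopfH (natAct k H A n) q := fun _ => Subq.mk _ _
  have hp : ∀ n, Surjective (π n) := fun n => Subq.mk_surjective _ _
  let f : ∀ n, HopfNat k H A (q + 1) n →ₗ[k] HopfZ k H A q n := fun n =>
    (hopfδ (natAct k H A n) q).codRestrict _ fun x => hopfδ_mem_hopfCycles hS n q x
  have hf : ∀ n, Function.Exact (f n) (π n) := fun n x =>
    (Subq.mk_eq_zero x).trans ⟨fun ⟨y, hy⟩ => ⟨y, Subtype.ext hy⟩, fun ⟨y, hy⟩ =>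
      ⟨y, congrArg Subtype.val hy⟩⟩
  have hι : Injective (boxIncl u H A p q) := Box.mapTo_injective _ u fun n => Subtype.val_injective
  have key : ∀ z, boxIncl u H A p q z ∈ LinearMap.range (rowδ k H A u p q) ↔
      z ∈ Set.range (Box.mapTo u (lowersTo_piMap f) (add_zero p)) := by
    refine fun z => exists_congr fun y => ?_
    rw [← hι.eq_iff, boxIncl, Box.mapTo_mapTo (lowersTo_piMap fun n => hopfδ (natAct k H A n) q)
      (add_zero p) fun _ => rfl, ← rowδ_eq]
  obtain ⟨e, he⟩ := exists_equiv_of_ker_eq (s := s) (fun y => by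
    obtain ⟨y, rfl⟩ := Subq.mk_surjective _ _ y
    obtain ⟨z, hz⟩ := (mem_rowCycles_iff p q _).1 y.2
    exact ⟨z, congrArg (Subq.mk _ _) (Subtype.ext hz)⟩) (Box.mapTo_surjective _ u hp)
    fun z => (Subq.mk_eq_zero _).trans ((key z).trans (Box.mapTo_exact u hf hp z).symm)
  exact ⟨e, fun z y h => (congrArg (fun y => e (Subq.mk _ _ y)) (Subtype.ext h.symm)).trans (he z)⟩

variable [IsModuleAlgebra k H A]

lemma totFilt_pageTwo (hS : Bijective (HopfAlgebra.antipode k : H →ₗ[k] H))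
    (hW : ∀ j, Module.Flat k (W j)) (p : ℤ) (q : ℕ) :
    Nonempty ((totFilt A u hS).E 2 p q ≃ₗ[k] HC u (hopfHOps A hS q) p) := by
  choose κ hκ using fun p => exists_rowH_equiv (A := A) (u := u) hS p q
  refine totFilt_isFilteredComplex.pageTwo (T := Box k u id fun n => HopfH (natAct k H A n) q)
    (fun h => cycD u (hopfHOps A hS q) h) (fun p => (pageOne A hS u p q).trans (κ p))
    (c := (-1) ^ q) (by rw [← mul_pow, neg_one_mul, neg_neg, one_pow]) (fun {p p'} h x => ?_) p
  obtain rfl : p' = p - 1 := by omega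
  rw [LinearEquiv.trans_apply, LinearEquiv.trans_apply, pageOne_d, map_smul]
  refine congrArg (((-1 : k) ^ q) • ·) ?_
  obtain ⟨y, hy⟩ := Subq.mk_surjective _ _ (pageOne A hS u p q x)
  obtain ⟨z, hz⟩ := (mem_rowCycles_iff p q _).1 y.2
  have rd := rowDescends (A := A) hS q
  let O : CycOps k (HopfZ k H A q) :=
    { d := fun n i => ((rowOps A hS q).d n i).restrict (rd.d n i).1
      s := fun n i => ((rowOps A hS q).s n i).restrict (rd.s n i).1
      t := fun n => ((rowOps A hS q).t n).restrict (rd.t n).1 }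
  have hι : CycHom O (rowOps A hS q) (fun _ => Submodule.subtype _) :=
    ⟨fun _ _ _ => rfl, fun _ _ _ => rfl, fun _ _ => rfl⟩
  have hπ : CycHom O (hopfHOps A hS q) (fun _ => Subq.mk _ _) :=
    ⟨fun n i x => (Subq.map_mk (rd.d n i) x).symm, fun n i x => (Subq.map_mk (rd.s n i) x).symm,
      fun n x => (Subq.map_mk (rd.t n) x).symm⟩
  have e := mapTo_cycD (u := u) hπ h z
  rw [← hy, hκ p z y hz, boxProj, ← e]
  refine (congrArg (κ (p - 1)) (Subq.map_mk (rowDDescends hS u h q) y)).trans (hκ (p - 1) _ _ ?_)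
  exact (mapTo_cycD hι h z).trans (congrArg (cycD u (rowOps A hS q) h) hz)

end PageTwo

section Homology

variable {k : Type uk} [CommRing k]

lemma Subq.nonempty_equiv {X Y : Type*} [AddCommGroup X] [Module k X] [AddCommGroup Y] [Module k Y]
    {Z B : Submodule k X} {Z' B' : Submodule k Y} (a : X →ₗ[k] Y) (b : Y →ₗ[k] X)
    (ha : ∀ x ∈ Z, a x ∈ Z') (ha' : ∀ x ∈ B, a x ∈ B') (hb : ∀ y ∈ Z', b y ∈ Z)
    (hb' : ∀ y ∈ B', b y ∈ B) (hba : ∀ x ∈ Z, x - b (a x) ∈ B) (hab : ∀ y ∈ Z', y - a (b y) ∈ B') :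
    Nonempty (Subq Z B ≃ₗ[k] Subq Z' B') := by
  refine ⟨Subq.liftEquiv (Subq.mk Z' B' ∘ₗ a.restrict ha) (fun z => (Subq.mk_eq_zero _).trans
    ⟨fun h => ?_, fun h => ha' _ h⟩) fun y => ?_⟩
  · exact (sub_add_cancel (z : X) (b (a z))) ▸ add_mem (hba z z.2) (hb' _ h)
  · obtain ⟨y, rfl⟩ := Subq.mk_surjective _ _ y
    refine ⟨⟨b y, hb y y.2⟩, (Subq.mk_eq_mk _ _).2 ?_⟩
    have := neg_mem (hab y y.2)
    rwa [neg_sub] at this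

lemma CycOps.defect_eq_zero {X : ℕ → Type*} [∀ n, AddCommGroup (X n)] [∀ n, Module k (X n)]
    {O : CycOps k X} (hO : ∀ n x, (O.t n ^ (n + 1)) x = x) (x : ∀ n, X n) : O.defect x = 0 := by
  rw [CycOps.defect_eq]
  exact funext fun n => (congrArg (_ - ·) (hO n _)).trans (sub_self _)

variable {H : Type uH} {A : Type uA} [Ring H] [HopfAlgebra k H] [Ring A] [Algebra k A]
  [Module H A] [IsScalarTower k H A] [IsModuleAlgebra k H A]
  (hS : Bijective (HopfAlgebra.antipode k : H →ₗ[k] H))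

lemma exists_tot_homotopyEquiv : ∃ (α : (∀ i : ℕ × ℕ, Cyl k H A i.1 i.2) →ₗ[k]
      (∀ n, TPow k (CrossedProduct k H A) (n + 1))) (β : _ →ₗ[k] _) (h : _ →ₗ[k] _) (h' : _ →ₗ[k] _),
    (LowersTo k totDeg (id : ℕ → ℕ) 0 α ∧ LowersTo k (id : ℕ → ℕ) totDeg 0 β ∧
      LowersTo k totDeg totDeg (-1) h ∧ LowersTo k (id : ℕ → ℕ) (id : ℕ → ℕ) (-1) h') ∧
    (∀ x, (algOps k (CrossedProduct k H A)).mixedD (α x) = α (totD (cylH k H A) (cylA hS A) x)) ∧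
    (∀ y, totD (cylH k H A) (cylA hS A) (β y) = β ((algOps k (CrossedProduct k H A)).mixedD y)) ∧
    (∀ x, x - β (α x) = totD (cylH k H A) (cylA hS A) (h x) + h (totD (cylH k H A) (cylA hS A) x)) ∧
    ∀ y, y - α (β y) = (algOps k (CrossedProduct k H A)).mixedD (h' y) +
      h' ((algOps k (CrossedProduct k H A)).mixedD y) := by
  obtain ⟨f, g, h, h', ⟨lf, lg, lh, lh'⟩, hf, hg, hh, hh'⟩ :=
    eilenbergZilber.{max uH uA, uk} (cyl_isBiPara (A := A) hS)
  have hψ := psi_hom (A := A) hS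
  have hψ' := CycHom.of_inverse _ hψ
  have hD := (cyl_isBiPara (A := A) hS).diag
  set D := diagOps (cylH k H A) (cylA hS A)
  have hT : ∀ x, D.defect x = 0 := CycOps.defect_eq_zero fun n x =>
    ((cyl_isBiPara (A := A) hS).diag_t_pow n (n + 1) x).trans (cyl_t_pow_t_pow hS n n x)
  let P := piMap (fun n => (psi hS A (n + 1)).toLinearMap) ∘ₗ D.twist
  let Q := D.untwist ∘ₗ piMap fun n => (psi hS A (n + 1)).symm.toLinearMap
  have hPQ : ∀ y, P (Q y) = y := fun y => by
    refine (congrArg (piMap fun n => (psi hS A (n + 1)).toLinearMap)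
      (D.twist_untwist _)).trans (funext fun n => ?_)
    exact (psi hS A (n + 1)).apply_symm_apply _
  have hQP : ∀ x, Q (P x) = x := fun x => by
    refine (congrArg D.untwist (funext fun n => ?_)).trans (D.untwist_twist x)
    exact (psi hS A (n + 1)).symm_apply_apply _
  have lP : LowersTo k (id : ℕ → ℕ) (id : ℕ → ℕ) 0 P :=
    (lowersTo_piMap _).comp lowersTo_twist (zero_add 0)
  have lQ : LowersTo k (id : ℕ → ℕ) (id : ℕ → ℕ) 0 Q := lowersTo_untwist.comp (lowersTo_piMap _) (zero_add 0)
  have hP : ∀ x, (algOps k (CrossedProduct k H A)).mixedD (P x) = P (D.mixedD' x) := fun x => by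
    refine (hψ.mixedD _).symm.trans (congrArg _ ?_)
    rw [hD.mixedD_twist, hT, add_zero]
  have hQ : ∀ y, D.mixedD' (Q y) = Q ((algOps k (CrossedProduct k H A)).mixedD y) := fun y => by
    conv_rhs => rw [← hPQ y, hP, hQP]
  refine ⟨P ∘ₗ f, g ∘ₗ Q, h, P ∘ₗ h' ∘ₗ Q, ⟨lP.comp lf (zero_add 0), lg.comp lQ (zero_add 0), lh,
    lP.comp (lh'.comp lQ (add_zero _)) (zero_add _)⟩, fun x => ?_, fun y => ?_, fun x => ?_, fun y => ?_⟩
  · exact (hP _).trans (congrArg P (hf x))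
  · exact (hg _).trans (congrArg g (hQ y))
  · refine Eq.trans ?_ (hh x)
    exact congrArg (fun z => x - g z) (hQP _)
  · have := congrArg P (hh' (Q y))
    rwa [map_sub, map_add, hPQ, ← hP, hQ] at this

variable {W : ℤ → Type*} [∀ j, AddCommGroup (W j)] [∀ j, Module k (W j)]
  (u : ∀ j, W j →ₗ[k] W (j - 2))

lemma totFilt_Hom_equiv (n : ℤ) : Nonempty ((totFilt A u hS).Hom n ≃ₗ[k]
    HC u (algOps k (CrossedProduct k H A)) n) := by
  obtain ⟨α, β, h, h', ⟨lα, lβ, lh, lh'⟩, hα, hβ, hh, hh'⟩ := exists_tot_homotopyEquiv (A := A) hS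
  have ea : ∀ {n n' : ℤ} (e : n' + 1 = n) z, Box.mapTo u lα (add_zero n') ((totFilt A u hS).d e z) =
      cycD u (algOps k (CrossedProduct k H A)) e (Box.mapTo u lα (add_zero n) z) := fun {n n'} e z => by
    refine app_eq (f := Box.mapTo u lα (add_zero n') ∘ₗ (totFilt A u hS).d e)
      (g := cycD u _ e ∘ₗ Box.mapTo u lα (add_zero n)) (Box.hom_ext fun j x w => ?_) z
    rw [comp_apply, comp_apply, totFilt_d_tmul, Box.mapTo_tmul, Box.mapTo_tmul, cycD_tmul]
    exact Box.tmul_congr (hα x.1).symm w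
  have eb : ∀ {n n' : ℤ} (e : n' + 1 = n) z, Box.mapTo u lβ (add_zero n')
      (cycD u (algOps k (CrossedProduct k H A)) e z) =
      (totFilt A u hS).d e (Box.mapTo u lβ (add_zero n) z) := fun {n n'} e z => by
    refine app_eq (g := (totFilt A u hS).d e ∘ₗ Box.mapTo u lβ (add_zero n))
      (f := Box.mapTo u lβ (add_zero n') ∘ₗ cycD u _ e) (Box.hom_ext fun j x w => ?_) z
    rw [comp_apply, comp_apply, cycD_tmul, Box.mapTo_tmul, Box.mapTo_tmul, totFilt_d_tmul]
    exact Box.tmul_congr (hβ x.1).symm w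
  have e₁ : n - 1 + 1 = n := sub_add_cancel n 1
  have eh : ∀ z, z - Box.mapTo u lβ (add_zero n) (Box.mapTo u lα (add_zero n) z) =
      (totFilt A u hS).d rfl (Box.mapTo u lh (add_neg_cancel_right n 1) z) +
        Box.mapTo u lh (n' := n) (by omega) ((totFilt A u hS).d e₁ z) := fun z => by
    refine app_eq (f := 𝟙 - Box.mapTo u lβ (add_zero n) ∘ₗ Box.mapTo u lα _)
      (g := (totFilt A u hS).d rfl ∘ₗ Box.mapTo u lh (add_neg_cancel_right n 1) +
        Box.mapTo u lh (n' := n) (by omega) ∘ₗ (totFilt A u hS).d e₁) (Box.hom_ext fun j x w => ?_) z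
    simp only [LinearMap.sub_apply, LinearMap.add_apply, comp_apply, id_apply,
      totFilt_d_tmul, Box.mapTo_tmul, ← Box.tmul_sub, ← Box.tmul_add]
    exact Box.tmul_congr (hh x.1) w
  have eh' : ∀ z, z - Box.mapTo u lα (add_zero n) (Box.mapTo u lβ (add_zero n) z) =
      cycD u (algOps k (CrossedProduct k H A)) rfl (Box.mapTo u lh' (add_neg_cancel_right n 1) z) +
        Box.mapTo u lh' (n' := n) (by omega) (cycD u (algOps k (CrossedProduct k H A)) e₁ z) :=
      fun z => by
    refine app_eq (f := 𝟙 - Box.mapTo u lα (add_zero n) ∘ₗ Box.mapTo u lβ _)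
      (g := cycD u _ rfl ∘ₗ Box.mapTo u lh' (add_neg_cancel_right n 1) +
        Box.mapTo u lh' (n' := n) (by omega) ∘ₗ cycD u _ e₁) (Box.hom_ext fun j x w => ?_) z
    simp only [LinearMap.sub_apply, LinearMap.add_apply, comp_apply, id_apply,
      cycD_tmul, Box.mapTo_tmul, ← Box.tmul_sub, ← Box.tmul_add]
    exact Box.tmul_congr (hh' x.1) w
  refine Subq.nonempty_equiv (Box.mapTo u lα (add_zero n)) (Box.mapTo u lβ (add_zero n))
    (fun x hx => ?_) ?_ (fun y hy => ?_) ?_ (fun x hx => ?_) fun y hy => ?_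
  · exact (ea e₁ x).symm.trans ((congrArg _ hx).trans (map_zero _))
  · rintro _ ⟨x, rfl⟩
    exact ⟨_, (ea rfl x).symm⟩
  · exact (eb e₁ y).symm.trans ((congrArg _ hy).trans (map_zero _))
  · rintro _ ⟨y, rfl⟩
    exact ⟨_, (eb rfl y).symm⟩
  · rw [eh, show (totFilt A u hS).d e₁ x = 0 from hx, map_zero, add_zero]
    exact ⟨_, rfl⟩
  · rw [eh', show cycD u _ e₁ y = 0 from hy, map_zero, add_zero]
    exact ⟨_, rfl⟩

end Homology

section StrongConvergence

variable {k : Type*} [CommRing k]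

lemma FiltOps.IsFilteredComplex.exists_stable {K : ℤ → Type*} [∀ n, AddCommGroup (K n)]
    [∀ n, Module k (K n)] {C : FiltOps k K} (hC : C.IsFilteredComplex) {N : ℤ}
    (hbot : ∀ n p : ℤ, p < N → C.F n p = ⊥) (htop : ∀ n p : ℤ, n ≤ p → C.F n p = ⊤) (p q : ℤ)
    {L : Type*} [AddCommGroup L] [Module k L] (θ : C.Hom (p + q) ≃ₗ[k] L) :
    ∃ r₀ : ℕ, ∀ r ≥ r₀, ∃ ε : C.E r p q ≃ₗ[k] Subq ((C.filtHom (p + q) p).map θ.toLinearMap)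
        ((C.filtHom (p + q) (p - 1)).map θ.toLinearMap),
      ∀ (x : C.Z r p (p + q)) (hx : x.1 ∈ C.cycles (p + q))
        (y : (C.filtHom (p + q) p).map θ.toLinearMap), y.1 = θ (Subq.mk _ _ ⟨x.1, hx⟩) →
          ε (Subq.mk _ _ x) = Subq.mk _ _ y := by
  refine ⟨(max (p - N + 1) (q + 2)).toNat, fun r hr => ?_⟩
  have hr := (Int.self_le_toNat _).trans (Int.ofNat_le.2 hr)
  have h1 : p - r < N := by omega
  have h2 : p + q + 1 ≤ p + r - 1 := by omega
  have hd : p + q - 1 + 1 = p + q := sub_add_cancel _ 1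
  have mZ : ∀ {x : K (p + q)}, x ∈ C.Z r p (p + q) ↔ x ∈ C.F (p + q) p ∧ x ∈ C.cycles (p + q) := by
    intro x
    rw [FiltOps.mem_Z hd (sub_add_cancel p _), hbot _ _ h1]
    rfl
  let g : C.Z r p (p + q) →ₗ[k] (C.filtHom (p + q) p).map θ.toLinearMap :=
    (θ.toLinearMap ∘ₗ Subq.mk _ _ ∘ₗ Submodule.inclusion fun x hx => (mZ.1 hx).2).codRestrict _
      fun z => ⟨_, ⟨⟨z.1, (mZ.1 z.2).2⟩, (mZ.1 z.2).1, rfl⟩, rfl⟩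
  refine ⟨Subq.liftEquiv (Subq.mk _ _ ∘ₗ g) (fun z => (Subq.mk_eq_zero _).trans ?_) fun y => ?_,
    fun x hx y hy => congrArg (Subq.mk _ _) (Subtype.ext hy.symm)⟩
  · rw [FiltOps.mem_Bd rfl (sub_add_cancel _ 1) (sub_add_cancel _ 1) rfl]
    constructor
    · rintro ⟨_, ⟨a, ha, rfl⟩, h⟩
      obtain ⟨y, hy⟩ := (Subq.mk_eq_mk _ _).1 (θ.injective h.symm)
      have hy : C.d rfl y = z.1 - a.1 := hy
      refine ⟨a.1, (FiltOps.mem_Z hd (p' := p - r) (by omega)).2 ⟨ha, ?_⟩, y,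
        (FiltOps.mem_Z rfl (p' := p) (by omega)).2 ⟨?_, ?_⟩, by rw [hy, add_sub_cancel]⟩
      · rw [show C.d hd a.1 = 0 from a.2]
        exact zero_mem _
      · rw [htop _ _ (by omega)]
        trivial
      · rw [hy]
        exact sub_mem z.2.1 (hC.mono _ (by omega) ha)
    · rintro ⟨a, ha, y, -, h⟩
      have ha' : C.d hd a = 0 := by
        have := ((FiltOps.mem_Z hd (p' := p - r) (by omega)).1 ha).2
        rwa [hbot _ _ h1] at this
      refine ⟨_, ⟨⟨a, ha'⟩, ha.1, rfl⟩, congrArg θ ((Subq.mk_eq_mk _ _).2 ⟨-y, ?_⟩)⟩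
      rw [map_neg]
      show -C.d rfl y = a - z.1
      rw [← h, sub_add_cancel_left]
  · obtain ⟨⟨_, ⟨_, ⟨x, hx, rfl⟩, rfl⟩⟩, rfl⟩ := Subq.mk_surjective _ _ y
    exact ⟨⟨x.1, mZ.2 ⟨hx, x.2⟩⟩, rfl⟩

section

variable {I : Type*} {deg : I → ℕ} {V : I → Type*} [∀ i, AddCommGroup (V i)] [∀ i, Module k (V i)]
  {W : ℤ → Type*} [∀ j, AddCommGroup (W j)] [∀ j, Module k (W j)] {u : ∀ j, W j →ₗ[k] W (j - 2)}

lemma mem_PS_sub_two {n j : ℤ} {x : ∀ i, V i} (hx : x ∈ PS k deg V (n - j))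
    (h : ∀ i, (deg i : ℤ) ≤ n - j → x i = 0) : x ∈ PS k deg V (n - (j - 2)) := by
  intro i hi
  by_cases hj : (deg i : ℤ) ≤ n - j
  · exact h i hj
  · refine hx i fun ⟨h1, r, hr⟩ => hi ⟨by omega, r - 1, by omega⟩

lemma Box.tmul_eq_zero_of_le {N n : ℤ} (hW : ∀ j < N, Subsingleton (W j)) {j : ℤ}
    (x : PS k deg V (n - j)) (hx : ∀ i, (deg i : ℤ) ≤ n - N → x.1 i = 0) (w : W j) :
    Box.tmul k u deg V n j x w = 0 := by
  have key : ∀ (t : ℕ) (j : ℤ), j < N + 2 * t → ∀ x : PS k deg V (n - j),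
      (∀ i, (deg i : ℤ) ≤ n - N → x.1 i = 0) → ∀ w, Box.tmul k u deg V n j x w = 0 := by
    intro t
    induction t with
    | zero =>
      intro j hj x _ w
      have := hW j (by simpa using hj)
      rw [Subsingleton.elim w 0, ← Box.tmulHom_apply, map_zero]
    | succ t ih =>
      intro j hj x hx w
      by_cases hN : j < N + 2 * t
      · exact ih j hN x hx w
      · let x' : PS k deg V (n - (j - 2)) := ⟨x.1, mem_PS_sub_two x.2 fun i hi => hx i (by omega)⟩
        exact (Box.tmul_incl (u := u) x' w).trans
          (ih (j - 2) (by push_cast at hj; omega) x' hx (u j w))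
  have := Int.self_le_toNat (j - N + 1)
  exact key (j - N + 1).toNat j (by omega) x hx w

end

variable {H A : Type*} [Ring H] [HopfAlgebra k H] [Ring A] [Algebra k A]
  [Module H A] [IsScalarTower k H A] {hS : Bijective (HopfAlgebra.antipode k : H →ₗ[k] H)}
  {W : ℤ → Type*} [∀ j, AddCommGroup (W j)] [∀ j, Module k (W j)] {u : ∀ j, W j →ₗ[k] W (j - 2)}

lemma totFilt_eq_bot {N : ℤ} (hW : ∀ j < N, Subsingleton (W j)) (n p : ℤ) (hp : p < N) :
    (totFilt A u hS).F n p = ⊥ := by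
  refine le_bot_iff.1 (totFilt_le fun j x w hx => ?_)
  refine Box.tmul_eq_zero_of_le hW x (fun i hi => hx i ?_) w
  have : (i.1 : ℤ) ≤ totDeg i := Int.ofNat_le.2 (Nat.le_add_right _ _)
  omega

end StrongConvergence

section PiTensor

variable (k : Type*) [CommRing k] {I : Type*} (V : I → Type*) [∀ i, AddCommGroup (V i)]
  [∀ i, Module k (V i)] (Y : Type*) [AddCommGroup Y] [Module k Y]

/-- The map `(∏ V_i) ⊗ Y → ∏ (V_i ⊗ Y)`. -/
def piTensor : (∀ i, V i) ⊗[k] Y →ₗ[k] ∀ i, V i ⊗[k] Y := LinearMap.pi fun i => (proj i).rTensor Y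

variable {Y}

lemma piTensor_lTensor {Y' : Type*} [AddCommGroup Y'] [Module k Y'] (s : Y →ₗ[k] Y')
    (z : (∀ i, V i) ⊗[k] Y) (i : I) :
    piTensor k V Y' (s.lTensor _ z) i = s.lTensor (V i) (piTensor k V Y z i) :=
  app_eq ((LinearMap.rTensor_comp_lTensor _ (proj i) s).trans
    (LinearMap.lTensor_comp_rTensor _ (proj i) s).symm) z

lemma piTensor_bijective_fin (n : ℕ) : Bijective (piTensor k V (Fin n → k)) := by
  have h : ∀ z a i, piScalarRight k k (V i) (Fin n) (piTensor k V (Fin n → k) z i) a =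
      piScalarRight k k (∀ i, V i) (Fin n) z a i := fun z a i =>
    app_eq
      (f := proj a ∘ₗ (piScalarRight k k (V i) (Fin n)).toLinearMap ∘ₗ (proj i).rTensor _)
      (g := (proj i : (∀ i, V i) →ₗ[k] V i) ∘ₗ (proj a : (Fin n → ∀ i, V i) →ₗ[k] ∀ i, V i) ∘ₗ
        (piScalarRight k k (∀ i, V i) (Fin n)).toLinearMap)
      (ext' fun _ _ => rfl) z
  refine ⟨fun z z' e => (piScalarRight k k _ (Fin n)).injective ?_, fun t => ?_⟩
  · exact funext fun a => funext fun i => by rw [← h, ← h, e]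
  · refine ⟨(piScalarRight k k _ (Fin n)).symm fun a i =>
      piScalarRight k k (V i) (Fin n) (t i) a, funext fun i => ?_⟩
    refine (piScalarRight k k (V i) (Fin n)).injective (funext fun a => ?_)
    rw [h, LinearEquiv.apply_symm_apply]

lemma piTensor_bijective [Module.FinitePresentation k Y] : Bijective (piTensor k V Y) := by
  obtain ⟨n, m, s, g, hs, hg⟩ := Module.FinitePresentation.exists_fin' k Y
  refine ⟨(injective_iff_map_eq_zero _).2 fun z hz => ?_, fun t => ?_⟩
  · obtain ⟨z, rfl⟩ := LinearMap.lTensor_surjective _ hs z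
    have h : ∀ i, ∃ y, g.lTensor (V i) y = piTensor k V _ z i := fun i =>
      (lTensor_exact (V i) hg hs _).1 ((piTensor_lTensor k V s z i).symm.trans (congrFun hz i))
    choose t ht using h
    obtain ⟨y, rfl⟩ := (piTensor_bijective_fin k V m).2 t
    obtain rfl : g.lTensor _ y = z := (piTensor_bijective_fin k V n).1 (funext fun i =>
      (piTensor_lTensor k V g y i).trans (ht i))
    exact (lTensor_exact _ hg hs).apply_apply_eq_zero y
  · choose t' ht using fun i => LinearMap.lTensor_surjective (V i) hs (t i)
    obtain ⟨z, rfl⟩ := (piTensor_bijective_fin k V n).2 t'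
    exact ⟨s.lTensor _ z, funext fun i => (piTensor_lTensor k V s z i).trans (ht i)⟩

end PiTensor

section Compat

variable {k : Type*} [CommRing k] {W : ℤ → Type*} [∀ j, AddCommGroup (W j)] [∀ j, Module k (W j)]
  (u : ∀ j, W j →ₗ[k] W (j - 2))

/-- Given maps `v` that invert `u` in degrees `≤ J`, the maps `W_j → W_J × W_{J-1}` given by the
powers of `u` and `v`. -/
def compat (v : ∀ {j j' : ℤ}, j' + 2 = j → (W j' →ₗ[k] W j)) (J j : ℤ) :
    W j →ₗ[k] W J × W (J - 1) :=
  if h : j = J then LinearMap.inl k _ _ ∘ₗ (h ▸ 𝟙 : W j →ₗ[k] W J)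
  else if h : j = J - 1 then LinearMap.inr k _ _ ∘ₗ (h ▸ 𝟙 : W j →ₗ[k] W (J - 1))
  else if J < j then compat v J (j - 2) ∘ₗ u j
  else compat v J (j + 2) ∘ₗ v rfl
termination_by (2 * (j - J) + 1).natAbs

lemma exists_compat (J : ℤ) (hu : ∀ j ≤ J, Bijective (u j)) :
    ∃ c : ∀ j, W j →ₗ[k] W J × W (J - 1), c J = LinearMap.inl k _ _ ∧
      c (J - 1) = LinearMap.inr k _ _ ∧ ∀ j w, c (j - 2) (u j w) = c j w := by
  have hv : ∀ j j' : ℤ, j' + 2 = j → ∃ v : W j' →ₗ[k] W j,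
      ∀ (h : j - 2 = j'), j ≤ J → ∀ w, v (h ▸ u j w) = w := by
    intro j j' e
    obtain rfl : j' = j - 2 := by omega
    by_cases hj : j ≤ J
    · exact ⟨(LinearEquiv.ofBijective (u j) (hu j hj)).symm.toLinearMap, fun _ _ w =>
        (LinearEquiv.ofBijective (u j) (hu j hj)).symm_apply_apply w⟩
    · exact ⟨0, fun _ h => absurd h hj⟩
  choose v hv using hv
  refine ⟨compat u (fun {j j'} h => v j j' h) J, ?_, ?_, fun j w => ?_⟩
  · rw [compat, dif_pos rfl]
    rfl
  · rw [compat, dif_neg (by omega), dif_pos rfl]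
    rfl
  · by_cases hj : J < j
    · conv_rhs => rw [compat, dif_neg (by omega), dif_neg (by omega), if_pos hj]
      rfl
    · rw [compat, dif_neg (by omega), dif_neg (by omega), if_neg (by omega)]
      have : ∀ (j' : ℤ) (h : j - 2 + 2 = j') (y : W (j - 2)),
          compat u (fun {j j'} h => v j j' h) J (j - 2 + 2) (v _ _ rfl y) =
            compat u (fun {j j'} h => v j j' h) J j' (v _ _ h y) := by
        rintro _ rfl y
        rfl
      refine (this j (by ring) (u j w)).trans (congrArg _ ?_)
      exact hv j (j - 2) (by ring) rfl (by omega) w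

end Compat

section Complete

variable {k : Type*} [CommRing k] {I : Type*} {deg : I → ℕ} {V : I → Type*}
  [∀ i, AddCommGroup (V i)] [∀ i, Module k (V i)]
  {W : ℤ → Type*} [∀ j, AddCommGroup (W j)] [∀ j, Module k (W j)]
  (u : ∀ j, W j →ₗ[k] W (j - 2)) {J : ℤ} (n : ℤ)

open Classical in
variable (deg V) in
/-- The projection onto `V[[u]]_m`. -/
def psProj (m : ℤ) : (∀ i, V i) →ₗ[k] PS k deg V m :=
  (LinearMap.pi fun i => if m ≤ deg i ∧ Even ((deg i : ℤ) - m) then proj i else 0).codRestrict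
    _ fun x _ hi => congrArg (fun f : (∀ i, V i) →ₗ[k] V _ => f x) (if_neg hi)

lemma psProj_apply {m : ℤ} (x : PS k deg V m) : psProj deg V m x.1 = x := by
  refine Subtype.ext (funext fun i => ?_)
  by_cases h : m ≤ deg i ∧ Even ((deg i : ℤ) - m)
  · exact congrArg (fun f : (∀ i, V i) →ₗ[k] V i => f x.1) (if_pos h)
  · exact (congrArg (fun f : (∀ i, V i) →ₗ[k] V i => f x.1) (if_neg h)).trans (x.2 i h).symm

variable (k) in
lemma psProj_eq_zero {m : ℤ} {x : ∀ i, V i} {i : I} (h : x i = 0) :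
    (psProj (k := k) deg V m x).1 i = 0 := by
  by_cases hm : m ≤ deg i ∧ Even ((deg i : ℤ) - m)
  · exact (congrArg (fun f : (∀ i, V i) →ₗ[k] V i => f x) (if_pos hm)).trans h
  · exact congrArg (fun f : (∀ i, V i) →ₗ[k] V i => f x) (if_neg hm)

/-- The map `(∏ V_i) ⊗ (W_J × W_{J-1}) → (V ⊠ W)_n`. -/
def fromCoeff : (∀ i, V i) →ₗ[k] W J × W (J - 1) →ₗ[k] Box k u deg V n :=
  (Box.tmulHom deg V u n J).compl₁₂ (psProj deg V (n - J)) (LinearMap.fst k _ _) +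
    (Box.tmulHom deg V u n (J - 1)).compl₁₂ (psProj deg V (n - (J - 1))) (LinearMap.snd k _ _)

variable {u n} {c : ∀ j, W j →ₗ[k] W J × W (J - 1)} (hc : ∀ j w, c (j - 2) (u j w) = c j w)

/-- The map `(V ⊠ W)_n → (∏ V_i) ⊗ (W_J × W_{J-1})`. -/
def toCoeff : Box k u deg V n →ₗ[k] (∀ i, V i) ⊗[k] (W J × W (J - 1)) :=
  Box.desc u (fun j => (mk k _ _).compl₁₂ (Submodule.subtype _) (c j))
    fun j x w => congrArg (x.1 ⊗ₜ[k] ·) (hc j w).symm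

lemma toCoeff_tmul (j : ℤ) (x : PS k deg V (n - j)) (w : W j) :
    toCoeff hc (Box.tmul k u deg V n j x w) = x.1 ⊗ₜ[k] c j w := Box.desc_tmul _ _ j x w

include hc in
lemma fromCoeff_tmul (hu : ∀ j ≤ J, Bijective (u j)) (h0 : c J = LinearMap.inl k _ _)
    (h1 : c (J - 1) = LinearMap.inr k _ _) (j : ℤ) (x : PS k deg V (n - j)) (w : W j)
    (hx : ∀ i, (deg i : ℤ) ≤ n - J → x.1 i = 0) :
    fromCoeff u n x.1 (c j w) = Box.tmul k u deg V n j x w := by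
  have key : ∀ (m : ℕ) (j : ℤ), -(2 * m + 1) ≤ 2 * (j - J) + 1 → 2 * (j - J) + 1 ≤ 2 * m + 1 →
      ∀ (x : PS k deg V (n - j)) (w : W j), (∀ i, (deg i : ℤ) ≤ n - J → x.1 i = 0) →
        fromCoeff u n x.1 (c j w) = Box.tmul k u deg V n j x w := by
    intro m
    induction m with
    | zero =>
      intro j hj hj' x w _
      obtain rfl | rfl : j = J ∨ j = J - 1 := by omega
      · rw [h0]
        show Box.tmulHom deg V u n j _ w + Box.tmulHom deg V u n (j - 1) _ 0 = _
        rw [map_zero, add_zero, psProj_apply, Box.tmulHom_apply]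
      · rw [h1]
        show Box.tmulHom deg V u n J _ 0 + Box.tmulHom deg V u n (J - 1) _ w = _
        rw [map_zero, zero_add, psProj_apply, Box.tmulHom_apply]
    | succ m ih =>
      intro j hj hj' x w hx
      by_cases h : J < j
      · let x' : PS k deg V (n - (j - 2)) := ⟨x.1, mem_PS_sub_two x.2 fun i hi => hx i (by omega)⟩
        rw [← hc]
        exact (ih (j - 2) (by push_cast at hj; omega) (by push_cast at hj'; omega) x' (u j w) hx).trans
          (Box.tmul_incl (u := u) x' w).symm
      · by_cases h' : j = J ∨ j = J - 1
        · exact ih j (by omega) (by omega) x w hx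
        · obtain ⟨j, rfl⟩ : ∃ i, j = i - 2 := ⟨j + 2, by ring⟩
          obtain ⟨w, rfl⟩ := (hu j (by omega)).2 w
          rw [hc]
          exact (ih j (by push_cast at hj; omega) (by push_cast at hj'; omega)
            (Submodule.inclusion (PS_le k deg V (by ring)) x) w hx).trans (Box.tmul_incl (u := u) x w)
  exact key (2 * (j - J) + 1).natAbs j (by omega) (by omega) x w hx

variable [∀ j, Module.FinitePresentation k (W j)]

/-- `(V ⊠ W)_n` is complete for the filtration given by subfamilies of coordinates. -/
lemma Box.existsUnique_limit (hu : ∃ j₀ : ℤ, ∀ j ≤ j₀, Bijective (u j)) (l : I → ℤ)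
    (hl : ∀ i, l i ≤ deg i) (F : ℤ → Submodule k (Box k u deg V n))
    (hF : ∀ p, F p = Submodule.span k {z | ∃ (j : ℤ) (x : PS k deg V (n - j)) (w : W j),
      (∀ i, l i < n - p → x.1 i = 0) ∧ z = Box.tmul k u deg V n j x w})
    (y : ℤ → Box k u deg V n) (hy : ∀ p, y p - y (p - 1) ∈ F p) : ∃! x, ∀ p, x - y p ∈ F p := by
  obtain ⟨J, hu⟩ := hu
  obtain ⟨c, h0, h1, hc⟩ := exists_compat u J hu
  let Φ := piTensor k V (W J × W (J - 1))
  have hΦ : Bijective Φ := piTensor_bijective k V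
  let ξ := toCoeff (deg := deg) (V := V) (n := n) hc
  let G := TensorProduct.lift (fromCoeff (deg := deg) (V := V) u (J := J) n)
  have mono : ∀ {p p'}, p ≤ p' → F p ≤ F p' := fun {p p'} h => by
    rw [hF, hF]
    refine Submodule.span_mono ?_
    rintro _ ⟨j, x, w, hx, rfl⟩
    exact ⟨j, x, w, fun i hi => hx i (by omega), rfl⟩
  have hξ : ∀ {p z}, z ∈ F p → ∀ i, l i < n - p → Φ (ξ z) i = 0 := fun {p z} hz i hi => by
    rw [hF] at hz
    refine LinearMap.eqOn_span' (f := proj i ∘ₗ Φ ∘ₗ ξ) (g := 0) ?_ hz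
    rintro _ ⟨j, x, w, hx, rfl⟩
    refine (congrArg (fun t => Φ t i) (toCoeff_tmul hc j x w)).trans ?_
    show x.1 i ⊗ₜ[k] c j w = 0
    rw [hx i hi, zero_tmul]
  have hGξ : ∀ z ∈ F (J - 1), G (ξ z) = z := fun z hz => by
    rw [hF] at hz
    refine LinearMap.eqOn_span' (f := G ∘ₗ ξ) (g := 𝟙) ?_ hz
    rintro _ ⟨j, x, w, hx, rfl⟩
    refine (congrArg G (toCoeff_tmul hc j x w)).trans ?_
    exact fromCoeff_tmul hc hu h0 h1 j x w fun i hi => hx i (by have := hl i; omega)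
  have hG : ∀ {p s}, (∀ i, l i < n - p → Φ s i = 0) → G s ∈ F p := fun {p s} hs => by
    classical
    let P : (∀ i, V i) →ₗ[k] ∀ i, V i := LinearMap.pi fun i => if l i < n - p then 0 else proj i
    have hP : ∀ x i, l i < n - p → P x i = 0 := fun x i hi =>
      congrArg (fun f : (∀ i, V i) →ₗ[k] V i => f x) (if_pos hi)
    have e : P.rTensor _ s = s := hΦ.1 (funext fun i => by
      show (proj i).rTensor _ (P.rTensor _ s) = _
      rw [← comp_apply, ← LinearMap.rTensor_comp]
      by_cases hi : l i < n - p
      · rw [hs i hi, show proj i ∘ₗ P = 0 from LinearMap.ext fun x => hP x i hi,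
          LinearMap.rTensor_zero, LinearMap.zero_apply]
      · rw [show proj i ∘ₗ P = proj i from LinearMap.ext fun x =>
          congrArg (fun f : (∀ i, V i) →ₗ[k] V i => f x) (if_neg hi)]
        rfl)
    rw [← e]
    clear hs e
    induction s with
    | zero => rw [map_zero, map_zero]; exact zero_mem _
    | add a b ha hb => rw [map_add, map_add]; exact add_mem ha hb
    | tmul x a =>
      rw [hF]
      show Box.tmul k u deg V n J (psProj deg V _ (P x)) a.1 +
        Box.tmul k u deg V n (J - 1) (psProj deg V _ (P x)) a.2 ∈ _
      refine add_mem (Submodule.subset_span ?_) (Submodule.subset_span ?_)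
      · exact ⟨J, _, _, fun i hi => psProj_eq_zero k (hP x i hi), rfl⟩
      · exact ⟨J - 1, _, _, fun i hi => psProj_eq_zero k (hP x i hi), rfl⟩
  have tele : ∀ {p p'}, p ≤ p' → y p' - y p ∈ F p' := fun {p p'} h => by
    induction p', h using Int.le_induction with
    | base => rw [sub_self]; exact zero_mem _
    | succ m hm ih =>
      have := hy (m + 1)
      rw [add_sub_cancel_right] at this
      rw [← sub_add_sub_cancel _ (y m)]
      exact add_mem this (mono (by omega) ih)
  have tele' : ∀ {p p'}, p ≤ p' → y p - y p' ∈ F p' := fun h => by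
    rw [← neg_sub]
    exact neg_mem (tele h)
  refine existsUnique_of_exists_of_unique ?_ fun x x' hx hx' => ?_
  · obtain ⟨s, hs⟩ := hΦ.2 fun i =>
      if n - l i - 1 ≤ J - 1 then Φ (ξ (y (n - l i - 1) - y (J - 1))) i else 0
    refine ⟨y (J - 1) + G s, fun p => ?_⟩
    obtain h | h := le_total (J - 1) p
    · rw [add_sub_right_comm]
      refine add_mem (tele' h) (mono h (hG fun i hi => ?_))
      rw [hs]
      dsimp only
      split_ifs with hi'
      · rw [show n - l i - 1 = J - 1 by omega, sub_self, map_zero, map_zero]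
        rfl
      · rfl
    · have hz := tele' h
      rw [add_sub_right_comm, ← neg_sub, neg_add_eq_sub, ← hGξ _ hz, ← map_sub]
      refine hG fun i hi => ?_
      rw [map_sub, Pi.sub_apply, hs]
      dsimp only
      split_ifs with hi'
      · rw [← Pi.sub_apply, ← map_sub, ← map_sub, sub_sub_sub_cancel_right]
        exact hξ (tele (by omega)) i (by omega)
      · rw [hξ hz i (by omega), sub_zero]
  · have hd : ∀ p, x - x' ∈ F p := fun p => by
      rw [← sub_sub_sub_cancel_right _ _ (y p)]
      exact sub_mem (hx p) (hx' p)
    have h0 : ξ (x - x') = 0 := hΦ.1 (funext fun i => by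
      rw [map_zero]
      exact hξ (hd (n - l i - 1)) i (by omega))
    rw [← sub_eq_zero, ← hGξ _ (hd _), h0, map_zero]

end Complete

end CrossedCyclic

end

theorem mainTheorem5 {k H A : Type*} [CommRing k] [Ring H] [HopfAlgebra k H] [Ring A] [Algebra k A]
    [Module H A] [IsScalarTower k H A] [IsModuleAlgebra k H A]
    (hS : Function.Bijective (HopfAlgebra.antipode k : H →ₗ[k] H))
    {W : ℤ → Type*} [∀ j, AddCommGroup (W j)] [∀ j, Module k (W j)]
    (u : ∀ j, W j →ₗ[k] W (j - 2)) :
    -- the filtered complex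
    (totFilt A u hS).IsFilteredComplex ∧
    (∀ n p : ℤ, n ≤ p → (totFilt A u hS).F n p = ⊤) ∧
    (∀ (r : ℕ) (p q : ℤ), q < 0 → Subsingleton ((totFilt A u hS).E r p q)) ∧
    -- the induced operators on Hopf homology
    (∀ q : ℕ, RowDescends A hS q ∧ (hopfHOps A hS q).IsCyclic) ∧
    (∀ (p : ℤ) (q : ℕ), RowDDescends A u hS (show (p - 1) + 1 = p by omega) q) ∧
    -- the terms `E⁰`, `E¹`, with their differentials
    (∃ (e₀ : ∀ (p : ℤ) (q : ℕ), (totFilt A u hS).E 0 p q ≃ₗ[k] RowBox k H A u p q)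
       (e₁ : ∀ (p : ℤ) (q : ℕ), (totFilt A u hS).E 1 p q ≃ₗ[k] RowH k H A u p q),
      (∀ (p : ℤ) (q : ℕ) (x : (totFilt A u hS).E 0 p (q + 1 : ℕ)),
        e₀ p q ((totFilt A u hS).dE 0 (p' := p) (q' := q) (by simp) (by push_cast; ring) x) =
          rowδ k H A u p q (e₀ p (q + 1) x)) ∧
      (∀ (p : ℤ) (q : ℕ) (x₁ : (totFilt A u hS).Z (1 : ℕ) p (p + q))
        (x₀ : (totFilt A u hS).Z (0 : ℕ) p (p + q)) (z : rowCycles k H A u p q),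
        x₀.1 = x₁.1 → z.1 = e₀ p q (Subq.mk _ _ x₀) →
          e₁ p q (Subq.mk _ _ x₁) = Subq.mk _ _ z) ∧
      (∀ (p : ℤ) (q : ℕ) (x : (totFilt A u hS).E 1 p q),
        e₁ (p - 1) q ((totFilt A u hS).dE 1 (p' := p - 1) (q' := q) (by simp) (by simp) x) =
          (-1 : k) ^ q • rowHD A u hS (show (p - 1) + 1 = p by omega) q (e₁ p q x))) ∧
    -- the term `E²`
    ((∀ j, Module.Flat k (W j)) → ∀ (p : ℤ) (q : ℕ),
      Nonempty ((totFilt A u hS).E 2 p q ≃ₗ[k] HC u (hopfHOps A hS q) p)) ∧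
    -- convergence
    (∃ θ : ∀ n : ℤ, (totFilt A u hS).Hom n ≃ₗ[k] HC u (algOps k (CrossedProduct k H A)) n,
      ∀ N : ℤ, (∀ j < N, Subsingleton (W j)) →
        (∀ n p : ℤ, p < N → (totFilt A u hS).F n p = ⊥) ∧
        ∀ p q : ℤ, ∃ r₀ : ℕ, ∀ r ≥ r₀,
          ∃ ε : (totFilt A u hS).E r p q ≃ₗ[k]
              Subq (((totFilt A u hS).filtHom (p + q) p).map (θ (p + q)).toLinearMap)
                (((totFilt A u hS).filtHom (p + q) (p - 1)).map (θ (p + q)).toLinearMap),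
            ∀ (x : (totFilt A u hS).Z r p (p + q)) (hx : x.1 ∈ (totFilt A u hS).cycles (p + q))
              (y : ((totFilt A u hS).filtHom (p + q) p).map (θ (p + q)).toLinearMap),
              y.1 = θ (p + q) (Subq.mk _ _ ⟨x.1, hx⟩) →
                ε (Subq.mk _ _ x) = Subq.mk _ _ y) ∧
    ((∀ j, Module.FinitePresentation k (W j)) →
      (∃ j₀ : ℤ, ∀ j ≤ j₀, Function.Bijective (u j)) →
      ∀ (n : ℤ) (y : ℤ → TotBox k H A u n),
        (∀ p, y p - y (p - 1) ∈ (totFilt A u hS).F n p) →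
          ∃! x, ∀ p, x - y p ∈ (totFilt A u hS).F n p) := by
  refine ⟨totFilt_isFilteredComplex, fun n p h => totFilt_eq_top h, fun r p q hq =>
    FiltOps.E_subsingleton r (totFilt_eq_top (by omega)),
    fun q => ⟨rowDescends hS q, hopfHOps_isCyclic hS q⟩, fun p q => rowDDescends hS u _ q,
    ⟨pageZero A hS u, pageOne A hS u, pageZero_d, fun p q x₁ x₀ z hx hz =>
      congrArg (Subq.mk _ _) (Subtype.ext ?_), pageOne_d⟩,
    fun hW p q => totFilt_pageTwo hS hW p q,
    ⟨fun n => (totFilt_Hom_equiv hS u n).some, fun N hN => ⟨totFilt_eq_bot hN, fun p q =>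
      totFilt_isFilteredComplex.exists_stable (totFilt_eq_bot hN) (fun n p h => totFilt_eq_top h)
        p q _⟩⟩,
    fun hW hu n y hy => Box.existsUnique_limit (deg := totDeg)
      (V := fun i : ℕ × ℕ => Cyl k H A i.1 i.2) hu (fun i => (i.1 : ℤ))
      (fun i => Int.ofNat_le.2 (Nat.le_add_right _ _)) ((totFilt A u hS).F n) (fun p => rfl) y hy⟩
  exact (congrArg (boxR hS u rfl) hx.symm).trans hz.symm
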